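/- Let $d\in\{2,3\}$, let $\Omega_1,\dots,\Omega_L\subset\mathbb R^d$ be mutually disjoint bounded Lipschitz polygons ($d=2$) or polyhedra ($d=3$), let $\Omega_0:=\mathbb R^d\setminus\bigcup_{\ell=1}^L\overline{\Omega_\ell}$ and $\Gamma:=\bigcup_{\ell=1}^L\partial\Omega_\ell$. Let $\Gamma$ be decomposed into finitely many disjoint relatively open flat faces $\Gamma_1,\dots,\Gamma_M$, i.e. $\Gamma=\bigcup_i\overline{\Gamma_i}$, and for $\ell=0,\dots,L$ let $\mathcal I(\ell)\subseteq\{1,\dots,M\}$ satisfy $\partial\Omega_\ell=\bigcup_{i\in\mathcal I(\ell)}\overline{\Gamma_i}$. Let $H^{1/2}(\partial\Omega_\ell)$ carry the Sobolev--Slobodeckij norm $$\|u\|^2=\int_{\partial\Omega_\ell}|u|^2+\int_{\partial\Omega_\ell}\int_{\partial\Omega_\ell}\frac{|u(x)-u(y)|^2}{|x-y|^{d}},$$ let $H^{-1/2}(\partial\Omega_\ell)$ be its dual ($L^2(\partial\Omega_\ell)$ being embedded by the $L^2$ pairing), and let $\mathcal H^{\pm1/2}:=\prod_{\ell=0}^L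 H^{\pm1/2}(\partial\Omega_\ell)$ with the product norms. With the trace $\gamma_\ell$ and the normal trace $\gamma_{\nu,\ell}$ taken from inside $\Omega_\ell$ (normal exterior to $\Omega_\ell$), let $$\mathcal Y:=\{(\gamma_\ell u)_{\ell=0}^L: u\in H^1(\mathbb R^d)\}\subseteq\mathcal H^{1/2},\qquad \mathcal X:=\{(\gamma_{\nu,\ell}v)_{\ell=0}^L: v\in H(\mathrm{div},\mathbb R^d)\}\subseteq\mathcal H^{-1/2}.$$ Let $H^k_{\rm pw}(\partial\Omega_\ell)$ be the space of $f\in L^2(\partial\Omega_\ell)$ with $f|_{\Gamma_i}\in H^k(\Gamma_i)$ for all $i\in\mathcal I(\ell)$, with $\|f\|_{H^k_{\rm pw}(\partial\Omega_\ell)}^2=\sum_{i\in\mathcal I(\ell)}\|f\|_{H^k(\Gamma_i)}^2$. Let $s_0,\dots,s_L:\Gamma\to\{-1,0,1\}$ be constant on each $\Gamma_i$, with $|s_\ell|=1$ on $\Gamma_i$ if $i\in\mathcal I(\ell)$, $s_\ell=0$ on $\Gamma_i$ if $i\notin\mathcal I(\ell)$, and $s_\ell+s_j=0$ on $\Gamma_i$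 whenever $\ell\neq j$ and $i\in\mathcal I(\ell)\cap\mathcal I(j)$. For a conforming triangulation $\Gamma_h$ of $\Gamma$ (into segments or triangles) such that each open element lies in one of the $\Gamma_i$, let $h$ be its mesh size (the largest element diameter) and put $$\mathcal P_h:=\{\phi_h:\Gamma\to\mathbb R:\ \phi_h|_e\in\mathcal P_\rho(e)\ \forall e\in\Gamma_h\},\qquad \mathcal Q_h:=\{\psi_h\in C(\Gamma):\ \psi_h|_e\in\mathcal P_{\rho+1}(e)\ \forall e\in\Gamma_h\},$$ $$\mathcal X_h:=\{(s_\ell\phi_h|_{\partial\Omega_\ell})_{\ell=0}^L:\phi_h\in\mathcal P_h\},\qquad \mathcal Y_h:=\{(\psi_h|_{\partial\Omega_\ell})_{\ell=0}^L:\psi_h\in\mathcal Q_h\}.$$ **Proposition.** Let $r\ge0$ be an integer and $\kappa$ a real number. There is a constant $C$, depending only on $r$, $\kappa$ and the geometry (the domains and the decomposition of $\Gamma$ into faces), such that for all integers $\rho\ge r$, all sign functions $s_\ell$ as above and all triangulations $\Gamma_h$ as above that are shape regular with constant $\kappa$ (the diameter of each element is at most $\kappa$ times the diameter of some ball of its affine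 hull contained in the element): $$\inf_{\boldsymbol\phi^h\in\mathcal X_h}\|\boldsymbol\phi-\boldsymbol\phi^h\|_{\mathcal H^{-1/2}}\le C\,h^{r+3/2}\sum_{\ell=0}^L\|\phi_\ell\|_{H^{r+1}_{\rm pw}(\partial\Omega_\ell)}$$ for all $\boldsymbol\phi=(\phi_\ell)_{\ell=0}^L\in\mathcal X$ with $\phi_\ell\in H^{r+1}_{\rm pw}(\partial\Omega_\ell)$ for all $\ell$, and $$\inf_{\boldsymbol\psi^h\in\mathcal Y_h}\|\boldsymbol\psi-\boldsymbol\psi^h\|_{\mathcal H^{1/2}}\le C\,h^{r+3/2}\sum_{\ell=0}^L\|\psi_\ell\|_{H^{r+2}_{\rm pw}(\partial\Omega_\ell)}$$ for all $\boldsymbol\psi=(\psi_\ell)_{\ell=0}^L\in\mathcal Y$ with $\psi_\ell\in H^{r+2}_{\rm pw}(\partial\Omega_\ell)$ for all $\ell$ that have a lifting $u\in H^1(\mathbb R^d)$, $\gamma_\ell u=\psi_\ell$ for all $\ell$, which is continuous on $\Gamma$ (its traces on the $\partial\Omega_\ell$ are the restrictions of one continuous function on $\Gamma$). -/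

import Mathlib

open MeasureTheory Filter Topology
open scoped ContDiff ENNReal NNReal

noncomputable section

namespace MultiTrace

/-- The Euclidean space `ℝᵐ`. -/
abbrev Euc (m : ℕ) : Type := EuclideanSpace ℝ (Fin m)

/-! ### Sobolev spaces of integer order on open subsets of `ℝᵐ` -/

/-- Smooth compactly supported functions on `ℝᵐ`. -/
def IsTest {m : ℕ} (w : Euc m → ℝ) : Prop := ContDiff ℝ ∞ w ∧ HasCompactSupport w

/-- The iterated partial derivative `∂_{idx 0} ⋯ ∂_{idx (j-1)} w` at `x`. -/
def partialDeriv {m j : ℕ} (idx : Fin j → Fin m) (w : Euc m → ℝ) (x : Euc m) : ℝ :=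
  iteratedFDeriv ℝ j w x (fun a => EuclideanSpace.single (idx a) (1 : ℝ))

/-- `g` is the weak derivative `∂_{idx 0} ⋯ ∂_{idx (j-1)} f` on the open set `U`. -/
def IsWeakDeriv {m j : ℕ} (U : Set (Euc m)) (idx : Fin j → Fin m) (f g : Euc m → ℝ) : Prop :=
  ∀ w : Euc m → ℝ, IsTest w → tsupport w ⊆ U →
    ∫ x in U, f x * partialDeriv idx w x = (-1) ^ j * ∫ x in U, g x * w x

/-- `f ∈ Hᵏ(U)`: `f` and all its weak derivatives up to order `k` are in `L²(U)`. -/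
def MemHk {m : ℕ} (k : ℕ) (U : Set (Euc m)) (f : Euc m → ℝ) : Prop :=
  MemLp f 2 (volume.restrict U) ∧
    ∀ j ≤ k, ∀ idx : Fin j → Fin m,
      ∃ g : Euc m → ℝ, MemLp g 2 (volume.restrict U) ∧ IsWeakDeriv U idx f g

open Classical in
/-- A chosen `L²(U)` weak derivative (unique almost everywhere on `U` for `f ∈ Hᵏ(U)`). -/
def weakDeriv {m j : ℕ} (U : Set (Euc m)) (idx : Fin j → Fin m) (f : Euc m → ℝ) : Euc m → ℝ :=
  if h : ∃ g : Euc m → ℝ, MemLp g 2 (volume.restrict U) ∧ IsWeakDeriv U idx f g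
  then h.choose else 0

/-- The `Hᵏ(U)` norm: the square root of `∑_{j ≤ k} ‖Dʲ f‖²_{L²(U)}`, where `|Dʲ f|` is the
Frobenius norm of the tensor of `j`-th derivatives (so it is invariant under rigid motions). -/
def normHk {m : ℕ} (k : ℕ) (U : Set (Euc m)) (f : Euc m → ℝ) : ℝ :=
  Real.sqrt (∑ j ∈ Finset.range (k + 1), ∑ idx : Fin j → Fin m,
    ∫ x in U, (weakDeriv U idx f x) ^ 2)

/-! ### The spaces `H^{1/2}` and `H^{-1/2}` on a surface

A hypersurface `S` of `ℝⁿ⁺¹` enters through its surface measure `σ` (the `n`-dimensional Hausdorff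
measure restricted to `S`). -/

/-- The Sobolev–Slobodeckij space `H^{1/2}(S)`: functions `u ∈ L²(σ)` such that
`U(x,y) = (u(x) - u(y)) / |x - y|^{(n+1)/2}` is in `L²(σ ⊗ σ)`. It is realized as the space of
pairs `(u, U)` in the Hilbert sum `L²(σ) ⊕ L²(σ ⊗ σ)`, so that its norm is
`(∫ |u|² dσ + ∫∫ |u(x) - u(y)|² / |x - y|^{n+1} dσ dσ)^{1/2}`. -/
def HHalf {n : ℕ} (σ : Measure (Euc (n + 1))) :
    Submodule ℝ (WithLp 2 (Lp ℝ 2 σ × Lp ℝ 2 (σ.prod σ))) where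
  carrier := {p | ∃ u : Euc (n + 1) → ℝ, ⇑p.fst =ᵐ[σ] u ∧
    ⇑p.snd =ᵐ[σ.prod σ] fun z => (u z.1 - u z.2) / ‖z.1 - z.2‖ ^ (((n : ℝ) + 1) / 2)}
  zero_mem' := by
    refine ⟨0, Lp.coeFn_zero _ _ _, ?_⟩
    filter_upwards [Lp.coeFn_zero ℝ 2 (σ.prod σ)] with z hz
    simpa using hz
  add_mem' := by
    rintro p q ⟨u, hu, hU⟩ ⟨v, hv, hV⟩
    refine ⟨u + v, ?_, ?_⟩
    · filter_upwards [Lp.coeFn_add p.fst q.fst, hu, hv] with x h1 h2 h3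
      change (p.fst + q.fst : Lp ℝ 2 σ) x = _
      rw [h1, Pi.add_apply, h2, h3, Pi.add_apply]
    · filter_upwards [Lp.coeFn_add p.snd q.snd, hU, hV] with z h1 h2 h3
      change (p.snd + q.snd : Lp ℝ 2 (σ.prod σ)) z = _
      rw [h1, Pi.add_apply, h2, h3, Pi.add_apply, Pi.add_apply]
      ring
  smul_mem' := by
    rintro c p ⟨u, hu, hU⟩
    refine ⟨c • u, ?_, ?_⟩
    · filter_upwards [Lp.coeFn_smul c p.fst, hu] with x h1 h2
      change (c • p.fst : Lp ℝ 2 σ) x = _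
      rw [h1, Pi.smul_apply, h2, Pi.smul_apply]
    · filter_upwards [Lp.coeFn_smul c p.snd, hU] with z h1 h2
      change (c • p.snd : Lp ℝ 2 (σ.prod σ)) z = _
      rw [h1, Pi.smul_apply, h2]
      simp only [Pi.smul_apply, smul_eq_mul]
      ring

/-- The function on the surface underlying an element of `H^{1/2}`. -/
def fnOf {n : ℕ} {σ : Measure (Euc (n + 1))} (η : HHalf σ) : Lp ℝ 2 σ :=
  (η : WithLp 2 (Lp ℝ 2 σ × Lp ℝ 2 (σ.prod σ))).fst

/-- `H^{-1/2}`, the dual space of `H^{1/2}` with the dual norm. -/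
abbrev HNegHalf {n : ℕ} (σ : Measure (Euc (n + 1))) : Type := StrongDual ℝ (HHalf σ)

/-- The embedding `L²(σ) → H^{-1/2}`, `f ↦ (η ↦ ∫ f η dσ)`. -/
def ofL2 {n : ℕ} {σ : Measure (Euc (n + 1))} (f : Lp ℝ 2 σ) : HNegHalf σ :=
  (innerSL ℝ f).comp
    ((WithLp.fstL 2 ℝ (Lp ℝ 2 σ) (Lp ℝ 2 (σ.prod σ))).comp (HHalf σ).subtypeL)

theorem ofL2_zero {n : ℕ} {σ : Measure (Euc (n + 1))} : ofL2 (0 : Lp ℝ 2 σ) = 0 := by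
  simp only [ofL2, map_zero, ContinuousLinearMap.zero_comp]

theorem ofL2_add {n : ℕ} {σ : Measure (Euc (n + 1))} (f g : Lp ℝ 2 σ) :
    ofL2 (f + g) = ofL2 f + ofL2 g := by
  simp only [ofL2, map_add, ContinuousLinearMap.add_comp]

theorem ofL2_smul {n : ℕ} {σ : Measure (Euc (n + 1))} (c : ℝ) (f : Lp ℝ 2 σ) :
    ofL2 (c • f) = c • ofL2 f := by
  simp only [ofL2, map_smul, ContinuousLinearMap.smul_comp]

/-! ### Traces -/

/-- `τ` is the trace on `∂Ω`, taken from inside `Ω`, of `u ∈ H¹(Ω)`: there are smooth functions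
that converge to `u` in `H¹(Ω)` and whose boundary values converge to `τ` in `L²(∂Ω)`. -/
def IsTrace {n : ℕ} (Ω : Set (Euc (n + 1))) (σ : Measure (Euc (n + 1)))
    (u τ : Euc (n + 1) → ℝ) : Prop :=
  MemHk 1 Ω u ∧ ∃ w : ℕ → Euc (n + 1) → ℝ, (∀ k, IsTest (w k)) ∧
    Tendsto (fun k => normHk 1 Ω (w k - u)) atTop (𝓝 0) ∧
    Tendsto (fun k => eLpNorm (w k - τ) 2 σ) atTop (𝓝 0)

/-- `D ∈ L²(ℝᵐ)` is the weak divergence of the vector field `v ∈ L²(ℝᵐ)ᵐ`;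
thus `v ∈ H(div, ℝᵐ)`. -/
def IsHdiv {m : ℕ} (v : Euc m → Euc m) (D : Euc m → ℝ) : Prop :=
  MemLp v 2 volume ∧ MemLp D 2 volume ∧
    ∀ w : Euc m → ℝ, IsTest w → ∫ x, fderiv ℝ w x (v x) = - ∫ x, D x * w x

/-- `φ ∈ H^{-1/2}(∂Ω)` is the normal trace `ν · v` from inside `Ω` of the field `v` with divergence
`D`, where `ν` is the exterior normal of `Ω`: Green's formula
`⟨φ, w|_{∂Ω}⟩ = ∫_Ω (v · ∇w + (div v) w)` holds for smooth `w`. -/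
def IsNormalTrace {n : ℕ} (Ω : Set (Euc (n + 1))) (σ : Measure (Euc (n + 1)))
    (v : Euc (n + 1) → Euc (n + 1)) (D : Euc (n + 1) → ℝ) (φ : HNegHalf σ) : Prop :=
  ∀ w : Euc (n + 1) → ℝ, IsTest w → ∀ η : HHalf σ, ⇑(fnOf η) =ᵐ[σ] w →
    φ η = ∫ x in Ω, (fderiv ℝ w x (v x) + D x * w x)

/-! ### Geometry -/

/-- Bounded Lipschitz domains: bounded, open, connected, and near each boundary point the set of
points strictly above the graph of a Lipschitz function, in suitable orthonormal coordinates
(`e` is the vertical direction, `y - ⟨e, y⟩ e` the horizontal part of `y`). -/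
def IsLipschitzDomain {m : ℕ} (Ω : Set (Euc m)) : Prop :=
  IsOpen Ω ∧ IsConnected Ω ∧ Bornology.IsBounded Ω ∧
    ∀ x ∈ frontier Ω, ∃ V ∈ 𝓝 x, ∃ e : Euc m, ‖e‖ = 1 ∧
      ∃ (K : ℝ≥0) (g : Euc m → ℝ), LipschitzWith K g ∧
        ∀ y ∈ V, y ∈ Ω ↔ g (y - inner ℝ e y • e) < inner ℝ e y

/-- The subdomains `Ω₀, Ω₁, …, Ω_L`, where `Ω₀` is the complement of the union of the closures of
the given bounded sets. -/
def allDomains {m L : ℕ} (Ω : Fin L → Set (Euc m)) : Fin (L + 1) → Set (Euc m) :=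
  Fin.cons (⋃ ℓ, closure (Ω ℓ))ᶜ Ω

/-- Disjoint Lipschitz polygons (`n = 1`) or polyhedra (`n = 2`) `Ω₁, …, Ω_L` in `ℝⁿ⁺¹` together
with a decomposition of the skeleton into finitely many disjoint relatively open flat faces
`Γ₁, …, Γ_M`. Each face is the image of an open subset `patch i` of `ℝⁿ` under an isometric affine
map `chart i` (tangential coordinates). -/
structure Partition (n L M : ℕ) where
  Ω : Fin L → Set (Euc (n + 1))
  lipschitz : ∀ ℓ, IsLipschitzDomain (Ω ℓ)
  disjoint : Pairwise fun ℓ j => Disjoint (Ω ℓ) (Ω j)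
  patch : Fin M → Set (Euc n)
  isOpen_patch : ∀ i, IsOpen (patch i)
  chart : Fin M → (Euc n →ᵃⁱ[ℝ] Euc (n + 1))
  disjoint_face : Pairwise fun i j => Disjoint (chart i '' patch i) (chart j '' patch j)
  skeleton_eq : ⋃ ℓ, frontier (Ω ℓ) = ⋃ i, closure (chart i '' patch i)
  /-- The faces of each subdomain, `Ω₀` included. -/
  I : Fin (L + 1) → Finset (Fin M)
  boundary_eq : ∀ ℓ, frontier (allDomains Ω ℓ) = ⋃ i ∈ I ℓ, closure (chart i '' patch i)

namespace Partition

variable {n L M : ℕ} (G : Partition n L M)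

/-- The subdomain `Ω_ℓ`, `ℓ = 0, …, L`; `Ω₀` is the unbounded exterior. -/
def dom (ℓ : Fin (L + 1)) : Set (Euc (n + 1)) := allDomains G.Ω ℓ

/-- The flat face `Γ_i`. -/
def face (i : Fin M) : Set (Euc (n + 1)) := G.chart i '' G.patch i

/-- The skeleton `Γ`. -/
def skeleton : Set (Euc (n + 1)) := ⋃ ℓ, frontier (G.Ω ℓ)

/-- The surface measure on `∂Ω_ℓ`. -/
def surf (ℓ : Fin (L + 1)) : Measure (Euc (n + 1)) :=
  (Measure.euclideanHausdorffMeasure n).restrict (frontier (G.dom ℓ))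

/-- The product of the spaces `H^{1/2}(∂Ω_ℓ)`, with the product norm. -/
abbrev ProdHHalf : Type := PiLp 2 fun ℓ : Fin (L + 1) => HHalf (G.surf ℓ)

/-- The product of the spaces `H^{-1/2}(∂Ω_ℓ)`, with the product norm. -/
abbrev ProdHNegHalf : Type := PiLp 2 fun ℓ : Fin (L + 1) => HNegHalf (G.surf ℓ)

/-- `u ∈ H¹(ℝᵈ)` is a lifting of `ψ`: `ψ_ℓ` is the interior trace of `u` on `∂Ω_ℓ` for all `ℓ`. -/
def IsLifting (u : Euc (n + 1) → ℝ) (ψ : G.ProdHHalf) : Prop :=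
  MemHk 1 Set.univ u ∧ ∀ ℓ, IsTrace (G.dom ℓ) (G.surf ℓ) u (fnOf (ψ ℓ))

/-- The single-trace space `𝒴`. -/
def Y : Set G.ProdHHalf := {ψ | ∃ u, G.IsLifting u ψ}

/-- The single-trace space `𝒳`. -/
def X : Set G.ProdHNegHalf :=
  {φ | ∃ v D, IsHdiv v D ∧ ∀ ℓ, IsNormalTrace (G.dom ℓ) (G.surf ℓ) v D (φ ℓ)}

/-- `u ∈ H¹(ℝᵈ)` is continuous on the skeleton: its traces on the boundaries `∂Ω_ℓ` are the
restrictions of one continuous function on `Γ`. -/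
def ContinuousOnSkeleton (u : Euc (n + 1) → ℝ) : Prop :=
  ∃ g : Euc (n + 1) → ℝ, ContinuousOn g G.skeleton ∧
    ∀ ℓ, ∀ τ : HHalf (G.surf ℓ), IsTrace (G.dom ℓ) (G.surf ℓ) u (fnOf τ) → ⇑(fnOf τ) =ᵐ[G.surf ℓ] g

/-- `f ∈ Hᵏ_pw(∂Ω_ℓ)`: in tangential coordinates `f` is in `Hᵏ` on each face of `∂Ω_ℓ`. -/
def MemHpw (k : ℕ) (ℓ : Fin (L + 1)) (f : Lp ℝ 2 (G.surf ℓ)) : Prop :=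
  ∀ i ∈ G.I ℓ, MemHk k (G.patch i) (fun x => f (G.chart i x))

/-- The norm of `Hᵏ_pw(∂Ω_ℓ)`. -/
def normHpw (k : ℕ) (ℓ : Fin (L + 1)) (f : Lp ℝ 2 (G.surf ℓ)) : ℝ :=
  Real.sqrt (∑ i ∈ G.I ℓ, (normHk k (G.patch i) fun x => f (G.chart i x)) ^ 2)

/-- Signs `s_ℓ`, constant on each face, nonzero exactly on `∂Ω_ℓ`, opposite on common faces. -/
structure SignSystem where
  s : Fin (L + 1) → Fin M → ℤ
  eq_zero : ∀ ℓ, ∀ i ∉ G.I ℓ, s ℓ i = 0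
  abs_eq_one : ∀ ℓ, ∀ i ∈ G.I ℓ, |s ℓ i| = 1
  opposite : ∀ ℓ j, ℓ ≠ j → ∀ i ∈ G.I ℓ, i ∈ G.I j → s ℓ i + s j i = 0

variable {G}

/-- The sign function `s_ℓ` on the faces, extended by zero. -/
def SignSystem.fn (S : G.SignSystem) (ℓ : Fin (L + 1)) (x : Euc (n + 1)) : ℝ :=
  ∑ i, (G.face i).indicator (fun _ => (S.s ℓ i : ℝ)) x

variable (G)

/-- A conforming triangulation `Γ_h` of the skeleton that respects the decomposition into faces:
a finite simplicial complex with underlying space `Γ`, all of whose simplices are faces of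
`n`-dimensional simplices, such that each open `n`-simplex lies in one of the faces `Γ_i`. -/
structure Triangulation where
  K : Geometry.SimplicialComplex ℝ (Euc (n + 1))
  finite : K.faces.Finite
  space_eq : K.space = G.skeleton
  pure : ∀ t ∈ K.faces, ∃ t' ∈ K.faces, t ⊆ t' ∧ t'.card = n + 1
  respects : ∀ t ∈ K.faces, t.card = n + 1 →
    ∃ i, intrinsicInterior ℝ (convexHull ℝ (t : Set (Euc (n + 1)))) ⊆ G.face i

end Partition

/-! ### Triangulations and boundary element spaces -/

namespace Partition.Triangulation

variable {n L M : ℕ} {G : Partition n L M} (T : G.Triangulation)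

/-- The elements of the triangulation, given by their vertices. -/
def elems : Set (Finset (Euc (n + 1))) := {t | t ∈ T.K.faces ∧ t.card = n + 1}

/-- The closed element with vertices `t`. -/
def closedElem (t : Finset (Euc (n + 1))) : Set (Euc (n + 1)) := convexHull ℝ (t : Set (Euc (n + 1)))

/-- The (relatively) open element with vertices `t`. -/
def openElem (t : Finset (Euc (n + 1))) : Set (Euc (n + 1)) := intrinsicInterior ℝ (closedElem t)

/-- The mesh size `h`, the largest diameter of an element. -/
def meshSize : ℝ := sSup ((fun t => Metric.diam (closedElem t)) '' T.elems)

/-- Shape regularity: each element `e` contains a ball (of its affine span) whose diameter `2δ`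
satisfies `diam e ≤ κ · 2δ`. -/
def ShapeRegular (κ : ℝ) : Prop :=
  ∀ t ∈ T.elems, ∃ x ∈ affineSpan ℝ (t : Set (Euc (n + 1))), ∃ δ > 0,
    Metric.closedBall x δ ∩ affineSpan ℝ (t : Set (Euc (n + 1))) ⊆ closedElem t ∧
    Metric.diam (closedElem t) ≤ κ * (2 * δ)

/-- Discontinuous piecewise polynomials of degree at most `ρ`. (Polynomials in the tangential
coordinates of `e` are the restrictions to `e` of polynomials on `ℝⁿ⁺¹`. Values off the open
elements are irrelevant.) -/
def Ph (ρ : ℕ) : Submodule ℝ (Euc (n + 1) → ℝ) where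
  carrier := {φ | ∀ t ∈ T.elems, ∃ p ∈ MvPolynomial.restrictTotalDegree (Fin (n + 1)) ℝ ρ,
    ∀ x ∈ openElem t, φ x = MvPolynomial.eval (fun i => x i) p}
  zero_mem' := fun t _ => ⟨0, Submodule.zero_mem _, fun x _ => by simp⟩
  add_mem' := by
    intro φ χ hφ hχ t ht
    obtain ⟨p, hp, h1⟩ := hφ t ht
    obtain ⟨q, hq, h2⟩ := hχ t ht
    exact ⟨p + q, Submodule.add_mem _ hp hq, fun x hx => by simp [h1 x hx, h2 x hx]⟩
  smul_mem' := by
    intro c φ hφ t ht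
    obtain ⟨p, hp, h1⟩ := hφ t ht
    exact ⟨c • p, Submodule.smul_mem _ c hp, fun x hx => by
      simp [h1 x hx, MvPolynomial.smul_eval]⟩

/-- Continuous piecewise polynomials of degree at most `ρ + 1`. -/
def Qh (ρ : ℕ) : Submodule ℝ (Euc (n + 1) → ℝ) where
  carrier := {ψ | ψ ∈ T.Ph (ρ + 1) ∧ ContinuousOn ψ G.skeleton}
  zero_mem' := ⟨Submodule.zero_mem _, continuousOn_const⟩
  add_mem' := fun h1 h2 => ⟨Submodule.add_mem _ h1.1 h2.1, h1.2.add h2.2⟩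
  smul_mem' := fun c _ h => ⟨Submodule.smul_mem _ c h.1, h.2.const_smul c⟩

/-- The space `𝒴_h` of the families `(ψ_h|_{∂Ω_ℓ})_ℓ`, `ψ_h ∈ 𝒬_h`. -/
def Yh (ρ : ℕ) : Submodule ℝ G.ProdHHalf where
  carrier := {η | ∃ ψ ∈ T.Qh ρ, ∀ ℓ, ⇑(fnOf (η ℓ)) =ᵐ[G.surf ℓ] ψ}
  zero_mem' := ⟨0, Submodule.zero_mem _, fun ℓ => Lp.coeFn_zero _ _ _⟩
  add_mem' := by
    rintro η θ ⟨ψ, hψ, h1⟩ ⟨χ, hχ, h2⟩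
    refine ⟨ψ + χ, Submodule.add_mem _ hψ hχ, fun ℓ => ?_⟩
    filter_upwards [Lp.coeFn_add (fnOf (η ℓ)) (fnOf (θ ℓ)), h1 ℓ, h2 ℓ] with x e e1 e2
    change ((fnOf (η ℓ)) + (fnOf (θ ℓ)) : Lp ℝ 2 (G.surf ℓ)) x = _
    rw [e, Pi.add_apply, e1, e2, Pi.add_apply]
  smul_mem' := by
    rintro c η ⟨ψ, hψ, h1⟩
    refine ⟨c • ψ, Submodule.smul_mem _ c hψ, fun ℓ => ?_⟩
    filter_upwards [Lp.coeFn_smul c (fnOf (η ℓ)), h1 ℓ] with x e e1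
    change (c • (fnOf (η ℓ)) : Lp ℝ 2 (G.surf ℓ)) x = _
    rw [e, Pi.smul_apply, e1, Pi.smul_apply]

/-- The space `𝒳_h` of the families `(s_ℓ φ_h|_{∂Ω_ℓ})_ℓ`, `φ_h ∈ 𝒫_h`. -/
def Xh (S : G.SignSystem) (ρ : ℕ) : Submodule ℝ G.ProdHNegHalf where
  carrier := {χ | ∃ φ ∈ T.Ph ρ, ∀ ℓ, ∃ f : Lp ℝ 2 (G.surf ℓ),
    ⇑f =ᵐ[G.surf ℓ] (fun x => S.fn ℓ x * φ x) ∧ χ ℓ = ofL2 f}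
  zero_mem' := by
    refine ⟨0, Submodule.zero_mem _, fun ℓ => ⟨0, ?_, ?_⟩⟩
    · filter_upwards [Lp.coeFn_zero ℝ 2 (G.surf ℓ)] with x hx
      simpa using hx
    · rw [ofL2_zero]; rfl
  add_mem' := by
    rintro η θ ⟨φ, hφ, h1⟩ ⟨χ, hχ, h2⟩
    refine ⟨φ + χ, Submodule.add_mem _ hφ hχ, fun ℓ => ?_⟩
    obtain ⟨f, hf, e1⟩ := h1 ℓ
    obtain ⟨g, hg, e2⟩ := h2 ℓ
    refine ⟨f + g, ?_, ?_⟩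
    · filter_upwards [Lp.coeFn_add f g, hf, hg] with x e a b
      rw [e, Pi.add_apply, a, b, Pi.add_apply]
      ring
    · rw [ofL2_add, ← e1, ← e2]; rfl
  smul_mem' := by
    rintro c η ⟨φ, hφ, h1⟩
    refine ⟨c • φ, Submodule.smul_mem _ c hφ, fun ℓ => ?_⟩
    obtain ⟨f, hf, e1⟩ := h1 ℓ
    refine ⟨c • f, ?_, ?_⟩
    · filter_upwards [Lp.coeFn_smul c f, hf] with x e a
      rw [e, Pi.smul_apply, a]
      simp only [Pi.smul_apply, smul_eq_mul]
      ring
    · rw [ofL2_smul, ← e1]; rfl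

end Partition.Triangulation

end MultiTrace

end

open MultiTrace

open MeasureTheory Filter Topology
open scoped ContDiff ENNReal NNReal

noncomputable section

namespace MultiTrace

/-! ### Squared integrals in `ℝ≥0∞` and weak gradients -/

variable {m : ℕ}

/-! Let n = d - 1 be the dimension of Γ. Both estimates rest on one local fact, used in tangential
coordinates: on a convex set of diameter δ, a function in Hᵏ⁺¹ differs from the polynomial of degree
k whose derivatives have the same means by O(δᵏ⁺¹⁻ʲ) in the derivatives of order j
(`exists_poly_approx`), because Poincaré's inequality applies to each derivative in turn. Shape
regularity enters there through the ratio of δⁿ to the measure of the element.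

Neumann data. Adding Green's formula over all subdomains shows that ∑ ∫ f_ℓ w = 0 for every test
function w, hence the densities f_ℓ of the normal traces cancel almost everywhere on each element
(`sum_integral_eq_zero`, `ae_sum_eq_zero`). The sign conditions allow at most two subdomains at a
face, so all s_ℓ f_ℓ are one and the same function there, and one polynomial with its mean,
multiplied by the signs, approximates both sides. The error has mean zero on each element; when it
is paired with η ∈ H^{1/2} the local mean of η drops out, and the rest of η is bounded by δ^{1/2}
times its local Slobodeckij seminorm. The squares of the local seminorms add up to at most the
square of the global one, which yields the additional half power of h
(`ShapeRegular.enorm_ofL2_apply_sq_le`).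

Dirichlet data. The continuous function g on Γ is replaced by its Lagrange interpolant of degree r +
1. The difficulty is that the H^{1/2} norm is nonlocal while the constant may depend on the geometry
and κ only. One triangulation T₀ of Γ is therefore fixed in advance, and for continuous v with weak
gradients on the elements of T₀ it is shown that the squared seminorm is at most C (h⁻¹ ‖v‖² + h
‖∇v‖² + hⁿ⁻¹ sup |v|²) with C depending on T₀ and on an upper bound of h
(`exists_slobodeckij_bound`). Pairs of points at distance at least h cost a factor 1/h. For closer
pairs the mutual position of the two elements of T₀ decides. Within one element, translation
differences are bounded by the gradient. Across a common facet, one element is mapped affinely onto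
the other and Hardy's inequality compares both sides with the common value on the facet. At a single
common vertex (n = 2) the kernel itself has integral O(h), so the supremum suffices. Disjoint
elements have positive distance.

For v = g - I g each of the three terms is O(h^{2r+3}): interpolation reproduces polynomials and is
stable in the supremum norm (`elemInterp_eq_self`, `exists_elemInterp_bound`), and H² controls point
values in dimension n ≤ 2 (`weak_sup_bound`). The mesh and T₀ need not be related. The interpolant
is Lipschitz on Γ, so it has weak gradients on the elements of T₀ as well, and since both
triangulations exhaust the faces up to null sets the gradient term may be evaluated on the mesh. -/

theorem sq_lintegral_mul_le {α : Type*} [MeasurableSpace α] {μ : Measure α} {f g : α → ℝ≥0∞}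
    (hf : AEMeasurable f μ) (hg : AEMeasurable g μ) :
    (∫⁻ x, f x * g x ∂μ) ^ 2 ≤ (∫⁻ x, f x ^ 2 ∂μ) * ∫⁻ x, g x ^ 2 ∂μ := by
  have h := ENNReal.lintegral_mul_le_Lp_mul_Lq μ Real.HolderConjugate.two_two hf hg
  simp only [Pi.mul_apply, ENNReal.rpow_two] at h
  calc (∫⁻ x, f x * g x ∂μ) ^ 2
      ≤ ((∫⁻ x, f x ^ 2 ∂μ) ^ (1 / 2 : ℝ) * (∫⁻ x, g x ^ 2 ∂μ) ^ (1 / 2 : ℝ)) ^ 2 := by gcongr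
    _ = _ := by
      rw [mul_pow, ← ENNReal.rpow_natCast, ← ENNReal.rpow_natCast, ← ENNReal.rpow_mul,
        ← ENNReal.rpow_mul]
      norm_num

theorem sq_lintegral_le {α : Type*} [MeasurableSpace α] {μ : Measure α} {f : α → ℝ≥0∞}
    (hf : AEMeasurable f μ) :
    (∫⁻ x, f x ∂μ) ^ 2 ≤ μ Set.univ * ∫⁻ x, f x ^ 2 ∂μ := by
  simpa using sq_lintegral_mul_le (μ := μ) (f := fun _ => 1) (g := f) aemeasurable_const hf

theorem enorm_add_sq_le (a b : ℝ) : ‖a + b‖ₑ ^ 2 ≤ 2 * (‖a‖ₑ ^ 2 + ‖b‖ₑ ^ 2) := by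
  simp only [Real.enorm_eq_ofReal_abs]
  rw [← ENNReal.ofReal_pow (abs_nonneg _), ← ENNReal.ofReal_pow (abs_nonneg _),
    ← ENNReal.ofReal_pow (abs_nonneg _), ← ENNReal.ofReal_add (by positivity) (by positivity),
    ← ENNReal.ofReal_ofNat, ← ENNReal.ofReal_mul (by positivity)]
  apply ENNReal.ofReal_le_ofReal
  simp only [sq_abs]
  nlinarith [sq_nonneg (a - b)]

theorem enorm_sub_sq_le (a b : ℝ) : ‖a - b‖ₑ ^ 2 ≤ 2 * (‖a‖ₑ ^ 2 + ‖b‖ₑ ^ 2) := by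
  simpa [sub_eq_add_neg] using enorm_add_sq_le a (-b)


theorem lintegral_comp_linear_add {f : Euc m → ℝ≥0∞} (hf : Measurable f)
    (B : Euc m →ₗ[ℝ] Euc m) (b : Euc m) (hB : LinearMap.det B ≠ 0) :
    ∫⁻ x, f (B x + b) = ENNReal.ofReal |(LinearMap.det B)⁻¹| * ∫⁻ x, f x := by
  have hBm : Measurable (B : Euc m → Euc m) :=
    (LinearMap.continuous_of_finiteDimensional B).measurable
  calc ∫⁻ x, f (B x + b) = ∫⁻ y, f (y + b) ∂(Measure.map B volume) :=
        (lintegral_map (hf.comp (measurable_add_const b)) hBm).symm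
    _ = _ := by
      rw [Measure.map_linearMap_addHaar_eq_smul_addHaar volume hB, lintegral_smul_measure,
        lintegral_add_right_eq_self]
      rfl

/-- The coordinate vectors. -/
abbrev stdVec (i : Fin m) : Euc m := EuclideanSpace.single i (1 : ℝ)

/-- `G` is the weak gradient of `u` on `U`. -/
def HasWeakGrad (U : Set (Euc m)) (u : Euc m → ℝ) (G : Fin m → Euc m → ℝ) : Prop :=
  ∀ w : Euc m → ℝ, IsTest w → tsupport w ⊆ U → ∀ i,
    ∫ x in U, u x * fderiv ℝ w x (stdVec i) = - ∫ x in U, G i x * w x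

theorem norm_le_sqrt_sum_sq (T : Euc m →L[ℝ] ℝ) :
    ‖T‖ ≤ Real.sqrt (∑ i, T (stdVec i) ^ 2) := by
  refine T.opNorm_le_bound (Real.sqrt_nonneg _) fun x => ?_
  have hx : x = ∑ i, x i • stdVec i := by
    ext j
    simp [Finset.sum_apply, Pi.single_apply]
  have : T x = ∑ i, T (stdVec i) * x i := by
    conv_lhs => rw [hx]
    simp [map_sum, mul_comm]
  rw [this, EuclideanSpace.norm_eq, Real.norm_eq_abs]
  simp only [Real.norm_eq_abs, sq_abs]
  rw [← Real.sqrt_mul (Finset.sum_nonneg fun i _ => sq_nonneg _)]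
  exact Real.abs_le_sqrt (Finset.sum_mul_sq_le_sq_mul_sq _ _ _)

theorem enorm_sq_le_sum (T : Euc m →L[ℝ] ℝ) :
    ‖T‖ₑ ^ 2 ≤ ∑ i, ‖T (stdVec i)‖ₑ ^ 2 := by
  have h := norm_le_sqrt_sum_sq T
  have h2 : ‖T‖ ^ 2 ≤ ∑ i, T (stdVec i) ^ 2 := by
    calc ‖T‖ ^ 2 ≤ Real.sqrt (∑ i, T (stdVec i) ^ 2) ^ 2 := by gcongr
      _ = _ := Real.sq_sqrt (Finset.sum_nonneg fun i _ => sq_nonneg _)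
  have e : ∀ a : ℝ, ‖a‖ₑ ^ 2 = ENNReal.ofReal (a ^ 2) := fun a => by
    rw [Real.enorm_eq_ofReal_abs, ← ENNReal.ofReal_pow (abs_nonneg _), sq_abs]
  simp only [e]
  rw [← ENNReal.ofReal_sum_of_nonneg fun i _ => sq_nonneg _, ← ofReal_norm,
    ← ENNReal.ofReal_pow (norm_nonneg _)]
  exact ENNReal.ofReal_le_ofReal h2

/-! ### Mollification -/

/-- A fixed family of bump functions shrinking to the origin. -/
def bump (m k : ℕ) : ContDiffBump (0 : Euc m) where
  rIn := 1 / (2 * ((k : ℝ) + 1))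
  rOut := 1 / ((k : ℝ) + 1)
  rIn_pos := by positivity
  rIn_lt_rOut := by
    rw [div_lt_div_iff₀ (by positivity) (by positivity)]
    nlinarith [(Nat.cast_nonneg k : (0 : ℝ) ≤ k)]

/-- Mollification. -/
def moll (k : ℕ) (f : Euc m → ℝ) : Euc m → ℝ :=
  convolution ((bump m k).normed volume) f (ContinuousLinearMap.lsmul ℝ ℝ) volume

theorem moll_apply (k : ℕ) (f : Euc m → ℝ) (x : Euc m) :
    moll k f x = ∫ y, (bump m k).normed volume (x - y) * f y := by
  rw [moll, convolution_eq_swap]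
  rfl

theorem contDiff_moll (k : ℕ) {f : Euc m → ℝ} (hf : LocallyIntegrable f) :
    ContDiff ℝ ∞ (moll k f) :=
  (bump m k).hasCompactSupport_normed.contDiff_convolution_left _
    ((bump m k).contDiff_normed) hf

/-- Young's inequality for a kernel of mass one: Cauchy–Schwarz with respect to the probability
density ρ(x - ·), then Tonelli. -/
theorem lintegral_moll_sq_le (k : ℕ) {f : Euc m → ℝ} (hf : AEStronglyMeasurable f) :
    ∫⁻ x, ‖moll k f x‖ₑ ^ 2 ≤ ∫⁻ x, ‖f x‖ₑ ^ 2 := by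
  set ρ : Euc m → ℝ := (bump m k).normed volume with hρ
  have hρc : Continuous ρ := (bump m k).continuous_normed
  have hρ0 : ∀ x, 0 ≤ ρ x := (bump m k).nonneg_normed
  have hone : ∫⁻ x, ENNReal.ofReal (ρ x) = 1 := by
    rw [← ofReal_integral_eq_lintegral_ofReal (bump m k).integrable_normed
      (Eventually.of_forall hρ0), (bump m k).integral_normed, ENNReal.ofReal_one]
  have hfe : AEMeasurable (fun y => ‖f y‖ₑ) := hf.enorm
  have key : ∀ x, ‖moll k f x‖ₑ ^ 2 ≤ ∫⁻ y, ENNReal.ofReal (ρ (x - y)) * ‖f y‖ₑ ^ 2 := by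
    intro x
    have hm : Measurable fun y => ENNReal.ofReal (Real.sqrt (ρ (x - y))) := by
      refine ENNReal.measurable_ofReal.comp ?_
      exact (Real.continuous_sqrt.comp (hρc.comp (by fun_prop))).measurable
    have e2 : ∀ y, ENNReal.ofReal (Real.sqrt (ρ (x - y))) ^ 2 = ENNReal.ofReal (ρ (x - y)) :=
      fun y => by rw [← ENNReal.ofReal_pow (Real.sqrt_nonneg _), Real.sq_sqrt (hρ0 _)]
    calc ‖moll k f x‖ₑ ^ 2 ≤ (∫⁻ y, ‖ρ (x - y) * f y‖ₑ) ^ 2 := by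
          rw [moll_apply]; gcongr; exact enorm_integral_le_lintegral_enorm _
      _ = (∫⁻ y, ENNReal.ofReal (Real.sqrt (ρ (x - y))) *
            (ENNReal.ofReal (Real.sqrt (ρ (x - y))) * ‖f y‖ₑ)) ^ 2 := by
          congr 2; ext y
          rw [← mul_assoc, ← sq, e2, enorm_mul, Real.enorm_of_nonneg (hρ0 _)]
      _ ≤ (∫⁻ y, ENNReal.ofReal (Real.sqrt (ρ (x - y))) ^ 2) *
            ∫⁻ y, (ENNReal.ofReal (Real.sqrt (ρ (x - y))) * ‖f y‖ₑ) ^ 2 :=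
          sq_lintegral_mul_le hm.aemeasurable (hm.aemeasurable.mul hfe)
      _ = _ := by
          simp only [mul_pow, e2]
          rw [lintegral_sub_left_eq_self (fun y => ENNReal.ofReal (ρ y)) x, hone, one_mul]
  calc ∫⁻ x, ‖moll k f x‖ₑ ^ 2
      ≤ ∫⁻ x, ∫⁻ y, ENNReal.ofReal (ρ (x - y)) * ‖f y‖ₑ ^ 2 := lintegral_mono key
    _ = ∫⁻ y, ∫⁻ x, ENNReal.ofReal (ρ (x - y)) * ‖f y‖ₑ ^ 2 := by
        refine lintegral_lintegral_swap ?_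
        have h1 : Measurable fun p : Euc m × Euc m => ENNReal.ofReal (ρ (p.1 - p.2)) :=
          ENNReal.measurable_ofReal.comp
            (hρc.comp (continuous_fst.sub continuous_snd)).measurable
        exact h1.aemeasurable.mul ((hfe.pow_const 2).comp_snd)
    _ = ∫⁻ y, ‖f y‖ₑ ^ 2 := by
        refine lintegral_congr fun y => ?_
        have h1 : Measurable fun x : Euc m => ENNReal.ofReal (ρ (x - y)) :=
          ENNReal.measurable_ofReal.comp (hρc.comp (continuous_sub_right y)).measurable
        rw [lintegral_mul_const _ h1,
          lintegral_sub_right_eq_self (fun x => ENNReal.ofReal (ρ x)) y, hone, one_mul]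

/-- The points of `U` at distance more than `1 / (k + 1)` from the complement. -/
def shrink (k : ℕ) (U : Set (Euc m)) : Set (Euc m) :=
  {x | ∀ z : Euc m, ‖z‖ ≤ 1 / ((k : ℝ) + 1) → x + z ∈ U}

theorem shrink_subset (k : ℕ) (U : Set (Euc m)) : shrink k U ⊆ U := fun x hx => by
  simpa using hx 0 (by simp; positivity)

theorem convex_shrink (k : ℕ) {U : Set (Euc m)} (hU : Convex ℝ U) : Convex ℝ (shrink k U) := by
  intro x hx y hy a b ha hb hab z hz
  have := hU (hx z hz) (hy z hz) ha hb hab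
  convert this using 1
  rw [smul_add, smul_add, add_add_add_comm, ← add_smul, hab, one_smul]

-- The complement is the Minkowski sum of a closed set and a compact ball, hence closed.
open scoped Pointwise in
theorem isOpen_shrink (k : ℕ) {U : Set (Euc m)} (hU : IsOpen U) : IsOpen (shrink k U) := by
  have : shrink k U = (Uᶜ + Metric.closedBall (0 : Euc m) (1 / ((k : ℝ) + 1)))ᶜ := by
    ext x
    simp only [shrink, Set.mem_ofPred_eq, Set.mem_compl_iff, Set.mem_add, not_exists, not_and,
      mem_closedBall_zero_iff]
    constructor
    · intro h y hy z hz hyz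
      apply hy
      have := h (-z) (by simpa using hz)
      rwa [← hyz, add_neg_cancel_right] at this
    · intro h z hz
      by_contra hc
      exact h (x + z) hc (-z) (by simpa using hz) (by simp)
  rw [this, isOpen_compl_iff]
  exact hU.isClosed_compl.add_right_of_isCompact (isCompact_closedBall _ _)

theorem eventually_mem_shrink {U : Set (Euc m)} (hU : IsOpen U) {x : Euc m} (hx : x ∈ U) :
    ∀ᶠ k in atTop, x ∈ shrink k U := by
  obtain ⟨ε, hε, hb⟩ := Metric.isOpen_iff.1 hU x hx
  have h := (tendsto_order.1 (tendsto_one_div_add_atTop_nhds_zero_nat (𝕜 := ℝ))).2 ε hε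
  filter_upwards [h] with k hk z hz
  apply hb
  simp only [Metric.mem_ball, dist_eq_norm, add_sub_cancel_left]
  linarith

/-- For x in `shrink k U` the shifted kernel y ↦ ρ(x - y) is a test function supported in U, so the
weak gradient may be tested with it. The zero extension across the boundary of U is never seen. -/
theorem fderiv_moll {U : Set (Euc m)} (hU : IsOpen U) {u : Euc m → ℝ} {G : Fin m → Euc m → ℝ}
    (hu : MemLp u 2 (volume.restrict U)) (hw : HasWeakGrad U u G) (k : ℕ) {x : Euc m}
    (hx : x ∈ shrink k U) (i : Fin m) :
    fderiv ℝ (moll k (U.indicator u)) x (stdVec i) = moll k (U.indicator (G i)) x := by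
  set ρ : Euc m → ℝ := (bump m k).normed volume with hρ
  have hρs : ContDiff ℝ ∞ ρ := (bump m k).contDiff_normed
  have hρd : Differentiable ℝ ρ := hρs.differentiable (by simp)
  have hul : LocallyIntegrable (U.indicator u) volume :=
    ((memLp_indicator_iff_restrict hU.measurableSet).2 hu).locallyIntegrable (by norm_num)
  have hd := (bump m k).hasCompactSupport_normed.hasFDerivAt_convolution_left
    (ContinuousLinearMap.lsmul ℝ ℝ) (hρs.of_le (by simp)) hul x (μ := volume)
  have hci : ConvolutionExistsAt (fderiv ℝ ρ) (U.indicator u) x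
      (ContinuousLinearMap.precompL (Euc m) (ContinuousLinearMap.lsmul ℝ ℝ)) volume :=
    ((bump m k).hasCompactSupport_normed.fderiv ℝ).convolutionExists_left _
      (hρs.continuous_fderiv (by simp)) hul x
  rw [moll, hd.fderiv, convolution_eq_swap,
    ContinuousLinearMap.integral_apply hci.integrable_swap]
  rw [moll_apply]
  set w : Euc m → ℝ := fun y => ρ (x - y) with hwdef
  have hwt : IsTest w := by
    refine ⟨hρs.comp (by fun_prop), ?_⟩
    have := (bump m k).hasCompactSupport_normed (μ := volume)
    exact this.comp_homeomorph (Homeomorph.subLeft x)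
  have hsub : tsupport w ⊆ U := by
    have hsup : tsupport w ⊆ Metric.closedBall x (1 / ((k : ℝ) + 1)) := by
      refine closure_minimal ?_ Metric.isClosed_closedBall
      intro y hy
      have : x - y ∈ Function.support ρ := hy
      rw [hρ, (bump m k).support_normed_eq] at this
      have h2 : ‖x - y‖ < 1 / ((k : ℝ) + 1) := by simpa [bump] using this
      rw [Metric.mem_closedBall, dist_eq_norm, norm_sub_rev]
      exact h2.le
    intro y hy
    have h3 := hsup hy
    rw [Metric.mem_closedBall, dist_eq_norm] at h3
    simpa using hx (y - x) h3
  have hfd : ∀ y, fderiv ℝ w y (stdVec i) = - fderiv ℝ ρ (x - y) (stdVec i) := by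
    intro y
    have h1 : HasFDerivAt (fun y : Euc m => x - y) (-(ContinuousLinearMap.id ℝ (Euc m))) y :=
      (hasFDerivAt_id y).const_sub x
    have h2 : HasFDerivAt w _ y := (hρd (x - y)).hasFDerivAt.comp y h1
    rw [h2.fderiv]
    simp
  have := hw w hwt hsub i
  calc _ = ∫ y, U.indicator (fun y => -(u y * fderiv ℝ w y (stdVec i))) y := by
        congr 1; ext y
        by_cases hy : y ∈ U
        · simp [hy, hfd, ContinuousLinearMap.precompL_apply, mul_comm]
        · simp [hy]
    _ = ∫ y in U, G i y * w y := by
        rw [integral_indicator hU.measurableSet, integral_neg, this, neg_neg]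
    _ = _ := by
        rw [← integral_indicator hU.measurableSet]
        congr 1; ext y
        by_cases hy : y ∈ U
        · simp [hy, w, hρ, mul_comm]
        · simp [hy]

theorem ae_tendsto_moll {f : Euc m → ℝ} (hf : LocallyIntegrable f) :
    ∀ᵐ x, Tendsto (fun k => moll k f x) atTop (𝓝 (f x)) := by
  refine ContDiffBump.ae_convolution_tendsto_right_of_locallyIntegrable (K := 2)
    (φ := fun k => bump m k) ?_ ?_ hf
  · exact tendsto_one_div_add_atTop_nhds_zero_nat
  · refine Eventually.of_forall fun k => ?_
    simp only [bump]
    rw [← mul_div_assoc, mul_one, div_le_div_iff₀ (by positivity) (by positivity)]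
    linarith

theorem tendsto_moll_of_continuousAt {f : Euc m → ℝ} (hf : AEStronglyMeasurable f) {x : Euc m}
    (hx : ContinuousAt f x) : Tendsto (fun k => moll k f x) atTop (𝓝 (f x)) := by
  refine ContDiffBump.convolution_tendsto_right (φ := fun k => bump m k) (k := fun _ => x)
    (g := fun _ => f) ?_ (Eventually.of_forall fun _ => hf) ?_ tendsto_const_nhds
  · exact tendsto_one_div_add_atTop_nhds_zero_nat
  · exact hx.tendsto.comp tendsto_snd

/-! ### Differences along affine paths, and Poincaré's inequality -/

theorem lintegral_rpow_neg_half : ∫⁻ t in Set.Ioc (0 : ℝ) 1, ENNReal.ofReal (t ^ (-(1 / 2) : ℝ)) = 2 := by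
  have hi : IntervalIntegrable (fun t : ℝ => t ^ (-(1 / 2) : ℝ)) volume 0 1 :=
    intervalIntegral.intervalIntegrable_rpow' (by norm_num)
  rw [← ofReal_integral_eq_lintegral_ofReal]
  · rw [← intervalIntegral.integral_of_le zero_le_one, integral_rpow (by norm_num)]
    norm_num
  · exact (intervalIntegrable_iff_integrableOn_Ioc_of_le zero_le_one).1 hi
  · refine (ae_restrict_iff' measurableSet_Ioc).2 (Eventually.of_forall fun t ht => ?_)
    exact Real.rpow_nonneg ht.1.le _

/-- Cauchy–Schwarz with the factors t^{-1/4} and t^{1/4}; the first has squared integral at most 2.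
The remaining weight √t is what makes the Jacobian t⁻¹ of paths that collapse onto a facet
integrable. -/
theorem sq_lintegral_le_two_mul {θ : ℝ} (hθ : 0 ≤ θ) {f : ℝ → ℝ≥0∞} (hf : Measurable f) :
    (∫⁻ t in Set.Ioc θ 1, f t) ^ 2 ≤
      2 * ∫⁻ t in Set.Ioc θ 1, ENNReal.ofReal (Real.sqrt t) * f t ^ 2 := by
  have hm1 : Measurable fun t : ℝ => ENNReal.ofReal (t ^ (-(1 / 4) : ℝ)) := by fun_prop
  have hm2 : Measurable fun t : ℝ => ENNReal.ofReal (t ^ ((1 / 4) : ℝ)) := by fun_prop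
  calc (∫⁻ t in Set.Ioc θ 1, f t) ^ 2
      = (∫⁻ t in Set.Ioc θ 1, ENNReal.ofReal (t ^ (-(1 / 4) : ℝ)) *
          (ENNReal.ofReal (t ^ ((1 / 4) : ℝ)) * f t)) ^ 2 := by
        congr 1
        refine setLIntegral_congr_fun measurableSet_Ioc fun t ht => ?_
        have ht0 : 0 < t := lt_of_le_of_lt hθ ht.1
        rw [← mul_assoc, ← ENNReal.ofReal_mul (by positivity), ← Real.rpow_add ht0]
        norm_num
    _ ≤ (∫⁻ t in Set.Ioc θ 1, ENNReal.ofReal (t ^ (-(1 / 4) : ℝ)) ^ 2) *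
          ∫⁻ t in Set.Ioc θ 1, (ENNReal.ofReal (t ^ ((1 / 4) : ℝ)) * f t) ^ 2 :=
        sq_lintegral_mul_le hm1.aemeasurable (hm2.mul hf).aemeasurable
    _ ≤ _ := by
        gcongr ?_ * ?_
        · rw [← lintegral_rpow_neg_half]
          calc _ ≤ ∫⁻ t in Set.Ioc (0 : ℝ) 1, ENNReal.ofReal (t ^ (-(1 / 4) : ℝ)) ^ 2 :=
                lintegral_mono_set (Set.Ioc_subset_Ioc_left hθ)
            _ = _ := by
                refine setLIntegral_congr_fun measurableSet_Ioc fun t ht => ?_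
                rw [← ENNReal.ofReal_pow (Real.rpow_nonneg ht.1.le _), ← Real.rpow_natCast,
                  ← Real.rpow_mul ht.1.le]
                norm_num
        · refine (setLIntegral_congr_fun measurableSet_Ioc fun t ht => ?_).le
          have ht0 : 0 ≤ t := (lt_of_le_of_lt hθ ht.1).le
          rw [mul_pow, ← ENNReal.ofReal_pow (Real.rpow_nonneg ht0 _), ← Real.rpow_natCast,
            ← Real.rpow_mul ht0, Real.sqrt_eq_rpow]
          norm_num

/-- The point `t x + (1 - t) A x`, where `A x = B x + b`. -/
def pathPt (B : Euc m →ₗ[ℝ] Euc m) (b : Euc m) (t : ℝ) (x : Euc m) : Euc m :=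
  x + (1 - t) • (B x + b - x)

/-- The linear part of `pathPt`. -/
def pathLin (B : Euc m →ₗ[ℝ] Euc m) (t : ℝ) : Euc m →ₗ[ℝ] Euc m :=
  LinearMap.id + (1 - t) • (B - LinearMap.id)

theorem pathPt_eq (B : Euc m →ₗ[ℝ] Euc m) (b : Euc m) (t : ℝ) (x : Euc m) :
    pathPt B b t x = pathLin B t x + (1 - t) • b := by
  simp only [pathPt, pathLin, LinearMap.add_apply, LinearMap.smul_apply, LinearMap.sub_apply,
    LinearMap.id_apply]
  module

theorem continuous_pathPt (B : Euc m →ₗ[ℝ] Euc m) (b : Euc m) :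
    Continuous fun p : ℝ × Euc m => pathPt B b p.1 p.2 := by
  have : Continuous (B : Euc m → Euc m) := LinearMap.continuous_of_finiteDimensional B
  unfold pathPt
  fun_prop

/-- The derivative is integrated along the segment from A x (parameter 0) to x (parameter 1),
stopped at parameter θ. -/
theorem enorm_sub_pathPt_sq_le {w : Euc m → ℝ} (hw : ContDiff ℝ 1 w) (B : Euc m →ₗ[ℝ] Euc m)
    (b : Euc m) {θ : ℝ} (h0 : 0 ≤ θ) (h1 : θ ≤ 1) (x : Euc m) :
    ‖w x - w (pathPt B b θ x)‖ₑ ^ 2 ≤ ‖x - (B x + b)‖ₑ ^ 2 *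
      (2 * ∫⁻ t in Set.Ioc θ 1, ENNReal.ofReal (Real.sqrt t) *
        ‖fderiv ℝ w (pathPt B b t x)‖ₑ ^ 2) := by
  set d := B x + b - x with hd
  have hcont : Continuous fun t : ℝ => fderiv ℝ w (pathPt B b t x) :=
    (hw.continuous_fderiv one_ne_zero).comp
      ((continuous_pathPt B b).comp (continuous_id.prodMk continuous_const))
  have hder : ∀ t : ℝ, HasDerivAt (fun t => w (pathPt B b t x))
      (fderiv ℝ w (pathPt B b t x) (-d)) t := by
    intro t
    have h2 : HasDerivAt (fun t : ℝ => pathPt B b t x) (-d) t := by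
      have := (((hasDerivAt_id t).const_sub 1).smul_const d).const_add x
      simpa [pathPt] using this
    exact ((hw.differentiable one_ne_zero) _).hasFDerivAt.comp_hasDerivAt t h2
  have hint := intervalIntegral.integral_eq_sub_of_hasDerivAt (a := θ) (b := 1)
    (fun t _ => hder t) ((hcont.clm_apply continuous_const).intervalIntegrable _ _)
  have e1 : pathPt B b 1 x = x := by simp [pathPt]
  rw [e1, intervalIntegral.integral_of_le h1] at hint
  have hm : Measurable fun t : ℝ => ‖fderiv ℝ w (pathPt B b t x)‖ₑ := hcont.enorm.measurable
  calc ‖w x - w (pathPt B b θ x)‖ₑ ^ 2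
      ≤ (∫⁻ t in Set.Ioc θ 1, ‖fderiv ℝ w (pathPt B b t x)‖ₑ * ‖d‖ₑ) ^ 2 := by
        rw [← hint]
        gcongr
        refine (enorm_integral_le_lintegral_enorm _).trans (lintegral_mono fun t => ?_)
        simpa using ContinuousLinearMap.le_opENorm (fderiv ℝ w (pathPt B b t x)) (-d)
    _ = ‖x - (B x + b)‖ₑ ^ 2 * (∫⁻ t in Set.Ioc θ 1, ‖fderiv ℝ w (pathPt B b t x)‖ₑ) ^ 2 := by
        rw [lintegral_mul_const _ hm, mul_pow, mul_comm, hd, ← enorm_neg, neg_sub]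
    _ ≤ _ := by
        gcongr
        exact sq_lintegral_le_two_mul h0 hm

/-- After Tonelli the map `pathPt B b t` is affine for fixed t, with Jacobian at least tᵏ, so a
change of variables turns gradients along the paths into the gradient on W. The exponent k is the
number of dimensions lost at t = 0: it is 0 for translations and 1 for the projection onto a facet.
The weight q compensates the length of the paths. -/
theorem smooth_path_estimate {w : Euc m → ℝ} (hw : ContDiff ℝ 1 w) {W V : Set (Euc m)}
    (hW : MeasurableSet W) (hWc : Convex ℝ W) (hV : MeasurableSet V) (hVW : V ⊆ W)
    (B : Euc m →ₗ[ℝ] Euc m) (b : Euc m) {θ : ℝ} (h0 : 0 ≤ θ) (h1 : θ ≤ 1) {k : ℕ}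
    (hdet : ∀ t ∈ Set.Icc θ 1, t ^ k ≤ |LinearMap.det (pathLin B t)|)
    (hAV : ∀ x ∈ V, pathPt B b θ x ∈ W) {q : Euc m → ℝ} {S c : ℝ≥0∞}
    (hq : ∀ x ∈ V, ENNReal.ofReal (q x) * ‖x - (B x + b)‖ₑ ^ 2 ≤ S)
    (hc : 2 * ∫⁻ t in Set.Ioc θ 1, ENNReal.ofReal (Real.sqrt t) * ENNReal.ofReal ((t ^ k)⁻¹) ≤ c) :
    ∫⁻ x in V, ENNReal.ofReal (q x) * ‖w x - w (pathPt B b θ x)‖ₑ ^ 2 ≤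
      S * c * ∫⁻ x in W, ‖fderiv ℝ w x‖ₑ ^ 2 := by
  -- Extended by zero, so that the change of variables can be made on the whole space.
  set F : Euc m → ℝ≥0∞ := W.indicator fun x => ‖fderiv ℝ w x‖ₑ ^ 2 with hF
  have hFm : Measurable F :=
    (((hw.continuous_fderiv one_ne_zero).enorm.measurable).pow_const 2).indicator hW
  have hseg : ∀ x ∈ V, ∀ t ∈ Set.Ioc θ 1, pathPt B b t x ∈ W := by
    intro x hx t ht
    rcases eq_or_lt_of_le h1 with h | h
    · exact absurd (ht.1.trans_le ht.2) (by simp [h])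
    -- A convex combination of x and of the end of the stopped path, both of which lie in W.
    have key : pathPt B b t x = ((t - θ) / (1 - θ)) • x + ((1 - t) / (1 - θ)) • pathPt B b θ x := by
      have h2 : (1 - θ) ≠ 0 := by linarith
      have e1 : (t - θ) / (1 - θ) = 1 - (1 - t) / (1 - θ) := by field_simp; ring
      have e2 : (1 - t) / (1 - θ) * (1 - θ) = 1 - t := by field_simp
      simp only [pathPt]
      rw [e1, smul_add, smul_smul, e2]
      module
    rw [key]
    refine hWc (hVW hx) (hAV x hx) ?_ ?_ ?_
    · exact div_nonneg (by linarith [ht.1]) (by linarith)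
    · exact div_nonneg (by linarith [ht.2]) (by linarith)
    · rw [← add_div]; apply div_eq_one_iff_eq (by linarith) |>.2; ring
  have hFP : Measurable fun p : Euc m × ℝ => F (pathPt B b p.2 p.1) :=
    hFm.comp ((continuous_pathPt B b).comp continuous_swap).measurable
  calc ∫⁻ x in V, ENNReal.ofReal (q x) * ‖w x - w (pathPt B b θ x)‖ₑ ^ 2
      ≤ ∫⁻ x in V, S * (2 * ∫⁻ t in Set.Ioc θ 1, ENNReal.ofReal (Real.sqrt t) *
          F (pathPt B b t x)) := by
        refine setLIntegral_mono' hV fun x hx => ?_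
        calc _ ≤ ENNReal.ofReal (q x) * (‖x - (B x + b)‖ₑ ^ 2 *
              (2 * ∫⁻ t in Set.Ioc θ 1, ENNReal.ofReal (Real.sqrt t) *
              ‖fderiv ℝ w (pathPt B b t x)‖ₑ ^ 2)) := by
              gcongr; exact enorm_sub_pathPt_sq_le hw B b h0 h1 x
          _ ≤ _ := by
              rw [← mul_assoc]
              refine mul_le_mul' (hq x hx) (mul_le_mul_right ?_ _)
              refine setLIntegral_mono' measurableSet_Ioc fun t ht => ?_
              rw [hF, Set.indicator_of_mem (hseg x hx t ht)]
    _ = S * (2 * ∫⁻ t in Set.Ioc θ 1, ENNReal.ofReal (Real.sqrt t) *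
          ∫⁻ x in V, F (pathPt B b t x)) := by
        have hmm : Measurable fun p : Euc m × ℝ =>
            ENNReal.ofReal (Real.sqrt p.2) * F (pathPt B b p.2 p.1) :=
          (by fun_prop : Measurable fun p : Euc m × ℝ => ENNReal.ofReal (Real.sqrt p.2)).mul hFP
        have hm1 : Measurable fun x : Euc m => ∫⁻ t in Set.Ioc θ 1,
            ENNReal.ofReal (Real.sqrt t) * F (pathPt B b t x) := hmm.lintegral_prod_right'
        rw [lintegral_const_mul _ (hm1.const_mul 2), lintegral_const_mul _ hm1,
          lintegral_lintegral_swap hmm.aemeasurable]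
        congr 2
        refine lintegral_congr fun t => ?_
        rw [lintegral_const_mul]
        exact hFm.comp ((continuous_pathPt B b).comp (Continuous.prodMk_right t)).measurable
    _ ≤ S * (2 * ∫⁻ t in Set.Ioc θ 1, ENNReal.ofReal (Real.sqrt t) *
          (ENNReal.ofReal ((t ^ k)⁻¹) * ∫⁻ x, F x)) := by
        gcongr S * (2 * ?_)
        refine setLIntegral_mono' measurableSet_Ioc fun t ht => ?_
        gcongr
        have ht0 : 0 < t := lt_of_le_of_lt h0 ht.1
        have hdt := hdet t ⟨ht.1.le, ht.2⟩
        have hpos : 0 < t ^ k := by positivity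
        have hne : LinearMap.det (pathLin B t) ≠ 0 := abs_pos.1 (hpos.trans_le hdt)
        calc ∫⁻ x in V, F (pathPt B b t x) ≤ ∫⁻ x, F (pathPt B b t x) :=
              setLIntegral_le_lintegral _ _
          _ = ENNReal.ofReal |(LinearMap.det (pathLin B t))⁻¹| * ∫⁻ x, F x := by
              simp only [pathPt_eq]
              exact lintegral_comp_linear_add hFm _ _ hne
          _ ≤ _ := by
              gcongr
              rw [abs_inv]
              exact inv_anti₀ hpos hdt
    _ = S * (2 * ∫⁻ t in Set.Ioc θ 1, ENNReal.ofReal (Real.sqrt t) * ENNReal.ofReal ((t ^ k)⁻¹)) *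
          ∫⁻ x, F x := by
        simp only [← mul_assoc]
        rw [lintegral_mul_const _ (by fun_prop)]
        ring
    _ ≤ _ := by
        rw [hF, lintegral_indicator hW]
        gcongr

/-- Fatou's lemma, in the form by which bounds pass from mollifications to weakly differentiable
functions. -/
theorem lintegral_le_of_tendsto {α : Type*} [MeasurableSpace α] {μ : Measure α}
    {F : ℕ → α → ℝ≥0∞} {f : α → ℝ≥0∞} (hF : ∀ k, Measurable (F k))
    (h : ∀ᵐ x ∂μ, Tendsto (fun k => F k x) atTop (𝓝 (f x))) {C : ℝ≥0∞}
    (hC : ∀ k, ∫⁻ x, F k x ∂μ ≤ C) : ∫⁻ x, f x ∂μ ≤ C := by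
  calc ∫⁻ x, f x ∂μ = ∫⁻ x, liminf (fun k => F k x) atTop ∂μ :=
        lintegral_congr_ae (h.mono fun x hx => hx.liminf_eq.symm)
    _ ≤ liminf (fun k => ∫⁻ x, F k x ∂μ) atTop := lintegral_liminf_le hF
    _ ≤ C := liminf_le_of_frequently_le' (Frequently.of_forall hC)

theorem locallyIntegrable_indicator {U : Set (Euc m)} (hU : IsOpen U) {u : Euc m → ℝ}
    (hu : MemLp u 2 (volume.restrict U)) : LocallyIntegrable (U.indicator u) volume :=
  ((memLp_indicator_iff_restrict hU.measurableSet).2 hu).locallyIntegrable (by norm_num)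

theorem lintegral_moll_indicator_sq_le {U : Set (Euc m)} (hU : IsOpen U) {u : Euc m → ℝ}
    (hu : MemLp u 2 (volume.restrict U)) (k : ℕ) (W : Set (Euc m)) :
    ∫⁻ x in W, ‖moll k (U.indicator u) x‖ₑ ^ 2 ≤ ∫⁻ x in U, ‖u x‖ₑ ^ 2 := by
  calc _ ≤ ∫⁻ x, ‖moll k (U.indicator u) x‖ₑ ^ 2 := setLIntegral_le_lintegral _ _
    _ ≤ ∫⁻ x, ‖U.indicator u x‖ₑ ^ 2 := lintegral_moll_sq_le k
        ((memLp_indicator_iff_restrict hU.measurableSet).2 hu).1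
    _ = _ := by
        rw [← lintegral_indicator hU.measurableSet]
        refine lintegral_congr fun x => ?_
        by_cases hx : x ∈ U <;> simp [hx]

theorem lintegral_fderiv_moll_sq_le {U : Set (Euc m)} (hU : IsOpen U) {u : Euc m → ℝ}
    {G : Fin m → Euc m → ℝ} (hu : MemLp u 2 (volume.restrict U))
    (hG : ∀ i, MemLp (G i) 2 (volume.restrict U)) (hw : HasWeakGrad U u G) (k : ℕ) :
    ∫⁻ x in shrink k U, ‖fderiv ℝ (moll k (U.indicator u)) x‖ₑ ^ 2 ≤
      ∑ i, ∫⁻ x in U, ‖G i x‖ₑ ^ 2 := by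
  calc _ ≤ ∫⁻ x in shrink k U, ∑ i, ‖moll k (U.indicator (G i)) x‖ₑ ^ 2 := by
        refine setLIntegral_mono' (isOpen_shrink k hU).measurableSet fun x hx => ?_
        refine (enorm_sq_le_sum _).trans (Finset.sum_le_sum fun i _ => ?_)
        rw [fderiv_moll hU hu hw k hx i]
    _ = ∑ i, ∫⁻ x in shrink k U, ‖moll k (U.indicator (G i)) x‖ₑ ^ 2 := by
        refine lintegral_finsetSum _ fun i _ => ?_
        exact ((contDiff_moll k (locallyIntegrable_indicator hU (hG i))).continuous.enorm.measurable
          ).pow_const 2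
    _ ≤ _ := Finset.sum_le_sum fun i _ => lintegral_moll_indicator_sq_le hU (hG i) k _

/-- The smooth estimate is applied to mollifications on the shrunken convex sets, where their
gradients are mollified weak gradients, and Fatou's lemma gives the limit. By `hpos` the map to the
end of the path is nonsingular, so that almost everywhere convergence of the mollifications also
holds at the ends; a degenerate end θ = 0 has to be reached by a further limit. -/
theorem weak_path_estimate {U : Set (Euc m)} (hU : IsOpen U) (hUc : Convex ℝ U) {u : Euc m → ℝ}
    {G : Fin m → Euc m → ℝ} (hu : MemLp u 2 (volume.restrict U))
    (hG : ∀ i, MemLp (G i) 2 (volume.restrict U)) (hw : HasWeakGrad U u G)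
    {V : Set (Euc m)} (hV : MeasurableSet V) (hVU : V ⊆ U)
    (B : Euc m →ₗ[ℝ] Euc m) (b : Euc m) {θ : ℝ} (h0 : 0 ≤ θ) (h1 : θ ≤ 1) {k : ℕ}
    (hdet : ∀ t ∈ Set.Icc θ 1, t ^ k ≤ |LinearMap.det (pathLin B t)|) (hpos : 0 < θ ^ k)
    (hAV : ∀ x ∈ V, pathPt B b θ x ∈ U) {q : Euc m → ℝ} (hqm : Measurable q) {S c : ℝ≥0∞}
    (hq : ∀ x ∈ V, ENNReal.ofReal (q x) * ‖x - (B x + b)‖ₑ ^ 2 ≤ S)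
    (hc : 2 * ∫⁻ t in Set.Ioc θ 1, ENNReal.ofReal (Real.sqrt t) * ENNReal.ofReal ((t ^ k)⁻¹) ≤ c) :
    ∫⁻ x in V, ENNReal.ofReal (q x) * ‖u x - u (pathPt B b θ x)‖ₑ ^ 2 ≤
      S * c * ∑ i, ∫⁻ x in U, ‖G i x‖ₑ ^ 2 := by
  have hPc : Continuous (pathPt B b θ) := (continuous_pathPt B b).comp (Continuous.prodMk_right θ)
  have hul := locallyIntegrable_indicator hU hu
  have hne : LinearMap.det (pathLin B θ) ≠ 0 :=
    abs_pos.1 (hpos.trans_le (hdet θ ⟨le_rfl, h1⟩))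
  -- Points for which both ends of the path are in the shrunken set; each point of V has this
  -- property for large k.
  set Vk : ℕ → Set (Euc m) := fun k => V ∩ (shrink k U ∩ pathPt B b θ ⁻¹' shrink k U) with hVk
  have hVkm : ∀ k, MeasurableSet (Vk k) := fun k => hV.inter
    ((isOpen_shrink k hU).measurableSet.inter
      ((isOpen_shrink k hU).preimage hPc).measurableSet)
  have hsm : ∀ k, ContDiff ℝ ∞ (moll k (U.indicator u)) := fun k => contDiff_moll k hul
  rw [← lintegral_indicator hV]
  refine lintegral_le_of_tendsto (F := fun k => (Vk k).indicator fun x => ENNReal.ofReal (q x) *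
    ‖moll k (U.indicator u) x - moll k (U.indicator u) (pathPt B b θ x)‖ₑ ^ 2) ?_ ?_ ?_
  · intro k
    refine Measurable.indicator ?_ (hVkm k)
    have h3 := (hsm k).continuous
    exact (ENNReal.measurable_ofReal.comp hqm).mul
      (((h3.sub (h3.comp hPc)).enorm.measurable).pow_const 2)
  · have ha := ae_tendsto_moll hul
    have hb : ∀ᵐ x, Tendsto (fun k => moll k (U.indicator u) (pathPt B b θ x)) atTop
        (𝓝 (U.indicator u (pathPt B b θ x))) := by
      have hqm2 : Measure.QuasiMeasurePreserving (pathPt B b θ) volume volume := by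
        refine ⟨hPc.measurable, ?_⟩
        refine Measure.AbsolutelyContinuous.mk fun s hs h => ?_
        rw [Measure.map_apply hPc.measurable hs, ← lintegral_indicator_one (hPc.measurable hs)]
        have := lintegral_comp_linear_add (measurable_one.indicator hs : Measurable
          (s.indicator (1 : Euc m → ℝ≥0∞))) (pathLin B θ) ((1 - θ) • b) hne
        rw [lintegral_indicator_one hs, h, mul_zero] at this
        rw [← this]
        refine lintegral_congr fun x => ?_
        rw [← pathPt_eq]
        rfl
      exact hqm2.ae ha
    filter_upwards [ha, hb] with x hxa hxb
    by_cases hx : x ∈ V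
    · have e1 : ∀ᶠ k in atTop, x ∈ Vk k := by
        filter_upwards [eventually_mem_shrink hU (hVU hx), eventually_mem_shrink hU (hAV x hx)]
          with k k1 k2 using ⟨hx, k1, k2⟩
      rw [Set.indicator_of_mem hx]
      rw [Set.indicator_of_mem (hVU hx)] at hxa
      rw [Set.indicator_of_mem (hAV x hx)] at hxb
      have := ENNReal.Tendsto.const_mul (a := ENNReal.ofReal (q x))
        (((ENNReal.continuous_pow 2).tendsto _).comp
          ((continuous_enorm.tendsto _).comp (hxa.sub hxb))) (Or.inr ENNReal.ofReal_ne_top)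
      refine this.congr' ?_
      filter_upwards [e1] with k hk
      rw [Set.indicator_of_mem hk]
      rfl
    · have : ∀ k, x ∉ Vk k := fun k h => hx h.1
      simp [this, hx]
  · intro j
    rw [lintegral_indicator (hVkm j)]
    refine (smooth_path_estimate ((hsm j).of_le (by simp)) (isOpen_shrink j hU).measurableSet
      (convex_shrink j hUc) (hVkm j) (fun x hx => hx.2.1) B b h0 h1 hdet (fun x hx => hx.2.2)
      (fun x hx => hq x hx.1) hc).trans ?_
    gcongr
    exact lintegral_fderiv_moll_sq_le hU hu hG hw j

theorem lintegral_sqrt_le : 2 * ∫⁻ t in Set.Ioc (0 : ℝ) 1,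
    ENNReal.ofReal (Real.sqrt t) * ENNReal.ofReal ((t ^ 0)⁻¹) ≤ 2 := by
  calc _ ≤ 2 * ∫⁻ t in Set.Ioc (0 : ℝ) 1, 1 := by
        gcongr 2 * ?_
        refine setLIntegral_mono' measurableSet_Ioc fun t ht => ?_
        simpa using ht.2
    _ = 2 := by simp

/-- Paths from x to x + z: every path map is a translation, so the Jacobian is 1 and k = 0, θ = 0
are admissible. -/
theorem lintegral_translate_sub_sq_le {U : Set (Euc m)} (hU : IsOpen U) (hUc : Convex ℝ U)
    {u : Euc m → ℝ} {G : Fin m → Euc m → ℝ} (hu : MemLp u 2 (volume.restrict U))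
    (hG : ∀ i, MemLp (G i) 2 (volume.restrict U)) (hw : HasWeakGrad U u G) (z : Euc m) :
    ∫⁻ x in U ∩ (fun x => x + z) ⁻¹' U, ‖u x - u (x + z)‖ₑ ^ 2 ≤
      2 * ‖z‖ₑ ^ 2 * ∑ i, ∫⁻ x in U, ‖G i x‖ₑ ^ 2 := by
  have e : ∀ x, pathPt LinearMap.id z 0 x = x + z := fun x => by simp [pathPt]
  have := weak_path_estimate hU hUc hu hG hw (V := U ∩ (fun x => x + z) ⁻¹' U)
    (hU.measurableSet.inter (hU.preimage (continuous_add_const z)).measurableSet)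
    Set.inter_subset_left LinearMap.id z (θ := 0) le_rfl zero_le_one (k := 0)
    (fun t _ => by simp [pathLin]) (by simp) (fun x hx => by rw [e]; exact hx.2)
    (q := fun _ => 1) measurable_const (S := ‖z‖ₑ ^ 2) (c := 2)
    (fun x _ => by simp) lintegral_sqrt_le
  simp only [e, ENNReal.ofReal_one, one_mul] at this
  rwa [mul_comm (2 : ℝ≥0∞)]

/-- Substituting y = x + z and exchanging the integrals leaves, for each z, a difference of
translates, which is bounded by |z|² times the squared gradient. -/
theorem lintegral_kernel_sub_sq_le {U : Set (Euc m)} (hU : IsOpen U) (hUc : Convex ℝ U)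
    {u : Euc m → ℝ} {G : Fin m → Euc m → ℝ} (hu : MemLp u 2 (volume.restrict U))
    (hG : ∀ i, MemLp (G i) 2 (volume.restrict U)) (hw : HasWeakGrad U u G)
    {K : Euc m → ℝ≥0∞} (hK : Measurable K) :
    ∫⁻ x in U, ∫⁻ y in U, K (y - x) * ‖u x - u y‖ₑ ^ 2 ≤
      2 * (∫⁻ z, K z * ‖z‖ₑ ^ 2) * ∑ i, ∫⁻ x in U, ‖G i x‖ₑ ^ 2 := by
  have hum : AEMeasurable (U.indicator u) :=
    ((memLp_indicator_iff_restrict hU.measurableSet).2 hu).1.aemeasurable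
  set I : Euc m → ℝ≥0∞ := U.indicator 1 with hI
  have hIm : Measurable I := measurable_one.indicator hU.measurableSet
  set F : Euc m × Euc m → ℝ≥0∞ := fun p => I p.1 * I p.2 *
    (K (p.2 - p.1) * ‖U.indicator u p.1 - U.indicator u p.2‖ₑ ^ 2) with hF
  have hFm : AEMeasurable F (volume.prod volume) := by
    refine ((hIm.comp measurable_fst).mul (hIm.comp measurable_snd)).aemeasurable.mul ?_
    refine (hK.comp (measurable_snd.sub measurable_fst)).aemeasurable.mul ?_
    exact (hum.comp_fst.sub hum.comp_snd).enorm.pow_const 2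
  have hFxy : ∀ x ∈ U, ∀ y ∈ U, F (x, y) = K (y - x) * ‖u x - u y‖ₑ ^ 2 := by
    intro x hx y hy
    simp [hF, hI, hx, hy]
  have hF0 : ∀ x y, x ∉ U ∨ y ∉ U → F (x, y) = 0 := by
    rintro x y (h | h) <;> simp [hF, hI, h]
  calc ∫⁻ x in U, ∫⁻ y in U, K (y - x) * ‖u x - u y‖ₑ ^ 2
      = ∫⁻ x in U, ∫⁻ y in U, F (x, y) :=
        setLIntegral_congr_fun hU.measurableSet fun x hx =>
          setLIntegral_congr_fun hU.measurableSet fun y hy => (hFxy x hx y hy).symm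
    _ ≤ ∫⁻ x, ∫⁻ y, F (x, y) :=
        (setLIntegral_le_lintegral _ _).trans (lintegral_mono fun x => setLIntegral_le_lintegral _ _)
    _ = ∫⁻ x, ∫⁻ z, F (x, x + z) := by
        refine lintegral_congr fun x => ?_
        rw [lintegral_add_left_eq_self (fun y => F (x, y)) x]
    _ = ∫⁻ z, ∫⁻ x, F (x, x + z) :=
        lintegral_lintegral_swap (hFm.comp_quasiMeasurePreserving
          (measurePreserving_prod_add volume volume).quasiMeasurePreserving)
    _ ≤ ∫⁻ z, K z * (2 * ‖z‖ₑ ^ 2 * ∑ i, ∫⁻ x in U, ‖G i x‖ₑ ^ 2) := by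
        refine lintegral_mono fun z => ?_
        have hVm : MeasurableSet (U ∩ (fun x => x + z) ⁻¹' U) :=
          hU.measurableSet.inter (hU.preimage (continuous_add_const z)).measurableSet
        calc ∫⁻ x, F (x, x + z)
            = ∫⁻ x in U ∩ (fun x => x + z) ⁻¹' U, F (x, x + z) := by
              rw [← lintegral_indicator hVm]
              refine lintegral_congr fun x => ?_
              by_cases hx : x ∈ U ∩ (fun x => x + z) ⁻¹' U
              · rw [Set.indicator_of_mem hx]
              · rw [Set.indicator_of_notMem hx]
                refine hF0 _ _ ?_
                by_contra! h
                exact hx h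
          _ = ∫⁻ x in U ∩ (fun x => x + z) ⁻¹' U, K z * ‖u x - u (x + z)‖ₑ ^ 2 := by
              refine setLIntegral_congr_fun hVm fun x hx => ?_
              simp only [hFxy x hx.1 _ hx.2, add_sub_cancel_left]
          _ = K z * ∫⁻ x in U ∩ (fun x => x + z) ⁻¹' U, ‖u x - u (x + z)‖ₑ ^ 2 := by
              refine lintegral_const_mul'' _ ?_
              have h1 : AEMeasurable (fun x => ‖U.indicator u x - U.indicator u (x + z)‖ₑ ^ 2)
                  (volume.restrict (U ∩ (fun x => x + z) ⁻¹' U)) :=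
                ((hum.sub (hum.comp_quasiMeasurePreserving
                  (measurePreserving_add_right volume z).quasiMeasurePreserving)).enorm.pow_const 2).restrict
              refine h1.congr ((ae_restrict_iff' hVm).2 (Eventually.of_forall fun x hx => ?_))
              have hx2 : x + z ∈ U := hx.2
              simp only [Set.indicator_of_mem hx.1, Set.indicator_of_mem hx2]
          _ ≤ _ := by
              gcongr
              exact lintegral_translate_sub_sq_le hU hUc hu hG hw z
    _ = _ := by
        rw [← lintegral_const_mul _ (by fun_prop),
          ← lintegral_mul_const _ (by fun_prop)]
        exact lintegral_congr fun z => by ring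

/-- Poincaré's inequality, in terms of differences. -/
theorem lintegral_sub_sq_le {U : Set (Euc m)} (hU : IsOpen U) (hUc : Convex ℝ U)
    {u : Euc m → ℝ} {G : Fin m → Euc m → ℝ} (hu : MemLp u 2 (volume.restrict U))
    (hG : ∀ i, MemLp (G i) 2 (volume.restrict U)) (hw : HasWeakGrad U u G) {h : ℝ}
    (hd : ∀ x ∈ U, ∀ y ∈ U, dist x y ≤ h) :
    ∫⁻ x in U, ∫⁻ y in U, ‖u x - u y‖ₑ ^ 2 ≤
      2 * (ENNReal.ofReal h ^ 2 * volume (Metric.closedBall (0 : Euc m) h)) *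
        ∑ i, ∫⁻ x in U, ‖G i x‖ₑ ^ 2 := by
  -- The kernel that equals 1 on all differences of points of U.
  set K : Euc m → ℝ≥0∞ := (Metric.closedBall (0 : Euc m) h).indicator 1 with hKd
  have hK : Measurable K := measurable_one.indicator Metric.isClosed_closedBall.measurableSet
  calc _ = ∫⁻ x in U, ∫⁻ y in U, K (y - x) * ‖u x - u y‖ₑ ^ 2 := by
        refine setLIntegral_congr_fun hU.measurableSet fun x hx =>
          setLIntegral_congr_fun hU.measurableSet fun y hy => ?_
        have : y - x ∈ Metric.closedBall (0 : Euc m) h := by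
          rw [mem_closedBall_zero_iff, ← dist_eq_norm]; exact hd y hy x hx
        simp [hKd, this]
    _ ≤ _ := lintegral_kernel_sub_sq_le hU hUc hu hG hw hK
    _ ≤ _ := by
        gcongr 2 * ?_ * _
        calc ∫⁻ z, K z * ‖z‖ₑ ^ 2
            ≤ ∫⁻ z in Metric.closedBall (0 : Euc m) h, ENNReal.ofReal h ^ 2 := by
              rw [← lintegral_indicator Metric.isClosed_closedBall.measurableSet]
              refine lintegral_mono fun z => ?_
              by_cases hz : z ∈ Metric.closedBall (0 : Euc m) h
              · simp only [hKd, Set.indicator_of_mem hz, Pi.one_apply, one_mul]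
                gcongr
                rw [← ofReal_norm]
                exact ENNReal.ofReal_le_ofReal (mem_closedBall_zero_iff.1 hz)
              · simp [hKd, hz]
          _ = _ := by simp

/-! ### A pointwise bound -/

theorem enorm_add_three_sq_le (a b c : ℝ) :
    ‖a + b + c‖ₑ ^ 2 ≤ 3 * (‖a‖ₑ ^ 2 + ‖b‖ₑ ^ 2 + ‖c‖ₑ ^ 2) := by
  simp only [Real.enorm_eq_ofReal_abs]
  rw [← ENNReal.ofReal_pow (abs_nonneg _), ← ENNReal.ofReal_pow (abs_nonneg _),
    ← ENNReal.ofReal_pow (abs_nonneg _), ← ENNReal.ofReal_pow (abs_nonneg _),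
    ← ENNReal.ofReal_add (by positivity) (by positivity),
    ← ENNReal.ofReal_add (by positivity) (by positivity),
    ← ENNReal.ofReal_ofNat, ← ENNReal.ofReal_mul (by positivity)]
  apply ENNReal.ofReal_le_ofReal
  simp only [sq_abs]
  nlinarith [sq_nonneg (a - b), sq_nonneg (a - c), sq_nonneg (b - c)]

theorem enorm_sq_eq_ofReal {E : Type*} [SeminormedAddCommGroup E] (a : E) :
    ‖a‖ₑ ^ 2 = ENNReal.ofReal (‖a‖ ^ 2) := by
  rw [← ofReal_norm, ← ENNReal.ofReal_pow (norm_nonneg _)]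

theorem measurable_enorm_snd_fderiv {E : Type*} [NormedAddCommGroup E] [NormedSpace ℝ E]
    [MeasurableSpace E] [BorelSpace E] {w : E → ℝ} (hw : ContDiff ℝ 2 w) :
    Measurable fun x => ‖fderiv ℝ (fderiv ℝ w) x‖ₑ :=
  ((hw.fderiv_right (m := 1) (by norm_num)).continuous_fderiv (by norm_num)).enorm.measurable

/-- Expansion at y with integral remainder: w(x) = w(y) - Dw(y)d + ∫ s D²w(d, d) ds, where d = y - x
and s = 0 corresponds to x. The factor s vanishes at x, and its square compensates the Jacobian s⁻ᵐ
of the contraction towards x as long as m ≤ 2. -/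
theorem taylor_two_bound {w : Euc m → ℝ} (hw : ContDiff ℝ 2 w) {h : ℝ} {x y : Euc m}
    (hxy : dist x y ≤ h) :
    ‖w x‖ₑ ^ 2 ≤ 3 * (‖w y‖ₑ ^ 2 + ENNReal.ofReal h ^ 2 * ‖fderiv ℝ w y‖ₑ ^ 2 +
      ENNReal.ofReal h ^ 4 * ∫⁻ s in Set.Ioc (0 : ℝ) 1, ENNReal.ofReal (s ^ 2) *
        ‖fderiv ℝ (fderiv ℝ w) (s • y + (1 - s) • x)‖ₑ ^ 2) := by
  set d := y - x with hd
  have hdn : ‖d‖ₑ ≤ ENNReal.ofReal h := by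
    rw [← ofReal_norm, hd, ← dist_eq_norm, dist_comm]; exact ENNReal.ofReal_le_ofReal hxy
  set γ : ℝ → Euc m := fun s => s • y + (1 - s) • x with hγ
  have hγc : Continuous γ := by fun_prop
  have hγd : ∀ s, HasDerivAt γ d s := by
    intro s
    have := ((hasDerivAt_id s).smul_const y).add (((hasDerivAt_id s).const_sub 1).smul_const x)
    have e : d = (1 : ℝ) • y + (-1 : ℝ) • x := by rw [hd]; module
    rw [e]
    exact this
  have hw1 : ContDiff ℝ 1 (fderiv ℝ w) := hw.fderiv_right (by norm_num)
  have hD1 : Differentiable ℝ w := hw.differentiable (by norm_num)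
  have hD2 : Differentiable ℝ (fderiv ℝ w) := hw1.differentiable (by norm_num)
  have hc2 : Continuous fun s => fderiv ℝ (fderiv ℝ w) (γ s) :=
    (hw1.continuous_fderiv (by norm_num)).comp hγc
  have hder1 : ∀ s, HasDerivAt (fun s => w (γ s)) (fderiv ℝ w (γ s) d) s := fun s =>
    (hD1 _).hasFDerivAt.comp_hasDerivAt s (hγd s)
  have hder2 : ∀ s, HasDerivAt (fun s => fderiv ℝ w (γ s) d)
      (fderiv ℝ (fderiv ℝ w) (γ s) d d) s := fun s => by
    have h1 := ((hD2 (γ s)).hasFDerivAt.comp_hasDerivAt s (hγd s))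
    simpa using h1.clm_apply (hasDerivAt_const s d)
  -- The primitive of the remainder: it equals Dw(y)d - w(y) at s = 1 and -w(x) at s = 0.
  have hder3 : ∀ s, HasDerivAt (fun s => s * fderiv ℝ w (γ s) d - w (γ s))
      (s * fderiv ℝ (fderiv ℝ w) (γ s) d d) s := fun s => by
    have := ((hasDerivAt_id s).mul (hder2 s)).sub (hder1 s)
    have e : s * fderiv ℝ (fderiv ℝ w) (γ s) d d = 1 * fderiv ℝ w (γ s) d +
      s * fderiv ℝ (fderiv ℝ w) (γ s) d d - fderiv ℝ w (γ s) d := by ring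
    rw [e]
    exact this
  have hint := intervalIntegral.integral_eq_sub_of_hasDerivAt (a := 0) (b := 1)
    (fun s _ => hder3 s) (Continuous.intervalIntegrable (by fun_prop) _ _)
  have g1 : γ 1 = y := by simp [hγ]
  have g0 : γ 0 = x := by simp [hγ]
  rw [g1, g0] at hint
  rw [intervalIntegral.integral_of_le zero_le_one] at hint
  have hx : w x = w y + (-(fderiv ℝ w y d)) +
      ∫ s in Set.Ioc (0 : ℝ) 1, s * fderiv ℝ (fderiv ℝ w) (γ s) d d := by
    rw [hint]; ring
  rw [hx]
  refine (enorm_add_three_sq_le _ _ _).trans ?_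
  gcongr 3 * (_ + ?_ + ?_)
  · rw [enorm_neg, ← mul_pow, mul_comm]
    gcongr
    exact ((fderiv ℝ w y).le_opENorm d).trans (by gcongr)
  · calc _ ≤ (∫⁻ s in Set.Ioc (0 : ℝ) 1, ENNReal.ofReal h ^ 2 *
            (ENNReal.ofReal s * ‖fderiv ℝ (fderiv ℝ w) (γ s)‖ₑ)) ^ 2 := by
          gcongr
          refine (enorm_integral_le_lintegral_enorm _).trans
            (setLIntegral_mono' measurableSet_Ioc fun s hs => ?_)
          rw [enorm_mul, Real.enorm_of_nonneg hs.1.le]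
          calc _ ≤ ENNReal.ofReal s * (‖fderiv ℝ (fderiv ℝ w) (γ s)‖ₑ * ‖d‖ₑ * ‖d‖ₑ) := by
                gcongr
                refine (ContinuousLinearMap.le_opENorm _ d).trans ?_
                gcongr
                exact ContinuousLinearMap.le_opENorm _ d
            _ ≤ ENNReal.ofReal s * (‖fderiv ℝ (fderiv ℝ w) (γ s)‖ₑ * ENNReal.ofReal h *
                  ENNReal.ofReal h) := by gcongr
            _ = _ := by ring
      _ = ENNReal.ofReal h ^ 4 * (∫⁻ s in Set.Ioc (0 : ℝ) 1,
            (ENNReal.ofReal s * ‖fderiv ℝ (fderiv ℝ w) (γ s)‖ₑ)) ^ 2 := by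
          rw [lintegral_const_mul _ (by fun_prop)]; ring
      _ ≤ _ := by
          gcongr
          refine (sq_lintegral_le ?_).trans ?_
          · exact (by fun_prop : Measurable fun s => ENNReal.ofReal s *
              ‖fderiv ℝ (fderiv ℝ w) (γ s)‖ₑ).aemeasurable
          · simp only [Measure.restrict_apply_univ, Real.volume_Ioc, sub_zero,
              ENNReal.ofReal_one, one_mul]
            refine setLIntegral_mono' measurableSet_Ioc fun s hs => ?_
            rw [mul_pow, ENNReal.ofReal_pow hs.1.le]

/-- The Taylor bound is averaged over y ∈ W. In the last term y ↦ s y + (1 - s) x maps W into W with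
Jacobian sᵐ, and s² s⁻ᵐ ≤ 1. This is the embedding of H² into bounded functions for m ≤ 2, with its
scaling in the diameter made explicit. -/
theorem smooth_sup_bound (hm : m ≤ 2) {w : Euc m → ℝ} (hw : ContDiff ℝ 2 w) {W : Set (Euc m)}
    (hW : MeasurableSet W) (hWc : Convex ℝ W) {h : ℝ} (hd : ∀ x ∈ W, ∀ y ∈ W, dist x y ≤ h)
    {x : Euc m} (hx : x ∈ W) :
    ∫⁻ _ in W, ‖w x‖ₑ ^ 2 ≤ 3 * ((∫⁻ y in W, ‖w y‖ₑ ^ 2) +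
      ENNReal.ofReal h ^ 2 * (∫⁻ y in W, ‖fderiv ℝ w y‖ₑ ^ 2) +
      ENNReal.ofReal h ^ 4 * ∫⁻ y in W, ‖fderiv ℝ (fderiv ℝ w) y‖ₑ ^ 2) := by
  have hw1 : ContDiff ℝ 1 (fderiv ℝ w) := hw.fderiv_right (by norm_num)
  have hc1 : Continuous (fderiv ℝ w) := hw1.continuous
  set F : Euc m → ℝ≥0∞ := W.indicator fun x => ‖fderiv ℝ (fderiv ℝ w) x‖ₑ ^ 2 with hF
  have hFm : Measurable F := ((measurable_enorm_snd_fderiv hw).pow_const 2).indicator hW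
  have hmm : Measurable fun p : Euc m × ℝ =>
      ENNReal.ofReal (p.2 ^ 2) * F (p.2 • p.1 + (1 - p.2) • x) := by
    have : Measurable fun p : Euc m × ℝ => F (p.2 • p.1 + (1 - p.2) • x) :=
      hFm.comp (by fun_prop : Continuous fun p : Euc m × ℝ => p.2 • p.1 + (1 - p.2) • x).measurable
    fun_prop
  have hw0 : Continuous w := hw.continuous
  calc ∫⁻ _ in W, ‖w x‖ₑ ^ 2
      ≤ ∫⁻ y in W, 3 * (‖w y‖ₑ ^ 2 + ENNReal.ofReal h ^ 2 * ‖fderiv ℝ w y‖ₑ ^ 2 +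
        ENNReal.ofReal h ^ 4 * ∫⁻ s in Set.Ioc (0 : ℝ) 1, ENNReal.ofReal (s ^ 2) *
        F (s • y + (1 - s) • x)) := by
        refine setLIntegral_mono' hW fun y hy => (taylor_two_bound hw (hd x hx y hy)).trans ?_
        gcongr 3 * (_ + _ + _ * ?_)
        refine setLIntegral_mono' measurableSet_Ioc fun s hs => ?_
        have : s • y + (1 - s) • x ∈ W :=
          hWc hy hx hs.1.le (by linarith [hs.2]) (by ring)
        rw [hF, Set.indicator_of_mem this]
    _ = 3 * ((∫⁻ y in W, ‖w y‖ₑ ^ 2) + ENNReal.ofReal h ^ 2 * (∫⁻ y in W, ‖fderiv ℝ w y‖ₑ ^ 2) +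
        ENNReal.ofReal h ^ 4 * ∫⁻ s in Set.Ioc (0 : ℝ) 1, ENNReal.ofReal (s ^ 2) *
          ∫⁻ y in W, F (s • y + (1 - s) • x)) := by
        have hm1 : Measurable fun y : Euc m => ∫⁻ s in Set.Ioc (0 : ℝ) 1,
            ENNReal.ofReal (s ^ 2) * F (s • y + (1 - s) • x) := hmm.lintegral_prod_right'
        have h1 : Measurable fun y => ‖fderiv ℝ w y‖ₑ ^ 2 := hc1.enorm.measurable.pow_const 2
        have h2 : Measurable fun y => ‖w y‖ₑ ^ 2 := hw0.enorm.measurable.pow_const 2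
        rw [lintegral_const_mul _ (by fun_prop), lintegral_add_left (by fun_prop),
          lintegral_add_left (by fun_prop), lintegral_const_mul _ h1, lintegral_const_mul _ hm1,
          lintegral_lintegral_swap hmm.aemeasurable]
        congr 3
        refine lintegral_congr fun s => ?_
        rw [lintegral_const_mul]
        exact hFm.comp (by fun_prop : Continuous fun y : Euc m => s • y + (1 - s) • x).measurable
    _ ≤ 3 * ((∫⁻ y in W, ‖w y‖ₑ ^ 2) + ENNReal.ofReal h ^ 2 * (∫⁻ y in W, ‖fderiv ℝ w y‖ₑ ^ 2) +
        ENNReal.ofReal h ^ 4 * ∫⁻ s in Set.Ioc (0 : ℝ) 1, ∫⁻ y, F y) := by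
        gcongr 3 * (_ + _ + _ * ?_)
        refine setLIntegral_mono' measurableSet_Ioc fun s hs => ?_
        have hdet : LinearMap.det (s • (LinearMap.id : Euc m →ₗ[ℝ] Euc m)) = s ^ m := by
          rw [LinearMap.det_smul]; simp
        have hpos : 0 < s ^ m := pow_pos hs.1 m
        calc _ ≤ ENNReal.ofReal (s ^ 2) * ∫⁻ y, F (s • y + (1 - s) • x) := by
              gcongr; exact Measure.restrict_le_self
          _ = ENNReal.ofReal (s ^ 2) * (ENNReal.ofReal (s ^ m)⁻¹ * ∫⁻ y, F y) := by
              have := lintegral_comp_linear_add hFm (s • (LinearMap.id : Euc m →ₗ[ℝ] Euc m))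
                ((1 - s) • x) (by rw [hdet]; exact hpos.ne')
              rw [hdet, abs_of_pos (inv_pos.2 hpos)] at this
              rw [← this]; rfl
          _ ≤ _ := by
              rw [← mul_assoc, ← ENNReal.ofReal_mul (by positivity)]
              refine mul_le_of_le_one_left' ?_
              rw [ENNReal.ofReal_le_one, ← div_eq_mul_inv, div_le_one hpos]
              exact pow_le_pow_of_le_one hs.1.le hs.2 hm
    _ = _ := by
        rw [hF, lintegral_indicator hW]; simp

theorem enorm_snd_fderiv_sq_le {w : Euc m → ℝ} (hw : ContDiff ℝ 2 w) (x : Euc m) :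
    ‖fderiv ℝ (fderiv ℝ w) x‖ₑ ^ 2 ≤
      ∑ i, ‖fderiv ℝ (fun y => fderiv ℝ w y (stdVec i)) x‖ₑ ^ 2 := by
  have hw1 : ContDiff ℝ 1 (fderiv ℝ w) := hw.fderiv_right (by norm_num)
  have hD2 : DifferentiableAt ℝ (fderiv ℝ w) x := (hw1.differentiable (by norm_num)) x
  set T := fderiv ℝ (fderiv ℝ w) x with hT
  set T' : Fin m → Euc m →L[ℝ] ℝ := fun i => fderiv ℝ (fun y => fderiv ℝ w y (stdVec i)) x with hT'
  have hTi : ∀ i v, T' i v = T v (stdVec i) := by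
    intro i v
    have := hD2.hasFDerivAt.clm_apply (hasFDerivAt_const (stdVec i) x)
    rw [hT']
    simp only
    rw [this.fderiv]
    simp [hT]
  have hb : ‖T‖ ≤ Real.sqrt (∑ i, ‖T' i‖ ^ 2) := by
    refine T.opNorm_le_bound (Real.sqrt_nonneg _) fun v => ?_
    refine (norm_le_sqrt_sum_sq (T v)).trans ?_
    rw [← Real.sqrt_sq (norm_nonneg v), ← Real.sqrt_mul (by positivity)]
    apply Real.sqrt_le_sqrt
    rw [Finset.sum_mul]
    refine Finset.sum_le_sum fun i _ => ?_
    rw [← hTi, ← sq_abs, ← mul_pow]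
    exact pow_le_pow_left₀ (abs_nonneg _) ((T' i).le_opNorm v) 2
  refine (enorm_sq_eq_ofReal T).trans_le ?_
  change _ ≤ ∑ i, ‖T' i‖ₑ ^ 2
  simp only [enorm_sq_eq_ofReal]
  rw [← ENNReal.ofReal_sum_of_nonneg fun i _ => sq_nonneg _]
  apply ENNReal.ofReal_le_ofReal
  calc ‖T‖ ^ 2 ≤ Real.sqrt (∑ i, ‖T' i‖ ^ 2) ^ 2 := by gcongr
    _ = _ := Real.sq_sqrt (Finset.sum_nonneg fun i _ => sq_nonneg _)

/-- Mollification again; the values at x converge because u is continuous there, so the bound holds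
at every point and not only almost everywhere. -/
theorem weak_sup_bound (hm : m ≤ 2) {U : Set (Euc m)} (hU : IsOpen U) (hUc : Convex ℝ U)
    {u : Euc m → ℝ} {G : Fin m → Euc m → ℝ} {H : Fin m → Fin m → Euc m → ℝ}
    (hu : MemLp u 2 (volume.restrict U)) (hG : ∀ i, MemLp (G i) 2 (volume.restrict U))
    (hH : ∀ i j, MemLp (H i j) 2 (volume.restrict U))
    (hw : HasWeakGrad U u G) (hw2 : ∀ i, HasWeakGrad U (G i) (H i))
    (huc : ContinuousOn u U) {h : ℝ} (hd : ∀ x ∈ U, ∀ y ∈ U, dist x y ≤ h)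
    {x : Euc m} (hx : x ∈ U) :
    volume U * ‖u x‖ₑ ^ 2 ≤ 3 * ((∫⁻ y in U, ‖u y‖ₑ ^ 2) +
      ENNReal.ofReal h ^ 2 * (∑ i, ∫⁻ y in U, ‖G i y‖ₑ ^ 2) +
      ENNReal.ofReal h ^ 4 * ∑ i, ∑ j, ∫⁻ y in U, ‖H i j y‖ₑ ^ 2) := by
  have hul := locallyIntegrable_indicator hU hu
  have hsm : ∀ k, ContDiff ℝ ∞ (moll k (U.indicator u)) := fun k => contDiff_moll k hul
  have hsmG : ∀ k i, ContDiff ℝ ∞ (moll k (U.indicator (G i))) := fun k i =>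
    contDiff_moll k (locallyIntegrable_indicator hU (hG i))
  have hev := eventually_mem_shrink hU hx
  have hconv : Tendsto (fun k => moll k (U.indicator u) x) atTop (𝓝 (u x)) := by
    have hc : ContinuousAt (U.indicator u) x := by
      refine (huc.continuousAt (hU.mem_nhds hx)).congr ?_
      filter_upwards [hU.mem_nhds hx] with y hy
      rw [Set.indicator_of_mem hy]
    have := tendsto_moll_of_continuousAt hul.aestronglyMeasurable hc
    rwa [Set.indicator_of_mem hx] at this
  have e0 : volume U * ‖u x‖ₑ ^ 2 = ∫⁻ y, U.indicator (fun _ => ‖u x‖ₑ ^ 2) y := by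
    rw [lintegral_indicator hU.measurableSet, lintegral_const, mul_comm]; simp
  rw [e0]
  classical
  -- The left-hand side has been written as the integral of a constant over U, so that Fatou's lemma
  -- covers both the growth of the domains and the convergence of the value at x. The `if` discards
  -- those k for which x is not yet in the shrunken set.
  refine lintegral_le_of_tendsto (F := fun k => (if x ∈ shrink k U then shrink k U else ∅).indicator
    fun _ => ‖moll k (U.indicator u) x‖ₑ ^ 2) ?_ (Eventually.of_forall fun y => ?_) ?_
  · intro k
    refine measurable_const.indicator ?_
    split_ifs
    exacts [(isOpen_shrink k hU).measurableSet, MeasurableSet.empty]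
  · by_cases hy : y ∈ U
    · rw [Set.indicator_of_mem hy]
      have := ((ENNReal.continuous_pow 2).tendsto _).comp ((continuous_enorm.tendsto _).comp hconv)
      refine this.congr' ?_
      filter_upwards [hev, eventually_mem_shrink hU hy] with k k1 k2
      rw [if_pos k1, Set.indicator_of_mem k2]
      rfl
    · rw [Set.indicator_of_notMem hy]
      refine tendsto_const_nhds.congr fun k => ?_
      rw [Set.indicator_of_notMem]
      intro h
      split_ifs at h
      · exact hy (shrink_subset k U h)
      · exact h
  · intro k
    by_cases hk : x ∈ shrink k U
    · simp only [if_pos hk]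
      have hSo := isOpen_shrink k hU
      rw [lintegral_indicator hSo.measurableSet]
      refine (smooth_sup_bound hm ((hsm k).of_le (by norm_cast))
        hSo.measurableSet (convex_shrink k hUc)
        (fun a ha b hb => hd a (shrink_subset k U ha) b (shrink_subset k U hb)) hk).trans ?_
      gcongr 3 * (?_ + _ * ?_ + _ * ?_)
      · exact lintegral_moll_indicator_sq_le hU hu k _
      · exact lintegral_fderiv_moll_sq_le hU hu hG hw k
      · calc ∫⁻ y in shrink k U, ‖fderiv ℝ (fderiv ℝ (moll k (U.indicator u))) y‖ₑ ^ 2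
            ≤ ∫⁻ y in shrink k U, ∑ i, ‖fderiv ℝ (moll k (U.indicator (G i))) y‖ₑ ^ 2 := by
              refine setLIntegral_mono' hSo.measurableSet fun y hy => ?_
              refine (enorm_snd_fderiv_sq_le ((hsm k).of_le (by norm_cast)) y).trans
                (Finset.sum_le_sum fun i _ => ?_)
              have : (fun y => fderiv ℝ (moll k (U.indicator u)) y (stdVec i)) =ᶠ[𝓝 y]
                  moll k (U.indicator (G i)) := by
                filter_upwards [hSo.mem_nhds hy] with z hz
                exact fderiv_moll hU hu hw k hz i
              rw [this.fderiv_eq]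
          _ = ∑ i, ∫⁻ y in shrink k U, ‖fderiv ℝ (moll k (U.indicator (G i))) y‖ₑ ^ 2 := by
              refine lintegral_finsetSum _ fun i _ => ?_
              exact (((hsmG k i).continuous_fderiv (by simp)).enorm.measurable).pow_const 2
          _ ≤ _ := Finset.sum_le_sum fun i _ =>
              lintegral_fderiv_moll_sq_le hU (hG i) (hH i) (hw2 i) k
    · simp [hk]

/-! ### Iterated and weak derivatives along lists of directions -/

/-- The iterated partial derivative along a list of directions. -/
def dlist : List (Fin m) → (Euc m → ℝ) → Euc m → ℝ
  | [], w => w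
  | i :: l, w => fun x => fderiv ℝ (dlist l w) x (stdVec i)

theorem contDiff_dlist {w : Euc m → ℝ} (hw : ContDiff ℝ ∞ w) (l : List (Fin m)) :
    ContDiff ℝ ∞ (dlist l w) := by
  induction l with
  | nil => exact hw
  | cons i l ih => exact (ih.fderiv_right (m := ∞) (by simp)).clm_apply contDiff_const

theorem dlist_append (l l' : List (Fin m)) (w : Euc m → ℝ) :
    dlist (l ++ l') w = dlist l (dlist l' w) := by
  induction l with
  | nil => rfl
  | cons i l ih => simp only [List.cons_append, dlist, ih]

/-- Permutations are generated by transpositions at the head of a list, for which this is the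
symmetry of the second derivative. -/
theorem dlist_perm {w : Euc m → ℝ} (hw : ContDiff ℝ ∞ w) {l l' : List (Fin m)} (h : l.Perm l') :
    dlist l w = dlist l' w := by
  induction h with
  | nil => rfl
  | cons i _ ih => simp only [dlist, ih]
  | swap i j l =>
    have hv := contDiff_dlist hw l
    set v := dlist l w
    have hd : Differentiable ℝ (fderiv ℝ v) :=
      (hv.fderiv_right (m := ∞) (by simp)).differentiable (by simp)
    have key : ∀ (a b : Fin m) (x : Euc m),
        dlist [a, b] v x = fderiv ℝ (fderiv ℝ v) x (stdVec a) (stdVec b) := by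
      intro a b x
      have h1 : HasFDerivAt (fun y => fderiv ℝ v y (stdVec b)) _ x :=
        (hd x).hasFDerivAt.clm_apply (hasFDerivAt_const (stdVec b) x)
      simp only [dlist]
      rw [h1.fderiv]
      simp
    have hs := fun x => (hv.contDiffAt (x := x)).isSymmSndFDerivAt
      (by rw [minSmoothness_of_isRCLikeNormedField]; norm_cast)
    funext x
    change dlist [j, i] v x = dlist [i, j] v x
    rw [key, key]
    exact hs x _ _
  | trans _ _ h1 h2 => exact h1.trans h2

theorem dlist_add {p q : Euc m → ℝ} (hp : ContDiff ℝ ∞ p) (hq : ContDiff ℝ ∞ q)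
    (l : List (Fin m)) : dlist l (p + q) = dlist l p + dlist l q := by
  induction l with
  | nil => rfl
  | cons i l ih =>
    funext x
    have h1 := (contDiff_dlist hp l).differentiable (by simp) x
    have h2 := (contDiff_dlist hq l).differentiable (by simp) x
    simp only [dlist, ih, Pi.add_apply]
    rw [fderiv_add h1 h2]
    rfl

theorem partialDeriv_eq_dlist {w : Euc m → ℝ} (hw : ContDiff ℝ ∞ w) :
    ∀ {j : ℕ} (idx : Fin j → Fin m), partialDeriv idx w = dlist (List.ofFn idx) w
  | 0, idx => by
    funext x
    simp [partialDeriv, dlist]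
  | j + 1, idx => by
    funext x
    rw [List.ofFn_succ]
    simp only [dlist]
    rw [← partialDeriv_eq_dlist hw]
    simp only [partialDeriv]
    rw [iteratedFDeriv_succ_apply_left]
    have hd : DifferentiableAt ℝ (iteratedFDeriv ℝ j w) x :=
      (hw.differentiable_iteratedFDeriv (m := j) (by exact_mod_cast ENat.natCast_lt_top j)) x
    have h1 := (ContinuousMultilinearMap.apply ℝ (fun _ : Fin j => Euc m) ℝ
      (fun a : Fin j => stdVec (idx a.succ))).hasFDerivAt.comp x hd.hasFDerivAt
    have h2 : HasFDerivAt (fun y => iteratedFDeriv ℝ j w y (fun a : Fin j => stdVec (idx a.succ)))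
      _ x := h1
    change _ = fderiv ℝ (fun y => iteratedFDeriv ℝ j w y fun a : Fin j => stdVec (idx a.succ)) x _
    rw [h2.fderiv]
    rfl

theorem tsupport_fderiv_apply_subset (w : Euc m → ℝ) (v : Euc m) :
    tsupport (fun x => fderiv ℝ w x v) ⊆ tsupport w := by
  refine closure_minimal (fun x hx => ?_) (isClosed_tsupport w)
  apply support_fderiv_subset ℝ (f := w)
  intro h
  apply hx
  simp [h]

theorem IsTest.fderiv_apply {w : Euc m → ℝ} (hw : IsTest w) (v : Euc m) :
    IsTest fun x => fderiv ℝ w x v :=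
  ⟨(hw.1.fderiv_right (m := ∞) (by simp)).clm_apply contDiff_const,
    hw.2.of_isClosed_subset (isClosed_tsupport _) (tsupport_fderiv_apply_subset w v)⟩

theorem IsTest.dlist {w : Euc m → ℝ} (hw : IsTest w) (l : List (Fin m)) :
    IsTest (dlist l w) ∧ tsupport (MultiTrace.dlist l w) ⊆ tsupport w := by
  induction l with
  | nil => exact ⟨hw, subset_rfl⟩
  | cons i l ih => exact ⟨ih.1.fderiv_apply _, (tsupport_fderiv_apply_subset _ _).trans ih.2⟩

/-- `g l` is the weak derivative of `u ∈ Hᵏ(U)` along the list `l`. -/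
def HasWeakDerivs (U : Set (Euc m)) (k : ℕ) (u : Euc m → ℝ)
    (g : List (Fin m) → Euc m → ℝ) : Prop :=
  ∀ l : List (Fin m), l.length ≤ k → MemLp (g l) 2 (volume.restrict U) ∧
    ∀ w : Euc m → ℝ, IsTest w → tsupport w ⊆ U →
      ∫ x in U, u x * dlist l w x = (-1) ^ l.length * ∫ x in U, g l x * w x

theorem HasWeakDerivs.mono {U : Set (Euc m)} {k k' : ℕ} {u : Euc m → ℝ}
    {g : List (Fin m) → Euc m → ℝ} (h : HasWeakDerivs U k u g) (hk : k' ≤ k) :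
    HasWeakDerivs U k' u g := fun l hl => h l (hl.trans hk)

theorem setIntegral_eq_of_tsupport {U V : Set (Euc m)} (hUV : V ⊆ U) (hV : MeasurableSet V)
    (hU : MeasurableSet U)
    {w f : Euc m → ℝ} (hw : tsupport w ⊆ V) (hf : ∀ x, w x = 0 → f x = 0) :
    ∫ x in U, f x = ∫ x in V, f x := by
  rw [← integral_indicator hV, ← integral_indicator hU]
  congr 1
  funext x
  by_cases hx : x ∈ V
  · simp [hx, hUV hx]
  · have : f x = 0 := hf x (image_eq_zero_of_notMem_tsupport fun h => hx (hw h))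
    by_cases hxU : x ∈ U <;> simp [hx, hxU, this]

theorem HasWeakDerivs.restrict {U V : Set (Euc m)} {k : ℕ} {u : Euc m → ℝ}
    {g : List (Fin m) → Euc m → ℝ} (h : HasWeakDerivs U k u g) (hU : IsOpen U) (hV : IsOpen V)
    (hVU : V ⊆ U) : HasWeakDerivs V k u g := by
  intro l hl
  obtain ⟨h1, h2⟩ := h l hl
  refine ⟨h1.mono_measure (Measure.restrict_mono hVU le_rfl), fun w hw hwV => ?_⟩
  have h3 := h2 w hw (hwV.trans hVU)
  rwa [setIntegral_eq_of_tsupport hVU hV.measurableSet hU.measurableSet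
      (((hw.dlist l).2).trans hwV) (fun x hx => by simp [hx]),
    setIntegral_eq_of_tsupport hVU hV.measurableSet hU.measurableSet hwV
      (fun x hx => by simp [hx])] at h3

/-- The defining identity is tested with ∂ᵢw. Only the derivatives of the test function have to be
commuted, so no symmetry of `g` is needed. -/
theorem HasWeakDerivs.hasWeakGrad {U : Set (Euc m)} {k : ℕ} {u : Euc m → ℝ}
    {g : List (Fin m) → Euc m → ℝ} (h : HasWeakDerivs U k u g) {l : List (Fin m)}
    (hl : l.length + 1 ≤ k) : HasWeakGrad U (g l) (fun i => g (i :: l)) := by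
  intro w hw hwU i
  have h1 := (h l (by omega)).2 _ (hw.fderiv_apply (stdVec i))
    ((tsupport_fderiv_apply_subset _ _).trans hwU)
  have h2 := (h (i :: l) (by simpa using hl)).2 w hw hwU
  have e : dlist l (fun x => fderiv ℝ w x (stdVec i)) = dlist (i :: l) w := by
    change dlist l (dlist [i] w) = _
    rw [← dlist_append]
    exact dlist_perm hw.1 (List.perm_append_singleton i l)
  rw [e, h2, List.length_cons, pow_succ] at h1
  have h3 : ((-1 : ℝ) ^ l.length) ≠ 0 := by positivity
  have h4 : (-1 : ℝ) ^ l.length * (-∫ x in U, g (i :: l) x * w x) =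
      (-1) ^ l.length * ∫ x in U, g l x * fderiv ℝ w x (stdVec i) := by
    rw [← h1]; ring
  exact (mul_left_cancel₀ h3 h4).symm

theorem ae_eq_of_integral_mul_test {U : Set (Euc m)} (hU : IsOpen U) {f g : Euc m → ℝ}
    (hf : MemLp f 2 (volume.restrict U)) (hg : MemLp g 2 (volume.restrict U))
    (h : ∀ w : Euc m → ℝ, IsTest w → tsupport w ⊆ U →
      ∫ x in U, f x * w x = ∫ x in U, g x * w x) :
    f =ᵐ[volume.restrict U] g := by
  have hl : ∀ {f : Euc m → ℝ}, MemLp f 2 (volume.restrict U) → LocallyIntegrableOn f U volume :=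
    fun {f} hf x hx => by
      obtain ⟨ε, hε, hb⟩ := Metric.isOpen_iff.1 hU x hx
      refine ⟨Metric.ball x ε, mem_nhdsWithin_of_mem_nhds (Metric.ball_mem_nhds x hε), ?_⟩
      have hfb : MemLp f 2 (volume.restrict (Metric.ball x ε)) :=
        hf.mono_measure (Measure.restrict_mono hb le_rfl)
      have : IsFiniteMeasure (volume.restrict (Metric.ball x ε)) :=
        ⟨by simpa using measure_ball_lt_top⟩
      exact hfb.integrable (by norm_num)
  have hi : ∀ {f : Euc m → ℝ}, MemLp f 2 (volume.restrict U) → ∀ w, IsTest w →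
      Integrable (fun x => f x * w x) (volume.restrict U) := fun {f} hf w hw => by
    have hwm : MemLp w 2 (volume.restrict U) :=
      (hw.1.continuous.memLp_of_hasCompactSupport hw.2).restrict U
    exact hf.integrable_mul hwm
  have := hU.ae_eq_zero_of_integral_contDiff_smul_eq_zero ((hl hf).sub (hl hg))
    fun w hw1 hw2 hw3 => by
      have hz := h w ⟨hw1, hw2⟩ hw3
      have e : ∫ x, w x • (f - g) x = ∫ x in U, w x • (f - g) x := by
        rw [← setIntegral_univ]
        refine setIntegral_eq_of_tsupport (Set.subset_univ _) hU.measurableSet MeasurableSet.univ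
          hw3 fun x hx => by simp [hx]
      rw [e]
      calc ∫ x in U, w x • (f - g) x = ∫ x in U, (f x * w x - g x * w x) := by
            congr 1; funext x; simp only [Pi.sub_apply, smul_eq_mul]; ring
        _ = 0 := by
            rw [integral_sub (hi hf w ⟨hw1, hw2⟩) (hi hg w ⟨hw1, hw2⟩), hz, sub_self]
  refine (ae_restrict_iff' hU.measurableSet).2 (this.mono fun x hx hxU => ?_)
  simpa [sub_eq_zero] using hx hxU

/-- The functions `g l` are chosen separately for each list; uniqueness of weak derivatives gives
the symmetry that is required to prescribe their means as derivatives of a polynomial. -/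
theorem HasWeakDerivs.ae_eq_of_perm {U : Set (Euc m)} (hU : IsOpen U) {k : ℕ} {u : Euc m → ℝ}
    {g : List (Fin m) → Euc m → ℝ} (h : HasWeakDerivs U k u g) {l l' : List (Fin m)}
    (hl : l.length ≤ k) (hp : l.Perm l') : g l =ᵐ[volume.restrict U] g l' := by
  have hl' : l'.length ≤ k := hp.length_eq ▸ hl
  refine ae_eq_of_integral_mul_test hU (h l hl).1 (h l' hl').1 fun w hw hwU => ?_
  have h1 := (h l hl).2 w hw hwU
  have h2 := (h l' hl').2 w hw hwU
  rw [dlist_perm hw.1 hp, h2, hp.length_eq] at h1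
  exact (mul_left_cancel₀ (by positivity) h1).symm

theorem HasWeakDerivs.ae_eq_nil {U : Set (Euc m)} (hU : IsOpen U) {k : ℕ} {u : Euc m → ℝ}
    {g : List (Fin m) → Euc m → ℝ} (h : HasWeakDerivs U k u g)
    (hu : MemLp u 2 (volume.restrict U)) : g [] =ᵐ[volume.restrict U] u := by
  refine ae_eq_of_integral_mul_test hU (h [] (Nat.zero_le _)).1 hu fun w hw hwU => ?_
  simpa [dlist] using ((h [] (Nat.zero_le _)).2 w hw hwU).symm

theorem integral_mul_fderiv_test {p w : Euc m → ℝ} (hp : ContDiff ℝ ∞ p) (hw : IsTest w)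
    (v : Euc m) : ∫ x, p x * fderiv ℝ w x v = - ∫ x, fderiv ℝ p x v * w x := by
  have hwc : Continuous w := hw.1.continuous
  have hpc : Continuous p := hp.continuous
  have h1 : Continuous fun x => fderiv ℝ p x v :=
    ((hp.fderiv_right (m := ∞) (by simp)).clm_apply contDiff_const).continuous
  have h2 := hw.fderiv_apply v
  refine integral_mul_fderiv_eq_neg_fderiv_mul_of_integrable ?_ ?_ ?_
    (fun x _ => hp.differentiable (by simp) x) (fun x _ => hw.1.differentiable (by simp) x)
  · exact (h1.mul hwc).integrable_of_hasCompactSupport hw.2.mul_left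
  · exact (hpc.mul h2.1.continuous).integrable_of_hasCompactSupport h2.2.mul_left
  · exact (hpc.mul hwc).integrable_of_hasCompactSupport hw.2.mul_left

/-- Each integration by parts puts a direction at the inner end of the list of p rather than at its
head; symmetry of smooth derivatives restores the order. -/
theorem integral_mul_dlist_test {p w : Euc m → ℝ} (hp : ContDiff ℝ ∞ p) (hw : IsTest w)
    (l : List (Fin m)) : ∫ x, p x * dlist l w x = (-1) ^ l.length * ∫ x, dlist l p x * w x := by
  induction l generalizing p with
  | nil => simp [dlist]
  | cons i l ih =>
    have hp' : ContDiff ℝ ∞ (dlist [i] p) := contDiff_dlist hp [i]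
    calc ∫ x, p x * dlist (i :: l) w x = - ∫ x, dlist [i] p x * dlist l w x :=
          integral_mul_fderiv_test hp (hw.dlist l).1 (stdVec i)
      _ = - ((-1) ^ l.length * ∫ x, dlist l (dlist [i] p) x * w x) := by rw [ih hp']
      _ = _ := by
          rw [← dlist_append, dlist_perm hp (List.perm_append_singleton i l), List.length_cons,
            pow_succ]
          ring

theorem Continuous.memLp_restrict_bounded {f : Euc m → ℝ} (hf : Continuous f) {U : Set (Euc m)}
    (hU : MeasurableSet U) (hb : Bornology.IsBounded U) : MemLp f 2 (volume.restrict U) := by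
  obtain ⟨R, hR⟩ := hb.subset_closedBall 0
  obtain ⟨C, hC⟩ := (isCompact_closedBall (0 : Euc m) R).exists_bound_of_continuousOn
    hf.continuousOn
  have : IsFiniteMeasure (volume.restrict U) := ⟨by simpa using hb.measure_lt_top⟩
  exact MemLp.of_bound hf.aestronglyMeasurable C
    ((ae_restrict_iff' hU).2 (Eventually.of_forall fun x hx => hC x (hR hx)))

theorem hasWeakDerivs_of_contDiff {U : Set (Euc m)} (hU : IsOpen U) (hb : Bornology.IsBounded U)
    {p : Euc m → ℝ} (hp : ContDiff ℝ ∞ p) (k : ℕ) :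
    HasWeakDerivs U k p fun l => dlist l p := by
  intro l _
  refine ⟨Continuous.memLp_restrict_bounded (contDiff_dlist hp l).continuous hU.measurableSet hb,
    fun w hw hwU => ?_⟩
  have := integral_mul_dlist_test hp hw l
  rwa [← setIntegral_univ, ← setIntegral_univ (f := fun x => dlist l p x * w x),
    setIntegral_eq_of_tsupport (Set.subset_univ U) hU.measurableSet MeasurableSet.univ
      (((hw.dlist l).2).trans hwU) (fun x hx => by simp [hx]),
    setIntegral_eq_of_tsupport (Set.subset_univ U) hU.measurableSet MeasurableSet.univ hwU
      (fun x hx => by simp [hx])] at this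

theorem MemLp.integrable_mul_test {U : Set (Euc m)} {f w : Euc m → ℝ}
    (hf : MemLp f 2 (volume.restrict U)) (hw : IsTest w) :
    Integrable (fun x => f x * w x) (volume.restrict U) :=
  have hwm : MemLp w 2 (volume.restrict U) :=
    (hw.1.continuous.memLp_of_hasCompactSupport hw.2).restrict U
  hf.integrable_mul hwm

theorem HasWeakDerivs.sub {U : Set (Euc m)} {k : ℕ} {u v : Euc m → ℝ}
    {g g' : List (Fin m) → Euc m → ℝ} (h : HasWeakDerivs U k u g) (h' : HasWeakDerivs U k v g')
    (hu : MemLp u 2 (volume.restrict U)) (hv : MemLp v 2 (volume.restrict U)) :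
    HasWeakDerivs U k (u - v) fun l => g l - g' l := by
  intro l hl
  refine ⟨(h l hl).1.sub (h' l hl).1, fun w hw hwU => ?_⟩
  have hd := (hw.dlist l).1
  calc ∫ x in U, (u - v) x * dlist l w x
      = ∫ x in U, (u x * dlist l w x - v x * dlist l w x) := by
        congr 1; funext x; simp only [Pi.sub_apply]; ring
    _ = (-1) ^ l.length * (∫ x in U, (g l x * w x - g' l x * w x)) := by
        rw [integral_sub (MemLp.integrable_mul_test hu hd) (MemLp.integrable_mul_test hv hd),
          integral_sub (MemLp.integrable_mul_test (h l hl).1 hw)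
            (MemLp.integrable_mul_test (h' l hl).1 hw), (h l hl).2 w hw hwU, (h' l hl).2 w hw hwU]
        ring
    _ = _ := by
        congr 2; funext x; simp only [Pi.sub_apply]; ring

/-! ### Polynomial functions and polynomials with prescribed means of derivatives -/

/-- Polynomial functions of total degree at most `k`. -/
def polyFn (m k : ℕ) : Submodule ℝ (Euc m → ℝ) where
  carrier := {f | ∃ p ∈ MvPolynomial.restrictTotalDegree (Fin m) ℝ k,
    ∀ x, f x = MvPolynomial.eval (fun i => x i) p}
  zero_mem' := ⟨0, Submodule.zero_mem _, fun x => by simp⟩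
  add_mem' := by
    rintro f g ⟨p, hp, h1⟩ ⟨q, hq, h2⟩
    exact ⟨p + q, Submodule.add_mem _ hp hq, fun x => by simp [h1 x, h2 x]⟩
  smul_mem' := by
    rintro c f ⟨p, hp, h1⟩
    exact ⟨c • p, Submodule.smul_mem _ c hp, fun x => by simp [h1 x, MvPolynomial.smul_eval]⟩

theorem polyFn_mono {k k' : ℕ} (h : k ≤ k') : polyFn m k ≤ polyFn m k' := by
  rintro f ⟨p, hp, hf⟩
  rw [MvPolynomial.mem_restrictTotalDegree] at hp
  exact ⟨p, (MvPolynomial.mem_restrictTotalDegree _ _ _).2 (hp.trans h), hf⟩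

theorem const_mem_polyFn (c : ℝ) (k : ℕ) : (fun _ : Euc m => c) ∈ polyFn m k :=
  ⟨MvPolynomial.C c, by simp [MvPolynomial.mem_restrictTotalDegree], fun x => by simp⟩

theorem coord_mem_polyFn (i : Fin m) : (fun x : Euc m => x i) ∈ polyFn m 1 :=
  ⟨MvPolynomial.X i, by simp [MvPolynomial.mem_restrictTotalDegree], fun x => by simp⟩

theorem mul_mem_polyFn {a b : ℕ} {f g : Euc m → ℝ} (hf : f ∈ polyFn m a) (hg : g ∈ polyFn m b) :
    f * g ∈ polyFn m (a + b) := by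
  obtain ⟨p, hp, h1⟩ := hf
  obtain ⟨q, hq, h2⟩ := hg
  rw [MvPolynomial.mem_restrictTotalDegree] at hp hq
  refine ⟨p * q, (MvPolynomial.mem_restrictTotalDegree _ _ _).2 ?_, fun x => by simp [h1 x, h2 x]⟩
  exact (MvPolynomial.totalDegree_mul _ _).trans (add_le_add hp hq)

theorem prod_mem_polyFn {ι : Type*} (s : Finset ι) (a : ι → ℕ) (f : ι → Euc m → ℝ)
    (hf : ∀ i ∈ s, f i ∈ polyFn m (a i)) :
    (fun x => ∏ i ∈ s, f i x) ∈ polyFn m (∑ i ∈ s, a i) := by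
  classical
  induction s using Finset.induction_on with
  | empty => simpa using const_mem_polyFn (m := m) 1 0
  | insert i s hi ih =>
    have := mul_mem_polyFn (hf i (Finset.mem_insert_self i s))
      (ih fun j hj => hf j (Finset.mem_insert_of_mem hj))
    rw [Finset.sum_insert hi]
    convert this using 1
    funext x
    simp [Finset.prod_insert hi]

theorem contDiff_of_mem_polyFn {k : ℕ} {f : Euc m → ℝ} (hf : f ∈ polyFn m k) : ContDiff ℝ ∞ f := by
  obtain ⟨p, -, hp⟩ := hf
  have : f = fun x => MvPolynomial.eval (fun i => x i) p := funext hp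
  rw [this]
  clear hp this
  induction p using MvPolynomial.induction_on with
  | C a => simpa using contDiff_const
  | add p q hp hq => simpa using hp.add hq
  | mul_X p i hp =>
    simp only [map_mul, MvPolynomial.eval_X]
    exact hp.mul ((EuclideanSpace.proj i : Euc m →L[ℝ] ℝ).contDiff)

/-- Polynomials are stable under affine substitutions. -/
theorem comp_mem_polyFn {m' k : ℕ} {f : Euc m → ℝ} (hf : f ∈ polyFn m k) {A : Euc m' → Euc m}
    (hA : ∀ i, (fun x => A x i) ∈ polyFn m' 1) : f ∘ A ∈ polyFn m' k := by
  obtain ⟨p, hp, h⟩ := hf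
  rw [MvPolynomial.mem_restrictTotalDegree] at hp
  have e : f ∘ A = ∑ d ∈ p.support, p.coeff d • fun x => ∏ i ∈ d.support, (A x i) ^ d i := by
    funext x
    simp [h, MvPolynomial.eval_eq, Finset.sum_apply]
  rw [e]
  refine Submodule.sum_mem _ fun d hd => Submodule.smul_mem _ _ ?_
  have h1 := prod_mem_polyFn (m := m') d.support (fun i => d i) (fun i x => (A x i) ^ d i)
    fun i _ => by
      have h2 := prod_mem_polyFn (m := m') (Finset.range (d i)) (fun _ => 1) (fun _ x => A x i)
        fun _ _ => hA i
      simpa using h2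
  refine polyFn_mono ?_ h1
  exact (MvPolynomial.le_totalDegree hd).trans hp

theorem affine_mem_polyFn (A : Euc m →ᵃ[ℝ] ℝ) : (A : Euc m → ℝ) ∈ polyFn m 1 := by
  have e : (A : Euc m → ℝ) = (∑ i, A.linear (stdVec i) • fun x : Euc m => x i) +
      fun _ => A 0 := by
    funext x
    have hx : x = ∑ i, x i • stdVec i := by
      ext j
      simp [Finset.sum_apply, Pi.single_apply]
    have h1 : A x = A.linear x + A 0 := by
      have := A.map_vadd 0 x
      simpa using this
    rw [h1]
    conv_lhs => rw [hx]
    simp [map_sum, Finset.sum_apply, mul_comm]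
  rw [e]
  exact Submodule.add_mem _ (Submodule.sum_mem _ fun i _ => Submodule.smul_mem _ _
    (coord_mem_polyFn i)) (const_mem_polyFn _ _)

theorem dlist_eq_zero_of_le {p : Euc m → ℝ} {k : ℕ}
    (h : ∀ l : List (Fin m), l.length = k → dlist l p = 0) :
    ∀ l : List (Fin m), k ≤ l.length → dlist l p = 0 := by
  intro l
  induction l with
  | nil => intro hl; exact h [] (by simpa using hl.antisymm' (Nat.zero_le k))
  | cons i l ih =>
    intro hl
    rcases Nat.lt_or_ge l.length k with h1 | h1
    · exact h _ (le_antisymm (by simpa using h1) hl)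
    · funext x
      simp only [dlist, ih h1, Pi.zero_apply]
      have : fderiv ℝ (0 : Euc m → ℝ) x = 0 := fderiv_const_apply (0 : ℝ)
      rw [this]; rfl

/-- A homogeneous polynomial with prescribed derivatives of top order. -/
theorem exists_homogeneous (k : ℕ) (c : List (Fin m) → ℝ)
    (hc : ∀ l l' : List (Fin m), l.length = k → l.Perm l' → c l = c l') :
    ∃ q ∈ polyFn m k, (∀ l : List (Fin m), l.length = k → dlist l q = fun _ => c l) ∧
      ∀ l : List (Fin m), k < l.length → dlist l q = 0 := by
  -- The k-th derivative of the diagonal of M along a list is the sum of M over all orderings of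
  -- that list. Since c is symmetric these k! terms coincide, which the factor 1/k! in `q` cancels.
  set M : ContinuousMultilinearMap ℝ (fun _ : Fin k => Euc m) ℝ :=
    ∑ idx : Fin k → Fin m, c (List.ofFn idx) •
      (ContinuousMultilinearMap.mkPiAlgebra ℝ (Fin k) ℝ).compContinuousLinearMap
        (fun a => (EuclideanSpace.proj (idx a) : Euc m →L[ℝ] ℝ)) with hM
  have hMv : ∀ v, M v = ∑ idx : Fin k → Fin m, c (List.ofFn idx) * ∏ a, v a (idx a) := by
    intro v
    simp [hM]
  set q : Euc m → ℝ := ((k.factorial : ℝ)⁻¹) • fun x => M fun _ => x with hq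
  have hmem : q ∈ polyFn m k := by
    refine Submodule.smul_mem _ _ ?_
    have : (fun x => M fun _ => x) = ∑ idx : Fin k → Fin m, c (List.ofFn idx) •
        fun x : Euc m => ∏ a, x (idx a) := by
      funext x
      simp [hMv, Finset.sum_apply]
    rw [this]
    refine Submodule.sum_mem _ fun idx _ => Submodule.smul_mem _ _ ?_
    have h2 := prod_mem_polyFn (m := m) (Finset.univ : Finset (Fin k)) (fun _ => 1)
      (fun a x => x (idx a)) fun a _ => coord_mem_polyFn _
    simpa using h2
  have hqs := contDiff_of_mem_polyFn hmem
  have htop : ∀ l : List (Fin m), l.length = k → dlist l q = fun _ => c l := by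
    intro l hl
    subst hl
    have h1 := partialDeriv_eq_dlist hqs l.get
    rw [List.ofFn_get] at h1
    rw [← h1]
    funext x
    have hMs : ContDiff ℝ ∞ fun x : Euc m => M fun _ => x := M.contDiff.comp (by fun_prop)
    simp only [partialDeriv, hq]
    rw [iteratedFDeriv_const_smul_apply (hMs.contDiffAt.of_le (by exact_mod_cast le_top))]
    rw [smul_apply, M.iteratedFDeriv_comp_diagonal]
    have h2 : ∀ σ : Equiv.Perm (Fin l.length),
        M (fun i => EuclideanSpace.single (l.get (σ i)) (1 : ℝ)) = c l := by
      intro σ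
      rw [hMv, Finset.sum_eq_single (l.get ∘ σ)]
      · simp only [PiLp.single_apply, Function.comp_apply, if_true, Finset.prod_const_one, mul_one]
        refine hc _ _ (by simp) ?_
        have := Equiv.Perm.ofFn_comp_perm σ l.get
        rwa [List.ofFn_get] at this
      · intro idx _ hne
        obtain ⟨a, ha⟩ := Function.ne_iff.1 hne
        have : ∏ a, (EuclideanSpace.single (l.get (σ a)) (1 : ℝ) : Euc m) (idx a) = 0 := by
          refine Finset.prod_eq_zero (Finset.mem_univ a) ?_
          rw [PiLp.single_apply]
          exact if_neg ha
        rw [this, mul_zero]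
      · intro h; exact absurd (Finset.mem_univ _) h
    rw [Finset.sum_congr rfl fun σ _ => h2 σ]
    simp [Fintype.card_perm]
    field_simp
  refine ⟨q, hmem, htop, fun l hl => dlist_eq_zero_of_le (k := k + 1) ?_ l hl⟩
  rintro (_ | ⟨i, l⟩) hl
  · simp at hl
  · funext x
    simp only [dlist, htop l (by simpa using hl)]
    simp

/-- A polynomial with the same averages of derivatives as a given function. -/
theorem exists_poly_matching {U : Set (Euc m)} (hU : IsOpen U) (hb : Bornology.IsBounded U)
    (hne : U.Nonempty) : ∀ (k : ℕ) {u : Euc m → ℝ} {g : List (Fin m) → Euc m → ℝ},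
      MemLp u 2 (volume.restrict U) → HasWeakDerivs U k u g →
      ∃ p ∈ polyFn m k, (∀ l : List (Fin m), k < l.length → dlist l p = 0) ∧
        ∀ l : List (Fin m), l.length ≤ k → ∫ x in U, (g l x - dlist l p x) = 0 := by
  have hfin : IsFiniteMeasure (volume.restrict U) := ⟨by simpa using hb.measure_lt_top⟩
  have hvol : volume.real U ≠ 0 := by
    rw [Measure.real, ENNReal.toReal_ne_zero]
    exact ⟨(hU.measure_pos volume hne).ne', hb.measure_lt_top.ne⟩
  intro k
  induction k with
  | zero =>
    intro u g hu hg
    obtain ⟨q, hq, h1, h2⟩ := exists_homogeneous (m := m) 0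
      (fun l => (volume.real U)⁻¹ * ∫ x in U, g l x) (fun l l' hl hp => by
        rw [List.length_eq_zero_iff.1 hl] at hp ⊢
        rw [List.nil_perm.1 hp])
    refine ⟨q, hq, h2, fun l hl => ?_⟩
    have hi : Integrable (g l) (volume.restrict U) := (hg l hl).1.integrable (by norm_num)
    rw [h1 l (by omega), integral_sub hi (integrable_const _)]
    simp [hvol]
  | succ k ih =>
    intro u g hu hg
    -- The homogeneous part q takes care of the means of order k + 1. The lower orders are corrected
    -- by the induction hypothesis for u - q, with a polynomial of degree k that does not affect the
    -- top order.
    obtain ⟨q, hq, h1, h2⟩ := exists_homogeneous (m := m) (k + 1)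
      (fun l => (volume.real U)⁻¹ * ∫ x in U, g l x) (fun l l' hl hp => by
        rw [integral_congr_ae (hg.ae_eq_of_perm hU hl.le hp)])
    have hqs := contDiff_of_mem_polyFn hq
    have hqL := Continuous.memLp_restrict_bounded hqs.continuous hU.measurableSet hb
    have hsub := hg.sub (hasWeakDerivs_of_contDiff hU hb hqs (k + 1)) hu hqL
    obtain ⟨p, hp, h3, h4⟩ := ih (hu.sub hqL) (hsub.mono (Nat.le_succ k))
    have hps := contDiff_of_mem_polyFn hp
    refine ⟨p + q, Submodule.add_mem _ (polyFn_mono (Nat.le_succ k) hp) hq, fun l hl => ?_,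
      fun l hl => ?_⟩
    · rw [dlist_add hps hqs, h3 l (by omega), h2 l hl, add_zero]
    · rcases Nat.lt_or_ge k l.length with h | h
      · have hl' : l.length = k + 1 := by omega
        have hi : Integrable (g l) (volume.restrict U) := (hg l hl).1.integrable (by norm_num)
        rw [dlist_add hps hqs, h3 l h, zero_add, h1 l hl', integral_sub hi (integrable_const _)]
        simp [hvol]
      · rw [dlist_add hps hqs, ← h4 l h]
        congr 1
        funext x
        simp only [Pi.add_apply, Pi.sub_apply]
        ring

/-! ### Poincaré's inequality and approximation by polynomials -/

/-- A function of mean zero satisfies v(x) = mean over y of v(x) - v(y); the square follows by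
Cauchy–Schwarz. -/
theorem sq_enorm_mul_le_of_integral_eq_zero {α : Type*} [MeasurableSpace α] {μ : Measure α}
    [IsFiniteMeasure μ] {v : α → ℝ} (hv : Integrable v μ) (h0 : ∫ x, v x ∂μ = 0) (x : α) :
    μ Set.univ * ‖v x‖ₑ ^ 2 ≤ ∫⁻ y, ‖v x - v y‖ₑ ^ 2 ∂μ := by
  rcases eq_or_ne (μ Set.univ) 0 with hμ | hμ
  · simp [hμ]
  have h1 : μ.real Set.univ * v x = ∫ y, (v x - v y) ∂μ := by
    rw [integral_sub (integrable_const _) hv, h0]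
    simp
  have h2 : μ Set.univ * ‖v x‖ₑ ≤ ∫⁻ y, ‖v x - v y‖ₑ ∂μ := by
    refine le_trans (le_of_eq ?_) (enorm_integral_le_lintegral_enorm _)
    rw [← h1, enorm_mul, Real.enorm_of_nonneg measureReal_nonneg, ofReal_measureReal]
  have hm : AEMeasurable (fun y => ‖v x - v y‖ₑ) μ :=
    (hv.1.aemeasurable.const_sub (v x)).enorm
  have h3 : μ Set.univ * (μ Set.univ * ‖v x‖ₑ ^ 2) ≤
      μ Set.univ * ∫⁻ y, ‖v x - v y‖ₑ ^ 2 ∂μ := by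
    calc _ = (μ Set.univ * ‖v x‖ₑ) ^ 2 := by ring
      _ ≤ (∫⁻ y, ‖v x - v y‖ₑ ∂μ) ^ 2 := by gcongr
      _ ≤ _ := sq_lintegral_le hm
  exact (ENNReal.mul_le_mul_iff_right hμ (measure_ne_top μ _)).1 h3

/-- Integration of the preceding bound over x gives the double integral of differences, hence the
gradient. The constant c measures how much of a ball of radius h the set U fills; for elements it
comes from shape regularity. -/
theorem poincare {U : Set (Euc m)} (hU : IsOpen U) (hUc : Convex ℝ U)
    (hb : Bornology.IsBounded U) (hne : U.Nonempty)
    {u : Euc m → ℝ} {G : Fin m → Euc m → ℝ} (hu : MemLp u 2 (volume.restrict U))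
    (hG : ∀ i, MemLp (G i) 2 (volume.restrict U)) (hw : HasWeakGrad U u G) {h : ℝ}
    (hd : ∀ x ∈ U, ∀ y ∈ U, dist x y ≤ h) {c : ℝ≥0∞}
    (hc : volume (Metric.closedBall (0 : Euc m) h) ≤ c * volume U) (h0 : ∫ x in U, u x = 0) :
    ∫⁻ x in U, ‖u x‖ₑ ^ 2 ≤
      2 * c * ENNReal.ofReal h ^ 2 * ∑ i, ∫⁻ x in U, ‖G i x‖ₑ ^ 2 := by
  have hfin : IsFiniteMeasure (volume.restrict U) := ⟨by simpa using hb.measure_lt_top⟩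
  have hpos : volume U ≠ 0 := (hU.measure_pos volume hne).ne'
  have hi : Integrable u (volume.restrict U) := hu.integrable (by norm_num)
  have h1 : volume U * ∫⁻ x in U, ‖u x‖ₑ ^ 2 ≤
      volume U * (2 * c * ENNReal.ofReal h ^ 2 * ∑ i, ∫⁻ x in U, ‖G i x‖ₑ ^ 2) := by
    calc _ = ∫⁻ x in U, volume U * ‖u x‖ₑ ^ 2 :=
          (lintegral_const_mul'' _ (hu.1.aemeasurable.enorm.pow_const 2)).symm
      _ ≤ ∫⁻ x in U, ∫⁻ y in U, ‖u x - u y‖ₑ ^ 2 := by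
          refine lintegral_mono fun x => ?_
          have := sq_enorm_mul_le_of_integral_eq_zero hi h0 x
          rwa [Measure.restrict_apply_univ] at this
      _ ≤ 2 * (ENNReal.ofReal h ^ 2 * volume (Metric.closedBall (0 : Euc m) h)) *
            ∑ i, ∫⁻ x in U, ‖G i x‖ₑ ^ 2 := lintegral_sub_sq_le hU hUc hu hG hw hd
      _ ≤ 2 * (ENNReal.ofReal h ^ 2 * (c * volume U)) * ∑ i, ∫⁻ x in U, ‖G i x‖ₑ ^ 2 := by gcongr
      _ = _ := by ring
  exact (ENNReal.mul_le_mul_iff_right hpos hb.measure_lt_top.ne).1 h1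

/-- The squared `L²(U)` norm of the derivatives of order `j` in a family `g`. -/
def sobSq (U : Set (Euc m)) (g : List (Fin m) → Euc m → ℝ) (j : ℕ) : ℝ≥0∞ :=
  ∑ idx : Fin j → Fin m, ∫⁻ x in U, ‖g (List.ofFn idx) x‖ₑ ^ 2

theorem sobSq_succ (U : Set (Euc m)) (g : List (Fin m) → Euc m → ℝ) (j : ℕ) :
    sobSq U g (j + 1) = ∑ idx : Fin j → Fin m, ∑ i : Fin m,
      ∫⁻ x in U, ‖g (i :: List.ofFn idx) x‖ₑ ^ 2 := by
  rw [sobSq, ← (Fin.consEquiv fun _ : Fin (j + 1) => Fin m).sum_comp, Fintype.sum_prod_type,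
    Finset.sum_comm]
  refine Finset.sum_congr rfl fun idx _ => Finset.sum_congr rfl fun i _ => ?_
  simp [Fin.consEquiv]

theorem sobSq_zero (U : Set (Euc m)) (g : List (Fin m) → Euc m → ℝ) :
    sobSq U g 0 = ∫⁻ x in U, ‖g [] x‖ₑ ^ 2 := by
  simp [sobSq]

theorem sobSq_le_succ {U : Set (Euc m)} (hU : IsOpen U) (hUc : Convex ℝ U)
    (hb : Bornology.IsBounded U) (hne : U.Nonempty) {k : ℕ}
    {u : Euc m → ℝ} {g : List (Fin m) → Euc m → ℝ} (hg : HasWeakDerivs U k u g) {h : ℝ}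
    (hd : ∀ x ∈ U, ∀ y ∈ U, dist x y ≤ h) {c : ℝ≥0∞}
    (hc : volume (Metric.closedBall (0 : Euc m) h) ≤ c * volume U) {j : ℕ} (hj : j + 1 ≤ k)
    (h0 : ∀ l : List (Fin m), l.length = j → ∫ x in U, g l x = 0) :
    sobSq U g j ≤ 2 * c * ENNReal.ofReal h ^ 2 * sobSq U g (j + 1) := by
  rw [sobSq_succ, sobSq, Finset.mul_sum]
  refine Finset.sum_le_sum fun idx _ => ?_
  have hl : (List.ofFn idx).length = j := List.length_ofFn
  exact poincare hU hUc hb hne (hg _ (by omega)).1 (fun i => (hg _ (by simp; omega)).1)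
    (hg.hasWeakGrad (by omega)) hd hc (h0 _ hl)

/-- Approximation of `u ∈ Hᵏ⁺¹(U)` by polynomials of degree `k`. -/
theorem exists_poly_approx {U : Set (Euc m)} (hU : IsOpen U) (hUc : Convex ℝ U)
    (hb : Bornology.IsBounded U) (hne : U.Nonempty) {k : ℕ}
    {u : Euc m → ℝ} {g : List (Fin m) → Euc m → ℝ} (hu : MemLp u 2 (volume.restrict U))
    (hg : HasWeakDerivs U (k + 1) u g) {h : ℝ}
    (hd : ∀ x ∈ U, ∀ y ∈ U, dist x y ≤ h) {c : ℝ≥0∞}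
    (hc : volume (Metric.closedBall (0 : Euc m) h) ≤ c * volume U) :
    ∃ p ∈ polyFn m k, ∫ x in U, (u x - p x) = 0 ∧
      HasWeakDerivs U (k + 1) (u - p) (fun l => g l - dlist l p) ∧
      ∀ i j, i + j = k + 1 → sobSq U (fun l => g l - dlist l p) j ≤
        (2 * c * ENNReal.ofReal h ^ 2) ^ i * sobSq U g (k + 1) := by
  obtain ⟨p, hp, h1, h2⟩ := exists_poly_matching hU hb hne k hu (hg.mono (Nat.le_succ k))
  have hps := contDiff_of_mem_polyFn hp
  have hpL := Continuous.memLp_restrict_bounded hps.continuous hU.measurableSet hb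
  have hsub := hg.sub (hasWeakDerivs_of_contDiff hU hb hps (k + 1)) hu hpL
  refine ⟨p, hp, ?_, hsub, ?_⟩
  · rw [← h2 [] (Nat.zero_le _)]
    refine integral_congr_ae ?_
    filter_upwards [hg.ae_eq_nil hU hu] with x hx
    rw [hx]; rfl
  -- Induction on the number i of orders below the top. At the top the derivatives of p vanish, and
  -- each Poincaré inequality costs one factor 2 c h² in the squares.
  · intro i
    induction i with
    | zero =>
      intro j hj
      have : j = k + 1 := by omega
      subst this
      rw [pow_zero, one_mul]
      refine le_of_eq (Finset.sum_congr rfl fun idx _ => ?_)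
      simp only [h1 (List.ofFn idx) (by simp), sub_zero]
    | succ i ih =>
      intro j hj
      calc _ ≤ 2 * c * ENNReal.ofReal h ^ 2 * sobSq U (fun l => g l - dlist l p) (j + 1) :=
            sobSq_le_succ hU hUc hb hne hsub hd hc (by omega) fun l hl => by
              simpa using h2 l (by omega)
        _ ≤ 2 * c * ENNReal.ofReal h ^ 2 *
              ((2 * c * ENNReal.ofReal h ^ 2) ^ i * sobSq U g (k + 1)) := by
            gcongr; exact ih (j + 1) (by omega)
        _ = _ := by ring

/-! ### Lagrange interpolation on simplices in barycentric coordinates -/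

section Lagrange

variable {ι : Type*} [DecidableEq ι]

/-- The Lagrange basis function of degree `k` of the node `α / k` in barycentric coordinates. -/
def lagrange (t : Finset ι) (k : ℕ) (α : ι →₀ ℕ) (lam : ι → ℝ) : ℝ :=
  ∏ v ∈ t, Ring.choose ((k : ℝ) * lam v) (α v)

theorem ring_choose_succ (s : ℝ) (a : ℕ) :
    ((a : ℝ) + 1) * Ring.choose s (a + 1) = (s - a) * Ring.choose s a := by
  have := Ring.choose_smul_choose s (Nat.le_succ a)
  rw [Nat.succ_eq_add_one, Nat.choose_succ_self_right, Nat.add_sub_cancel_left,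
    Ring.choose_one_right, nsmul_eq_mul] at this
  push_cast at this
  linarith

/-- Vandermonde's identity by generating functions. The series with coefficients C(a, β) C(s, a) is
C(s, β) Xᵝ (1 + X)^{s - β}. With s = k λ_v, the exponents of the product over v add up to k - ∑ β
because the λ_v sum to 1, and its coefficient of Xᵏ is read off in two ways. -/
theorem sum_choose_mul_lagrange {t : Finset ι} {k : ℕ} {lam : ι → ℝ} (hlam : ∑ v ∈ t, lam v = 1)
    {β : ι → ℕ} (hβ : ∑ v ∈ t, β v ≤ k) :
    ∑ α ∈ t.finsuppAntidiag k, (∏ v ∈ t, Ring.choose (α v : ℝ) (β v)) * lagrange t k α lam =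
      ∏ v ∈ t, Ring.choose ((k : ℝ) * lam v) (β v) := by
  set f : ι → PowerSeries ℝ := fun v =>
    (PowerSeries.X ^ β v) * (PowerSeries.C (Ring.choose ((k : ℝ) * lam v) (β v)) *
      PowerSeries.binomialSeries ℝ ((k : ℝ) * lam v - β v)) with hf
  have hc : ∀ v a, PowerSeries.coeff a (f v) =
      Ring.choose (a : ℝ) (β v) * Ring.choose ((k : ℝ) * lam v) a := by
    intro v a
    rw [hf]
    simp only
    rw [PowerSeries.coeff_X_pow_mul', Ring.choose_natCast]
    split_ifs with h
    · rw [PowerSeries.coeff_C_mul, PowerSeries.binomialSeries_coeff, smul_eq_mul, mul_one,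
        ← Ring.choose_smul_choose _ h, nsmul_eq_mul]
    · rw [Nat.choose_eq_zero_of_lt (by omega)]
      simp
  have h1 := PowerSeries.coeff_prod f k t
  have h2 : ∏ v ∈ t, f v = PowerSeries.X ^ (∑ v ∈ t, β v) *
      (PowerSeries.C (∏ v ∈ t, Ring.choose ((k : ℝ) * lam v) (β v)) *
        PowerSeries.binomialSeries ℝ (∑ v ∈ t, ((k : ℝ) * lam v - β v))) := by
    rw [hf]
    simp only [Finset.prod_mul_distrib, Finset.prod_pow_eq_pow_sum, map_prod]
    congr 2
    clear hlam hβ hc h1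
    induction t using Finset.induction_on with
    | empty => simp [PowerSeries.binomialSeries_zero]
    | insert v t hv ih => rw [Finset.prod_insert hv, Finset.sum_insert hv, ih, PowerSeries.binomialSeries_add]
  have h3 : ∑ v ∈ t, ((k : ℝ) * lam v - β v) = ((k - ∑ v ∈ t, β v : ℕ) : ℝ) := by
    rw [Finset.sum_sub_distrib, ← Finset.mul_sum, hlam, Nat.cast_sub hβ]
    simp
  rw [h2, h3, PowerSeries.coeff_X_pow_mul', if_pos hβ, PowerSeries.coeff_C_mul,
    PowerSeries.binomialSeries_coeff, Ring.choose_natCast, Nat.choose_self] at h1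
  rw [Nat.cast_one, smul_eq_mul, mul_one, mul_one] at h1
  rw [h1]
  refine Finset.sum_congr rfl fun α _ => ?_
  rw [lagrange, ← Finset.prod_mul_distrib]
  exact Finset.prod_congr rfl fun v _ => (hc v _).symm

/-- Span of the products of binomial coefficients of total degree at most `j`. -/
def chooseSpan (t : Finset ι) (k j : ℕ) : Submodule ℝ ((ι → ℝ) → ℝ) :=
  Submodule.span ℝ {F | ∃ β : ι → ℕ, ∑ v ∈ t, β v ≤ j ∧
    F = fun lam => ∏ v ∈ t, Ring.choose ((k : ℝ) * lam v) (β v)}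

/-- From s C(s, b) = (b + 1) C(s, b + 1) + b C(s, b) with s = k λ_v: multiplication by a coordinate
raises the degree by one. -/
theorem coord_mul_mem_chooseSpan {t : Finset ι} {k j : ℕ} (hk : k ≠ 0) {v : ι} (hv : v ∈ t)
    {F : (ι → ℝ) → ℝ} (hF : F ∈ chooseSpan t k j) :
    (fun lam => lam v * F lam) ∈ chooseSpan t k (j + 1) := by
  have hk' : (k : ℝ) ≠ 0 := by exact_mod_cast hk
  induction hF using Submodule.span_induction with
  | mem F hF =>
    obtain ⟨β, hβ, rfl⟩ := hF
    have hβ' : ∑ w ∈ t, Function.update β v (β v + 1) w ≤ j + 1 := by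
      rw [Finset.sum_update_of_mem hv, add_right_comm]
      have h0 : β v + ∑ w ∈ t \ {v}, β w = ∑ w ∈ t, β w := by
        rw [Finset.sdiff_singleton_eq_erase, Finset.add_sum_erase _ _ hv]
      omega
    have e : (fun lam : ι → ℝ => lam v * ∏ w ∈ t, Ring.choose ((k : ℝ) * lam w) (β w)) =
        (((β v : ℝ) + 1) / k) • (fun lam : ι → ℝ => ∏ w ∈ t, Ring.choose ((k : ℝ) * lam w)
          (Function.update β v (β v + 1) w)) +
        ((β v : ℝ) / k) • fun lam : ι → ℝ => ∏ w ∈ t, Ring.choose ((k : ℝ) * lam w) (β w) := by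
      funext lam
      simp only [Pi.add_apply, Pi.smul_apply, smul_eq_mul]
      rw [← Finset.mul_prod_erase _ _ hv, ← Finset.mul_prod_erase t (fun w =>
        Ring.choose ((k : ℝ) * lam w) (Function.update β v (β v + 1) w)) hv]
      have h1 : ∏ w ∈ t.erase v, Ring.choose ((k : ℝ) * lam w) (Function.update β v (β v + 1) w) =
          ∏ w ∈ t.erase v, Ring.choose ((k : ℝ) * lam w) (β w) :=
        Finset.prod_congr rfl fun w hw => by
          rw [Function.update_of_ne (Finset.ne_of_mem_erase hw)]
      rw [h1, Function.update_self]
      have h2 := ring_choose_succ ((k : ℝ) * lam v) (β v)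
      set P := ∏ w ∈ t.erase v, Ring.choose ((k : ℝ) * lam w) (β w)
      generalize Ring.choose ((k : ℝ) * lam v) (β v + 1) = X at h2 ⊢
      generalize Ring.choose ((k : ℝ) * lam v) (β v) = Y at h2 ⊢
      field_simp
      linear_combination (-P) * h2
    rw [e]
    refine Submodule.add_mem _ (Submodule.smul_mem _ _ (Submodule.subset_span ⟨_, hβ', rfl⟩))
      (Submodule.smul_mem _ _ (Submodule.subset_span ⟨_, hβ.trans (Nat.le_succ j), rfl⟩))
  | zero =>
    have : (fun lam : ι → ℝ => lam v * (0 : (ι → ℝ) → ℝ) lam) = 0 := by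
      funext lam
      simp
    rw [this]
    exact Submodule.zero_mem _
  | add F G _ _ h1 h2 =>
    convert Submodule.add_mem _ h1 h2 using 1
    funext lam
    simp [mul_add]
  | smul c F _ h1 =>
    convert Submodule.smul_mem _ c h1 using 1
    funext lam
    simp only [Pi.smul_apply, smul_eq_mul]
    ring

theorem chooseSpan_mono {t : Finset ι} {k j j' : ℕ} (h : j ≤ j') :
    chooseSpan t k j ≤ chooseSpan t k j' := by
  apply Submodule.span_mono
  rintro F ⟨β, hβ, rfl⟩
  exact ⟨β, hβ.trans h, rfl⟩

/-- Each Cartesian coordinate is linear in the barycentric ones, so a monomial is built up from the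
constant 1 by `coord_mul_mem_chooseSpan`. -/
theorem polyFn_comp_mem_chooseSpan {m : ℕ} {t : Finset ι} {k j : ℕ} (hk : k ≠ 0)
    (pt : ι → Euc m) {f : Euc m → ℝ} (hf : f ∈ polyFn m j) :
    (fun lam : ι → ℝ => f (∑ v ∈ t, lam v • pt v)) ∈ chooseSpan t k j := by
  obtain ⟨p, hp, h⟩ := hf
  rw [MvPolynomial.mem_restrictTotalDegree] at hp
  have e : (fun lam : ι → ℝ => f (∑ v ∈ t, lam v • pt v)) = ∑ d ∈ p.support, p.coeff d •
      fun lam : ι → ℝ => ∏ i ∈ d.support, ((∑ v ∈ t, lam v • pt v : Euc m) i) ^ d i := by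
    funext lam
    simp only [h, MvPolynomial.eval_eq, Finset.sum_apply, Pi.smul_apply, smul_eq_mul]
  rw [e]
  refine Submodule.sum_mem _ fun d hd => Submodule.smul_mem _ _ ?_
  have hlin : ∀ (i : Fin m) {a : ℕ} {F : (ι → ℝ) → ℝ}, F ∈ chooseSpan t k a →
      (fun lam => (∑ v ∈ t, lam v • pt v : Euc m) i * F lam) ∈ chooseSpan t k (a + 1) := by
    intro i a F hF
    have : (fun lam : ι → ℝ => (∑ v ∈ t, lam v • pt v : Euc m) i * F lam) =
        ∑ v ∈ t, (pt v i) • fun lam : ι → ℝ => lam v * F lam := by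
      funext lam
      simp only [WithLp.ofLp_sum, Finset.sum_apply, PiLp.smul_apply, smul_eq_mul, Pi.smul_apply,
        Finset.sum_mul]
      exact Finset.sum_congr rfl fun v _ => by ring
    rw [this]
    exact Submodule.sum_mem _ fun v hv => Submodule.smul_mem _ _ (coord_mul_mem_chooseSpan hk hv hF)
  have hpow : ∀ (i : Fin m) (b : ℕ) {a : ℕ} {F : (ι → ℝ) → ℝ}, F ∈ chooseSpan t k a →
      (fun lam => (∑ v ∈ t, lam v • pt v : Euc m) i ^ b * F lam) ∈ chooseSpan t k (a + b) := by
    intro i b a F hF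
    induction b with
    | zero => simpa using hF
    | succ b ih =>
      rw [← add_assoc]
      have e : (fun lam : ι → ℝ => (∑ v ∈ t, lam v • pt v : Euc m) i ^ (b + 1) * F lam) =
          fun lam => (∑ v ∈ t, lam v • pt v : Euc m) i *
            ((∑ v ∈ t, lam v • pt v : Euc m) i ^ b * F lam) := by
        funext lam
        ring
      rw [e]
      exact hlin i ih
  have hone : (fun _ : ι → ℝ => (1 : ℝ)) ∈ chooseSpan t k 0 :=
    Submodule.subset_span ⟨0, by simp, by funext lam; simp⟩
  have hprod : ∀ s : Finset (Fin m),
      (fun lam : ι → ℝ => ∏ i ∈ s, ((∑ v ∈ t, lam v • pt v : Euc m) i) ^ d i) ∈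
        chooseSpan t k (∑ i ∈ s, d i) := by
    intro s
    induction s using Finset.induction_on with
    | empty => simpa using hone
    | insert i s hi ih =>
      rw [Finset.sum_insert hi, add_comm]
      convert hpow i (d i) ih using 1
      funext lam
      rw [Finset.prod_insert hi]
  exact chooseSpan_mono ((MvPolynomial.le_totalDegree hd).trans hp) (hprod d.support)

/-- Lagrange interpolation of degree `k` reproduces polynomials of degree `k`. -/
theorem sum_lagrange_eq {m : ℕ} {t : Finset ι} {k : ℕ} (hk : k ≠ 0)
    (pt : ι → Euc m) {f : Euc m → ℝ} (hf : f ∈ polyFn m k) {lam : ι → ℝ}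
    (hlam : ∑ v ∈ t, lam v = 1) :
    ∑ α ∈ t.finsuppAntidiag k, f (∑ v ∈ t, ((α v : ℝ) / k) • pt v) * lagrange t k α lam =
      f (∑ v ∈ t, lam v • pt v) := by
  have hk' : (k : ℝ) ≠ 0 := by exact_mod_cast hk
  -- By linearity only products of binomial coefficients have to be reproduced, and for these the
  -- claim is `sum_choose_mul_lagrange`.
  have key : ∀ F ∈ chooseSpan t k k,
      ∑ α ∈ t.finsuppAntidiag k, F (fun v => (α v : ℝ) / k) * lagrange t k α lam = F lam := by
    intro F hF
    induction hF using Submodule.span_induction with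
    | mem F hF =>
      obtain ⟨β, hβ, rfl⟩ := hF
      beta_reduce
      rw [← sum_choose_mul_lagrange hlam hβ]
      refine Finset.sum_congr rfl fun α _ => ?_
      congr 1
      refine Finset.prod_congr rfl fun v _ => ?_
      rw [mul_div_cancel₀ _ hk']
    | zero => simp
    | add F G _ _ h1 h2 => simp only [Pi.add_apply, add_mul, Finset.sum_add_distrib, h1, h2]
    | smul c F _ h1 =>
      simp only [Pi.smul_apply, smul_eq_mul, mul_assoc, ← Finset.mul_sum, h1]
  exact key _ (polyFn_comp_mem_chooseSpan hk pt hf)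

theorem choose_mem_polyFn {m : ℕ} {f : Euc m → ℝ} (hf : f ∈ polyFn m 1) (k a : ℕ) :
    (fun x => Ring.choose ((k : ℝ) * f x) a) ∈ polyFn m a := by
  induction a with
  | zero =>
    simp only [Ring.choose_zero_right]
    exact const_mem_polyFn 1 0
  | succ a ih =>
    have h1 : ((k : ℝ) • f - fun _ => (a : ℝ)) ∈ polyFn m 1 :=
      Submodule.sub_mem _ (Submodule.smul_mem _ _ hf) (const_mem_polyFn _ _)
    have := Submodule.smul_mem _ (((a : ℝ) + 1)⁻¹) (mul_mem_polyFn ih h1)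
    convert this using 1
    funext x
    have h2 := ring_choose_succ ((k : ℝ) * f x) a
    have h3 : (a : ℝ) + 1 ≠ 0 := by positivity
    simp only [Pi.smul_apply, Pi.mul_apply, Pi.sub_apply, smul_eq_mul]
    field_simp
    linarith

theorem lagrange_comp_mem_polyFn {m : ℕ} {t : Finset ι} {k : ℕ} {α : ι →₀ ℕ}
    (hα : α ∈ t.finsuppAntidiag k) {ell : ι → Euc m → ℝ} (hl : ∀ v ∈ t, ell v ∈ polyFn m 1) :
    (fun x => lagrange t k α (fun v => ell v x)) ∈ polyFn m k := by
  have := prod_mem_polyFn t (fun v => α v) (fun v x => Ring.choose ((k : ℝ) * ell v x) (α v))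
    fun v hv => choose_mem_polyFn (hl v hv) k _
  rwa [(Finset.mem_finsuppAntidiag.1 hα).1] at this

/-- Induction by (a + 1) C(s, a + 1) = (s - a) C(s, a), with the product rule for the Lipschitz
bound. -/
theorem exists_choose_bound (k a : ℕ) : ∃ C : ℝ, 1 ≤ C ∧ ∀ x ∈ Set.Icc (0 : ℝ) 1,
    ∀ y ∈ Set.Icc (0 : ℝ) 1, |Ring.choose ((k : ℝ) * x) a| ≤ C ∧
      |Ring.choose ((k : ℝ) * x) a - Ring.choose ((k : ℝ) * y) a| ≤ C * |x - y| := by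
  induction a with
  | zero =>
    refine ⟨1, le_rfl, fun x _ y _ => ?_⟩
    simp [Ring.choose_zero_right]
  | succ a ih =>
    obtain ⟨C, hC, h⟩ := ih
    have hka : (0 : ℝ) ≤ k + a := by positivity
    refine ⟨C * (k + a + 1) + C * k, by nlinarith [(Nat.cast_nonneg k : (0 : ℝ) ≤ k)],
      fun x hx y hy => ?_⟩
    have key : ∀ s : ℝ, Ring.choose s (a + 1) = (s - a) * Ring.choose s a / (a + 1) := fun s => by
      rw [eq_div_iff (by positivity), mul_comm, ring_choose_succ]
    have hs : ∀ x ∈ Set.Icc (0 : ℝ) 1, |(k : ℝ) * x - a| ≤ k + a := by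
      intro x hx
      have : (k : ℝ) * x ≤ k := mul_le_of_le_one_right (by positivity) hx.2
      have h0 : 0 ≤ (k : ℝ) * x := mul_nonneg (by positivity) hx.1
      rw [abs_le]
      constructor <;> [linarith [(Nat.cast_nonneg k : (0 : ℝ) ≤ k)];
        linarith [(Nat.cast_nonneg a : (0 : ℝ) ≤ a)]]
    have hdiv : ∀ z : ℝ, |z / ((a : ℝ) + 1)| ≤ |z| := fun z => by
      rw [abs_div, abs_of_pos (by positivity : (0 : ℝ) < a + 1)]
      exact div_le_self (abs_nonneg _) (by linarith [(Nat.cast_nonneg a : (0 : ℝ) ≤ a)])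
    obtain ⟨h1, h2⟩ := h x hx y hy
    obtain ⟨h1y, -⟩ := h y hy x hx
    have hC0 : 0 ≤ C := by linarith
    constructor
    · rw [key]
      refine (hdiv _).trans ?_
      rw [abs_mul]
      calc _ ≤ ((k : ℝ) + a) * C := mul_le_mul (hs x hx) h1 (abs_nonneg _) hka
        _ ≤ _ := by nlinarith [(Nat.cast_nonneg k : (0 : ℝ) ≤ k)]
    · rw [key, key, ← sub_div]
      refine (hdiv _).trans ?_
      have e : ((k : ℝ) * x - a) * Ring.choose ((k : ℝ) * x) a -
          ((k : ℝ) * y - a) * Ring.choose ((k : ℝ) * y) a =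
          ((k : ℝ) * x - a) * (Ring.choose ((k : ℝ) * x) a - Ring.choose ((k : ℝ) * y) a) +
          (k * (x - y)) * Ring.choose ((k : ℝ) * y) a := by ring
      rw [e]
      refine (abs_add_le _ _).trans ?_
      rw [abs_mul, abs_mul, abs_mul, Nat.abs_cast]
      have a1 : |(k : ℝ) * x - a| * |Ring.choose ((k : ℝ) * x) a - Ring.choose ((k : ℝ) * y) a| ≤
          (k + a) * (C * |x - y|) := mul_le_mul (hs x hx) h2 (abs_nonneg _) hka
      have a2 : (k : ℝ) * |x - y| * |Ring.choose ((k : ℝ) * y) a| ≤ k * |x - y| * C :=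
        mul_le_mul_of_nonneg_left h1y (by positivity)
      nlinarith [abs_nonneg (x - y), mul_nonneg hC0 (abs_nonneg (x - y))]

/-- Uniform bounds of the Lagrange basis functions. -/
theorem exists_lagrange_bound (k N : ℕ) : ∃ C : ℝ, 1 ≤ C ∧ ∀ (t : Finset ι), t.card = N →
    ∀ α ∈ t.finsuppAntidiag k, ∀ lam mu : ι → ℝ, (∀ v ∈ t, lam v ∈ Set.Icc (0 : ℝ) 1) →
    (∀ v ∈ t, mu v ∈ Set.Icc (0 : ℝ) 1) → |lagrange t k α lam| ≤ C ∧
      |lagrange t k α lam - lagrange t k α mu| ≤ C * ∑ v ∈ t, |lam v - mu v| := by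
  choose c hc1 hc using exists_choose_bound k
  set D : ℝ := ∑ a ∈ Finset.range (k + 1), c a with hD
  have hcD : ∀ a ≤ k, c a ≤ D := fun a ha =>
    Finset.single_le_sum (f := c) (fun i _ => zero_le_one.trans (hc1 i))
      (Finset.mem_range.2 (Nat.lt_succ_of_le ha))
  have hD1 : 1 ≤ D := (hc1 0).trans (hcD 0 (Nat.zero_le k))
  refine ⟨D ^ N, one_le_pow₀ hD1, fun t ht α hα lam mu hl hm => ?_⟩
  have hαk : ∀ v ∈ t, α v ≤ k := fun v hv => by
    have := (Finset.mem_finsuppAntidiag.1 hα).1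
    rw [← this]
    exact Finset.single_le_sum (f := α) (fun _ _ => Nat.zero_le _) hv
  rw [← ht]
  clear hα ht
  unfold lagrange
  induction t using Finset.induction_on with
  | empty => simp
  | insert v t hv ih =>
    obtain ⟨i1, i2⟩ := ih (fun w hw => hl w (Finset.mem_insert_of_mem hw))
      (fun w hw => hm w (Finset.mem_insert_of_mem hw))
      (fun w hw => hαk w (Finset.mem_insert_of_mem hw))
    have hvi := Finset.mem_insert_self v t
    obtain ⟨j1, j2⟩ := hc (α v) (lam v) (hl v hvi) (mu v) (hm v hvi)
    obtain ⟨j3, -⟩ := hc (α v) (mu v) (hm v hvi) (lam v) (hl v hvi)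
    have hcv := hcD _ (hαk v hvi)
    rw [Finset.prod_insert hv, Finset.prod_insert hv, Finset.card_insert_of_notMem hv,
      Finset.sum_insert hv]
    set P := ∏ w ∈ t, Ring.choose ((k : ℝ) * lam w) (α w)
    set Q := ∏ w ∈ t, Ring.choose ((k : ℝ) * mu w) (α w)
    set a := Ring.choose ((k : ℝ) * lam v) (α v)
    set b := Ring.choose ((k : ℝ) * mu v) (α v)
    set S := ∑ w ∈ t, |lam w - mu w|
    have hS : 0 ≤ S := Finset.sum_nonneg fun _ _ => abs_nonneg _
    have hDp : 0 ≤ D ^ t.card := by positivity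
    have hb : |b| ≤ D := j3.trans hcv
    have hab : |a - b| ≤ D * |lam v - mu v| :=
      j2.trans (mul_le_mul_of_nonneg_right hcv (abs_nonneg _))
    constructor
    · rw [abs_mul, pow_succ, mul_comm]
      exact mul_le_mul i1 (j1.trans hcv) (abs_nonneg _) hDp
    · have e : a * P - b * Q = (a - b) * P + b * (P - Q) := by ring
      rw [e]
      refine (abs_add_le _ _).trans ?_
      rw [abs_mul, abs_mul]
      calc _ ≤ D * |lam v - mu v| * D ^ t.card + D * (D ^ t.card * S) :=
            add_le_add (mul_le_mul hab i1 (abs_nonneg _) (by positivity))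
              (mul_le_mul hb i2 (abs_nonneg _) (by positivity))
        _ = _ := by rw [pow_succ]; ring

end Lagrange

/-! ### Barycentric coordinates in a simplicial complex -/

section Barycentric

variable {E : Type*} [NormedAddCommGroup E] [NormedSpace ℝ E]

theorem affineMap_sum_smul {ι : Type*} (f : E →ᵃ[ℝ] ℝ) {s : Finset ι} {w : ι → ℝ}
    (hw : ∑ i ∈ s, w i = 1) (p : ι → E) : f (∑ i ∈ s, w i • p i) = ∑ i ∈ s, w i * f (p i) := by
  have h : ∀ x, f x = f.linear x + f 0 := fun x => by
    conv_lhs => rw [f.decomp]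
    rfl
  rw [h, map_sum]
  simp only [map_smul, smul_eq_mul]
  calc _ = ∑ i ∈ s, w i * f.linear (p i) + (∑ i ∈ s, w i) * f 0 := by rw [hw, one_mul]
    _ = _ := by
      rw [Finset.sum_mul, ← Finset.sum_add_distrib]
      refine Finset.sum_congr rfl fun i _ => ?_
      rw [h (p i)]; ring

-- The vertices are completed to an affine basis of E. The resulting affine functions depend on the
-- completion, but not their values on the affine span of s.
open Classical in
theorem exists_baryFun {s : Finset E} (hs : AffineIndependent ℝ ((↑) : s → E)) :
    ∃ β : E → (E →ᵃ[ℝ] ℝ), (∀ v ∈ s, ∀ w ∈ s, β v w = if v = w then 1 else 0) ∧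
      ∀ v ∉ s, β v = 0 := by
  obtain ⟨t, hst, hti, htt⟩ := exists_subset_affineIndependent_affineSpan_eq_top
    (s := (s : Set E)) hs
  let b : AffineBasis t ℝ E := ⟨(↑), hti, by rw [Subtype.range_coe]; exact htt⟩
  refine ⟨fun v => if h : v ∈ s then b.coord ⟨v, hst h⟩ else 0, ?_, ?_⟩
  · intro v hv w hw
    have e : w = b ⟨w, hst hw⟩ := rfl
    have e2 : (fun v => if h : v ∈ s then b.coord ⟨v, hst h⟩ else 0) v = b.coord ⟨v, hst hv⟩ :=
      dif_pos hv
    rw [e2]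
    conv_lhs => rw [e]
    rw [b.coord_apply]
    simp [Subtype.ext_iff]
  · intro v hv
    exact dif_neg hv

open Classical in
/-- The barycentric coordinate of the vertex `v` of the simplex `s`, extended to an affine
function on the whole space. -/
def baryFun (s : Finset E) (v : E) : E →ᵃ[ℝ] ℝ :=
  if h : AffineIndependent ℝ ((↑) : s → E) then (exists_baryFun h).choose v else 0

open Classical in
theorem baryFun_vertex {s : Finset E} (hs : AffineIndependent ℝ ((↑) : s → E)) {v w : E}
    (hv : v ∈ s) (hw : w ∈ s) : baryFun s v w = if v = w then 1 else 0 := by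
  rw [baryFun, dif_pos hs]
  exact (exists_baryFun hs).choose_spec.1 v hv w hw

theorem baryFun_of_notMem {s : Finset E} {v : E} (hv : v ∉ s) : baryFun s v = 0 := by
  rw [baryFun]
  split_ifs with hs
  · rw [(exists_baryFun hs).choose_spec.2 v hv]
  · rfl

theorem baryFun_sum {s : Finset E} (hs : AffineIndependent ℝ ((↑) : s → E)) {w : E → ℝ}
    (hw : ∑ u ∈ s, w u = 1) {v : E} (hv : v ∈ s) : baryFun s v (∑ u ∈ s, w u • u) = w v := by
  classical
  rw [affineMap_sum_smul _ hw, Finset.sum_eq_single v]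
  · rw [baryFun_vertex hs hv hv, if_pos rfl, mul_one]
  · intro u hu huv
    rw [baryFun_vertex hs hv hu, if_neg (Ne.symm huv), mul_zero]
  · exact fun h => absurd hv h

theorem mem_affineSpan_finset_iff {s : Finset E} {x : E} :
    x ∈ affineSpan ℝ (s : Set E) ↔ ∃ w : E → ℝ, ∑ u ∈ s, w u = 1 ∧ ∑ u ∈ s, w u • u = x := by
  constructor
  · intro h
    obtain ⟨w, hw, e⟩ := eq_affineCombination_of_mem_affineSpan_of_fintype (ι := s)
      (p := ((↑) : s → E)) (k := ℝ) (p1 := x) (by simpa using h)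
    classical
    refine ⟨fun u => if h : u ∈ s then w ⟨u, h⟩ else 0, ?_, ?_⟩
    · rw [← Finset.sum_coe_sort]
      simpa using hw
    · rw [e, Finset.affineCombination_eq_linear_combination _ _ _ hw, ← Finset.sum_coe_sort]
      simp
  · rintro ⟨w, hw, rfl⟩
    rw [← Finset.sum_coe_sort] at hw
    have := affineCombination_mem_affineSpan (k := ℝ) hw ((↑) : s → E)
    rw [Finset.affineCombination_eq_linear_combination _ _ _ hw] at this
    rw [← Finset.sum_coe_sort]
    simpa using this

theorem sum_baryFun {s : Finset E} (hs : AffineIndependent ℝ ((↑) : s → E)) {x : E}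
    (hx : x ∈ affineSpan ℝ (s : Set E)) : ∑ v ∈ s, baryFun s v x = 1 := by
  obtain ⟨w, hw, rfl⟩ := mem_affineSpan_finset_iff.1 hx
  rw [← hw]
  exact Finset.sum_congr rfl fun v hv => by rw [baryFun_sum hs hw hv]

theorem sum_baryFun_smul {s : Finset E} (hs : AffineIndependent ℝ ((↑) : s → E)) {x : E}
    (hx : x ∈ affineSpan ℝ (s : Set E)) : ∑ v ∈ s, baryFun s v x • v = x := by
  obtain ⟨w, hw, rfl⟩ := mem_affineSpan_finset_iff.1 hx
  exact Finset.sum_congr rfl fun v hv => by rw [baryFun_sum hs hw hv]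

theorem mem_convexHull_iff_baryFun {s : Finset E} (hs : AffineIndependent ℝ ((↑) : s → E))
    {x : E} : x ∈ convexHull ℝ (s : Set E) ↔
      x ∈ affineSpan ℝ (s : Set E) ∧ ∀ v ∈ s, 0 ≤ baryFun s v x := by
  rw [Finset.mem_convexHull']
  constructor
  · rintro ⟨w, h0, hw, rfl⟩
    exact ⟨mem_affineSpan_finset_iff.2 ⟨w, hw, rfl⟩, fun v hv => by
      rw [baryFun_sum hs hw hv]; exact h0 v hv⟩
  · rintro ⟨hx, h0⟩
    exact ⟨fun v => baryFun s v x, h0, sum_baryFun hs hx, sum_baryFun_smul hs hx⟩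

theorem baryFun_mem_Icc {s : Finset E} (hs : AffineIndependent ℝ ((↑) : s → E)) {x : E}
    (hx : x ∈ convexHull ℝ (s : Set E)) (v : E) : baryFun s v x ∈ Set.Icc (0 : ℝ) 1 := by
  by_cases hv : v ∈ s
  · obtain ⟨h1, h2⟩ := (mem_convexHull_iff_baryFun hs).1 hx
    refine ⟨h2 v hv, ?_⟩
    rw [← sum_baryFun hs h1]
    exact Finset.single_le_sum (f := fun v => baryFun s v x) h2 hv
  · rw [baryFun_of_notMem hv]
    simp

/-- Split d into positive part P, carried by s, and negative part N, carried by t. If they are not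
zero, then after normalisation both represent one point of the two simplices, which therefore lies
in the hull of the common face. Uniqueness of barycentric coordinates in s and in t shows that P and
N are carried by s ∩ t and coincide there; being the two parts of d, they then vanish. -/
theorem cone_pos {s t : Finset E} [DecidableEq E] (hs : AffineIndependent ℝ ((↑) : s → E))
    (ht : AffineIndependent ℝ ((↑) : t → E))
    (hst : convexHull ℝ (s : Set E) ∩ convexHull ℝ t ⊆ convexHull ℝ (s ∩ t : Set E))
    {d : E → ℝ} (h0 : ∑ v ∈ s ∪ t, d v = 0) (h1 : ∀ v ∈ s \ t, 0 ≤ d v)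
    (h2 : ∀ v ∈ t \ s, d v ≤ 0) (h3 : ∑ v ∈ s ∪ t, d v • v = 0) : ∀ v ∈ s ∪ t, d v = 0 := by
  set P : E → ℝ := fun v => max (d v) 0 with hP
  set N : E → ℝ := fun v => max (-d v) 0 with hN
  have hPN : ∀ v, d v = P v - N v := fun v => by
    simp only [hP, hN]
    rcases le_total (d v) 0 with h | h
    · rw [max_eq_right h, max_eq_left (by linarith)]; ring
    · rw [max_eq_left h, max_eq_right (by linarith)]; ring
  have hPs : ∀ v ∈ s ∪ t, v ∉ s → P v = 0 := fun v hv hvs =>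
    max_eq_right (h2 v (Finset.mem_sdiff.2 ⟨(Finset.mem_union.1 hv).resolve_left hvs, hvs⟩))
  have hNt : ∀ v ∈ s ∪ t, v ∉ t → N v = 0 := fun v hv hvt =>
    max_eq_right (neg_nonpos.2
      (h1 v (Finset.mem_sdiff.2 ⟨(Finset.mem_union.1 hv).resolve_right hvt, hvt⟩)))
  have sumP : ∑ v ∈ s, P v = ∑ v ∈ s ∪ t, P v :=
    Finset.sum_subset Finset.subset_union_left fun v hv hvs => hPs v hv hvs
  have sumN : ∑ v ∈ t, N v = ∑ v ∈ s ∪ t, N v :=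
    Finset.sum_subset Finset.subset_union_right fun v hv hvs => hNt v hv hvs
  have sumPv : ∑ v ∈ s, P v • v = ∑ v ∈ s ∪ t, P v • v :=
    Finset.sum_subset Finset.subset_union_left fun v hv hvs => by rw [hPs v hv hvs, zero_smul]
  have sumNv : ∑ v ∈ t, N v • v = ∑ v ∈ s ∪ t, N v • v :=
    Finset.sum_subset Finset.subset_union_right fun v hv hvs => by rw [hNt v hv hvs, zero_smul]
  have eS : ∑ v ∈ t, N v = ∑ v ∈ s, P v := by
    rw [sumP, sumN]
    have : ∑ v ∈ s ∪ t, (P v - N v) = 0 := by simpa only [← hPN] using h0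
    rw [Finset.sum_sub_distrib] at this
    linarith
  have eV : ∑ v ∈ t, N v • v = ∑ v ∈ s, P v • v := by
    rw [sumPv, sumNv]
    have : ∑ v ∈ s ∪ t, (P v - N v) • v = 0 := by simpa only [← hPN] using h3
    simp only [sub_smul, Finset.sum_sub_distrib] at this
    exact (sub_eq_zero.1 this).symm
  set S := ∑ v ∈ s, P v with hS
  have hP0 : ∀ v, 0 ≤ P v := fun v => le_max_right _ _
  have hN0 : ∀ v, 0 ≤ N v := fun v => le_max_right _ _
  rcases (Finset.sum_nonneg fun v _ => hP0 v : 0 ≤ S).eq_or_lt with hz | hpos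
  · have a1 := (Finset.sum_eq_zero_iff_of_nonneg fun v _ => hP0 v).1 (sumP.symm.trans hz.symm)
    have a2 := (Finset.sum_eq_zero_iff_of_nonneg fun v _ => hN0 v).1
      (sumN.symm.trans (eS.trans hz.symm))
    intro v hv
    rw [hPN, a1 v hv, a2 v hv, sub_zero]
  · exfalso
    set x := ∑ v ∈ s, (S⁻¹ * P v) • v with hx
    have sum1 : ∑ v ∈ s, S⁻¹ * P v = 1 := by
      rw [← Finset.mul_sum, inv_mul_cancel₀ hpos.ne']
    have sum2 : ∑ v ∈ t, S⁻¹ * N v = 1 := by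
      rw [← Finset.mul_sum, eS, inv_mul_cancel₀ hpos.ne']
    have hx2 : x = ∑ v ∈ t, (S⁻¹ * N v) • v := by
      simp only [hx, mul_smul, ← Finset.smul_sum, eV]
    have hmem : x ∈ convexHull ℝ ((s ∩ t : Finset E) : Set E) := by
      rw [Finset.coe_inter]
      exact hst ⟨Finset.mem_convexHull'.2 ⟨_, fun v _ => mul_nonneg (inv_nonneg.2 hpos.le) (hP0 v),
        sum1, rfl⟩, Finset.mem_convexHull'.2 ⟨_, fun v _ => mul_nonneg (inv_nonneg.2 hpos.le)
        (hN0 v), sum2, hx2.symm⟩⟩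
    obtain ⟨w, -, hw, hwx⟩ := Finset.mem_convexHull'.1 hmem
    set w' : E → ℝ := fun v => if v ∈ s ∩ t then w v else 0 with hw'
    -- In either simplex r the coordinates of x are those w of the common face, extended by zero.
    have key : ∀ r : Finset E, AffineIndependent ℝ ((↑) : r → E) → s ∩ t ⊆ r → ∀ c : E → ℝ,
        ∑ v ∈ r, c v = 1 → x = ∑ v ∈ r, c v • v → ∀ v ∈ r, c v = w' v := by
      intro r hr hsub c hc hxc v hv
      have e1 : ∑ v ∈ r, w' v = 1 := by
        rw [← hw]
        refine (Finset.sum_subset hsub fun v _ hv => if_neg hv).symm.trans ?_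
        exact Finset.sum_congr rfl fun v hv => if_pos hv
      have e2 : ∑ v ∈ r, w' v • v = x := by
        rw [← hwx]
        refine (Finset.sum_subset hsub fun v _ hv => ?_).symm.trans ?_
        · simp only [hw', if_neg hv, zero_smul]
        · exact Finset.sum_congr rfl fun v hv => by simp only [hw', if_pos hv]
      rw [← baryFun_sum hr hc hv, ← hxc, ← e2, baryFun_sum hr e1 hv]
    have k1 := key s hs Finset.inter_subset_left _ sum1 rfl
    have k2 := key t ht Finset.inter_subset_right _ sum2 hx2
    have : ∀ v ∈ s, P v = 0 := by
      intro v hv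
      have hi : S⁻¹ ≠ 0 := inv_ne_zero hpos.ne'
      by_cases hvt : v ∈ t
      · have e : P v = N v := mul_left_cancel₀ hi ((k1 v hv).trans (k2 v hvt).symm)
        rcases le_total (d v) 0 with h | h
        · exact max_eq_right h
        · rw [e]; exact max_eq_right (by linarith)
      · have := k1 v hv
        rw [hw'] at this
        simp only [Finset.mem_inter, hvt, and_false, if_false] at this
        exact (mul_eq_zero.1 this).resolve_left hi
    exact hpos.ne' (Finset.sum_eq_zero this)

/-- The coordinate differences of two points form a vector d of sum zero that is nonnegative off t
and nonpositive off s, and ∑ d_v v = x - y. On the compact set of such vectors of norm 1 the length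
of ∑ d_v v is positive by `cone_pos`, hence bounded below; homogeneity gives the rest. The bound
expresses that two simplices of a complex meet at positive angles. -/
theorem exists_cone_bound {s t : Finset E} (hs : AffineIndependent ℝ ((↑) : s → E))
    (ht : AffineIndependent ℝ ((↑) : t → E))
    (hst : convexHull ℝ (s : Set E) ∩ convexHull ℝ t ⊆ convexHull ℝ (s ∩ t : Set E)) :
    ∃ c > 0, ∀ x ∈ convexHull ℝ (s : Set E), ∀ y ∈ convexHull ℝ (t : Set E), ∀ v : E,
      c * |baryFun s v x - baryFun t v y| ≤ ‖x - y‖ := by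
  classical
  set D : Set (↥(s ∪ t) → ℝ) := {d | ‖d‖ = 1 ∧ ∑ v, d v = 0 ∧
    (∀ v : ↥(s ∪ t), (v : E) ∉ t → 0 ≤ d v) ∧ ∀ v : ↥(s ∪ t), (v : E) ∉ s → d v ≤ 0} with hD
  have hDc : IsCompact D := by
    refine (isCompact_sphere (0 : ↥(s ∪ t) → ℝ) 1).of_isClosed_subset ?_ fun d hd => by
      simpa using hd.1
    have h3 : ∀ r : Finset E, IsClosed {d : ↥(s ∪ t) → ℝ | ∀ v : ↥(s ∪ t), (v : E) ∉ r → 0 ≤ d v} := by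
      intro r
      simp only [Set.ofPred_forall]
      exact isClosed_iInter fun v => isClosed_iInter fun _ =>
        isClosed_le continuous_const (continuous_apply v)
    have h4 : ∀ r : Finset E, IsClosed {d : ↥(s ∪ t) → ℝ | ∀ v : ↥(s ∪ t), (v : E) ∉ r → d v ≤ 0} := by
      intro r
      simp only [Set.ofPred_forall]
      exact isClosed_iInter fun v => isClosed_iInter fun _ =>
        isClosed_le (continuous_apply v) continuous_const
    have h2 : IsClosed {d : ↥(s ∪ t) → ℝ | ∑ v, d v = 0} :=
      isClosed_eq (by fun_prop) continuous_const
    have h1 : IsClosed {d : ↥(s ∪ t) → ℝ | ‖d‖ = 1} := isClosed_eq continuous_norm continuous_const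
    exact h1.inter (h2.inter ((h3 t).inter (h4 s)))
  have hf : Continuous fun d : ↥(s ∪ t) → ℝ => ‖∑ v, d v • (v : E)‖ := by fun_prop
  have hpos : ∀ d ∈ D, 0 < ‖∑ v, d v • (v : E)‖ := by
    rintro d ⟨hd1, hd2, hd3, hd4⟩
    rw [norm_pos_iff]
    intro hz
    set d' : E → ℝ := fun v => if h : v ∈ s ∪ t then d ⟨v, h⟩ else 0 with hd'
    have e : ∀ v : ↥(s ∪ t), d' v = d v := fun v => by
      simp only [hd']
      rw [dif_pos v.2]
    have := cone_pos hs ht hst (d := d') (by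
        rw [← Finset.sum_coe_sort]; simpa only [e] using hd2)
      (fun v hv => by
        have hv' := Finset.mem_sdiff.1 hv
        have := hd3 ⟨v, Finset.mem_union_left _ hv'.1⟩ hv'.2
        rwa [← e] at this)
      (fun v hv => by
        have hv' := Finset.mem_sdiff.1 hv
        have := hd4 ⟨v, Finset.mem_union_right _ hv'.1⟩ hv'.2
        rwa [← e] at this)
      (by rw [← Finset.sum_coe_sort]; simpa only [e] using hz)
    have hd0 : d = 0 := by
      funext v
      rw [← e, this v v.2]; rfl
    rw [hd0, norm_zero] at hd1
    exact zero_ne_one hd1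
  obtain ⟨c, hc, hcD⟩ : ∃ c > 0, ∀ d ∈ D, c ≤ ‖∑ v, d v • (v : E)‖ := by
    rcases D.eq_empty_or_nonempty with he | hne
    · exact ⟨1, one_pos, by simp [he]⟩
    · obtain ⟨d₀, hd₀, hmin⟩ := hDc.exists_isMinOn hne hf.continuousOn
      exact ⟨_, hpos d₀ hd₀, fun d hd => hmin hd⟩
  refine ⟨c, hc, fun x hx y hy v => ?_⟩
  by_cases hv : v ∈ s ∪ t
  swap
  · rw [Finset.mem_union, not_or] at hv
    rw [baryFun_of_notMem hv.1, baryFun_of_notMem hv.2]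
    simp
  obtain ⟨hx1, hx2⟩ := (mem_convexHull_iff_baryFun hs).1 hx
  obtain ⟨hy1, hy2⟩ := (mem_convexHull_iff_baryFun ht).1 hy
  set d : ↥(s ∪ t) → ℝ := fun v => baryFun s v x - baryFun t v y with hd
  have hle : |baryFun s v x - baryFun t v y| ≤ ‖d‖ := norm_le_pi_norm d ⟨v, hv⟩
  have exs : ∑ v ∈ s ∪ t, baryFun s v x = ∑ v ∈ s, baryFun s v x :=
    (Finset.sum_subset Finset.subset_union_left fun v _ h => by
      rw [baryFun_of_notMem h]; simp).symm
  have ext : ∑ v ∈ s ∪ t, baryFun t v y = ∑ v ∈ t, baryFun t v y :=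
    (Finset.sum_subset Finset.subset_union_right fun v _ h => by
      rw [baryFun_of_notMem h]; simp).symm
  have exs' : ∑ v ∈ s ∪ t, baryFun s v x • v = ∑ v ∈ s, baryFun s v x • v :=
    (Finset.sum_subset Finset.subset_union_left fun v _ h => by
      rw [baryFun_of_notMem h]; simp).symm
  have ext' : ∑ v ∈ s ∪ t, baryFun t v y • v = ∑ v ∈ t, baryFun t v y • v :=
    (Finset.sum_subset Finset.subset_union_right fun v _ h => by
      rw [baryFun_of_notMem h]; simp).symm
  have hsum : ∑ v, d v = 0 := by
    have := Finset.sum_coe_sort (s ∪ t) fun v => baryFun s v x - baryFun t v y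
    rw [hd, this, Finset.sum_sub_distrib]
    rw [exs, ext, sum_baryFun hs hx1, sum_baryFun ht hy1, sub_self]
  have hvec : ∑ v, d v • (v : E) = x - y := by
    have := Finset.sum_coe_sort (s ∪ t) fun v => (baryFun s v x - baryFun t v y) • v
    rw [hd, this]
    simp only [sub_smul, Finset.sum_sub_distrib]
    rw [exs', ext', sum_baryFun_smul hs hx1, sum_baryFun_smul ht hy1]
  rcases eq_or_ne d 0 with h0 | h0
  · rw [h0, norm_zero] at hle
    have : |baryFun s v x - baryFun t v y| = 0 := le_antisymm hle (abs_nonneg _)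
    rw [this, mul_zero]
    exact norm_nonneg _
  · have hn : 0 < ‖d‖ := norm_pos_iff.2 h0
    have hmem : ‖d‖⁻¹ • d ∈ D := by
      refine ⟨by rw [norm_smul, norm_inv, norm_norm, inv_mul_cancel₀ hn.ne'], ?_, ?_, ?_⟩
      · simp only [Pi.smul_apply, ← Finset.smul_sum, hsum, smul_zero]
      · intro v hv
        have hvs : (v : E) ∈ s := (Finset.mem_union.1 v.2).resolve_right hv
        simp only [Pi.smul_apply, hd, baryFun_of_notMem hv, smul_eq_mul]
        exact mul_nonneg (inv_nonneg.2 hn.le) (by simpa using hx2 v hvs)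
      · intro v hv
        have hvt : (v : E) ∈ t := (Finset.mem_union.1 v.2).resolve_left hv
        simp only [Pi.smul_apply, hd, baryFun_of_notMem hv, smul_eq_mul]
        exact mul_nonpos_of_nonneg_of_nonpos (inv_nonneg.2 hn.le) (by simpa using hy2 v hvt)
    have := hcD _ hmem
    simp only [Pi.smul_apply, smul_eq_mul, mul_smul, ← Finset.smul_sum, hvec] at this
    rw [norm_smul, norm_inv, norm_norm, inv_mul_eq_div, le_div_iff₀ hn] at this
    exact (mul_le_mul_of_nonneg_left hle hc.le).trans this

open Classical in
/-- The hat function of the vertex `v` of a simplicial complex. -/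
def hat (K : Geometry.SimplicialComplex ℝ E) (v x : E) : ℝ :=
  if h : ∃ s ∈ K.faces, x ∈ convexHull ℝ (s : Set E) then baryFun h.choose v x else 0

/-- The cone bound with x = y: two simplices that contain x assign the same coordinates to it. -/
theorem hat_eq {K : Geometry.SimplicialComplex ℝ E} {s : Finset E} (hs : s ∈ K.faces) {x : E}
    (hx : x ∈ convexHull ℝ (s : Set E)) (v : E) : hat K v x = baryFun s v x := by
  have h : ∃ s ∈ K.faces, x ∈ convexHull ℝ (s : Set E) := ⟨s, hs, hx⟩
  rw [hat, dif_pos h]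
  obtain ⟨h1, h2⟩ := h.choose_spec
  obtain ⟨c, hc, hb⟩ := exists_cone_bound (K.indep h1) (K.indep hs)
    (K.inter_subset_convexHull h1 hs)
  have := hb x h2 x hx v
  rw [sub_self, norm_zero] at this
  have h3 : |baryFun h.choose v x - baryFun s v x| ≤ 0 := by
    by_contra hcon
    exact absurd (mul_pos hc (not_le.1 hcon)) (not_lt.2 this)
  exact sub_eq_zero.1 (abs_eq_zero.1 (le_antisymm h3 (abs_nonneg _)))

theorem hat_mem_Icc {K : Geometry.SimplicialComplex ℝ E} {x : E} (hx : x ∈ K.space) (v : E) :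
    hat K v x ∈ Set.Icc (0 : ℝ) 1 := by
  obtain ⟨s, hs, hxs⟩ := Geometry.SimplicialComplex.mem_space_iff.1 hx
  rw [hat_eq hs hxs]
  exact baryFun_mem_Icc (K.indep hs) hxs v

theorem exists_cone_bound_finite (K : Geometry.SimplicialComplex ℝ E) (hK : K.faces.Finite) :
    ∃ c > 0, ∀ s ∈ K.faces, ∀ t ∈ K.faces, ∀ x ∈ convexHull ℝ (s : Set E),
      ∀ y ∈ convexHull ℝ (t : Set E), ∀ v : E,
      c * |baryFun s v x - baryFun t v y| ≤ ‖x - y‖ := by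
  have hfin : ∀ F : Set (Finset E × Finset E), F.Finite → F ⊆ K.faces ×ˢ K.faces →
      ∃ c > 0, ∀ p ∈ F, ∀ x ∈ convexHull ℝ (p.1 : Set E), ∀ y ∈ convexHull ℝ (p.2 : Set E),
        ∀ v : E, c * |baryFun p.1 v x - baryFun p.2 v y| ≤ ‖x - y‖ := by
    intro F hF
    induction F, hF using Set.Finite.induction_on with
    | empty => exact fun _ => ⟨1, one_pos, by simp⟩
    | @insert p F _ _ ih =>
      intro hsub
      obtain ⟨c, hc, h1⟩ := ih ((Set.subset_insert _ _).trans hsub)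
      obtain ⟨hp1, hp2⟩ := hsub (Set.mem_insert p F)
      obtain ⟨c', hc', h2⟩ := exists_cone_bound (K.indep hp1) (K.indep hp2)
        (K.inter_subset_convexHull hp1 hp2)
      refine ⟨min c c', lt_min hc hc', ?_⟩
      rintro q (rfl | hq) x hx y hy v
      · exact (mul_le_mul_of_nonneg_right (min_le_right _ _) (abs_nonneg _)).trans (h2 x hx y hy v)
      · exact (mul_le_mul_of_nonneg_right (min_le_left _ _) (abs_nonneg _)).trans
          (h1 q hq x hx y hy v)
  obtain ⟨c, hc, h⟩ := hfin _ (hK.prod hK) subset_rfl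
  exact ⟨c, hc, fun s hs t ht => h (s, t) ⟨hs, ht⟩⟩

/-- The cone bound for pairs of simplices is already a Lipschitz estimate for points of different
simplices, which a simplexwise estimate would not give on a nonconvex set. -/
theorem exists_hat_lipschitz (K : Geometry.SimplicialComplex ℝ E) (hK : K.faces.Finite) :
    ∃ C : ℝ, 0 ≤ C ∧ ∀ x ∈ K.space, ∀ y ∈ K.space, ∀ v, |hat K v x - hat K v y| ≤ C * ‖x - y‖ := by
  obtain ⟨c, hc, h⟩ := exists_cone_bound_finite K hK
  refine ⟨c⁻¹, inv_nonneg.2 hc.le, fun x hx y hy v => ?_⟩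
  obtain ⟨s, hs, hxs⟩ := Geometry.SimplicialComplex.mem_space_iff.1 hx
  obtain ⟨t, ht, hyt⟩ := Geometry.SimplicialComplex.mem_space_iff.1 hy
  rw [hat_eq hs hxs, hat_eq ht hyt, inv_mul_eq_div, le_div_iff₀ hc, mul_comm]
  exact h s hs t ht x hxs y hyt v

end Barycentric

/-! ### Flat simplices in tangential coordinates -/

theorem intrinsicInterior_eq_interior {E : Type*} [NormedAddCommGroup E] [NormedSpace ℝ E]
    {s : Set E} (hs : affineSpan ℝ s = ⊤) : intrinsicInterior ℝ s = interior s := by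
  refine subset_antisymm ?_ interior_subset_intrinsicInterior
  have ho : IsOpen ((affineSpan ℝ s : AffineSubspace ℝ E) : Set E) := by
    rw [hs]; exact isOpen_univ
  refine interior_maximal intrinsicInterior_subset ?_
  exact (ho.isOpenEmbedding_subtypeVal).isOpenMap _ isOpen_interior

/-- The segment from a relative interior point p to v stays in the relative interior for a while,
and two of its points in A determine the line through v. -/
theorem subset_of_intrinsicInterior_subset {E : Type*} [NormedAddCommGroup E] [NormedSpace ℝ E]
    [FiniteDimensional ℝ E] {s : Set E} (hs : Convex ℝ s) {A : AffineSubspace ℝ E}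
    (h : intrinsicInterior ℝ s ⊆ A) : s ⊆ A := by
  intro v hv
  obtain ⟨p, hp⟩ := Set.Nonempty.intrinsicInterior hs ⟨v, hv⟩
  have hpA := h hp
  obtain ⟨p', hp', rfl⟩ := mem_intrinsicInterior.1 hp
  have hv' := subset_affineSpan ℝ s hv
  set f : ℝ → affineSpan ℝ s := fun ε => ⟨AffineMap.lineMap (p' : E) v ε,
    AffineMap.lineMap_mem ε p'.2 hv'⟩ with hf
  have hfc : Continuous f := by
    refine Continuous.subtype_mk ?_ _
    exact AffineMap.lineMap_continuous
  have h0 : f 0 = p' := Subtype.ext (by simp [hf])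
  have hev : ∀ᶠ ε in 𝓝 (0 : ℝ), f ε ∈ interior ((↑) ⁻¹' s : Set (affineSpan ℝ s)) :=
    hfc.continuousAt.eventually_mem (isOpen_interior.mem_nhds (by rw [h0]; exact hp'))
  obtain ⟨ε, hε, hε0⟩ := ((hev.filter_mono nhdsWithin_le_nhds).and
    (self_mem_nhdsWithin : Set.Ioi (0 : ℝ) ∈ 𝓝[>] 0)).exists
  have hA : AffineMap.lineMap (p' : E) v ε ∈ A := h (mem_intrinsicInterior.2 ⟨_, hε, rfl⟩)
  have e : v = AffineMap.lineMap (p' : E) (AffineMap.lineMap (p' : E) v ε) ε⁻¹ := by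
    have : ε ≠ 0 := ne_of_gt hε0
    simp only [AffineMap.lineMap_apply_module']
    rw [add_sub_cancel_right, smul_smul, inv_mul_cancel₀ this, one_smul]
    abel
  rw [e]
  exact AffineMap.lineMap_mem _ hpA hA

section Chart

variable {n : ℕ}

/-- The range of a chart, as an affine subspace. -/
def chartRange (χ : Euc n →ᵃⁱ[ℝ] Euc (n + 1)) : AffineSubspace ℝ (Euc (n + 1)) :=
  (⊤ : AffineSubspace ℝ (Euc n)).map χ.toAffineMap

theorem coe_chartRange (χ : Euc n →ᵃⁱ[ℝ] Euc (n + 1)) :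
    (chartRange χ : Set (Euc (n + 1))) = Set.range χ := by
  rw [chartRange, AffineSubspace.coe_map, AffineSubspace.top_coe, Set.image_univ]
  rfl

theorem finrank_chartRange (χ : Euc n →ᵃⁱ[ℝ] Euc (n + 1)) :
    Module.finrank ℝ (chartRange χ).direction = n := by
  rw [chartRange, AffineSubspace.map_direction, AffineSubspace.direction_top, Submodule.map_top,
    LinearMap.finrank_range_of_inj, finrank_euclideanSpace_fin]
  rw [χ.linear_eq_linearIsometry]
  exact χ.linearIsometry.injective

theorem affineSpan_eq_chartRange {χ : Euc n →ᵃⁱ[ℝ] Euc (n + 1)} {A : AffineSubspace ℝ (Euc (n + 1))}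
    (hA : Module.finrank ℝ A.direction = n) (hne : (A : Set (Euc (n + 1))).Nonempty)
    (h : A ≤ chartRange χ) : A = chartRange χ := by
  refine AffineSubspace.eq_of_direction_eq_of_nonempty_of_le ?_ hne h
  exact Submodule.eq_of_le_of_finrank_eq (AffineSubspace.direction_le h)
    (by rw [hA, finrank_chartRange])

theorem isClosed_range_chart (χ : Euc n →ᵃⁱ[ℝ] Euc (n + 1)) : IsClosed (Set.range χ) :=
  χ.isometry.isClosedEmbedding.isClosed_range

theorem measurableEmbedding_chart (χ : Euc n →ᵃⁱ[ℝ] Euc (n + 1)) : MeasurableEmbedding χ :=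
  χ.isometry.isClosedEmbedding.measurableEmbedding

theorem restrict_image_chart (χ : Euc n →ᵃⁱ[ℝ] Euc (n + 1)) {B : Set (Euc (n + 1))}
    (hB : MeasurableSet B) (hBχ : B ⊆ Set.range χ) :
    (Measure.euclideanHausdorffMeasure n).restrict B = (volume.restrict (χ ⁻¹' B)).map χ := by
  rw [← (measurableEmbedding_chart χ).restrict_map, ← EuclideanSpace.euclideanHausdorffMeasure_eq_volume,
    χ.isometry.map_euclideanHausdorffMeasure, Measure.restrict_restrict hB,
    Set.inter_eq_left.2 hBχ]

/-- If the two faces lie in the same hyperplane, an open face that meets the closure of the other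
would meet the other itself. Otherwise the intersection lies in a proper affine subspace. -/
theorem volume_inter_closure_face {χ χ' : Euc n →ᵃⁱ[ℝ] Euc (n + 1)} {V V' : Set (Euc n)}
    (hV : IsOpen V) (hd : Disjoint (χ '' V) (χ' '' V')) :
    volume (V ∩ χ ⁻¹' closure (χ' '' V')) = 0 := by
  have hcl : closure (χ' '' V') ⊆ Set.range χ' :=
    closure_minimal (Set.image_subset_range _ _) (isClosed_range_chart χ')
  set A : AffineSubspace ℝ (Euc n) := (chartRange χ').comap χ.toAffineMap with hA
  by_cases hT : A = ⊤
  · have hle : chartRange χ ≤ chartRange χ' := by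
      rw [chartRange, AffineSubspace.map_le_iff_le_comap, ← hA, hT]
    have heq : chartRange χ = chartRange χ' :=
      affineSpan_eq_chartRange (finrank_chartRange χ) (by
        rw [coe_chartRange]; exact Set.range_nonempty _) hle
    have hr : Set.range χ = Set.range χ' := by rw [← coe_chartRange, ← coe_chartRange, heq]
    have : V ∩ χ ⁻¹' closure (χ' '' V') = ∅ := by
      rw [Set.eq_empty_iff_forall_notMem]
      rintro x ⟨hx, hxc⟩
      obtain ⟨ε, hε, hball⟩ := Metric.isOpen_iff.1 hV x hx
      obtain ⟨_, ⟨y, hy, rfl⟩, hxy⟩ := Metric.mem_closure_iff.1 hxc ε hε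
      obtain ⟨z, hz⟩ : χ' y ∈ Set.range χ := by rw [hr]; exact ⟨y, rfl⟩
      rw [← hz, χ.dist_map] at hxy
      refine Set.disjoint_left.1 hd ⟨z, hball ?_, hz⟩ ⟨y, hy, rfl⟩
      rwa [Metric.mem_ball, dist_comm]
    rw [this, measure_empty]
  · refine measure_mono_null ?_ (Measure.addHaar_affineSubspace volume A hT)
    rintro x ⟨-, hx⟩
    have : χ x ∈ (chartRange χ' : Set (Euc (n + 1))) := by
      rw [coe_chartRange]; exact hcl hx
    exact this

end Chart

namespace Partition.Triangulation

variable {n L M : ℕ} {G : Partition n L M} (T : G.Triangulation)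

theorem finite_elems : T.elems.Finite := T.finite.subset fun _ h => h.1

instance : Fintype T.elems := T.finite_elems.fintype

/-- The index of the face that contains an element. -/
def idx (t : T.elems) : Fin M := (T.respects t t.2.1 t.2.2).choose

/-- The chart of the face that contains an element. -/
def chart (t : T.elems) : Euc n →ᵃⁱ[ℝ] Euc (n + 1) := G.chart (T.idx t)

/-- The open element in tangential coordinates. -/
def pull (t : T.elems) : Set (Euc n) := T.chart t ⁻¹' openElem (t : Finset (Euc (n + 1)))

/-- The closed element in tangential coordinates. -/
def cpull (t : T.elems) : Set (Euc n) := T.chart t ⁻¹' closedElem (t : Finset (Euc (n + 1)))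

variable {T}

theorem openElem_subset_face (t : T.elems) : openElem (t : Finset _) ⊆ G.face (T.idx t) :=
  (T.respects t t.2.1 t.2.2).choose_spec

theorem indep (t : T.elems) :
    AffineIndependent ℝ ((↑) : ↥(t : Finset (Euc (n + 1))) → Euc (n + 1)) :=
  T.K.indep t.2.1

theorem nonempty (t : T.elems) : (t : Finset (Euc (n + 1))).Nonempty :=
  Finset.card_pos.1 (by rw [t.2.2]; exact Nat.succ_pos n)

theorem convex_closedElem (t : Finset (Euc (n + 1))) : Convex ℝ (closedElem t) :=
  convex_convexHull ℝ _

theorem isCompact_closedElem (t : Finset (Euc (n + 1))) : IsCompact (closedElem t) :=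
  t.finite_toSet.isCompact_convexHull (𝕜 := ℝ)

theorem openElem_subset_closedElem (t : Finset (Euc (n + 1))) : openElem t ⊆ closedElem t :=
  intrinsicInterior_subset

theorem closedElem_subset_range (t : T.elems) : closedElem (t : Finset _) ⊆ Set.range (T.chart t) := by
  rw [← coe_chartRange]
  refine subset_of_intrinsicInterior_subset (convex_closedElem _) ?_
  rw [coe_chartRange]
  exact (openElem_subset_face t).trans (Set.image_subset_range _ _)

theorem affineSpan_eq (t : T.elems) :
    affineSpan ℝ ((t : Finset (Euc (n + 1))) : Set (Euc (n + 1))) = chartRange (T.chart t) := by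
  refine affineSpan_eq_chartRange ?_ ?_ ?_
  · rw [direction_affineSpan]
    have := (indep t).finrank_vectorSpan (n := n) (by rw [Fintype.card_coe, t.2.2])
    have hr : Set.range ((↑) : ↥(t : Finset (Euc (n + 1))) → Euc (n + 1)) =
      ((t : Finset (Euc (n + 1))) : Set (Euc (n + 1))) := Subtype.range_coe
    exact hr ▸ this
  · exact (affineSpan_nonempty ℝ).2 (nonempty t)
  · rw [affineSpan_le, coe_chartRange]
    exact (subset_convexHull ℝ _).trans (closedElem_subset_range t)

theorem mem_affineSpan_chart (t : T.elems) (x : Euc n) :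
    T.chart t x ∈ affineSpan ℝ ((t : Finset (Euc (n + 1))) : Set (Euc (n + 1))) := by
  rw [affineSpan_eq t, ← SetLike.mem_coe, coe_chartRange]
  exact ⟨x, rfl⟩

theorem image_cpull (t : T.elems) : T.chart t '' T.cpull t = closedElem (t : Finset _) := by
  rw [cpull, Set.image_preimage_eq_iff]
  exact closedElem_subset_range t

theorem affineSpan_cpull (t : T.elems) : affineSpan ℝ (T.cpull t) = ⊤ := by
  rw [eq_top_iff]
  intro x _
  have h := mem_affineSpan_chart t x
  have e : affineSpan ℝ ((t : Finset (Euc (n + 1))) : Set (Euc (n + 1))) =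
      (affineSpan ℝ (T.cpull t)).map (T.chart t).toAffineMap := by
    rw [AffineSubspace.map_span]
    have : (T.chart t).toAffineMap '' T.cpull t = closedElem (t : Finset _) := image_cpull t
    rw [this, closedElem, affineSpan_convexHull]
  rw [e] at h
  obtain ⟨y, hy, hxy⟩ := h
  rwa [(T.chart t).injective hxy] at hy

theorem convex_cpull (t : T.elems) : Convex ℝ (T.cpull t) :=
  (convex_closedElem _).affine_preimage (T.chart t).toAffineMap

theorem isCompact_cpull (t : T.elems) : IsCompact (T.cpull t) :=
  (T.chart t).isometry.isClosedEmbedding.isCompact_preimage (isCompact_closedElem _)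

/-- The closed element affinely spans the range of its chart, so its relative interior is an
ordinary interior in ℝⁿ. -/
theorem interior_cpull (t : T.elems) : interior (T.cpull t) = T.pull t := by
  rw [← intrinsicInterior_eq_interior (affineSpan_cpull t), pull, openElem, ← image_cpull,
    AffineIsometry.intrinsicInterior_image, Set.preimage_image_eq _ (T.chart t).injective]

theorem isOpen_pull (t : T.elems) : IsOpen (T.pull t) := by
  rw [← interior_cpull]; exact isOpen_interior

theorem convex_pull (t : T.elems) : Convex ℝ (T.pull t) := by
  rw [← interior_cpull]; exact (convex_cpull t).interior

theorem pull_subset_cpull (t : T.elems) : T.pull t ⊆ T.cpull t := by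
  rw [← interior_cpull]; exact interior_subset

theorem isBounded_pull (t : T.elems) : Bornology.IsBounded (T.pull t) :=
  (isCompact_cpull t).isBounded.subset (pull_subset_cpull t)

theorem pull_nonempty (t : T.elems) : (T.pull t).Nonempty := by
  rw [← interior_cpull, (convex_cpull t).interior_nonempty_iff_affineSpan_eq_top]
  exact affineSpan_cpull t

theorem closure_pull (t : T.elems) : closure (T.pull t) = T.cpull t := by
  rw [← interior_cpull, (convex_cpull t).closure_interior_eq_closure_of_nonempty_interior
    (by rw [interior_cpull]; exact pull_nonempty t), (isCompact_cpull t).isClosed.closure_eq]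

theorem volume_cpull_diff_pull (t : T.elems) : volume (T.cpull t \ T.pull t) = 0 := by
  refine measure_mono_null ?_ ((convex_cpull t).addHaar_frontier volume)
  rw [frontier, ← interior_cpull]
  exact Set.sdiff_subset_sdiff_left subset_closure

theorem pull_subset_patch (t : T.elems) : T.pull t ⊆ G.patch (T.idx t) := by
  intro x hx
  obtain ⟨y, hy, hxy⟩ := openElem_subset_face t hx
  rwa [← (T.chart t).injective hxy]

theorem image_pull (t : T.elems) : T.chart t '' T.pull t = openElem (t : Finset _) := by
  rw [pull, Set.image_preimage_eq_iff]
  exact (openElem_subset_closedElem _).trans (closedElem_subset_range t)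

theorem measurableSet_openElem (t : T.elems) : MeasurableSet (openElem (t : Finset (Euc (n + 1)))) := by
  rw [← image_pull]
  exact (measurableEmbedding_chart _).measurableSet_image.2 (isOpen_pull t).measurableSet

/-- An affine function that is nonnegative on an element and not constant is positive inside. -/
theorem baryFun_pos (t : T.elems) {v : Euc (n + 1)} (hv : v ∈ (t : Finset (Euc (n + 1))))
    {x : Euc n} (hx : x ∈ T.pull t) : 0 < baryFun (t : Finset _) v (T.chart t x) := by
  obtain ⟨z, hz⟩ := closedElem_subset_range t (subset_convexHull ℝ _ hv)
  have hn : ∀ y ∈ T.cpull t, 0 ≤ baryFun (t : Finset _) v (T.chart t y) := fun y hy =>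
    ((mem_convexHull_iff_baryFun (indep t)).1 hy).2 v hv
  refine lt_of_le_of_ne (hn x (pull_subset_cpull t hx)) fun h0 => ?_
  have hc : Continuous fun ε : ℝ => AffineMap.lineMap x z ε := AffineMap.lineMap_continuous
  -- Small negative ε moves away from the vertex without leaving the element; a coordinate that
  -- vanished at x would become negative.
  have hev : ∀ᶠ ε in 𝓝 (0 : ℝ), AffineMap.lineMap x z ε ∈ T.pull t :=
    hc.continuousAt.eventually_mem ((isOpen_pull t).mem_nhds (by simpa using hx))
  obtain ⟨ε, hε, hε0⟩ := ((hev.filter_mono nhdsWithin_le_nhds).and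
    (self_mem_nhdsWithin : Set.Iio (0 : ℝ) ∈ 𝓝[<] 0)).exists
  have h1 := hn _ (pull_subset_cpull t hε)
  have h2 : T.chart t (AffineMap.lineMap x z ε) = AffineMap.lineMap (T.chart t x) (T.chart t z) ε :=
    (T.chart t).toAffineMap.apply_lineMap x z ε
  rw [h2, AffineMap.apply_lineMap, ← h0, hz, baryFun_vertex (indep t) hv hv, if_pos rfl,
    AffineMap.lineMap_apply_module'] at h1
  simp only [sub_zero, smul_eq_mul, mul_one, add_zero] at h1
  exact absurd hε0 (not_lt.2 h1)

/-- Some vertex v of t is not a vertex of t'. Its hat function is positive in the open element t and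
zero on t'. -/
theorem openElem_inter_closedElem {t t' : T.elems} (h : t ≠ t') :
    Disjoint (openElem (t : Finset (Euc (n + 1)))) (closedElem (t' : Finset (Euc (n + 1)))) := by
  rw [Set.disjoint_left]
  intro x hx hx'
  have hne : ¬ (t : Finset (Euc (n + 1))) ⊆ t' := fun hsub =>
    h (Subtype.ext (Finset.eq_of_subset_of_card_le hsub (by rw [t.2.2, t'.2.2])))
  obtain ⟨v, hv, hv'⟩ := Finset.not_subset.1 hne
  rw [← image_pull] at hx
  obtain ⟨y, hy, rfl⟩ := hx
  have h1 := baryFun_pos t hv hy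
  rw [← hat_eq t.2.1 (pull_subset_cpull t hy), hat_eq t'.2.1 hx', baryFun_of_notMem hv'] at h1
  simp at h1

theorem disjoint_openElem : Pairwise fun t t' : T.elems =>
    Disjoint (openElem (t : Finset (Euc (n + 1)))) (openElem (t' : Finset (Euc (n + 1)))) :=
  fun _ _ h => (openElem_inter_closedElem h).mono_right (openElem_subset_closedElem _)

theorem skeleton_subset {x : Euc (n + 1)} (hx : x ∈ G.skeleton) :
    ∃ t : T.elems, x ∈ closedElem (t : Finset (Euc (n + 1))) := by
  rw [← T.space_eq] at hx
  obtain ⟨s, hs, hxs⟩ := Geometry.SimplicialComplex.mem_space_iff.1 hx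
  obtain ⟨t, ht, hst, hc⟩ := T.pure s hs
  exact ⟨⟨t, ht, hc⟩, convexHull_mono (Finset.coe_subset.2 hst) hxs⟩

theorem closedElem_subset_skeleton (t : T.elems) :
    closedElem (t : Finset (Euc (n + 1))) ⊆ G.skeleton := by
  rw [← T.space_eq]
  exact Geometry.SimplicialComplex.convexHull_subset_space t.2.1

end Partition.Triangulation

/-! ### Surface integrals as sums over elements -/

namespace Partition

variable {n L M : ℕ} {G : Partition n L M}

theorem frontier_dom_subset (ℓ : Fin (L + 1)) : frontier (G.dom ℓ) ⊆ G.skeleton := by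
  rw [skeleton, G.skeleton_eq, dom, G.boundary_eq]
  exact Set.iUnion₂_subset fun i _ => Set.subset_iUnion (fun i => closure (G.chart i '' G.patch i)) i

theorem closure_face_subset {ℓ : Fin (L + 1)} {i : Fin M} (hi : i ∈ G.I ℓ) :
    closure (G.face i) ⊆ frontier (G.dom ℓ) := by
  rw [dom, G.boundary_eq]
  exact Set.subset_iUnion₂ (s := fun i _ => closure (G.chart i '' G.patch i)) i hi

theorem isCompact_skeleton : IsCompact G.skeleton := by
  refine isCompact_iUnion fun ℓ => ?_
  exact Metric.isCompact_of_isClosed_isBounded isClosed_frontier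
    ((G.lipschitz ℓ).2.2.1.closure.subset frontier_subset_closure)

namespace Triangulation

variable {T : G.Triangulation}

theorem closedElem_subset_frontier {ℓ : Fin (L + 1)} {t : T.elems} (ht : T.idx t ∈ G.I ℓ) :
    closedElem (t : Finset (Euc (n + 1))) ⊆ frontier (G.dom ℓ) := by
  refine subset_trans ?_ (closure_face_subset ht)
  rw [← image_cpull, ← closure_pull]
  refine (image_closure_subset_closure_image (T.chart t).continuous).trans (closure_mono ?_)
  rw [image_pull]
  exact openElem_subset_face t

theorem measure_closedElem_diff (t : T.elems) :
    Measure.euclideanHausdorffMeasure n (closedElem (t : Finset (Euc (n + 1))) \ openElem t) = 0 := by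
  rw [← image_cpull, ← image_pull, ← Set.image_sdiff (T.chart t).injective,
    (T.chart t).isometry.euclideanHausdorffMeasure_image,
    EuclideanSpace.euclideanHausdorffMeasure_eq_volume]
  exact volume_cpull_diff_pull t

/-- The boundary consists of closures of other faces, and each of these meets the face of t in a
null set. -/
theorem measure_openElem_inter_frontier {ℓ : Fin (L + 1)} {t : T.elems} (ht : T.idx t ∉ G.I ℓ) :
    Measure.euclideanHausdorffMeasure n (openElem (t : Finset (Euc (n + 1))) ∩ frontier (G.dom ℓ)) = 0 := by
  rw [dom, G.boundary_eq, Set.inter_iUnion₂]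
  refine (measure_biUnion_null_iff (G.I ℓ).countable_toSet).2 fun i hi => ?_
  have hne : T.idx t ≠ i := fun h => ht (h ▸ hi)
  refine measure_mono_null (t := T.chart t '' (G.patch (T.idx t) ∩
    T.chart t ⁻¹' closure (G.chart i '' G.patch i))) ?_ ?_
  · rw [Set.image_inter_preimage]
    exact Set.inter_subset_inter_left _ (openElem_subset_face t)
  · rw [(T.chart t).isometry.euclideanHausdorffMeasure_image,
      EuclideanSpace.euclideanHausdorffMeasure_eq_volume]
    exact volume_inter_closure_face (G.isOpen_patch _) (G.disjoint_face hne)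

variable (T) in
/-- The elements on `∂Ω_ℓ`. -/
def elemsOn (ℓ : Fin (L + 1)) : Finset T.elems := Finset.univ.filter fun t => T.idx t ∈ G.I ℓ

theorem mem_elemsOn {ℓ : Fin (L + 1)} {t : T.elems} : t ∈ T.elemsOn ℓ ↔ T.idx t ∈ G.I ℓ := by
  simp [elemsOn]

/-- Up to null sets the boundary is the disjoint union of the open elements in its faces, and the
charts, being isometries, carry Lebesgue measure to Hausdorff measure. All surface integrals are
computed in this way. -/
theorem surf_eq_sum (ℓ : Fin (L + 1)) :
    G.surf ℓ = ∑ t ∈ T.elemsOn ℓ, (volume.restrict (T.pull t)).map (T.chart t) := by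
  set μ : Measure (Euc (n + 1)) := Measure.euclideanHausdorffMeasure n with hμ
  have h1 : frontier (G.dom ℓ) =ᵐ[μ] ⋃ t ∈ T.elemsOn ℓ, openElem (t : Finset (Euc (n + 1))) := by
    rw [ae_eq_set]
    constructor
    · refine measure_mono_null (t := (⋃ t : T.elems, closedElem (t : Finset (Euc (n + 1))) \ openElem t) ∪
        ⋃ t : T.elems, ⋃ _ : T.idx t ∉ G.I ℓ, openElem (t : Finset (Euc (n + 1))) ∩
          frontier (G.dom ℓ)) ?_ ?_
      · rintro x ⟨hx, hx2⟩
        obtain ⟨t, ht⟩ := skeleton_subset (T := T) (frontier_dom_subset ℓ hx)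
        by_cases hxt : x ∈ openElem (t : Finset (Euc (n + 1)))
        · refine Or.inr (Set.mem_iUnion.2 ⟨t, Set.mem_iUnion.2 ⟨fun h => hx2 ?_, hxt, hx⟩⟩)
          exact Set.mem_iUnion₂.2 ⟨t, mem_elemsOn.2 h, hxt⟩
        · exact Or.inl (Set.mem_iUnion.2 ⟨t, ht, hxt⟩)
      · refine measure_union_null (measure_iUnion_null fun t => measure_closedElem_diff t)
          (measure_iUnion_null fun t => measure_iUnion_null fun h =>
            measure_openElem_inter_frontier h)
    · have : (⋃ t ∈ T.elemsOn ℓ, openElem (t : Finset (Euc (n + 1)))) \ frontier (G.dom ℓ) = ∅ := by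
        rw [Set.sdiff_eq_empty]
        exact Set.iUnion₂_subset fun t ht => (openElem_subset_closedElem _).trans
          (closedElem_subset_frontier (mem_elemsOn.1 ht))
      rw [this, measure_empty]
  rw [surf, Measure.restrict_congr_set h1, Measure.restrict_biUnion_finset
    (fun t _ t' _ h => disjoint_openElem h) (fun t => measurableSet_openElem t),
    Measure.sum_coe_finset (T.elemsOn ℓ) fun t => μ.restrict (openElem (t : Finset (Euc (n + 1))))]
  refine Finset.sum_congr rfl fun t _ => ?_
  exact restrict_image_chart (T.chart t) (measurableSet_openElem t)
    ((openElem_subset_closedElem _).trans (closedElem_subset_range t))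

theorem lintegral_surf (ℓ : Fin (L + 1)) (f : Euc (n + 1) → ℝ≥0∞) :
    ∫⁻ x, f x ∂G.surf ℓ = ∑ t ∈ T.elemsOn ℓ, ∫⁻ x in T.pull t, f (T.chart t x) := by
  rw [surf_eq_sum (T := T), lintegral_finsetSum_measure]
  exact Finset.sum_congr rfl fun t _ => (measurableEmbedding_chart _).lintegral_map _

theorem ae_pull_of_ae_surf {ℓ : Fin (L + 1)} {p : Euc (n + 1) → Prop} (h : ∀ᵐ x ∂G.surf ℓ, p x)
    {t : T.elems} (ht : t ∈ T.elemsOn ℓ) : ∀ᵐ x ∂volume.restrict (T.pull t), p (T.chart t x) := by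
  rw [surf_eq_sum (T := T), ae_finsetSum_measure_iff] at h
  exact (measurableEmbedding_chart _).ae_map_iff.1 (h t ht)

theorem ae_surf_of_ae_pull {ℓ : Fin (L + 1)} {p : Euc (n + 1) → Prop}
    (h : ∀ t ∈ T.elemsOn ℓ, ∀ᵐ x ∂volume.restrict (T.pull t), p (T.chart t x)) :
    ∀ᵐ x ∂G.surf ℓ, p x := by
  rw [surf_eq_sum (T := T), ae_finsetSum_measure_iff]
  exact fun t ht => (measurableEmbedding_chart _).ae_map_iff.2 (h t ht)

/-- The elements in one face cover it up to a null set. -/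
theorem lintegral_patch_le (i : Fin M) (f : Euc n → ℝ≥0∞) :
    ∫⁻ x in G.patch i, f x ≤ ∑ t with T.idx t = i, ∫⁻ x in T.pull t, f x := by
  set N : Set (Euc n) := ⋃ t : T.elems,
    G.chart i ⁻¹' (closedElem (t : Finset (Euc (n + 1))) \ openElem t) with hN
  have hN0 : volume N = 0 := by
    refine measure_iUnion_null fun t => ?_
    rw [← EuclideanSpace.euclideanHausdorffMeasure_eq_volume,
      (G.chart i).isometry.euclideanHausdorffMeasure_preimage]
    exact measure_mono_null Set.inter_subset_left (measure_closedElem_diff t)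
  have hsub : G.patch i ⊆ (⋃ t : {t : T.elems // T.idx t = i}, T.pull t) ∪ N := by
    intro x hx
    have hxf : G.chart i x ∈ G.face i := ⟨x, hx, rfl⟩
    have hxs : G.chart i x ∈ G.skeleton := by
      rw [skeleton, G.skeleton_eq]
      exact Set.mem_iUnion.2 ⟨i, subset_closure hxf⟩
    obtain ⟨t, ht⟩ := skeleton_subset (T := T) hxs
    by_cases hxt : G.chart i x ∈ openElem (t : Finset (Euc (n + 1)))
    · have hi : T.idx t = i := by
        by_contra hne
        exact Set.disjoint_left.1 (G.disjoint_face hne) (openElem_subset_face t hxt) hxf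
      refine Or.inl (Set.mem_iUnion.2 ⟨⟨t, hi⟩, ?_⟩)
      rw [pull, Set.mem_preimage, chart, hi]
      exact hxt
    · exact Or.inr (Set.mem_iUnion.2 ⟨t, ht, hxt⟩)
  have hle : (G.patch i : Set (Euc n)) ≤ᵐ[volume] ⋃ t : {t : T.elems // T.idx t = i}, T.pull t := by
    refine (LE.le.eventuallyLE hsub).trans ?_
    exact (union_ae_eq_left_of_ae_eq_empty (ae_eq_empty.2 hN0)).le
  calc _ ≤ ∫⁻ x in ⋃ t : {t : T.elems // T.idx t = i}, T.pull t, f x := lintegral_mono_set' hle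
    _ ≤ ∑' t : {t : T.elems // T.idx t = i}, ∫⁻ x in T.pull t, f x := lintegral_iUnion_le _ _
    _ = _ := by
      rw [tsum_fintype]
      exact (Finset.sum_subtype _ (fun t => by simp) fun t => ∫⁻ x in T.pull t, f x).symm

end Triangulation

end Partition

/-! ### The kernel of the Slobodeckij seminorm -/

section Kernel

variable {n : ℕ}

/-- The kernel `d⁻⁽ⁿ⁺¹⁾`. -/
def kern (n : ℕ) (d : ℝ) : ℝ≥0∞ := ENNReal.ofReal ((d ^ (n + 1))⁻¹)

/-- The kernel restricted to distances less than `h`. -/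
def kernNear (n : ℕ) (h d : ℝ) : ℝ≥0∞ := if d < h then kern n d else 0

/-- The kernel restricted to distances at least `h`. -/
def kernFar (n : ℕ) (h d : ℝ) : ℝ≥0∞ := if h ≤ d then kern n d else 0

theorem measurable_kern : Measurable (kern n) :=
  ENNReal.measurable_ofReal.comp (by fun_prop : Measurable fun d : ℝ => (d ^ (n + 1))⁻¹)

theorem measurable_kernNear (h : ℝ) : Measurable (kernNear n h) :=
  Measurable.ite measurableSet_Iio measurable_kern measurable_const

theorem measurable_kernFar (h : ℝ) : Measurable (kernFar n h) :=
  Measurable.ite measurableSet_Ici measurable_kern measurable_const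

theorem kern_eq_add (h d : ℝ) : kern n d = kernNear n h d + kernFar n h d := by
  unfold kernNear kernFar
  by_cases hd : d < h
  · simp [hd, not_le.2 hd]
  · simp [hd, not_lt.1 hd]

theorem kern_anti {d d' : ℝ} (h0 : 0 < d) (h : d ≤ d') : kern n d' ≤ kern n d := by
  refine ENNReal.ofReal_le_ofReal ?_
  gcongr

theorem kern_mul {a : ℝ} (ha : 0 ≤ a) (d : ℝ) :
    kern n (a * d) = ENNReal.ofReal ((a ^ (n + 1))⁻¹) * kern n d := by
  rw [kern, kern, ← ENNReal.ofReal_mul (by positivity), mul_pow, mul_inv]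

theorem lintegral_comp_inv_smul {f : Euc n → ℝ≥0∞} (hf : Measurable f) {a : ℝ} (ha : 0 < a) :
    ∫⁻ z, f (a⁻¹ • z) = ENNReal.ofReal (a ^ n) * ∫⁻ z, f z := by
  have hdet : LinearMap.det (a⁻¹ • (LinearMap.id : Euc n →ₗ[ℝ] Euc n)) = (a ^ n)⁻¹ := by
    rw [LinearMap.det_smul, LinearMap.det_id, finrank_euclideanSpace_fin, mul_one, inv_pow]
  have := lintegral_comp_linear_add hf (a⁻¹ • LinearMap.id) 0 (by
    rw [hdet]; positivity)
  rw [hdet, inv_inv, abs_of_pos (by positivity)] at this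
  simpa using this

/-- Scaling by a reduces to the integral of (1 + |z|)^{-(n+1)} over ℝⁿ, which is finite. -/
theorem exists_lintegral_kern_add (n : ℕ) : ∃ C : ℝ≥0∞, C ≠ ⊤ ∧ ∀ a : ℝ, 0 < a → ∀ p : Euc n,
    ∫⁻ y, kern n (a + ‖p - y‖) ≤ C * (ENNReal.ofReal a)⁻¹ := by
  have hm : Measurable fun z : Euc n => kern n (1 + ‖z‖) :=
    measurable_kern.comp (by fun_prop)
  refine ⟨∫⁻ z : Euc n, kern n (1 + ‖z‖), ?_, fun a ha p => le_of_eq ?_⟩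
  · have h := finite_integral_one_add_norm (E := Euc n) (μ := volume) (r := (n + 1 : ℕ))
      (by rw [finrank_euclideanSpace_fin]; push_cast; linarith)
    refine ne_of_lt (lt_of_le_of_lt (le_of_eq ?_) h)
    refine lintegral_congr fun z => ?_
    rw [kern, Real.rpow_neg (by positivity), Real.rpow_natCast]
  · rw [lintegral_sub_left_eq_self (fun z : Euc n => kern n (a + ‖z‖)) p]
    have e : ∀ z : Euc n, kern n (a + ‖z‖) =
        ENNReal.ofReal ((a ^ (n + 1))⁻¹) * kern n (1 + ‖a⁻¹ • z‖) := fun z => by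
      rw [← kern_mul ha.le, norm_smul, norm_inv, Real.norm_of_nonneg ha.le]
      congr 1
      field_simp
    simp only [e]
    rw [lintegral_const_mul' _ _ ENNReal.ofReal_ne_top, lintegral_comp_inv_smul hm ha, ← mul_assoc,
      ← ENNReal.ofReal_mul (by positivity), ← ENNReal.ofReal_inv_of_pos ha, mul_comm]
    congr 2
    field_simp
    ring

/-- Scaling by h reduces to h = 1, where the integrand |z|^{1-n} becomes constant in polar
coordinates. -/
theorem exists_lintegral_kernNear {n : ℕ} (hn : 1 ≤ n) : ∃ C : ℝ≥0∞, C ≠ ⊤ ∧ ∀ h : ℝ, 0 < h →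
    ∫⁻ z : Euc n, kernNear n h ‖z‖ * ‖z‖ₑ ^ 2 ≤ C * ENNReal.ofReal h := by
  have hm : Measurable fun z : Euc n => kernNear n 1 ‖z‖ * ‖z‖ₑ ^ 2 :=
    ((measurable_kernNear 1).comp measurable_norm).mul (by fun_prop)
  have : Nonempty (Fin n) := ⟨⟨0, hn⟩⟩
  refine ⟨∫⁻ z : Euc n, kernNear n 1 ‖z‖ * ‖z‖ₑ ^ 2, ?_, fun h hh => le_of_eq ?_⟩
  · set f : ℝ → ℝ := fun y => if y < 1 then (y ^ (n + 1))⁻¹ * y ^ 2 else 0 with hf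
    have hint : Integrable (fun z : Euc n => f ‖z‖) := by
      rw [integrable_fun_norm_addHaar]
      have : IntegrableOn ((Set.Ioo (0 : ℝ) 1).indicator fun _ => (1 : ℝ)) (Set.Ioi 0) :=
        (IntegrableOn.integrable_indicator (integrableOn_const (by simp)) measurableSet_Ioo).integrableOn
      refine this.congr_fun (fun y (hy : 0 < y) => ?_) measurableSet_Ioi
      by_cases h1 : y < 1
      · rw [Set.indicator_of_mem (Set.mem_Ioo.2 ⟨hy, h1⟩)]
        simp only [hf, if_pos h1, smul_eq_mul, finrank_euclideanSpace_fin]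
        obtain ⟨k, rfl⟩ : ∃ k, n = k + 1 := ⟨n - 1, by omega⟩
        rw [Nat.add_sub_cancel]
        field_simp
        ring
      · rw [Set.indicator_of_notMem (fun h => h1 h.2)]
        simp [hf, h1]
    have := hint.lintegral_lt_top
    refine ne_of_lt (lt_of_le_of_lt (le_of_eq ?_) this)
    refine lintegral_congr fun z => ?_
    simp only [hf, kernNear]
    split_ifs with h
    · rw [kern, enorm_sq_eq_ofReal, ← ENNReal.ofReal_mul (by positivity)]
    · simp
  · have e : ∀ z : Euc n, kernNear n h ‖z‖ * ‖z‖ₑ ^ 2 =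
        ENNReal.ofReal ((h ^ (n + 1))⁻¹ * h ^ 2) *
          (kernNear n 1 ‖h⁻¹ • z‖ * ‖h⁻¹ • z‖ₑ ^ 2) := fun z => by
      have h1 : ‖z‖ = h * ‖h⁻¹ • z‖ := by
        rw [norm_smul, norm_inv, Real.norm_of_nonneg hh.le, mul_inv_cancel_left₀ hh.ne']
      have h2 : ‖z‖ₑ ^ 2 = ENNReal.ofReal (h ^ 2) * ‖h⁻¹ • z‖ₑ ^ 2 := by
        rw [enorm_sq_eq_ofReal, enorm_sq_eq_ofReal, ← ENNReal.ofReal_mul (by positivity), ← mul_pow,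
          ← h1]
      have h3 : kernNear n h ‖z‖ = ENNReal.ofReal ((h ^ (n + 1))⁻¹) * kernNear n 1 ‖h⁻¹ • z‖ := by
        have : ‖z‖ < h ↔ ‖h⁻¹ • z‖ < 1 := by
          rw [norm_smul, norm_inv, Real.norm_of_nonneg hh.le, inv_mul_lt_iff₀ hh, mul_one]
        unfold kernNear
        simp only [this]
        split_ifs
        · rw [← kern_mul hh.le, ← h1]
        · rw [mul_zero]
      rw [h2, h3, ENNReal.ofReal_mul (by positivity)]
      ring
    simp only [e]
    rw [lintegral_const_mul' _ _ ENNReal.ofReal_ne_top, lintegral_comp_inv_smul hm hh, ← mul_assoc,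
      ← ENNReal.ofReal_mul (by positivity), mul_comm]
    congr 2
    field_simp
    ring

/-- Let χ p be the point of the plane nearest to X. Then |p - y| ≤ 2 |X - χ y|, so at distances of
at least h the sum h + |p - y| is at most four times the distance, and `exists_lintegral_kern_add`
applies with a = h. -/
theorem exists_lintegral_kernFar_chart (n : ℕ) : ∃ C : ℝ≥0∞, C ≠ ⊤ ∧
    ∀ (χ : Euc n →ᵃⁱ[ℝ] Euc (n + 1)) (X : Euc (n + 1)) (h : ℝ), 0 < h →
      ∫⁻ y, kernFar n h ‖X - χ y‖ ≤ C * (ENNReal.ofReal h)⁻¹ := by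
  obtain ⟨C, hC, hb⟩ := exists_lintegral_kern_add n
  refine ⟨ENNReal.ofReal (((4 : ℝ)⁻¹ ^ (n + 1))⁻¹) * C, ENNReal.mul_ne_top ENNReal.ofReal_ne_top hC,
    fun χ X h hh => ?_⟩
  obtain ⟨_, ⟨p, rfl⟩, hp⟩ := (isClosed_range_chart χ).exists_infDist_eq_dist
    (Set.range_nonempty χ) X
  have hle : ∀ y, ‖p - y‖ ≤ 2 * ‖X - χ y‖ := fun y => by
    have h1 : dist X (χ p) ≤ dist X (χ y) := hp ▸ Metric.infDist_le_dist_of_mem ⟨y, rfl⟩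
    have h2 : dist (χ p) (χ y) ≤ dist X (χ p) + dist X (χ y) := dist_triangle_left _ _ _
    rw [χ.dist_map, dist_eq_norm] at h2
    rw [← dist_eq_norm X]
    linarith
  calc ∫⁻ y, kernFar n h ‖X - χ y‖ ≤
        ∫⁻ y, ENNReal.ofReal (((4 : ℝ)⁻¹ ^ (n + 1))⁻¹) * kern n (h + ‖p - y‖) := by
        refine lintegral_mono fun y => ?_
        rw [← kern_mul (by norm_num)]
        unfold kernFar
        split_ifs with hd
        · exact kern_anti (by positivity) (by linarith [hle y, norm_nonneg (X - χ y)])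
        · exact zero_le
    _ ≤ _ := by
        rw [lintegral_const_mul' _ _ ENNReal.ofReal_ne_top, mul_assoc]
        gcongr
        exact hb h hh p

/-- Schur's test: the square of the difference is at most twice the sum of the squares, and the
kernel is integrated in the variable that does not occur. -/
theorem lintegral_mul_sub_sq_le {α β : Type*} [MeasurableSpace α] [MeasurableSpace β]
    {μ : Measure α} {ν : Measure β} [SFinite μ] [SFinite ν] {K : α → β → ℝ≥0∞}
    (hK : Measurable fun p : α × β => K p.1 p.2) {a : α → ℝ} {b : β → ℝ} (ha : Measurable a)
    (hb : Measurable b) {A : ℝ≥0∞} (h1 : ∀ x, ∫⁻ y, K x y ∂ν ≤ A) (h2 : ∀ y, ∫⁻ x, K x y ∂μ ≤ A) :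
    ∫⁻ x, ∫⁻ y, K x y * ‖a x - b y‖ₑ ^ 2 ∂ν ∂μ ≤
      2 * A * ((∫⁻ x, ‖a x‖ₑ ^ 2 ∂μ) + ∫⁻ y, ‖b y‖ₑ ^ 2 ∂ν) := by
  have ha2 : Measurable fun x => ‖a x‖ₑ ^ 2 := by fun_prop
  have hb2 : Measurable fun x => ‖b x‖ₑ ^ 2 := by fun_prop
  have hkx : ∀ x, Measurable fun y => K x y := fun x => hK.comp measurable_prodMk_left
  have hky : ∀ y, Measurable fun x => K x y := fun y => hK.comp measurable_prodMk_right
  calc _ ≤ ∫⁻ x, ∫⁻ y, (2 * (K x y * ‖a x‖ₑ ^ 2) + 2 * (K x y * ‖b y‖ₑ ^ 2)) ∂ν ∂μ := by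
        refine lintegral_mono fun x => lintegral_mono fun y => ?_
        refine (mul_le_mul_right (enorm_sub_sq_le (a x) (b y)) _).trans (le_of_eq ?_)
        ring
    _ = 2 * (∫⁻ x, (∫⁻ y, K x y ∂ν) * ‖a x‖ₑ ^ 2 ∂μ) +
        2 * ∫⁻ x, ∫⁻ y, K x y * ‖b y‖ₑ ^ 2 ∂ν ∂μ := by
        rw [← lintegral_const_mul' _ _ (by simp), ← lintegral_const_mul' _ _ (by simp),
          ← lintegral_add_left]
        · refine lintegral_congr fun x => ?_
          rw [lintegral_add_left (((hkx x).mul_const _).const_mul _),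
            lintegral_const_mul' _ _ (by simp), lintegral_const_mul' _ _ (by simp),
            lintegral_mul_const _ (hkx x)]
        · exact ((hK.lintegral_prod_right').mul ha2).const_mul _
    _ = 2 * (∫⁻ x, (∫⁻ y, K x y ∂ν) * ‖a x‖ₑ ^ 2 ∂μ) +
        2 * ∫⁻ y, (∫⁻ x, K x y ∂μ) * ‖b y‖ₑ ^ 2 ∂ν := by
        congr 2
        rw [lintegral_lintegral_swap]
        · exact lintegral_congr fun y => lintegral_mul_const _ (hky y)
        · exact (hK.mul (hb2.comp measurable_snd)).aemeasurable
    _ ≤ 2 * (∫⁻ x, A * ‖a x‖ₑ ^ 2 ∂μ) + 2 * ∫⁻ y, A * ‖b y‖ₑ ^ 2 ∂ν := by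
        gcongr with x y
        · exact h1 x
        · exact h2 y
    _ = _ := by
        rw [lintegral_const_mul _ ha2, lintegral_const_mul _ hb2]
        ring

theorem exists_far_pair_bound (n : ℕ) : ∃ C : ℝ≥0∞, C ≠ ⊤ ∧
    ∀ (χ χ' : Euc n →ᵃⁱ[ℝ] Euc (n + 1)) (h : ℝ), 0 < h → ∀ (U U' : Set (Euc n))
      (a b : Euc n → ℝ), Measurable a → Measurable b →
      ∫⁻ x in U, ∫⁻ y in U', kernFar n h ‖χ x - χ' y‖ * ‖a x - b y‖ₑ ^ 2 ≤
        C * (ENNReal.ofReal h)⁻¹ * ((∫⁻ x in U, ‖a x‖ₑ ^ 2) + ∫⁻ y in U', ‖b y‖ₑ ^ 2) := by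
  obtain ⟨C, hC, hb⟩ := exists_lintegral_kernFar_chart n
  refine ⟨2 * C, ENNReal.mul_ne_top (by simp) hC, fun χ χ' h hh U U' a b ha hbm => ?_⟩
  have hχ : Continuous χ := χ.continuous
  have hχ' : Continuous χ' := χ'.continuous
  have hc : Continuous fun p : Euc n × Euc n => ‖χ p.1 - χ' p.2‖ := by fun_prop
  have hk : Measurable fun p : Euc n × Euc n => kernFar n h ‖χ p.1 - χ' p.2‖ :=
    (measurable_kernFar h).comp hc.measurable
  have key := lintegral_mul_sub_sq_le (μ := volume.restrict U) (ν := volume.restrict U')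
    (K := fun x y => kernFar n h ‖χ x - χ' y‖) (A := C * (ENNReal.ofReal h)⁻¹) hk ha hbm
    (fun x => (setLIntegral_le_lintegral _ _).trans (hb χ' (χ x) h hh))
    (fun y => by
      refine (setLIntegral_le_lintegral _ _).trans ?_
      simp only [norm_sub_rev _ (χ' y)]
      exact hb χ (χ' y) h hh)
  rwa [← mul_assoc] at key

/-- Pairs of points of one element, close to each other. -/
theorem exists_near_same_bound {n : ℕ} (hn : 1 ≤ n) : ∃ C : ℝ≥0∞, C ≠ ⊤ ∧
    ∀ (h : ℝ), 0 < h → ∀ U : Set (Euc n), IsOpen U → Convex ℝ U → ∀ (u : Euc n → ℝ)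
      (G : Fin n → Euc n → ℝ), MemLp u 2 (volume.restrict U) →
      (∀ i, MemLp (G i) 2 (volume.restrict U)) → HasWeakGrad U u G →
      ∫⁻ x in U, ∫⁻ y in U, kernNear n h ‖y - x‖ * ‖u x - u y‖ₑ ^ 2 ≤
        C * ENNReal.ofReal h * ∑ i, ∫⁻ x in U, ‖G i x‖ₑ ^ 2 := by
  obtain ⟨C, hC, hb⟩ := exists_lintegral_kernNear hn
  refine ⟨2 * C, ENNReal.mul_ne_top (by simp) hC, fun h hh U hU hUc u G hu hG hw => ?_⟩
  refine (lintegral_kernel_sub_sq_le hU hUc hu hG hw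
    ((measurable_kernNear h).comp measurable_norm)).trans ?_
  rw [mul_assoc 2 C]
  gcongr
  exact hb h hh

/-- Pairs of elements of a surface that meet in one vertex at most. -/
theorem exists_near_vertex_bound : ∃ C : ℝ≥0∞, C ≠ ⊤ ∧
    ∀ (h : ℝ), 0 < h → ∀ (c : ℝ), 0 < c → ∀ (U U' : Set (Euc 2)) (δ : Euc 2 → Euc 2 → ℝ)
      (p p' : Euc 2), (∀ x ∈ U, ∀ y ∈ U', c * (‖x - p‖ + ‖y - p'‖) ≤ δ x y) →
      MeasurableSet U → MeasurableSet U' → p ∉ U →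
      ∫⁻ x in U, ∫⁻ y in U', kernNear 2 h (δ x y) ≤
        C * ENNReal.ofReal ((c ^ 4)⁻¹) * ENNReal.ofReal h := by
  obtain ⟨C₁, hC₁, hb₁⟩ := exists_lintegral_kern_add 2
  obtain ⟨C₂, hC₂, hb₂⟩ := exists_lintegral_kernNear (n := 2) (by norm_num)
  refine ⟨C₁ * C₂, ENNReal.mul_ne_top hC₁ hC₂, fun h hh c hc U U' δ p p' hδ hU hU' hp => ?_⟩
  -- The integral over y is of order |x - p|⁻¹, written as kernel times square, and it vanishes
  -- unless |x - p| < h / c. In the plane |x - p|⁻¹ has integral O(h / c) over that disc.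
  calc ∫⁻ x in U, ∫⁻ y in U', kernNear 2 h (δ x y) ≤
        ∫⁻ x in U, ENNReal.ofReal ((c ^ 3)⁻¹) * C₁ *
          (kernNear 2 (h / c) ‖x - p‖ * ‖x - p‖ₑ ^ 2) := by
        refine setLIntegral_mono' hU fun x hx => ?_
        have hxp : 0 < ‖x - p‖ := norm_pos_iff.2 (sub_ne_zero.2 fun h => hp (h ▸ hx))
        by_cases hxh : ‖x - p‖ < h / c
        · calc ∫⁻ y in U', kernNear 2 h (δ x y) ≤
                ∫⁻ y in U', ENNReal.ofReal ((c ^ 3)⁻¹) * kern 2 (‖x - p‖ + ‖p' - y‖) := by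
                refine setLIntegral_mono' hU' fun y hy => ?_
                rw [← kern_mul hc.le]
                unfold kernNear
                split_ifs
                · rw [norm_sub_rev p']
                  exact kern_anti (mul_pos hc (by positivity)) (hδ x hx y hy)
                · exact zero_le
            _ ≤ ENNReal.ofReal ((c ^ 3)⁻¹) * (C₁ * (ENNReal.ofReal ‖x - p‖)⁻¹) := by
                rw [lintegral_const_mul' _ _ ENNReal.ofReal_ne_top]
                gcongr
                exact (setLIntegral_le_lintegral _ _).trans (hb₁ _ hxp p')
            _ = _ := by
                rw [mul_assoc]
                congr 2
                rw [kernNear, if_pos hxh, kern, enorm_sq_eq_ofReal,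
                  ← ENNReal.ofReal_mul (by positivity), ← ENNReal.ofReal_inv_of_pos hxp]
                congr 1
                field_simp
        · rw [setLIntegral_congr_fun (g := fun _ => 0) hU' fun y hy => ?_]
          · simp
          · refine if_neg (not_lt.2 ?_)
            have := hδ x hx y hy
            rw [not_lt, div_le_iff₀ hc] at hxh
            nlinarith [norm_nonneg (y - p')]
    _ ≤ ENNReal.ofReal ((c ^ 3)⁻¹) * C₁ * (C₂ * ENNReal.ofReal (h / c)) := by
        rw [lintegral_const_mul' _ _ (ENNReal.mul_ne_top ENNReal.ofReal_ne_top hC₁)]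
        gcongr
        refine (setLIntegral_le_lintegral _ _).trans ?_
        rw [lintegral_sub_right_eq_self (fun z : Euc 2 => kernNear 2 (h / c) ‖z‖ * ‖z‖ₑ ^ 2) p]
        exact hb₂ _ (div_pos hh hc)
    _ = _ := by
        have : ENNReal.ofReal ((c ^ 4)⁻¹) * ENNReal.ofReal h =
            ENNReal.ofReal ((c ^ 3)⁻¹) * ENNReal.ofReal (h / c) := by
          rw [← ENNReal.ofReal_mul (by positivity), ← ENNReal.ofReal_mul (by positivity)]
          congr 1
          field_simp
        rw [mul_assoc (C₁ * C₂), this]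
        ring

end Kernel

/-! ### Hardy's inequality and pairs of elements with a common facet -/

section Facet

variable {n : ℕ}

/-- Hardy's inequality at a facet of a simplex. -/
theorem hardy_facet {U : Set (Euc n)} (hU : IsOpen U) (hUc : Convex ℝ U) {u : Euc n → ℝ}
    {G : Fin n → Euc n → ℝ} (hum : Measurable u) (hu : MemLp u 2 (volume.restrict U))
    (hG : ∀ i, MemLp (G i) 2 (volume.restrict U)) (hw : HasWeakGrad U u G)
    (lam : Euc n →ᵃ[ℝ] ℝ) {w : Euc n} (hlw : lam.linear w = 1) (hpos : ∀ x ∈ U, 0 < lam x)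
    (hpath : ∀ x ∈ U, ∀ θ ∈ Set.Ioc (0 : ℝ) 1, x - ((1 - θ) * lam x) • w ∈ U)
    (hlim : ∀ x ∈ U, Tendsto (fun θ : ℝ => u (x - ((1 - θ) * lam x) • w)) (𝓝[>] 0)
      (𝓝 (u (x - lam x • w)))) {ε : ℝ} (hε : 0 < ε) :
    ∫⁻ x in U ∩ {x | lam x < ε}, ENNReal.ofReal ((lam x)⁻¹) * ‖u x - u (x - lam x • w)‖ₑ ^ 2 ≤
      ENNReal.ofReal ε * ‖w‖ₑ ^ 2 * 4 * ∑ i, ∫⁻ x in U, ‖G i x‖ₑ ^ 2 := by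
  have hlc : Continuous lam := lam.continuous_of_finiteDimensional
  set V : Set (Euc n) := U ∩ {x | lam x < ε} with hV
  have hVm : MeasurableSet V := hU.measurableSet.inter (isOpen_lt hlc continuous_const).measurableSet
  set B : Euc n →ₗ[ℝ] Euc n := LinearMap.id - lam.linear.smulRight w with hB
  set b : Euc n := -(lam 0 • w) with hb
  have hlin : ∀ x, lam x = lam.linear x + lam 0 := fun x => by
    conv_lhs => rw [lam.decomp]
    rfl
  have hA : ∀ x, B x + b = x - lam x • w := fun x => by
    simp only [hB, hb, LinearMap.sub_apply, LinearMap.id_apply, LinearMap.smulRight_apply, hlin x,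
      add_smul]
    abel
  have hP : ∀ θ x, pathPt B b θ x = x - ((1 - θ) * lam x) • w := fun θ x => by
    rw [pathPt, hA, mul_smul]
    module
  -- The path map scales the direction w by t and fixes the directions parallel to the facet.
  have hdet : ∀ t, LinearMap.det (pathLin B t) = t := fun t => by
    have : pathLin B t = LinearMap.transvection lam.linear (-(1 - t) • w) := by
      ext1 x
      simp only [pathLin, hB, LinearMap.transvection.apply, LinearMap.add_apply, LinearMap.id_apply,
        LinearMap.smul_apply, LinearMap.sub_apply, LinearMap.smulRight_apply]
      module
    rw [this, LinearMap.transvection.det, map_smul, hlw]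
    simp
  have hmeas : ∀ θ : ℝ, Measurable fun x => ENNReal.ofReal ((lam x)⁻¹) *
      ‖u x - u (pathPt B b θ x)‖ₑ ^ 2 := fun θ => by
    have h1 : Measurable fun x => u (pathPt B b θ x) := hum.comp
      ((continuous_pathPt B b).comp (Continuous.prodMk_right θ)).measurable
    have h2 : Measurable fun x => (lam x)⁻¹ := hlc.measurable.inv
    exact h2.ennreal_ofReal.mul ((hum.sub h1).enorm.pow_const 2)
  -- On the facet itself, θ = 0, the path map is singular and u is determined only through
  -- continuity along the paths (`hlim`); it is approached through positive θ.
  set θ : ℕ → ℝ := fun k => ((k : ℝ) + 1)⁻¹ with hθ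
  have hθ0 : ∀ k, 0 < θ k := fun k => by positivity
  have hθ1 : ∀ k, θ k ≤ 1 := fun k => inv_le_one_of_one_le₀ (by linarith [(Nat.cast_nonneg k : (0:ℝ) ≤ k)])
  have hθt : Tendsto θ atTop (𝓝[>] 0) := by
    refine tendsto_nhdsWithin_iff.2 ⟨?_, Eventually.of_forall hθ0⟩
    exact tendsto_inv_atTop_zero.comp (tendsto_atTop_add_const_right _ _ tendsto_natCast_atTop_atTop)
  refine lintegral_le_of_tendsto (F := fun k x => ENNReal.ofReal ((lam x)⁻¹) *
    ‖u x - u (pathPt B b (θ k) x)‖ₑ ^ 2) (fun k => hmeas _) ?_ fun k => ?_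
  · refine (ae_restrict_iff' hVm).2 (Eventually.of_forall fun x hx => ?_)
    refine ENNReal.Tendsto.const_mul ?_ (Or.inr ENNReal.ofReal_ne_top)
    refine (ENNReal.continuous_pow 2).continuousAt.tendsto.comp ?_
    refine (continuous_enorm.tendsto _).comp ?_
    refine tendsto_const_nhds.sub ?_
    simp only [hP]
    exact (hlim x hx.1).comp hθt
  · refine weak_path_estimate hU hUc hu hG hw hVm Set.inter_subset_left B b (hθ0 k).le (hθ1 k)
      (k := 1) ?_ (by rw [pow_one]; exact hθ0 k) ?_ (hlc.measurable.inv) ?_ ?_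
    · intro t _
      rw [pow_one, hdet]
      exact le_abs_self t
    · intro x hx
      rw [hP]
      exact hpath x hx.1 _ ⟨hθ0 k, hθ1 k⟩
    · intro x hx
      have h0 := hpos x hx.1
      rw [hA, sub_sub_cancel, enorm_sq_eq_ofReal, enorm_sq_eq_ofReal,
        ← ENNReal.ofReal_mul (by simpa using h0.le), ← ENNReal.ofReal_mul hε.le]
      refine ENNReal.ofReal_le_ofReal ?_
      rw [norm_smul, mul_pow, Real.norm_of_nonneg h0.le, ← mul_assoc]
      refine mul_le_mul_of_nonneg_right ?_ (by positivity)
      rw [pow_two, Pi.inv_apply, inv_mul_cancel_left₀ h0.ne']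
      exact hx.2.le
    -- The weight √t against the Jacobian t⁻¹ leaves t^{-1/2}, whose integral is 2.
    · calc _ ≤ 2 * ∫⁻ t in Set.Ioc (0 : ℝ) 1, ENNReal.ofReal (t ^ (-(1 / 2) : ℝ)) := by
            gcongr 2 * ?_
            refine (lintegral_mono_set (Set.Ioc_subset_Ioc_left (hθ0 k).le)).trans ?_
            refine setLIntegral_mono' measurableSet_Ioc fun t ht => ?_
            rw [← ENNReal.ofReal_mul (Real.sqrt_nonneg _)]
            refine ENNReal.ofReal_le_ofReal (le_of_eq ?_)
            rw [Real.rpow_neg ht.1.le, ← Real.sqrt_eq_rpow, pow_one]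
            have := Real.sqrt_pos.2 ht.1
            field_simp
            rw [Real.sq_sqrt ht.1.le, div_self ht.1.ne']
        _ = 4 := by rw [lintegral_rpow_neg_half]; norm_num

theorem setLIntegral_comp_le {U U' : Set (Euc n)} (hU : MeasurableSet U) (hU' : MeasurableSet U')
    {B : Euc n →ₗ[ℝ] Euc n} {b : Euc n} (hB : LinearMap.det B ≠ 0)
    (hΞ : ∀ y ∈ U', B y + b ∈ U) {f : Euc n → ℝ≥0∞} (hf : Measurable f) :
    ∫⁻ y in U', f (B y + b) ≤ ENNReal.ofReal |(LinearMap.det B)⁻¹| * ∫⁻ y in U, f y := by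
  calc ∫⁻ y in U', f (B y + b) ≤ ∫⁻ y in U', U.indicator f (B y + b) := by
        refine setLIntegral_mono' hU' fun y hy => ?_
        rw [Set.indicator_of_mem (hΞ y hy)]
    _ ≤ ∫⁻ y, U.indicator f (B y + b) := setLIntegral_le_lintegral _ _
    _ = _ := by rw [lintegral_comp_linear_add (hf.indicator hU) B b hB, lintegral_indicator hU]

/-- Pairs of elements that share a facet. -/
theorem exists_facet_pair_bound {n : ℕ} (hn : 1 ≤ n) {c : ℝ} (hc : 0 < c)
    {B : Euc n →ₗ[ℝ] Euc n} (b₀ : Euc n) (hB : LinearMap.det B ≠ 0) :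
    ∃ C : ℝ≥0∞, C ≠ ⊤ ∧ ∀ (U U' : Set (Euc n)), IsOpen U → Convex ℝ U → IsOpen U' →
      (∀ y ∈ U', B y + b₀ ∈ U) → ∀ (δ : Euc n → Euc n → ℝ) (lam : Euc n → ℝ), Continuous lam →
      (∀ x ∈ U, 0 < lam x) →
      (∀ x ∈ U, ∀ y ∈ U', c * (lam (B y + b₀) + ‖(B y + b₀) - x‖) ≤ δ x y) →
      ∀ (a ta b tb : Euc n → ℝ), Measurable a → Measurable ta → Measurable b → Measurable tb →
      (∀ y ∈ U', ta (B y + b₀) = tb y) → ∀ (G : Fin n → Euc n → ℝ),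
      MemLp a 2 (volume.restrict U) → (∀ i, MemLp (G i) 2 (volume.restrict U)) →
      HasWeakGrad U a G → ∀ h : ℝ, 0 < h →
      ∫⁻ x in U, ∫⁻ y in U', kernNear n h (δ x y) * ‖a x - b y‖ₑ ^ 2 ≤
        C * (ENNReal.ofReal h * (∑ i, ∫⁻ x in U, ‖G i x‖ₑ ^ 2) +
          (∫⁻ x in U ∩ {x | lam x < h / c}, ENNReal.ofReal ((lam x)⁻¹) * ‖a x - ta x‖ₑ ^ 2) +
          ∫⁻ y in U' ∩ {y | lam (B y + b₀) < h / c},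
            ENNReal.ofReal ((lam (B y + b₀))⁻¹) * ‖b y - tb y‖ₑ ^ 2) := by
  obtain ⟨C₁, hC₁, hb₁⟩ := exists_near_same_bound hn
  obtain ⟨C₂, hC₂, hb₂⟩ := exists_lintegral_kern_add n
  set k : ℝ≥0∞ := ENNReal.ofReal ((c ^ (n + 1))⁻¹) with hk
  have hkt : k ≠ ⊤ := ENNReal.ofReal_ne_top
  set d : ℝ≥0∞ := ENNReal.ofReal |(LinearMap.det B)⁻¹| with hd
  have hdt : d ≠ ⊤ := ENNReal.ofReal_ne_top
  set D₁ : ℝ≥0∞ := 3 * k * d * (C₁ * ENNReal.ofReal c⁻¹)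
  set D₂ : ℝ≥0∞ := 3 * k * C₂ * d
  set D₃ : ℝ≥0∞ := 3 * k * C₂
  refine ⟨D₁ + D₂ + D₃, ?_, ?_⟩
  · simp only [D₁, D₂, D₃]
    finiteness
  intro U U' hU hUc hU' hΞ δ lam hlam hpos hδ a ta b tb ha hta hb htb hab G hua hG hw h hh
  have hUm := hU.measurableSet
  have hUm' := hU'.measurableSet
  have hBc : Continuous fun y => B y + b₀ :=
    (LinearMap.continuous_of_finiteDimensional B).add continuous_const
  set Ξ : Euc n → Euc n := fun y => B y + b₀ with hΞd
  have hhc : 0 < h / c := div_pos hh hc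
  set ga : Euc n → ℝ≥0∞ := fun y => {y | lam y < h / c}.indicator
    (fun y => ‖a y - ta y‖ₑ ^ 2) y with hga
  set gb : Euc n → ℝ≥0∞ := fun y => {y | lam (Ξ y) < h / c}.indicator
    (fun y => ‖b y - tb y‖ₑ ^ 2) y with hgb
  have hset : MeasurableSet {y | lam y < h / c} := (isOpen_lt hlam continuous_const).measurableSet
  have hset' : MeasurableSet {y | lam (Ξ y) < h / c} :=
    (isOpen_lt (hlam.comp hBc) continuous_const).measurableSet
  have hgam : Measurable ga := Measurable.indicator (by fun_prop) hset
  have hgbm : Measurable gb := Measurable.indicator (by fun_prop) hset'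
  set g : Euc n → ℝ≥0∞ := fun y => ga (Ξ y) + gb y with hg
  have hgm : Measurable g := (hgam.comp hBc.measurable).add hgbm
  -- Let Ξ y be the point of U matched with y. The difference a(x) - b(y) passes through a(Ξ y) and
  -- through the common value ta(Ξ y) = tb(y) on the facet: P bounds the step inside U, Q the two
  -- steps to the facet.
  set P : Euc n → Euc n → ℝ≥0∞ := fun x y =>
    3 * k * (kernNear n (h / c) ‖Ξ y - x‖ * ‖a x - a (Ξ y)‖ₑ ^ 2) with hP
  set Q : Euc n → Euc n → ℝ≥0∞ := fun x y => 3 * k * (kern n (lam (Ξ y) + ‖Ξ y - x‖) * g y) with hQ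
  have hPm : Measurable fun p : Euc n × Euc n => P p.1 p.2 := by
    have h1 : Measurable fun p : Euc n × Euc n => kernNear n (h / c) ‖Ξ p.2 - p.1‖ :=
      (measurable_kernNear _).comp (by fun_prop : Continuous fun p : Euc n × Euc n =>
        ‖Ξ p.2 - p.1‖).measurable
    have h2 : Measurable fun p : Euc n × Euc n => a (Ξ p.2) :=
      ha.comp (hBc.measurable.comp measurable_snd)
    fun_prop
  have hQm : Measurable fun p : Euc n × Euc n => Q p.1 p.2 := by
    have h1 : Measurable fun p : Euc n × Euc n => kern n (lam (Ξ p.2) + ‖Ξ p.2 - p.1‖) :=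
      measurable_kern.comp (by fun_prop : Continuous fun p : Euc n × Euc n =>
        lam (Ξ p.2) + ‖Ξ p.2 - p.1‖).measurable
    exact (h1.mul (hgm.comp measurable_snd)).const_mul _
  have hpt : ∀ x ∈ U, ∀ y ∈ U', kernNear n h (δ x y) * ‖a x - b y‖ₑ ^ 2 ≤ P x y + Q x y := by
    intro x hx y hy
    by_cases hlt : δ x y < h
    swap
    · rw [kernNear, if_neg hlt, zero_mul]; exact zero_le
    have hle := hδ x hx y hy
    have hl0 : 0 < lam (Ξ y) := hpos _ (hΞ y hy)
    have hl1 : lam (Ξ y) < h / c := by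
      rw [lt_div_iff₀ hc]
      nlinarith [norm_nonneg (Ξ y - x)]
    have hl2 : ‖Ξ y - x‖ < h / c := by
      rw [lt_div_iff₀ hc]
      have : c * lam (Ξ y) > 0 := mul_pos hc hl0
      have e : c * (lam (Ξ y) + ‖Ξ y - x‖) ≤ δ x y := hle
      nlinarith
    have e : a x - b y = (a x - a (Ξ y)) + (a (Ξ y) - ta (Ξ y)) + (tb y - b y) := by
      rw [hab y hy]; ring
    have hkk : kern n (δ x y) ≤ k * kern n (lam (Ξ y) + ‖Ξ y - x‖) := by
      rw [hk, ← kern_mul hc.le]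
      exact kern_anti (mul_pos hc (by positivity)) hle
    have hk1 : kern n (δ x y) * ‖a x - a (Ξ y)‖ₑ ^ 2 ≤
        k * (kernNear n (h / c) ‖Ξ y - x‖ * ‖a x - a (Ξ y)‖ₑ ^ 2) := by
      by_cases hz : Ξ y = x
      · rw [hz]; simp
      · rw [← mul_assoc]
        refine mul_le_mul_left ?_ _
        rw [kernNear, if_pos hl2, hk, ← kern_mul hc.le]
        refine kern_anti (mul_pos hc (norm_pos_iff.2 (sub_ne_zero.2 hz))) (le_trans ?_ hle)
        exact mul_le_mul_of_nonneg_left (le_add_of_nonneg_left hl0.le) hc.le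
    have hgy : g y = ‖a (Ξ y) - ta (Ξ y)‖ₑ ^ 2 + ‖tb y - b y‖ₑ ^ 2 := by
      simp only [hg, hga, hgb]
      rw [Set.indicator_of_mem (show Ξ y ∈ {y | lam y < h / c} from hl1),
        Set.indicator_of_mem (show y ∈ {y | lam (Ξ y) < h / c} from hl1), ← enorm_neg (b y - tb y),
        neg_sub]
    rw [kernNear, if_pos hlt, e]
    calc _ ≤ kern n (δ x y) * (3 * (‖a x - a (Ξ y)‖ₑ ^ 2 + ‖a (Ξ y) - ta (Ξ y)‖ₑ ^ 2 +
          ‖tb y - b y‖ₑ ^ 2)) := mul_le_mul_right (enorm_add_three_sq_le _ _ _) _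
      _ = 3 * (kern n (δ x y) * ‖a x - a (Ξ y)‖ₑ ^ 2) + 3 * (kern n (δ x y) * g y) := by
          rw [hgy]; ring
      _ ≤ 3 * (k * (kernNear n (h / c) ‖Ξ y - x‖ * ‖a x - a (Ξ y)‖ₑ ^ 2)) +
          3 * (k * kern n (lam (Ξ y) + ‖Ξ y - x‖) * g y) :=
          add_le_add (mul_le_mul_right hk1 _) (mul_le_mul_right (mul_le_mul_left hkk _) _)
      _ = _ := by simp only [hP, hQ]; ring
  have hI1 : ∫⁻ x in U, ∫⁻ y in U', P x y ≤
      D₁ * (ENNReal.ofReal h * ∑ i, ∫⁻ x in U, ‖G i x‖ₑ ^ 2) := by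
    calc ∫⁻ x in U, ∫⁻ y in U', P x y ≤
          ∫⁻ x in U, 3 * k * d * ∫⁻ y in U, kernNear n (h / c) ‖y - x‖ * ‖a x - a y‖ₑ ^ 2 := by
          refine lintegral_mono fun x => ?_
          simp only [hP]
          rw [lintegral_const_mul' _ _ (by finiteness), mul_assoc (3 * k)]
          refine mul_le_mul_right ?_ _
          have hfm : Measurable fun y : Euc n => kernNear n (h / c) ‖y - x‖ * ‖a x - a y‖ₑ ^ 2 := by
            have := (measurable_kernNear (n := n) (h / c)).comp
              (by fun_prop : Continuous fun y : Euc n => ‖y - x‖).measurable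
            exact this.mul (by fun_prop)
          exact setLIntegral_comp_le hUm hUm' hB hΞ hfm
      _ ≤ 3 * k * d * (C₁ * ENNReal.ofReal (h / c) * ∑ i, ∫⁻ x in U, ‖G i x‖ₑ ^ 2) := by
          rw [lintegral_const_mul' _ _ (by finiteness)]
          exact mul_le_mul_right (hb₁ _ hhc U hU hUc a G hua hG hw) _
      _ = _ := by
          rw [div_eq_mul_inv, ENNReal.ofReal_mul hh.le]
          simp only [D₁]
          ring
  have hI2 : ∫⁻ x in U, ∫⁻ y in U', Q x y ≤
      D₂ * (∫⁻ x in U ∩ {x | lam x < h / c}, ENNReal.ofReal ((lam x)⁻¹) * ‖a x - ta x‖ₑ ^ 2) +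
      D₃ * ∫⁻ y in U' ∩ {y | lam (Ξ y) < h / c},
        ENNReal.ofReal ((lam (Ξ y))⁻¹) * ‖b y - tb y‖ₑ ^ 2 := by
    have hlm : Measurable fun y => ENNReal.ofReal ((lam y)⁻¹) :=
      ENNReal.measurable_ofReal.comp hlam.measurable.inv
    -- Integrating over x first turns the kernel into lam(Ξ y)⁻¹, which is the weight in Hardy's
    -- inequality.
    rw [lintegral_lintegral_swap hQm.aemeasurable]
    calc ∫⁻ y in U', ∫⁻ x in U, Q x y ≤
          ∫⁻ y in U', 3 * k * C₂ * (ENNReal.ofReal ((lam (Ξ y))⁻¹) * ga (Ξ y) +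
            ENNReal.ofReal ((lam (Ξ y))⁻¹) * gb y) := by
          refine setLIntegral_mono' hUm' fun y hy => ?_
          have hl0 : 0 < lam (Ξ y) := hpos _ (hΞ y hy)
          have hkm : Measurable fun x => kern n (lam (Ξ y) + ‖Ξ y - x‖) :=
            measurable_kern.comp (by fun_prop)
          simp only [hQ]
          rw [lintegral_const_mul' _ _ (by finiteness), lintegral_mul_const _ hkm, ← mul_add,
            mul_assoc (3 * k)]
          change _ ≤ 3 * k * (C₂ * (ENNReal.ofReal ((lam (Ξ y))⁻¹) * g y))
          refine mul_le_mul_right ?_ _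
          rw [← mul_assoc, ENNReal.ofReal_inv_of_pos hl0]
          exact mul_le_mul_left ((setLIntegral_le_lintegral _ _).trans (hb₂ _ hl0 _)) _
      _ = 3 * k * C₂ * (∫⁻ y in U', ENNReal.ofReal ((lam (Ξ y))⁻¹) * ga (Ξ y)) +
            3 * k * C₂ * ∫⁻ y in U', ENNReal.ofReal ((lam (Ξ y))⁻¹) * gb y := by
          have hm1 : Measurable fun y => ENNReal.ofReal ((lam (Ξ y))⁻¹) * ga (Ξ y) :=
            (hlm.comp hBc.measurable).mul (hgam.comp hBc.measurable)
          rw [lintegral_const_mul' _ _ (by finiteness), lintegral_add_left hm1, mul_add]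
      _ ≤ 3 * k * C₂ * (d * ∫⁻ y in U, ENNReal.ofReal ((lam y)⁻¹) * ga y) +
            3 * k * C₂ * ∫⁻ y in U', ENNReal.ofReal ((lam (Ξ y))⁻¹) * gb y := by
          gcongr
          exact setLIntegral_comp_le (f := fun y => ENNReal.ofReal ((lam y)⁻¹) * ga y)
            hUm hUm' hB hΞ (hlm.mul hgam)
      _ = _ := by
          have e1 : ∫⁻ y in U, ENNReal.ofReal ((lam y)⁻¹) * ga y =
              ∫⁻ x in U ∩ {x | lam x < h / c}, ENNReal.ofReal ((lam x)⁻¹) * ‖a x - ta x‖ₑ ^ 2 := by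
            rw [Set.inter_comm, ← Measure.restrict_restrict hset, ← lintegral_indicator hset]
            refine lintegral_congr fun y => ?_
            simp only [hga, Set.indicator_apply]
            split_ifs <;> simp
          have e2 : ∫⁻ y in U', ENNReal.ofReal ((lam (Ξ y))⁻¹) * gb y =
              ∫⁻ y in U' ∩ {y | lam (Ξ y) < h / c},
                ENNReal.ofReal ((lam (Ξ y))⁻¹) * ‖b y - tb y‖ₑ ^ 2 := by
            rw [Set.inter_comm, ← Measure.restrict_restrict hset', ← lintegral_indicator hset']
            refine lintegral_congr fun y => ?_
            simp only [hgb, Set.indicator_apply]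
            split_ifs <;> simp
          rw [e1, e2]
          simp only [D₂, D₃]
          ring
  calc _ ≤ ∫⁻ x in U, ∫⁻ y in U', (P x y + Q x y) :=
        setLIntegral_mono' hUm fun x hx => setLIntegral_mono' hUm' fun y hy => hpt x hx y hy
    _ = (∫⁻ x in U, ∫⁻ y in U', P x y) + ∫⁻ x in U, ∫⁻ y in U', Q x y := by
        rw [← lintegral_add_left hPm.lintegral_prod_right']
        refine lintegral_congr fun x => ?_
        exact lintegral_add_left (hPm.comp measurable_prodMk_left) _
    _ ≤ _ := by
        refine (add_le_add hI1 hI2).trans ?_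
        rw [← add_assoc, mul_add, mul_add]
        gcongr
        · rw [add_assoc]; exact le_self_add
        · rw [add_right_comm]; exact le_add_self
        · exact le_add_self

end Facet

theorem affineMap_sum_smul' {E F ι : Type*} [NormedAddCommGroup E] [NormedSpace ℝ E]
    [NormedAddCommGroup F] [NormedSpace ℝ F] (f : E →ᵃ[ℝ] F) {s : Finset ι} {w : ι → ℝ}
    (hw : ∑ i ∈ s, w i = 1) (p : ι → E) : f (∑ i ∈ s, w i • p i) = ∑ i ∈ s, w i • f (p i) := by
  have h : ∀ x, f x = f.linear x + f 0 := fun x => by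
    conv_lhs => rw [f.decomp]
    rfl
  rw [h, map_sum]
  simp only [map_smul]
  calc _ = ∑ i ∈ s, w i • f.linear (p i) + (∑ i ∈ s, w i) • f 0 := by rw [hw, one_smul]
    _ = _ := by
      rw [Finset.sum_smul, ← Finset.sum_add_distrib]
      refine Finset.sum_congr rfl fun i _ => ?_
      rw [h (p i), smul_add]

/-! ### Barycentric coordinates of elements and the data of the seminorm estimate -/

namespace Partition.Triangulation

variable {n L M : ℕ} {G : Partition n L M} {T : G.Triangulation}

variable (T) in
/-- Barycentric coordinates of an element in tangential coordinates. -/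
def lam (t : T.elems) (v : Euc (n + 1)) : Euc n →ᵃ[ℝ] ℝ :=
  (baryFun (t : Finset (Euc (n + 1))) v).comp (T.chart t).toAffineMap

theorem lam_apply (t : T.elems) (v : Euc (n + 1)) (x : Euc n) :
    T.lam t v x = baryFun (t : Finset (Euc (n + 1))) v (T.chart t x) := rfl

theorem mem_cpull_iff {t : T.elems} {x : Euc n} :
    x ∈ T.cpull t ↔ ∀ v ∈ (t : Finset (Euc (n + 1))), 0 ≤ T.lam t v x :=
  (mem_convexHull_iff_baryFun (indep t)).trans
    ⟨fun h => h.2, fun h => ⟨mem_affineSpan_chart t x, h⟩⟩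

theorem mem_pull_iff {t : T.elems} {x : Euc n} :
    x ∈ T.pull t ↔ ∀ v ∈ (t : Finset (Euc (n + 1))), 0 < T.lam t v x := by
  constructor
  · exact fun hx v hv => baryFun_pos t hv hx
  · intro hx
    rw [← interior_cpull, mem_interior]
    refine ⟨⋂ v ∈ (t : Finset (Euc (n + 1))), {x | 0 < T.lam t v x}, ?_, ?_, ?_⟩
    · intro y hy
      rw [mem_cpull_iff]
      exact fun v hv => (Set.mem_iInter₂.1 hy v hv).le
    · exact isOpen_biInter_finset fun v _ =>
        isOpen_lt continuous_const (T.lam t v).continuous_of_finiteDimensional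
    · exact Set.mem_iInter₂.2 hx

theorem sum_lam (t : T.elems) (x : Euc n) :
    ∑ v ∈ (t : Finset (Euc (n + 1))), T.lam t v x = 1 :=
  sum_baryFun (indep t) (mem_affineSpan_chart t x)

theorem sum_lam_smul (t : T.elems) (x : Euc n) :
    ∑ v ∈ (t : Finset (Euc (n + 1))), T.lam t v x • v = T.chart t x :=
  sum_baryFun_smul (indep t) (mem_affineSpan_chart t x)

open Classical in
variable (T) in
/-- The vertices in tangential coordinates. -/
def vert (t : T.elems) (v : Euc (n + 1)) : Euc n :=
  if h : ∃ z, T.chart t z = v then h.choose else 0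

theorem chart_vert {t : T.elems} {v : Euc (n + 1)} (hv : v ∈ (t : Finset (Euc (n + 1)))) :
    T.chart t (T.vert t v) = v := by
  have h : ∃ z, T.chart t z = v := closedElem_subset_range t (subset_convexHull ℝ _ hv)
  rw [vert, dif_pos h]
  exact h.choose_spec

open Classical in
theorem lam_vert {t : T.elems} {v u : Euc (n + 1)} (hv : v ∈ (t : Finset (Euc (n + 1))))
    (hu : u ∈ (t : Finset (Euc (n + 1)))) : T.lam t v (T.vert t u) = if v = u then 1 else 0 := by
  rw [lam_apply, chart_vert hu, baryFun_vertex (indep t) hv hu]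
  split_ifs <;> rfl

theorem lam_sub_smul (t : T.elems) (v : Euc (n + 1)) (x : Euc n) (r : ℝ) (p q : Euc n) :
    T.lam t v (x - r • (p - q)) = T.lam t v x - r * (T.lam t v p - T.lam t v q) := by
  have h : ∀ x, T.lam t v x = (T.lam t v).linear x + T.lam t v 0 := fun x => by
    conv_lhs => rw [(T.lam t v).decomp]
    rfl
  rw [h, h x, h p, h q, map_sub, map_smul, map_sub, smul_eq_mul]
  ring

theorem chart_sub_smul (t : T.elems) (x : Euc n) (r : ℝ) (p q : Euc n) :
    T.chart t (x - r • (p - q)) = T.chart t x - r • (T.chart t p - T.chart t q) := by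
  have h : ∀ x, T.chart t x = (T.chart t).toAffineMap.linear x + T.chart t 0 := fun x =>
    congrFun ((T.chart t).toAffineMap.decomp) x
  rw [h, h x, h p, h q, map_sub, map_smul, map_sub]
  module

theorem norm_chart_sub (t : T.elems) (x y : Euc n) : ‖T.chart t x - T.chart t y‖ = ‖x - y‖ := by
  rw [← dist_eq_norm, (T.chart t).dist_map, dist_eq_norm]

theorem continuous_lam (t : T.elems) (v : Euc (n + 1)) : Continuous (T.lam t v) :=
  (T.lam t v).continuous_of_finiteDimensional

/-- The shift moves the amount r from the coordinate of a to the coordinate of c and leaves the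
others unchanged. -/
theorem move_mem_cpull {t : T.elems} {a c : Euc (n + 1)} (ha : a ∈ (t : Finset (Euc (n + 1))))
    (hc : c ∈ (t : Finset (Euc (n + 1)))) (hac : a ≠ c) {x : Euc n} (hx : x ∈ T.pull t) {r : ℝ}
    (hr : 0 ≤ r) :
    (r ≤ T.lam t a x → x - r • (T.vert t a - T.vert t c) ∈ T.cpull t) ∧
    (r < T.lam t a x → x - r • (T.vert t a - T.vert t c) ∈ T.pull t) := by
  classical
  have hp := mem_pull_iff.1 hx
  rw [mem_cpull_iff, mem_pull_iff]
  refine ⟨fun h v hv => ?_, fun h v hv => ?_⟩ <;>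
  · rw [lam_sub_smul, lam_vert hv ha, lam_vert hv hc]
    have := hp v hv
    by_cases h1 : v = a
    · subst h1
      rw [if_pos rfl, if_neg hac]
      linarith
    · rw [if_neg h1]
      split_ifs <;> linarith

/-- The data of the interpolation estimate for the Slobodeckij seminorm: a continuous function on
the skeleton, with weak gradients on the elements. -/
structure IsPiecewiseSobolev (T : G.Triangulation) (ℓ : Fin (L + 1)) (v : Euc (n + 1) → ℝ) (S : ℝ)
    (Gr : T.elems → Fin n → Euc n → ℝ) : Prop where
  meas : Measurable v
  cont : ContinuousOn v G.skeleton
  bound : ∀ᵐ x ∂G.surf ℓ, |v x| ≤ S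
  memLp : ∀ t ∈ T.elemsOn ℓ, MemLp (fun x => v (T.chart t x)) 2 (volume.restrict (T.pull t))
  memLp_grad : ∀ t ∈ T.elemsOn ℓ, ∀ i, MemLp (Gr t i) 2 (volume.restrict (T.pull t))
  weakGrad : ∀ t ∈ T.elemsOn ℓ, HasWeakGrad (T.pull t) (fun x => v (T.chart t x)) (Gr t)

/-- The right-hand side of the interpolation estimate. -/
def interpBound (T : G.Triangulation) (ℓ : Fin (L + 1)) (h : ℝ) (v : Euc (n + 1) → ℝ) (S : ℝ)
    (Gr : T.elems → Fin n → Euc n → ℝ) : ℝ≥0∞ :=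
  (ENNReal.ofReal h)⁻¹ * (∫⁻ x, ‖v x‖ₑ ^ 2 ∂G.surf ℓ) +
    ENNReal.ofReal h * (∑ t ∈ T.elemsOn ℓ, ∑ i, ∫⁻ x in T.pull t, ‖Gr t i x‖ₑ ^ 2) +
    ENNReal.ofReal (h ^ (n - 1) * S ^ 2)

section Pairs

variable {ℓ : Fin (L + 1)} {v : Euc (n + 1) → ℝ} {S : ℝ} {Gr : T.elems → Fin n → Euc n → ℝ}

theorem lintegral_pull_le {t : T.elems} (ht : t ∈ T.elemsOn ℓ) (f : Euc (n + 1) → ℝ≥0∞) :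
    ∫⁻ x in T.pull t, f (T.chart t x) ≤ ∫⁻ x, f x ∂G.surf ℓ := by
  rw [lintegral_surf (T := T)]
  exact Finset.single_le_sum (f := fun t => ∫⁻ x in T.pull t, f (T.chart t x))
    (fun _ _ => zero_le) ht

theorem mul_grad_le {t : T.elems} (ht : t ∈ T.elemsOn ℓ) (h : ℝ) :
    ENNReal.ofReal h * (∑ i, ∫⁻ x in T.pull t, ‖Gr t i x‖ₑ ^ 2) ≤ interpBound T ℓ h v S Gr := by
  refine le_trans (mul_le_mul_right ?_ _) (le_add_self.trans le_self_add)
  exact Finset.single_le_sum (f := fun t => ∑ i, ∫⁻ x in T.pull t, ‖Gr t i x‖ₑ ^ 2)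
    (fun _ _ => zero_le) ht

theorem inv_mul_le {t : T.elems} (ht : t ∈ T.elemsOn ℓ) (h : ℝ) :
    (ENNReal.ofReal h)⁻¹ * (∫⁻ x in T.pull t, ‖v (T.chart t x)‖ₑ ^ 2) ≤
      interpBound T ℓ h v S Gr :=
  le_trans (mul_le_mul_right (lintegral_pull_le ht fun x => ‖v x‖ₑ ^ 2) _)
    (le_self_add.trans le_self_add)

theorem measurable_comp_chart (hv : Measurable v) (t : T.elems) :
    Measurable fun x => v (T.chart t x) := hv.comp (T.chart t).continuous.measurable

variable (T ℓ) in
theorem exists_far_bound : ∃ C : ℝ≥0∞, C ≠ ⊤ ∧ ∀ s ∈ T.elemsOn ℓ, ∀ t ∈ T.elemsOn ℓ,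
    ∀ h : ℝ, 0 < h → ∀ v S Gr, IsPiecewiseSobolev T ℓ v S Gr →
    ∫⁻ x in T.pull s, ∫⁻ y in T.pull t, kernFar n h ‖T.chart s x - T.chart t y‖ *
      ‖v (T.chart s x) - v (T.chart t y)‖ₑ ^ 2 ≤ C * interpBound T ℓ h v S Gr := by
  obtain ⟨C, hC, hb⟩ := exists_far_pair_bound n
  refine ⟨2 * C, ENNReal.mul_ne_top (by simp) hC, fun s hs t ht h hh v S Gr hv => ?_⟩
  refine (hb (T.chart s) (T.chart t) h hh (T.pull s) (T.pull t) _ _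
    (measurable_comp_chart hv.meas s) (measurable_comp_chart hv.meas t)).trans ?_
  rw [mul_assoc, mul_add]
  refine (mul_le_mul_right (add_le_add (inv_mul_le (S := S) (Gr := Gr) hs h)
    (inv_mul_le (S := S) (Gr := Gr) ht h)) _).trans (le_of_eq ?_)
  ring

-- All pairs have distance at least c, so the whole kernel is the far kernel with threshold c. The
-- factor 1/c is exchanged for (D/c)/h, and for this h has to be bounded.
variable (ℓ) in
theorem exists_disjoint_bound {s t : T.elems} {c : ℝ} (hc : 0 < c)
    (hst : ∀ x ∈ T.pull s, ∀ y ∈ T.pull t, c ≤ ‖T.chart s x - T.chart t y‖) (D : ℝ) :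
    ∃ C : ℝ≥0∞, C ≠ ⊤ ∧ (s ∈ T.elemsOn ℓ → t ∈ T.elemsOn ℓ → ∀ h : ℝ, 0 < h → h ≤ D →
      ∀ v S Gr, IsPiecewiseSobolev T ℓ v S Gr →
      ∫⁻ x in T.pull s, ∫⁻ y in T.pull t, kern n ‖T.chart s x - T.chart t y‖ *
        ‖v (T.chart s x) - v (T.chart t y)‖ₑ ^ 2 ≤ C * interpBound T ℓ h v S Gr) := by
  obtain ⟨C, hC, hb⟩ := exists_far_pair_bound n
  refine ⟨2 * C * ENNReal.ofReal (D / c), by finiteness, fun hs ht h hh hD v S Gr hv => ?_⟩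
  calc _ = ∫⁻ x in T.pull s, ∫⁻ y in T.pull t, kernFar n c ‖T.chart s x - T.chart t y‖ *
        ‖v (T.chart s x) - v (T.chart t y)‖ₑ ^ 2 := by
        refine setLIntegral_congr_fun (isOpen_pull s).measurableSet fun x hx =>
          setLIntegral_congr_fun (isOpen_pull t).measurableSet fun y hy => ?_
        simp only [kernFar, if_pos (hst x hx y hy)]
    _ ≤ C * (ENNReal.ofReal c)⁻¹ * ((∫⁻ x in T.pull s, ‖v (T.chart s x)‖ₑ ^ 2) +
          ∫⁻ x in T.pull t, ‖v (T.chart t x)‖ₑ ^ 2) :=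
        hb (T.chart s) (T.chart t) c hc (T.pull s) (T.pull t) _ _
          (measurable_comp_chart hv.meas s) (measurable_comp_chart hv.meas t)
    _ ≤ C * (ENNReal.ofReal (D / c) * (ENNReal.ofReal h)⁻¹) *
          ((∫⁻ x in T.pull s, ‖v (T.chart s x)‖ₑ ^ 2) +
          ∫⁻ x in T.pull t, ‖v (T.chart t x)‖ₑ ^ 2) := by
        gcongr
        rw [← ENNReal.ofReal_inv_of_pos hc, ← ENNReal.ofReal_inv_of_pos hh,
          ← ENNReal.ofReal_mul (by have := hh.le.trans hD; positivity)]
        refine ENNReal.ofReal_le_ofReal ?_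
        rw [div_mul_eq_mul_div, le_div_iff₀ hc, inv_mul_cancel₀ hc.ne', ← div_eq_mul_inv,
          le_div_iff₀ hh, one_mul]
        exact hD
    _ = C * ENNReal.ofReal (D / c) * ((ENNReal.ofReal h)⁻¹ *
          (∫⁻ x in T.pull s, ‖v (T.chart s x)‖ₑ ^ 2) + (ENNReal.ofReal h)⁻¹ *
          ∫⁻ x in T.pull t, ‖v (T.chart t x)‖ₑ ^ 2) := by ring
    _ ≤ C * ENNReal.ofReal (D / c) * (interpBound T ℓ h v S Gr + interpBound T ℓ h v S Gr) := by
        gcongr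
        · exact inv_mul_le hs h
        · exact inv_mul_le ht h
    _ = _ := by ring

variable (T ℓ) in
theorem exists_same_bound (hn : 1 ≤ n) : ∃ C : ℝ≥0∞, C ≠ ⊤ ∧ ∀ s ∈ T.elemsOn ℓ,
    ∀ h : ℝ, 0 < h → ∀ v S Gr, IsPiecewiseSobolev T ℓ v S Gr →
    ∫⁻ x in T.pull s, ∫⁻ y in T.pull s, kernNear n h ‖T.chart s x - T.chart s y‖ *
      ‖v (T.chart s x) - v (T.chart s y)‖ₑ ^ 2 ≤ C * interpBound T ℓ h v S Gr := by
  obtain ⟨C, hC, hb⟩ := exists_near_same_bound hn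
  refine ⟨C, hC, fun s hs h hh v S Gr hv => ?_⟩
  simp only [norm_chart_sub]
  have := hb h hh (T.pull s) (isOpen_pull s) (convex_pull s) _ (Gr s) (hv.memLp s hs)
    (hv.memLp_grad s hs) (hv.weakGrad s hs)
  simp only [norm_sub_rev _ (_ : Euc n)] at this ⊢
  refine le_trans ?_ (this.trans ?_)
  · refine le_of_eq (lintegral_congr fun x => lintegral_congr fun y => ?_)
    rw [norm_sub_rev]
  · rw [mul_assoc]
    exact mul_le_mul_right (mul_grad_le hs h) _

/-- `hardy_facet` at the facet opposite to a, along paths parallel to the edge from a to c. Their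
ends lie in the closed element, where v is continuous. -/
theorem hardy_elem {t : T.elems} (ht : t ∈ T.elemsOn ℓ) {a c : Euc (n + 1)}
    (ha : a ∈ (t : Finset (Euc (n + 1)))) (hc : c ∈ (t : Finset (Euc (n + 1)))) (hac : a ≠ c)
    (hv : IsPiecewiseSobolev T ℓ v S Gr) {ε : ℝ} (hε : 0 < ε) :
    ∫⁻ x in T.pull t ∩ {x | T.lam t a x < ε}, ENNReal.ofReal ((T.lam t a x)⁻¹) *
      ‖v (T.chart t x) - v (T.chart t (x - T.lam t a x • (T.vert t a - T.vert t c)))‖ₑ ^ 2 ≤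
      ENNReal.ofReal ε * ‖T.vert t a - T.vert t c‖ₑ ^ 2 * 4 *
        ∑ i, ∫⁻ x in T.pull t, ‖Gr t i x‖ₑ ^ 2 := by
  classical
  have hvc : ContinuousOn (fun x => v (T.chart t x)) (T.cpull t) :=
    hv.cont.comp (T.chart t).continuous.continuousOn fun x hx =>
      closedElem_subset_skeleton t hx
  refine hardy_facet (isOpen_pull t) (convex_pull t) (measurable_comp_chart hv.meas t)
    (hv.memLp t ht) (hv.memLp_grad t ht) (hv.weakGrad t ht) (T.lam t a) ?_ ?_ ?_ ?_ hε
  · have := (T.lam t a).linearMap_vsub (T.vert t a) (T.vert t c)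
    rw [vsub_eq_sub, vsub_eq_sub] at this
    rw [this, lam_vert ha ha, lam_vert ha hc, if_pos rfl, if_neg hac, sub_zero]
  · exact fun x hx => mem_pull_iff.1 hx a ha
  · intro x hx θ hθ
    have h0 := mem_pull_iff.1 hx a ha
    refine (move_mem_cpull ha hc hac hx (mul_nonneg (by linarith [hθ.2]) h0.le)).2 ?_
    nlinarith [hθ.1]
  · intro x hx
    have h0 := mem_pull_iff.1 hx a ha
    have hend : x - T.lam t a x • (T.vert t a - T.vert t c) ∈ T.cpull t :=
      (move_mem_cpull ha hc hac hx h0.le).1 le_rfl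
    refine (hvc _ hend).tendsto.comp ?_
    refine tendsto_nhdsWithin_iff.2 ⟨?_, ?_⟩
    · have hcont : Continuous fun θ : ℝ =>
        x - ((1 - θ) * T.lam t a x) • (T.vert t a - T.vert t c) := by fun_prop
      have := (hcont.tendsto 0).mono_left (nhdsWithin_le_nhds (s := Set.Ioi (0 : ℝ)))
      simpa using this
    · filter_upwards [Ioc_mem_nhdsGT (zero_lt_one (α := ℝ))] with θ hθ
      refine (move_mem_cpull ha hc hac hx (mul_nonneg (by linarith [hθ.2]) h0.le)).1 ?_
      nlinarith [hθ.1]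

end Pairs

end Partition.Triangulation

/-! ### Pairs of elements by mutual position -/

namespace Partition.Triangulation

variable {n L M : ℕ} {G : Partition n L M} {T : G.Triangulation}

theorem exists_cone (T : G.Triangulation) : ∃ c > 0, ∀ s t : T.elems, ∀ x ∈ T.cpull s,
    ∀ y ∈ T.cpull t, ∀ v, c * |T.lam s v x - T.lam t v y| ≤ ‖T.chart s x - T.chart t y‖ := by
  obtain ⟨c, hc, h⟩ := exists_cone_bound_finite T.K T.finite
  exact ⟨c, hc, fun s t x hx y hy v => h s s.2.1 t t.2.1 _ hx _ hy v⟩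

theorem lam_of_notMem {t : T.elems} {v : Euc (n + 1)} (hv : v ∉ (t : Finset (Euc (n + 1))))
    (x : Euc n) : T.lam t v x = 0 := by
  rw [lam_apply, baryFun_of_notMem hv]
  rfl

/-- The coordinates of x belong to vertices at which the coordinates of y vanish, so each is bounded
by the distance over c; the n + 1 of them add up to 1. -/
theorem exists_dist_of_disjoint {s t : T.elems}
    (hst : Disjoint (s : Finset (Euc (n + 1))) t) : ∃ c > 0, ∀ x ∈ T.pull s, ∀ y ∈ T.pull t,
      c ≤ ‖T.chart s x - T.chart t y‖ := by
  obtain ⟨c, hc, h⟩ := T.exists_cone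
  refine ⟨c / (n + 1), by positivity, fun x hx y hy => ?_⟩
  have h1 : ∀ v ∈ (s : Finset (Euc (n + 1))), c * T.lam s v x ≤ ‖T.chart s x - T.chart t y‖ := by
    intro v hv
    have := h s t x (pull_subset_cpull s hx) y (pull_subset_cpull t hy) v
    rw [lam_of_notMem (Finset.disjoint_left.1 hst hv), sub_zero] at this
    exact (mul_le_mul_of_nonneg_left (le_abs_self _) hc.le).trans this
  have h2 := Finset.sum_le_sum h1
  rw [← Finset.mul_sum, sum_lam, mul_one, Finset.sum_const, s.2.2, nsmul_eq_mul] at h2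
  rw [div_le_iff₀ (by positivity)]
  push_cast at h2
  linarith

/-- Only the coordinate of p can be shared, so the cone bound controls all other coordinates of x,
and x - p = ∑ λ_v (v - p) does not involve that of p. -/
theorem exists_dist_of_vertex {s t : T.elems} {p : Euc (n + 1)} (hps : p ∈ (s : Finset (Euc (n + 1))))
    (hst : ∀ v ∈ (s : Finset (Euc (n + 1))), v ∈ (t : Finset (Euc (n + 1))) → v = p) :
    ∃ c > 0, ∀ x ∈ T.pull s, ∀ y ∈ T.pull t,
      c * ‖x - T.vert s p‖ ≤ ‖T.chart s x - T.chart t y‖ := by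
  obtain ⟨c, hc, h⟩ := T.exists_cone
  set R : ℝ := ∑ v ∈ (s : Finset (Euc (n + 1))), ‖v - p‖ with hR
  have hR0 : 0 ≤ R := Finset.sum_nonneg fun _ _ => norm_nonneg _
  refine ⟨c / (1 + R), by positivity, fun x hx y hy => ?_⟩
  have e : T.chart s x - p = ∑ v ∈ (s : Finset (Euc (n + 1))), T.lam s v x • (v - p) := by
    simp only [smul_sub, Finset.sum_sub_distrib]
    rw [sum_lam_smul, ← Finset.sum_smul, sum_lam, one_smul]
  have h1 : c * ‖x - T.vert s p‖ ≤ ‖T.chart s x - T.chart t y‖ * R := by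
    rw [← norm_chart_sub s, chart_vert hps, e, hR, Finset.mul_sum]
    refine (mul_le_mul_of_nonneg_left (norm_sum_le _ _) hc.le).trans ?_
    rw [Finset.mul_sum]
    refine Finset.sum_le_sum fun v hv => ?_
    rw [norm_smul, ← mul_assoc]
    by_cases hvp : v = p
    · rw [hvp]; simp
    · refine mul_le_mul_of_nonneg_right ?_ (norm_nonneg _)
      have := h s t x (pull_subset_cpull s hx) y (pull_subset_cpull t hy) v
      rwa [lam_of_notMem (fun hvt => hvp (hst v hv hvt)) y, sub_zero] at this
  rw [div_mul_eq_mul_div, div_le_iff₀ (by positivity)]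
  nlinarith [norm_nonneg (T.chart s x - T.chart t y)]

section Vertex

variable {L' M' : ℕ} {G' : Partition 2 L' M'} {T' : G'.Triangulation}

/-- At a single vertex there is no common facet through which values could be compared. The near
kernel is integrable over the pair, with integral O(h), so the bound of |v| by S is enough; this is
the source of the term hⁿ⁻¹ S², here with n = 2. -/
theorem exists_vertex_bound (ℓ : Fin (L' + 1)) {s t : T'.elems} {p : Euc 3}
    (hps : p ∈ (s : Finset (Euc 3))) (hpt : p ∈ (t : Finset (Euc 3)))
    (hst : ∀ v ∈ (s : Finset (Euc 3)), v ∈ (t : Finset (Euc 3)) → v = p) :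
    ∃ C : ℝ≥0∞, C ≠ ⊤ ∧ (s ∈ T'.elemsOn ℓ → t ∈ T'.elemsOn ℓ → ∀ h : ℝ, 0 < h →
      ∀ v S Gr, IsPiecewiseSobolev T' ℓ v S Gr →
      ∫⁻ x in T'.pull s, ∫⁻ y in T'.pull t, kernNear 2 h ‖T'.chart s x - T'.chart t y‖ *
        ‖v (T'.chart s x) - v (T'.chart t y)‖ₑ ^ 2 ≤ C * interpBound T' ℓ h v S Gr) := by
  obtain ⟨C, hC, hb⟩ := exists_near_vertex_bound
  obtain ⟨c₁, hc₁, h₁⟩ := exists_dist_of_vertex hps hst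
  obtain ⟨c₂, hc₂, h₂⟩ := exists_dist_of_vertex (s := t) (t := s) hpt fun v hv hvs => hst v hvs hv
  set c : ℝ := min c₁ c₂ / 2 with hcd
  have hc : 0 < c := by positivity
  refine ⟨4 * (C * ENNReal.ofReal ((c ^ 4)⁻¹)), by finiteness, fun hs ht h hh v S Gr hv => ?_⟩
  have hnot : T'.vert s p ∉ T'.pull s := by
    intro hmem
    obtain ⟨q, hq, hqp⟩ : ∃ q ∈ (s : Finset (Euc 3)), q ≠ p := by
      have : 1 < (s : Finset (Euc 3)).card := by rw [s.2.2]; norm_num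
      exact Finset.exists_mem_ne this p
    have := mem_pull_iff.1 hmem q hq
    classical
    rw [lam_vert hq hps, if_neg hqp] at this
    exact lt_irrefl _ this
  have hδ : ∀ x ∈ T'.pull s, ∀ y ∈ T'.pull t, c * (‖x - T'.vert s p‖ + ‖y - T'.vert t p‖) ≤
      ‖T'.chart s x - T'.chart t y‖ := by
    intro x hx y hy
    have a1 := h₁ x hx y hy
    have a2 := h₂ y hy x hx
    rw [norm_sub_rev (T'.chart t y)] at a2
    have b1 : 2 * c ≤ c₁ := by rw [hcd]; linarith [min_le_left c₁ c₂]
    have b2 : 2 * c ≤ c₂ := by rw [hcd]; linarith [min_le_right c₁ c₂]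
    have m1 := mul_le_mul_of_nonneg_right b1 (norm_nonneg (x - T'.vert s p))
    have m2 := mul_le_mul_of_nonneg_right b2 (norm_nonneg (y - T'.vert t p))
    have : 2 * (c * (‖x - T'.vert s p‖ + ‖y - T'.vert t p‖)) ≤
        2 * ‖T'.chart s x - T'.chart t y‖ := by
      calc _ = 2 * c * ‖x - T'.vert s p‖ + 2 * c * ‖y - T'.vert t p‖ := by ring
        _ ≤ c₁ * ‖x - T'.vert s p‖ + c₂ * ‖y - T'.vert t p‖ := add_le_add m1 m2
        _ ≤ ‖T'.chart s x - T'.chart t y‖ + ‖T'.chart s x - T'.chart t y‖ := add_le_add a1 a2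
        _ = _ := by ring
    exact le_of_mul_le_mul_left this two_pos
  have hS : ∀ r ∈ T'.elemsOn ℓ, ∀ᵐ x ∂volume.restrict (T'.pull r), |v (T'.chart r x)| ≤ S :=
    fun r hr => ae_pull_of_ae_surf hv.bound hr
  calc _ ≤ ∫⁻ x in T'.pull s, ∫⁻ y in T'.pull t, ENNReal.ofReal ((2 * S) ^ 2) *
        kernNear 2 h ‖T'.chart s x - T'.chart t y‖ := by
        refine lintegral_mono_ae ?_
        filter_upwards [hS s hs] with x hx
        refine lintegral_mono_ae ?_
        filter_upwards [hS t ht] with y hy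
        rw [mul_comm]
        refine mul_le_mul_left ?_ _
        rw [enorm_sq_eq_ofReal]
        refine ENNReal.ofReal_le_ofReal (pow_le_pow_left₀ (norm_nonneg _) ?_ 2)
        refine (norm_sub_le _ _).trans ?_
        rw [Real.norm_eq_abs, Real.norm_eq_abs]
        linarith
    _ = ENNReal.ofReal ((2 * S) ^ 2) * ∫⁻ x in T'.pull s, ∫⁻ y in T'.pull t,
        kernNear 2 h ‖T'.chart s x - T'.chart t y‖ := by
        rw [← lintegral_const_mul' _ _ ENNReal.ofReal_ne_top]
        exact lintegral_congr fun x => lintegral_const_mul' _ _ ENNReal.ofReal_ne_top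
    _ ≤ ENNReal.ofReal ((2 * S) ^ 2) * (C * ENNReal.ofReal ((c ^ 4)⁻¹) * ENNReal.ofReal h) := by
        gcongr
        exact hb h hh c hc _ _ _ _ _ hδ (isOpen_pull s).measurableSet (isOpen_pull t).measurableSet
          hnot
    _ = 4 * (C * ENNReal.ofReal ((c ^ 4)⁻¹)) * ENNReal.ofReal (h ^ (2 - 1) * S ^ 2) := by
        rw [mul_pow, ENNReal.ofReal_mul (by positivity), ENNReal.ofReal_mul (by positivity)]
        norm_num
        ring
    _ ≤ _ := by
        gcongr
        exact le_add_self

end Vertex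

/-- The affine map that sends b to a and fixes the common vertices. It preserves barycentric
coordinates, so it maps t onto s and displaces a point only by its distance coordinate from the
facet. -/
theorem exists_facet_matching {s t : T.elems} {a b : Euc (n + 1)}
    (has : a ∈ (s : Finset (Euc (n + 1)))) (hat' : a ∉ (t : Finset (Euc (n + 1))))
    (hbt : b ∈ (t : Finset (Euc (n + 1)))) (hbs : b ∉ (s : Finset (Euc (n + 1))))
    (hs : ∀ v ∈ (s : Finset (Euc (n + 1))), v ≠ a → v ∈ (t : Finset (Euc (n + 1))))
    (ht : ∀ v ∈ (t : Finset (Euc (n + 1))), v ≠ b → v ∈ (s : Finset (Euc (n + 1)))) :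
    ∃ (B : Euc n →ₗ[ℝ] Euc n) (b₀ : Euc n), LinearMap.det B ≠ 0 ∧
      (∀ y ∈ T.pull t, B y + b₀ ∈ T.pull s) ∧ (∀ y, T.lam s a (B y + b₀) = T.lam t b y) ∧
      (∀ y, ∀ u ∈ (s : Finset (Euc (n + 1))), u ≠ a → T.lam s u (B y + b₀) = T.lam t u y) ∧
      ∀ y, T.chart s (B y + b₀) - T.chart t y = T.lam t b y • (a - b) := by
  classical
  obtain ⟨π, hπb, hπn⟩ : ∃ π : Euc (n + 1) → Euc (n + 1), π b = a ∧ ∀ v, v ≠ b → π v = v :=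
    ⟨fun v => if v = b then a else v, if_pos rfl, fun v hv => if_neg hv⟩
  have hπs : ∀ v ∈ (t : Finset (Euc (n + 1))), π v ∈ (s : Finset (Euc (n + 1))) := fun v hv => by
    by_cases h : v = b
    · rw [h, hπb]; exact has
    · rw [hπn v h]; exact ht v hv h
  have hπi : ∀ v ∈ (t : Finset (Euc (n + 1))), ∀ u ∈ (t : Finset (Euc (n + 1))),
      π v = π u → v = u := by
    intro v hv u hu h
    by_cases h1 : v = b <;> by_cases h2 : u = b
    · rw [h1, h2]
    · rw [h1, hπb, hπn u h2] at h
      exact absurd (h ▸ hu) hat'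
    · rw [h2, hπb, hπn v h1] at h
      exact absurd (h ▸ hv) hat'
    · rwa [hπn v h1, hπn u h2] at h
  obtain ⟨B, hB⟩ : ∃ B : Euc n →ₗ[ℝ] Euc n, B = ∑ v ∈ (t : Finset (Euc (n + 1))),
    (T.lam t v).linear.smulRight (T.vert s (π v)) := ⟨_, rfl⟩
  obtain ⟨b₀, hb₀⟩ : ∃ b₀ : Euc n, b₀ = ∑ v ∈ (t : Finset (Euc (n + 1))),
    T.lam t v 0 • T.vert s (π v) := ⟨_, rfl⟩
  have hΞ : ∀ y, B y + b₀ = ∑ v ∈ (t : Finset (Euc (n + 1))), T.lam t v y • T.vert s (π v) := by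
    intro y
    rw [hB, hb₀, LinearMap.sum_apply, ← Finset.sum_add_distrib]
    refine Finset.sum_congr rfl fun v _ => ?_
    rw [LinearMap.smulRight_apply, ← add_smul]
    congr 1
    conv_rhs => rw [(T.lam t v).decomp]
    rfl
  have hlamΞ : ∀ y, ∀ v ∈ (t : Finset (Euc (n + 1))), T.lam s (π v) (B y + b₀) = T.lam t v y := by
    intro y v hv
    rw [hΞ, affineMap_sum_smul _ (sum_lam t y), Finset.sum_eq_single v]
    · rw [lam_vert (hπs v hv) (hπs v hv), if_pos rfl, mul_one]
    · intro u hu huv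
      rw [lam_vert (hπs v hv) (hπs u hu), if_neg (fun h => huv (hπi v hv u hu h).symm), mul_zero]
    · exact fun h => absurd hv h
  have hsurj : ∀ u ∈ (s : Finset (Euc (n + 1))), ∃ v ∈ (t : Finset (Euc (n + 1))), π v = u := by
    intro u hu
    by_cases h : u = a
    · exact ⟨b, hbt, by rw [hπb, h]⟩
    · have hut := hs u hu h
      exact ⟨u, hut, hπn u fun h => hbs (h ▸ hu)⟩
  have hdet : LinearMap.det B ≠ 0 := by
    -- A vector in the kernel of B has the same barycentric coordinates as the origin.
    intro h0
    obtain ⟨y, hy, hy0⟩ := Submodule.exists_mem_ne_zero_of_ne_bot (LinearMap.bot_lt_ker_of_det_eq_zero h0).ne'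
    refine hy0 ((T.chart t).injective ?_)
    have hy' : B y = 0 := hy
    rw [← sum_lam_smul t y, ← sum_lam_smul t 0]
    refine Finset.sum_congr rfl fun v hv => ?_
    rw [← hlamΞ y v hv, ← hlamΞ 0 v hv, hy', map_zero]
  have hmaps : ∀ y ∈ T.pull t, B y + b₀ ∈ T.pull s := by
    intro y hy
    rw [mem_pull_iff] at hy ⊢
    intro u hu
    obtain ⟨v, hv, rfl⟩ := hsurj u hu
    rw [hlamΞ y v hv]
    exact hy v hv
  refine ⟨B, b₀, hdet, hmaps, fun y => by rw [← hπb, hlamΞ y b hbt], fun y u hu hua => ?_,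
    fun y => ?_⟩
  · have := hlamΞ y u (hs u hu hua)
    rwa [hπn u fun h => hbs (h ▸ hu)] at this
  · have e1 : T.chart s (B y + b₀) = ∑ v ∈ (t : Finset (Euc (n + 1))), T.lam t v y • π v := by
        rw [hΞ]
        have := affineMap_sum_smul' (T.chart s).toAffineMap (sum_lam t y) (fun v => T.vert s (π v))
        refine this.trans (Finset.sum_congr rfl fun v hv => ?_)
        congr 1
        exact chart_vert (hπs v hv)
    rw [e1, ← sum_lam_smul t y, ← Finset.sum_sub_distrib, Finset.sum_eq_single b]
    · rw [hπb, smul_sub]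
    · intro v _ hvb
      rw [hπn v hvb, sub_self]
    · exact fun h => absurd hbt h

/-- The cone bound compares the coordinates of x in s with those of y in t. Those of a and b each
vanish on the other element, so both are nonnegative and at most δ / c₀, and so is their difference
in absolute value. Hence all coordinates of z and x differ by at most δ / c₀. -/
theorem facet_dist {c₀ : ℝ} (hc₀ : 0 < c₀) {s t : T.elems} {a b : Euc (n + 1)}
    (has : a ∈ (s : Finset (Euc (n + 1)))) (hat' : a ∉ (t : Finset (Euc (n + 1))))
    (hbt : b ∈ (t : Finset (Euc (n + 1)))) (hbs : b ∉ (s : Finset (Euc (n + 1))))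
    {x y z : Euc n} (hx : x ∈ T.pull s) (hy : y ∈ T.pull t)
    (hco : ∀ v, c₀ * |T.lam s v x - T.lam t v y| ≤ ‖T.chart s x - T.chart t y‖)
    (hla : T.lam s a z = T.lam t b y)
    (hlu : ∀ u ∈ (s : Finset (Euc (n + 1))), u ≠ a → T.lam s u z = T.lam t u y) :
    c₀ / (1 + ∑ v ∈ (s : Finset (Euc (n + 1))), ‖v‖) * (T.lam s a z + ‖z - x‖) ≤
      ‖T.chart s x - T.chart t y‖ := by
  obtain ⟨δ, hδ⟩ : ∃ δ, δ = ‖T.chart s x - T.chart t y‖ := ⟨_, rfl⟩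
  rw [← hδ] at hco ⊢
  have hR0 : 0 ≤ ∑ v ∈ (s : Finset (Euc (n + 1))), ‖v‖ := Finset.sum_nonneg fun _ _ => norm_nonneg _
  have hb1 : c₀ * T.lam t b y ≤ δ := by
    have := hco b
    rw [lam_of_notMem hbs, zero_sub, abs_neg] at this
    exact (mul_le_mul_of_nonneg_left (le_abs_self _) hc₀.le).trans this
  have ha1 : c₀ * T.lam s a x ≤ δ := by
    have := hco a
    rw [lam_of_notMem hat', sub_zero] at this
    exact (mul_le_mul_of_nonneg_left (le_abs_self _) hc₀.le).trans this
  have hd : c₀ * ‖z - x‖ ≤ δ * ∑ v ∈ (s : Finset (Euc (n + 1))), ‖v‖ := by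
    rw [← norm_chart_sub s, ← sum_lam_smul s z, ← sum_lam_smul s x,
      ← Finset.sum_sub_distrib, Finset.mul_sum]
    refine (mul_le_mul_of_nonneg_left (norm_sum_le _ _) hc₀.le).trans ?_
    rw [Finset.mul_sum]
    refine Finset.sum_le_sum fun u hu => ?_
    rw [← sub_smul, norm_smul, ← mul_assoc]
    refine mul_le_mul_of_nonneg_right ?_ (norm_nonneg _)
    rw [Real.norm_eq_abs]
    by_cases hua : u = a
    · rw [hua, hla]
      have q1 := mul_pos hc₀ (mem_pull_iff.1 hx a has)
      have q2 := mul_pos hc₀ (mem_pull_iff.1 hy b hbt)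
      calc c₀ * |T.lam t b y - T.lam s a x| = |c₀ * T.lam t b y - c₀ * T.lam s a x| := by
            rw [← mul_sub, abs_mul, abs_of_pos hc₀]
        _ ≤ δ := abs_le.2 ⟨by linarith, by linarith⟩
    · rw [hlu u hu hua, abs_sub_comm]
      exact hco u
  rw [hla, div_mul_eq_mul_div,
    div_le_iff₀ (add_pos_of_pos_of_nonneg one_pos hR0), mul_add, mul_add, mul_one]
  exact add_le_add hb1 hd

/-- The Hardy paths in s and t run parallel to the edges towards one common vertex c. For matched
points they end at the same point of the common facet (`hab`), and this is where the continuity of v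
across the facet is used. -/
theorem exists_facet_bound (hn : 1 ≤ n) (ℓ : Fin (L + 1)) {s t : T.elems} {a b c : Euc (n + 1)}
    (has : a ∈ (s : Finset (Euc (n + 1)))) (hat' : a ∉ (t : Finset (Euc (n + 1))))
    (hbt : b ∈ (t : Finset (Euc (n + 1)))) (hbs : b ∉ (s : Finset (Euc (n + 1))))
    (hcs : c ∈ (s : Finset (Euc (n + 1)))) (hct : c ∈ (t : Finset (Euc (n + 1))))
    (hs : ∀ v ∈ (s : Finset (Euc (n + 1))), v ≠ a → v ∈ (t : Finset (Euc (n + 1))))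
    (ht : ∀ v ∈ (t : Finset (Euc (n + 1))), v ≠ b → v ∈ (s : Finset (Euc (n + 1)))) :
    ∃ C : ℝ≥0∞, C ≠ ⊤ ∧ (s ∈ T.elemsOn ℓ → t ∈ T.elemsOn ℓ → ∀ h : ℝ, 0 < h →
      ∀ v S Gr, IsPiecewiseSobolev T ℓ v S Gr →
      ∫⁻ x in T.pull s, ∫⁻ y in T.pull t, kernNear n h ‖T.chart s x - T.chart t y‖ *
        ‖v (T.chart s x) - v (T.chart t y)‖ₑ ^ 2 ≤ C * interpBound T ℓ h v S Gr) := by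
  have hac : a ≠ c := fun h => hat' (h ▸ hct)
  have hbc : b ≠ c := fun h => hbs (h ▸ hcs)
  obtain ⟨c₀, hc₀, hcone⟩ := T.exists_cone
  obtain ⟨B, b₀, hdet, hmaps, hlaΞ, hluΞ, hch⟩ := exists_facet_matching has hat' hbt hbs hs ht
  obtain ⟨k, hk⟩ : ∃ k : ℝ, k = c₀ / (1 + ∑ v ∈ (s : Finset (Euc (n + 1))), ‖v‖) := ⟨_, rfl⟩
  have hR0 : 0 ≤ ∑ v ∈ (s : Finset (Euc (n + 1))), ‖v‖ := Finset.sum_nonneg fun _ _ => norm_nonneg _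
  have hk0 : 0 < k := hk ▸ div_pos hc₀ (add_pos_of_pos_of_nonneg one_pos hR0)
  have hδ : ∀ x ∈ T.pull s, ∀ y ∈ T.pull t,
      k * (T.lam s a (B y + b₀) + ‖(B y + b₀) - x‖) ≤ ‖T.chart s x - T.chart t y‖ := by
    intro x hx y hy
    rw [hk]
    exact facet_dist hc₀ has hat' hbt hbs hx hy
      (hcone s t x (pull_subset_cpull s hx) y (pull_subset_cpull t hy)) (hlaΞ y) (hluΞ y)
  obtain ⟨C, hC, hb⟩ := exists_facet_pair_bound hn hk0 b₀ hdet
  obtain ⟨w₁, hw₁⟩ : ∃ w, w = T.vert s a - T.vert s c := ⟨_, rfl⟩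
  obtain ⟨w₂, hw₂⟩ : ∃ w, w = T.vert t b - T.vert t c := ⟨_, rfl⟩
  refine ⟨C * (1 + ENNReal.ofReal k⁻¹ * ‖w₁‖ₑ ^ 2 * 4 + ENNReal.ofReal k⁻¹ * ‖w₂‖ₑ ^ 2 * 4),
    by finiteness, fun hsℓ htℓ h hh v S Gr hv => ?_⟩
  have hm1 := measurable_comp_chart hv.meas s
  have hm2 := measurable_comp_chart hv.meas t
  have hta : Measurable fun x => v (T.chart s (x - T.lam s a x • w₁)) :=
    hm1.comp (by have := continuous_lam s a; fun_prop : Continuous fun x : Euc n => x - T.lam s a x • w₁).measurable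
  have htb : Measurable fun x => v (T.chart t (x - T.lam t b x • w₂)) :=
    hm2.comp (by have := continuous_lam t b; fun_prop : Continuous fun x : Euc n => x - T.lam t b x • w₂).measurable
  have hab : ∀ y ∈ T.pull t, v (T.chart s ((B y + b₀) - T.lam s a (B y + b₀) • w₁)) =
      v (T.chart t (y - T.lam t b y • w₂)) := by
    intro y _
    congr 1
    rw [hw₁, hw₂, chart_sub_smul, chart_sub_smul, chart_vert has, chart_vert hcs, chart_vert hbt,
      chart_vert hct, hlaΞ]
    rw [sub_eq_iff_eq_add.1 (hch y)]
    module
  have hhk : 0 < h / k := div_pos hh hk0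
  have key := hb (T.pull s) (T.pull t) (isOpen_pull s) (convex_pull s) (isOpen_pull t) hmaps
    (fun x y => ‖T.chart s x - T.chart t y‖) (T.lam s a) (continuous_lam s a)
    (fun x hx => mem_pull_iff.1 hx a has) hδ _ _ _ _ hm1 hta hm2 htb hab (Gr s)
    (hv.memLp s hsℓ) (hv.memLp_grad s hsℓ) (hv.weakGrad s hsℓ) h hh
  refine key.trans ?_
  rw [mul_assoc]
  refine mul_le_mul_right ?_ _
  have H1 := hardy_elem hsℓ has hcs hac hv hhk
  have H2 := hardy_elem htℓ hbt hct hbc hv hhk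
  simp only [hlaΞ]
  rw [← hw₁] at H1
  rw [← hw₂] at H2
  have e : ENNReal.ofReal (h / k) = ENNReal.ofReal k⁻¹ * ENNReal.ofReal h := by
    rw [← ENNReal.ofReal_mul (by positivity), div_eq_inv_mul]
  have g1 := mul_grad_le (v := v) (S := S) (Gr := Gr) hsℓ h
  have g2 := mul_grad_le (v := v) (S := S) (Gr := Gr) htℓ h
  calc _ ≤ ENNReal.ofReal h * (∑ i, ∫⁻ x in T.pull s, ‖Gr s i x‖ₑ ^ 2) +
        ENNReal.ofReal (h / k) * ‖w₁‖ₑ ^ 2 * 4 * (∑ i, ∫⁻ x in T.pull s, ‖Gr s i x‖ₑ ^ 2) +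
        ENNReal.ofReal (h / k) * ‖w₂‖ₑ ^ 2 * 4 * (∑ i, ∫⁻ x in T.pull t, ‖Gr t i x‖ₑ ^ 2) :=
        add_le_add (add_le_add le_rfl H1) H2
    _ = ENNReal.ofReal h * (∑ i, ∫⁻ x in T.pull s, ‖Gr s i x‖ₑ ^ 2) +
        ENNReal.ofReal k⁻¹ * ‖w₁‖ₑ ^ 2 * 4 *
          (ENNReal.ofReal h * (∑ i, ∫⁻ x in T.pull s, ‖Gr s i x‖ₑ ^ 2)) +
        ENNReal.ofReal k⁻¹ * ‖w₂‖ₑ ^ 2 * 4 *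
          (ENNReal.ofReal h * (∑ i, ∫⁻ x in T.pull t, ‖Gr t i x‖ₑ ^ 2)) := by rw [e]; ring
    _ ≤ interpBound T ℓ h v S Gr + ENNReal.ofReal k⁻¹ * ‖w₁‖ₑ ^ 2 * 4 * interpBound T ℓ h v S Gr +
        ENNReal.ofReal k⁻¹ * ‖w₂‖ₑ ^ 2 * 4 * interpBound T ℓ h v S Gr := by gcongr
    _ = _ := by ring

/-- Two elements coincide, are disjoint, share n vertices or, when n = 2, share exactly one. Except
for disjoint elements the kernel is split at distance h, and the far part is the same in all cases.
-/
theorem exists_pair_bound (hn : n = 1 ∨ n = 2) (ℓ : Fin (L + 1)) (s t : T.elems) (D : ℝ) :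
    ∃ C : ℝ≥0∞, C ≠ ⊤ ∧ (s ∈ T.elemsOn ℓ → t ∈ T.elemsOn ℓ → ∀ h : ℝ, 0 < h → h ≤ D →
      ∀ v S Gr, IsPiecewiseSobolev T ℓ v S Gr →
      ∫⁻ x in T.pull s, ∫⁻ y in T.pull t, kern n ‖T.chart s x - T.chart t y‖ *
        ‖v (T.chart s x) - v (T.chart t y)‖ₑ ^ 2 ≤ C * interpBound T ℓ h v S Gr) := by
  classical
  have hn1 : 1 ≤ n := by omega
  obtain ⟨C₁, hC₁, hb₁⟩ := exists_far_bound T ℓ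
  have split : (∃ C : ℝ≥0∞, C ≠ ⊤ ∧ (s ∈ T.elemsOn ℓ → t ∈ T.elemsOn ℓ → ∀ h : ℝ, 0 < h →
      ∀ v S Gr, IsPiecewiseSobolev T ℓ v S Gr →
      ∫⁻ x in T.pull s, ∫⁻ y in T.pull t, kernNear n h ‖T.chart s x - T.chart t y‖ *
        ‖v (T.chart s x) - v (T.chart t y)‖ₑ ^ 2 ≤ C * interpBound T ℓ h v S Gr)) →
      ∃ C : ℝ≥0∞, C ≠ ⊤ ∧ (s ∈ T.elemsOn ℓ → t ∈ T.elemsOn ℓ → ∀ h : ℝ, 0 < h → h ≤ D →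
      ∀ v S Gr, IsPiecewiseSobolev T ℓ v S Gr →
      ∫⁻ x in T.pull s, ∫⁻ y in T.pull t, kern n ‖T.chart s x - T.chart t y‖ *
        ‖v (T.chart s x) - v (T.chart t y)‖ₑ ^ 2 ≤ C * interpBound T ℓ h v S Gr) := by
    rintro ⟨C, hC, hb⟩
    refine ⟨C + C₁, by finiteness, fun hs ht h hh _ v S Gr hv => ?_⟩
    have hcs : Continuous (T.chart s) := (T.chart s).continuous
    have hct : Continuous (T.chart t) := (T.chart t).continuous
    have hd : Continuous fun p : Euc n × Euc n => ‖T.chart s p.1 - T.chart t p.2‖ := by fun_prop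
    have hm : Measurable fun p : Euc n × Euc n => kernNear n h ‖T.chart s p.1 - T.chart t p.2‖ *
        ‖v (T.chart s p.1) - v (T.chart t p.2)‖ₑ ^ 2 :=
      ((measurable_kernNear h).comp hd.measurable).mul
        ((((measurable_comp_chart hv.meas s).comp measurable_fst).sub
          ((measurable_comp_chart hv.meas t).comp measurable_snd)).enorm.pow_const 2)
    simp only [kern_eq_add h, add_mul]
    calc _ = (∫⁻ x in T.pull s, ∫⁻ y in T.pull t, kernNear n h ‖T.chart s x - T.chart t y‖ *
        ‖v (T.chart s x) - v (T.chart t y)‖ₑ ^ 2) +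
        ∫⁻ x in T.pull s, ∫⁻ y in T.pull t, kernFar n h ‖T.chart s x - T.chart t y‖ *
        ‖v (T.chart s x) - v (T.chart t y)‖ₑ ^ 2 := by
          rw [← lintegral_add_left hm.lintegral_prod_right']
          refine lintegral_congr fun x => ?_
          exact lintegral_add_left (hm.comp measurable_prodMk_left) _
      _ ≤ _ := add_le_add (hb hs ht h hh v S Gr hv) (hb₁ s hs t ht h hh v S Gr hv)
  by_cases hst : s = t
  · subst hst
    obtain ⟨C, hC, hb⟩ := exists_same_bound T ℓ hn1
    exact split ⟨C, hC, fun hs _ => hb s hs⟩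
  have hne : (s : Finset (Euc (n + 1))) ≠ t := fun h => hst (Subtype.ext h)
  by_cases hdis : Disjoint (s : Finset (Euc (n + 1))) t
  · obtain ⟨c, hc, h⟩ := exists_dist_of_disjoint hdis
    exact exists_disjoint_bound ℓ hc h D
  obtain ⟨c, hcs, hct⟩ := Finset.not_disjoint_iff.1 hdis
  obtain ⟨a, has, hat'⟩ : ∃ a ∈ (s : Finset (Euc (n + 1))), a ∉ (t : Finset (Euc (n + 1))) :=
    Finset.not_subset.1 fun h => hne (Finset.eq_of_subset_of_card_le h (by rw [s.2.2, t.2.2]))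
  obtain ⟨b, hbt, hbs⟩ : ∃ b ∈ (t : Finset (Euc (n + 1))), b ∉ (s : Finset (Euc (n + 1))) :=
    Finset.not_subset.1 fun h => hne.symm
      (Finset.eq_of_subset_of_card_le h (by rw [s.2.2, t.2.2]))
  by_cases hcard : n ≤ ((s : Finset (Euc (n + 1))) ∩ t).card
  · refine split (exists_facet_bound hn1 ℓ has hat' hbt hbs hcs hct ?_ ?_)
    · have : ((s : Finset (Euc (n + 1))) ∩ t) = (s : Finset (Euc (n + 1))).erase a := by
        refine Finset.eq_of_subset_of_card_le (fun v hv => ?_) ?_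
        · rw [Finset.mem_inter] at hv
          exact Finset.mem_erase.2 ⟨fun h => hat' (h ▸ hv.2), hv.1⟩
        · rw [Finset.card_erase_of_mem has, s.2.2]; simpa using hcard
      intro v hv hva
      exact (Finset.mem_inter.1 (this ▸ Finset.mem_erase.2 ⟨hva, hv⟩)).2
    · have : ((s : Finset (Euc (n + 1))) ∩ t) = (t : Finset (Euc (n + 1))).erase b := by
        refine Finset.eq_of_subset_of_card_le (fun v hv => ?_) ?_
        · rw [Finset.mem_inter] at hv
          exact Finset.mem_erase.2 ⟨fun h => hbs (h ▸ hv.1), hv.2⟩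
        · rw [Finset.card_erase_of_mem hbt, t.2.2]; simpa using hcard
      intro v hv hvb
      exact (Finset.mem_inter.1 (this ▸ Finset.mem_erase.2 ⟨hvb, hv⟩)).1
  · have hpos : 0 < ((s : Finset (Euc (n + 1))) ∩ t).card :=
      Finset.card_pos.2 ⟨c, Finset.mem_inter.2 ⟨hcs, hct⟩⟩
    -- The number of common vertices is positive and less than n.
    obtain rfl : n = 2 := by omega
    refine split (exists_vertex_bound ℓ hcs hct fun v hvs hvt => ?_)
    have h1 : ((s : Finset (Euc (2 + 1))) ∩ t).card ≤ 1 := by omega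
    exact Finset.card_le_one.1 h1 v (Finset.mem_inter.2 ⟨hvs, hvt⟩) c
      (Finset.mem_inter.2 ⟨hcs, hct⟩)

/-- The interpolation estimate for the Slobodeckij seminorm. -/
theorem exists_slobodeckij_bound (hn : n = 1 ∨ n = 2) (T : G.Triangulation) (ℓ : Fin (L + 1))
    (D : ℝ) : ∃ C : ℝ≥0∞, C ≠ ⊤ ∧ ∀ h : ℝ, 0 < h → h ≤ D →
      ∀ v S Gr, IsPiecewiseSobolev T ℓ v S Gr →
      ∫⁻ x, ∫⁻ y, kern n ‖x - y‖ * ‖v x - v y‖ₑ ^ 2 ∂G.surf ℓ ∂G.surf ℓ ≤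
        C * interpBound T ℓ h v S Gr := by
  choose C hC hb using fun s t : T.elems => exists_pair_bound hn ℓ s t D
  refine ⟨∑ s ∈ T.elemsOn ℓ, ∑ t ∈ T.elemsOn ℓ, C s t, ?_, fun h hh hD v S Gr hv => ?_⟩
  · exact ENNReal.sum_ne_top.2 fun s _ => ENNReal.sum_ne_top.2 fun t _ => hC s t
  · rw [lintegral_surf (T := T), Finset.sum_mul]
    refine Finset.sum_le_sum fun s hs => ?_
    rw [Finset.sum_mul]
    simp only [lintegral_surf (T := T) ℓ (fun y => kern n ‖T.chart s _ - y‖ * ‖v (T.chart s _) - v y‖ₑ ^ 2)]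
    have hcs : Continuous (T.chart s) := (T.chart s).continuous
    rw [lintegral_finsetSum]
    · exact Finset.sum_le_sum fun t ht => hb s t hs ht h hh hD v S Gr hv
    · intro t _
      have hct : Continuous (T.chart t) := (T.chart t).continuous
      have hd : Continuous fun p : Euc n × Euc n => ‖T.chart s p.1 - T.chart t p.2‖ := by fun_prop
      have hm : Measurable fun p : Euc n × Euc n => kern n ‖T.chart s p.1 - T.chart t p.2‖ *
          ‖v (T.chart s p.1) - v (T.chart t p.2)‖ₑ ^ 2 :=
        (measurable_kern.comp hd.measurable).mul
          ((((measurable_comp_chart hv.meas s).comp measurable_fst).sub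
            ((measurable_comp_chart hv.meas t).comp measurable_snd)).enorm.pow_const 2)
      exact hm.lintegral_prod_right'

end Partition.Triangulation

/-! ### The Sobolev norm of integer order -/

theorem MemHk.weakDeriv_spec {k : ℕ} {U : Set (Euc m)} {f : Euc m → ℝ} (h : MemHk k U f) {j : ℕ}
    (hj : j ≤ k) (idx : Fin j → Fin m) : MemLp (weakDeriv U idx f) 2 (volume.restrict U) ∧
      IsWeakDeriv U idx f (weakDeriv U idx f) := by
  have h1 := h.2 j hj idx
  rw [weakDeriv, dif_pos h1]
  exact h1.choose_spec

theorem weakDeriv_congr {j j' : ℕ} (h : j = j') (U : Set (Euc m)) (f : Euc m → ℝ)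
    (idx : Fin j → Fin m) (idx' : Fin j' → Fin m) (hi : ∀ a, idx a = idx' (Fin.cast h a)) :
    weakDeriv U idx f = weakDeriv U idx' f := by
  subst h
  have : idx = idx' := funext hi
  rw [this]

/-- The weak derivatives of a function along lists of directions. -/
def weakDerivs (U : Set (Euc m)) (f : Euc m → ℝ) (l : List (Fin m)) : Euc m → ℝ :=
  weakDeriv U l.get f

theorem MemHk.hasWeakDerivs {k : ℕ} {U : Set (Euc m)} {f : Euc m → ℝ} (h : MemHk k U f) :
    HasWeakDerivs U k f (weakDerivs U f) := by
  intro l hl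
  obtain ⟨h1, h2⟩ := h.weakDeriv_spec hl l.get
  refine ⟨h1, fun w hw hwU => ?_⟩
  have := h2 w hw hwU
  rwa [partialDeriv_eq_dlist hw.1, List.ofFn_get] at this

theorem lintegral_enorm_sq_eq {α : Type*} [MeasurableSpace α] {μ : Measure α} {f : α → ℝ}
    (hf : MemLp f 2 μ) : ∫⁻ x, ‖f x‖ₑ ^ 2 ∂μ = ENNReal.ofReal (∫ x, f x ^ 2 ∂μ) := by
  rw [ofReal_integral_eq_lintegral_ofReal hf.integrable_sq (ae_of_all _ fun x => sq_nonneg _)]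
  refine lintegral_congr fun x => ?_
  rw [enorm_sq_eq_ofReal, Real.norm_eq_abs, sq_abs]

theorem MemHk.sum_sobSq {k : ℕ} {U : Set (Euc m)} {f : Euc m → ℝ} (h : MemHk k U f) :
    ∑ j ∈ Finset.range (k + 1), sobSq U (weakDerivs U f) j = ENNReal.ofReal (normHk k U f ^ 2) := by
  have hn : ∀ j ∈ Finset.range (k + 1), ∀ idx : Fin j → Fin m,
      0 ≤ ∫ x in U, (weakDeriv U idx f x) ^ 2 := fun j _ idx =>
    integral_nonneg fun x => sq_nonneg _
  rw [normHk, Real.sq_sqrt (Finset.sum_nonneg fun j hj => Finset.sum_nonneg fun idx _ =>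
    hn j hj idx), ENNReal.ofReal_sum_of_nonneg fun j hj => Finset.sum_nonneg fun idx _ =>
    hn j hj idx]
  refine Finset.sum_congr rfl fun j hj => ?_
  rw [ENNReal.ofReal_sum_of_nonneg fun idx _ => hn j hj idx]
  refine Finset.sum_congr rfl fun idx _ => ?_
  have e : weakDerivs U f (List.ofFn idx) = weakDeriv U idx f :=
    weakDeriv_congr List.length_ofFn U f _ _ fun a => by simp; rfl
  rw [e, lintegral_enorm_sq_eq (h.weakDeriv_spec (by simpa [Nat.lt_succ_iff] using hj) idx).1]

theorem MemHk.sobSq_le {k : ℕ} {U : Set (Euc m)} {f : Euc m → ℝ} (h : MemHk k U f) {j : ℕ}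
    (hj : j ≤ k) : sobSq U (weakDerivs U f) j ≤ ENNReal.ofReal (normHk k U f ^ 2) := by
  rw [← h.sum_sobSq]
  exact Finset.single_le_sum (f := fun j => sobSq U (weakDerivs U f) j) (fun _ _ => zero_le)
    (Finset.mem_range.2 (Nat.lt_succ_of_le hj))

namespace Partition

variable {n L M : ℕ} {G : Partition n L M}

theorem sum_sq_normHk_le {k : ℕ} {ℓ : Fin (L + 1)} (f : Lp ℝ 2 (G.surf ℓ)) :
    ∑ i ∈ G.I ℓ, ENNReal.ofReal ((normHk k (G.patch i) fun x => f (G.chart i x)) ^ 2) =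
      ENNReal.ofReal (G.normHpw k ℓ f ^ 2) := by
  rw [normHpw, Real.sq_sqrt (Finset.sum_nonneg fun _ _ => sq_nonneg _),
    ENNReal.ofReal_sum_of_nonneg fun _ _ => sq_nonneg _]

namespace Triangulation

variable {T : G.Triangulation}

/-- The diameter of an element. -/
def size (t : T.elems) : ℝ := Metric.diam (closedElem (t : Finset (Euc (n + 1))))

theorem dist_le_size {t : T.elems} {x y : Euc n} (hx : x ∈ T.cpull t) (hy : y ∈ T.cpull t) :
    dist x y ≤ size t := by
  rw [← (T.chart t).dist_map]
  exact Metric.dist_le_diam_of_mem (isCompact_closedElem _).isBounded hx hy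

theorem size_pos (hn : 1 ≤ n) (t : T.elems) : 0 < size t := by
  obtain ⟨a, ha, b, hb, hab⟩ := Finset.one_lt_card.1
    (show 1 < (t : Finset (Euc (n + 1))).card by rw [t.2.2]; omega)
  exact (dist_pos.2 hab).trans_le (Metric.dist_le_diam_of_mem (isCompact_closedElem _).isBounded
    (subset_convexHull ℝ _ ha) (subset_convexHull ℝ _ hb))

theorem size_le_meshSize (t : T.elems) : size t ≤ T.meshSize :=
  le_csSup (T.finite_elems.image _).bddAbove ⟨t, t.2, rfl⟩

theorem meshSize_nonneg : 0 ≤ T.meshSize := by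
  refine Real.sSup_nonneg ?_
  rintro _ ⟨t, _, rfl⟩
  exact Metric.diam_nonneg

theorem meshSize_le_diam : T.meshSize ≤ Metric.diam G.skeleton := by
  refine Real.sSup_le ?_ Metric.diam_nonneg
  rintro _ ⟨t, ht, rfl⟩
  exact Metric.diam_mono (closedElem_subset_skeleton (T := T) ⟨t, ht⟩)
    Partition.isCompact_skeleton.isBounded

variable {κ : ℝ}

theorem ShapeRegular.exists_ball (hT : T.ShapeRegular κ) (t : T.elems) : ∃ x₀ : Euc n, ∃ δ > 0,
    Metric.closedBall x₀ δ ⊆ T.cpull t ∧ size t ≤ κ * (2 * δ) := by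
  obtain ⟨x, hx, δ, hδ, hb, hd⟩ := hT t t.2
  have hx' := hx
  rw [affineSpan_eq, ← SetLike.mem_coe, coe_chartRange] at hx'
  obtain ⟨x₀, rfl⟩ := hx'
  refine ⟨x₀, δ, hδ, fun y hy => hb ⟨?_, mem_affineSpan_chart t y⟩, hd⟩
  rw [Metric.mem_closedBall, (T.chart t).dist_map]
  exact hy

theorem ShapeRegular.pos (hn : 1 ≤ n) (hT : T.ShapeRegular κ) (t : T.elems) : 0 < κ := by
  obtain ⟨x₀, δ, hδ, -, h⟩ := hT.exists_ball t
  have := (size_pos hn t).trans_le h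
  exact pos_of_mul_pos_left this (by positivity)

/-- The volumes of a ball of radius `size t` and of the inscribed ball of radius δ are compared,
where size t ≤ 2 κ δ. -/
theorem ShapeRegular.volume_le (hn : 1 ≤ n) (hT : T.ShapeRegular κ) (t : T.elems) :
    volume (Metric.closedBall (0 : Euc n) (size t)) ≤
      ENNReal.ofReal ((2 * κ) ^ n) * volume (T.pull t) := by
  obtain ⟨x₀, δ, hδ, hb, h⟩ := hT.exists_ball t
  have hκ := hT.pos hn t
  have h1 : Metric.ball x₀ δ ⊆ T.pull t := by
    rw [← interior_cpull]
    exact interior_maximal (Metric.ball_subset_closedBall.trans hb) Metric.isOpen_ball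
  calc _ ≤ volume (Metric.closedBall (0 : Euc n) (2 * κ * δ)) :=
        measure_mono (Metric.closedBall_subset_closedBall (by linarith))
    _ = ENNReal.ofReal ((2 * κ) ^ n) * volume (Metric.ball x₀ δ) := by
        rw [Measure.addHaar_closedBall _ _ (by positivity), Measure.addHaar_ball_of_pos _ _ hδ,
          mul_pow, ENNReal.ofReal_mul (by positivity), finrank_euclideanSpace_fin, mul_assoc]
    _ ≤ _ := by gcongr

/-- An affine function with values in [0, 1] on a ball of radius δ has slope at most 1 / δ, and 1 /
δ ≤ 2 κ / size t. -/
theorem ShapeRegular.lam_sub_le (hn : 1 ≤ n) (hT : T.ShapeRegular κ) (t : T.elems)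
    (v : Euc (n + 1)) (x y : Euc n) :
    |T.lam t v x - T.lam t v y| ≤ 2 * κ / size t * ‖x - y‖ := by
  obtain ⟨x₀, δ, hδ, hb, h⟩ := hT.exists_ball t
  have hκ := hT.pos hn t
  have hs := size_pos hn t
  have hl : ∀ x y, T.lam t v x - T.lam t v y = (T.lam t v).linear (x - y) := fun x y => by
    have := (T.lam t v).linearMap_vsub x y
    rw [vsub_eq_sub, vsub_eq_sub] at this
    exact this.symm
  rw [hl]
  obtain ⟨z, hz⟩ : ∃ z, z = x - y := ⟨_, rfl⟩
  rw [← hz]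
  rcases eq_or_ne z 0 with h0 | h0
  · simp [h0]
  have hz0 : 0 < ‖z‖ := norm_pos_iff.2 h0
  have hicc : ∀ x ∈ T.cpull t, T.lam t v x ∈ Set.Icc (0 : ℝ) 1 := fun x hx =>
    baryFun_mem_Icc (indep t) hx v
  have h1 := hicc x₀ (hb (Metric.mem_closedBall_self hδ.le))
  have h2 := hicc (x₀ + (δ / ‖z‖) • z) (hb (by
    rw [mem_closedBall_iff_norm, add_sub_cancel_left, norm_smul, norm_div, norm_norm,
      div_mul_cancel₀ _ hz0.ne', Real.norm_of_nonneg hδ.le]))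
  have h3 := hl (x₀ + (δ / ‖z‖) • z) x₀
  rw [add_sub_cancel_left, map_smul, smul_eq_mul] at h3
  have h4 : |δ / ‖z‖ * (T.lam t v).linear z| ≤ 1 := by
    rw [← h3, abs_le]
    constructor <;> linarith [h1.1, h1.2, h2.1, h2.2]
  rw [abs_mul, abs_of_pos (by positivity), div_mul_eq_mul_div, div_le_one hz0] at h4
  rw [div_mul_eq_mul_div, le_div_iff₀ hs]
  calc _ ≤ |(T.lam t v).linear z| * (κ * (2 * δ)) := by gcongr
    _ = 2 * κ * (δ * |(T.lam t v).linear z|) := by ring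
    _ ≤ _ := by gcongr

end Triangulation

end Partition

/-! ### The norm of `H^{1/2}` -/

theorem enorm_sq_Lp {α : Type*} [MeasurableSpace α] {μ : Measure α} (f : Lp ℝ 2 μ) :
    ‖f‖ₑ ^ 2 = ∫⁻ x, ‖f x‖ₑ ^ 2 ∂μ := by
  rw [Lp.enorm_def]
  have := eLpNorm_nnreal_pow_eq_lintegral (f := f) (μ := μ) (p := 2) two_ne_zero
  simpa using this

theorem enorm_sq_slobodeckij {n : ℕ} (a : ℝ) {d : ℝ} (hd : 0 ≤ d) :
    ‖a / d ^ (((n : ℝ) + 1) / 2)‖ₑ ^ 2 = kern n d * ‖a‖ₑ ^ 2 := by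
  have h : (d ^ (((n : ℝ) + 1) / 2)) ^ 2 = d ^ (n + 1) := by
    rw [← Real.rpow_natCast, ← Real.rpow_mul hd, ← Real.rpow_natCast]
    congr 1
    push_cast
    ring
  rw [enorm_sq_eq_ofReal, enorm_sq_eq_ofReal, kern, ← ENNReal.ofReal_mul (by positivity), norm_div,
    div_pow, Real.norm_eq_abs (d ^ _), sq_abs, h, div_eq_inv_mul]

variable {n : ℕ} {σ : Measure (Euc (n + 1))}

theorem enorm_sq_eq_fst_add_snd (η : HHalf σ) : ‖η‖ₑ ^ 2 = ‖fnOf η‖ₑ ^ 2 +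
    ‖(η : WithLp 2 (Lp ℝ 2 σ × Lp ℝ 2 (σ.prod σ))).snd‖ₑ ^ 2 := by
  rw [enorm_sq_eq_ofReal, enorm_sq_eq_ofReal, enorm_sq_eq_ofReal,
    ← ENNReal.ofReal_add (by positivity) (by positivity)]
  congr 1
  exact WithLp.prod_norm_sq_eq_of_L2 (η : WithLp 2 (Lp ℝ 2 σ × Lp ℝ 2 (σ.prod σ)))

variable [SFinite σ]

theorem HHalf.snd_ae_eq (η : HHalf σ) :
    ⇑(η : WithLp 2 (Lp ℝ 2 σ × Lp ℝ 2 (σ.prod σ))).snd =ᵐ[σ.prod σ] fun z =>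
      (fnOf η z.1 - fnOf η z.2) / ‖z.1 - z.2‖ ^ (((n : ℝ) + 1) / 2) := by
  obtain ⟨u, h1, h2⟩ := η.2
  have h3 := Measure.quasiMeasurePreserving_fst (μ := σ) (ν := σ) |>.ae_eq_comp h1
  have h4 := Measure.quasiMeasurePreserving_snd (μ := σ) (ν := σ) |>.ae_eq_comp h1
  filter_upwards [h2, h3, h4] with z a b c
  simp only [Function.comp_apply] at b c
  rw [a, ← b, ← c]
  rfl

theorem lintegral_prod_slobodeckij {v : Euc (n + 1) → ℝ} (hv : AEMeasurable v σ) :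
    ∫⁻ z, ‖(v z.1 - v z.2) / ‖z.1 - z.2‖ ^ (((n : ℝ) + 1) / 2)‖ₑ ^ 2 ∂(σ.prod σ) =
      ∫⁻ x, ∫⁻ y, kern n ‖x - y‖ * ‖v x - v y‖ₑ ^ 2 ∂σ ∂σ := by
  simp only [enorm_sq_slobodeckij _ (norm_nonneg _)]
  rw [lintegral_prod]
  have hd : Measurable fun z : Euc (n + 1) × Euc (n + 1) => ‖z.1 - z.2‖ := by fun_prop
  exact (measurable_kern.comp hd).aemeasurable.mul
    ((hv.comp_fst.sub hv.comp_snd).enorm.pow_const 2)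

theorem HHalf.enorm_sq_eq (η : HHalf σ) : ‖η‖ₑ ^ 2 = ∫⁻ x, ‖fnOf η x‖ₑ ^ 2 ∂σ +
    ∫⁻ x, ∫⁻ y, kern n ‖x - y‖ * ‖fnOf η x - fnOf η y‖ₑ ^ 2 ∂σ ∂σ := by
  rw [enorm_sq_eq_fst_add_snd, enorm_sq_Lp, enorm_sq_Lp,
    ← lintegral_prod_slobodeckij (Lp.aestronglyMeasurable (fnOf η)).aemeasurable]
  congr 1
  refine lintegral_congr_ae ?_
  filter_upwards [HHalf.snd_ae_eq η] with z hz
  rw [hz]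

/-- Functions with finite Slobodeckij seminorm are in `H^{1/2}`. -/
theorem exists_hHalf {v : Euc (n + 1) → ℝ} (hv : MemLp v 2 σ)
    (h : ∫⁻ x, ∫⁻ y, kern n ‖x - y‖ * ‖v x - v y‖ₑ ^ 2 ∂σ ∂σ ≠ ⊤) :
    ∃ η : HHalf σ, ⇑(fnOf η) =ᵐ[σ] v ∧ ‖η‖ₑ ^ 2 = ∫⁻ x, ‖v x‖ₑ ^ 2 ∂σ +
      ∫⁻ x, ∫⁻ y, kern n ‖x - y‖ * ‖v x - v y‖ₑ ^ 2 ∂σ ∂σ := by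
  have hva := hv.1.aemeasurable
  have hV : MemLp (fun z : Euc (n + 1) × Euc (n + 1) =>
      (v z.1 - v z.2) / ‖z.1 - z.2‖ ^ (((n : ℝ) + 1) / 2)) 2 (σ.prod σ) := by
    have hd : Measurable fun z : Euc (n + 1) × Euc (n + 1) =>
      ‖z.1 - z.2‖ ^ (((n : ℝ) + 1) / 2) := by fun_prop
    refine ⟨((hva.comp_fst.sub hva.comp_snd).div hd.aemeasurable).aestronglyMeasurable, ?_⟩
    rw [eLpNorm_lt_top_iff_lintegral_rpow_enorm_lt_top two_ne_zero ENNReal.ofNat_ne_top]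
    have := (lintegral_prod_slobodeckij hva).trans_lt h.lt_top
    simpa using this
  let p : WithLp 2 (Lp ℝ 2 σ × Lp ℝ 2 (σ.prod σ)) := WithLp.toLp 2 (hv.toLp v, hV.toLp _)
  have hp : p ∈ HHalf σ := ⟨v, hv.coeFn_toLp, hV.coeFn_toLp⟩
  refine ⟨⟨p, hp⟩, hv.coeFn_toLp, ?_⟩
  rw [enorm_sq_eq_fst_add_snd, enorm_sq_Lp, enorm_sq_Lp, ← lintegral_prod_slobodeckij hva]
  congr 1
  · refine lintegral_congr_ae ?_
    filter_upwards [hv.coeFn_toLp] with z hz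
    change ‖(hv.toLp v) z‖ₑ ^ 2 = _
    rw [hz]
  · refine lintegral_congr_ae ?_
    filter_upwards [hV.coeFn_toLp] with z hz
    change ‖(hV.toLp _) z‖ₑ ^ 2 = _
    rw [hz]

theorem norm_le_sum_piLp {ι : Type*} [Fintype ι] (β : ι → Type*)
    [∀ i, SeminormedAddCommGroup (β i)] (x : PiLp 2 β) : ‖x‖ ≤ ∑ i, ‖x i‖ := by
  refine le_of_sq_le_sq ?_ (Finset.sum_nonneg fun _ _ => norm_nonneg _)
  rw [PiLp.norm_sq_eq_of_L2]
  exact Finset.sum_sq_le_sq_sum_of_nonneg fun _ _ => norm_nonneg _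

namespace Partition.Triangulation

variable {L M : ℕ} {G : Partition n L M}

theorem isFiniteMeasure_surf (T : G.Triangulation) (ℓ : Fin (L + 1)) :
    IsFiniteMeasure (G.surf ℓ) := by
  refine ⟨?_⟩
  rw [← lintegral_one, lintegral_surf (T := T)]
  refine ENNReal.sum_lt_top.2 fun t _ => ?_
  rw [lintegral_one, Measure.restrict_apply_univ]
  exact (isBounded_pull t).measure_lt_top

end Partition.Triangulation

theorem sq_sum_le_of_sq_le_mul {ι : Type*} (s : Finset ι) {x a b : ι → ℝ≥0∞}
    (h : ∀ i ∈ s, x i ^ 2 ≤ a i * b i) :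
    (∑ i ∈ s, x i) ^ 2 ≤ (∑ i ∈ s, a i) * ∑ i ∈ s, b i := by
  have hr : ∀ c : ℝ≥0∞, (c ^ (1 / 2 : ℝ)) ^ (2 : ℝ) = c := fun c => by
    rw [← ENNReal.rpow_mul]; norm_num
  have h1 : ∀ i ∈ s, x i ≤ a i ^ (1 / 2 : ℝ) * b i ^ (1 / 2 : ℝ) := fun i hi => by
    rw [← ENNReal.mul_rpow_of_nonneg _ _ (by norm_num)]
    have := ENNReal.rpow_le_rpow (h i hi) (z := 1 / 2) (by norm_num)
    rwa [← ENNReal.rpow_natCast, ← ENNReal.rpow_mul, show ((2 : ℕ) : ℝ) * (1 / 2) = 1 by norm_num,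
      ENNReal.rpow_one] at this
  have h2 := (Finset.sum_le_sum h1).trans (ENNReal.inner_le_Lp_mul_Lq s _ _
    (Real.HolderConjugate.two_two))
  simp only [hr] at h2
  rw [← ENNReal.mul_rpow_of_nonneg _ _ (by norm_num)] at h2
  have h3 := ENNReal.rpow_le_rpow h2 (z := 2) (by norm_num)
  rw [hr] at h3
  simpa using h3

theorem norm_le_of_enorm_sq_le {E : Type*} [SeminormedAddCommGroup E] {x : E} {K : ℝ}
    (hK : 0 ≤ K) (h : ‖x‖ₑ ^ 2 ≤ ENNReal.ofReal (K ^ 2)) : ‖x‖ ≤ K := by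
  rw [enorm_sq_eq_ofReal, ENNReal.ofReal_le_ofReal_iff (by positivity)] at h
  exact le_of_sq_le_sq h hK

/-- From squared estimates in `ℝ≥0∞` to estimates of norms. -/
theorem exists_rate {ι : Type*} [Fintype ι] {C : ℝ≥0∞} (hC : C ≠ ⊤) (r : ℕ) {h : ℝ} (hh : 0 ≤ h)
    {N : ι → ℝ} (hN : ∀ i, 0 ≤ N i) :
    C * ENNReal.ofReal h ^ (2 * r + 3) * ∑ i, ENNReal.ofReal (N i ^ 2) ≤
      ENNReal.ofReal ((Real.sqrt C.toReal * h ^ ((r : ℝ) + 3 / 2) * ∑ i, N i) ^ 2) := by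
  have e : (h ^ ((r : ℝ) + 3 / 2)) ^ 2 = h ^ (2 * r + 3) := by
    rw [← Real.rpow_natCast, ← Real.rpow_mul hh, ← Real.rpow_natCast]
    congr 1
    push_cast
    ring
  rw [mul_pow, mul_pow, e, Real.sq_sqrt ENNReal.toReal_nonneg,
    ENNReal.ofReal_mul (by positivity), ENNReal.ofReal_mul (by positivity),
    ENNReal.ofReal_toReal hC, ENNReal.ofReal_pow hh,
    ← ENNReal.ofReal_sum_of_nonneg fun i _ => sq_nonneg _]
  gcongr
  exact Finset.sum_sq_le_sq_sum_of_nonneg fun i _ => hN i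

theorem memLp_finset_sum_measure {α ι : Type*} [MeasurableSpace α] (s : Finset ι)
    {μ : ι → Measure α} {f : α → ℝ} (h : ∀ i ∈ s, MemLp f 2 (μ i)) : MemLp f 2 (∑ i ∈ s, μ i) := by
  classical
  refine ⟨?_, ?_⟩
  · induction s using Finset.induction_on with
    | empty => simp
    | insert i s hi ih =>
      rw [Finset.sum_insert hi]
      exact (h i (Finset.mem_insert_self i s)).1.add_measure
        (ih fun j hj => h j (Finset.mem_insert_of_mem hj))
  · rw [eLpNorm_lt_top_iff_lintegral_rpow_enorm_lt_top two_ne_zero ENNReal.ofNat_ne_top,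
      lintegral_finsetSum_measure]
    refine ENNReal.sum_lt_top.2 fun i hi => ?_
    rw [← eLpNorm_lt_top_iff_lintegral_rpow_enorm_lt_top two_ne_zero ENNReal.ofNat_ne_top]
    exact (h i hi).2

theorem lintegral_sq_ne_top {α : Type*} [MeasurableSpace α] {μ : Measure α} {f : α → ℝ}
    (hf : MemLp f 2 μ) : ∫⁻ x, ‖f x‖ₑ ^ 2 ∂μ ≠ ⊤ := by
  rw [lintegral_enorm_sq_eq hf]
  exact ENNReal.ofReal_ne_top

namespace Partition.Triangulation

variable {n L M : ℕ} {G : Partition n L M} {T : G.Triangulation}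

theorem memLp_surf {ℓ : Fin (L + 1)} {f : Euc (n + 1) → ℝ}
    (h : ∀ t ∈ T.elemsOn ℓ, MemLp (fun x => f (T.chart t x)) 2 (volume.restrict (T.pull t))) :
    MemLp f 2 (G.surf ℓ) := by
  rw [surf_eq_sum (T := T)]
  exact memLp_finset_sum_measure _ fun t ht =>
    (measurableEmbedding_chart _).memLp_map_measure_iff.2 (h t ht)

theorem memLp_pull {ℓ : Fin (L + 1)} {f : Euc (n + 1) → ℝ} (h : MemLp f 2 (G.surf ℓ)) {t : T.elems}
    (ht : t ∈ T.elemsOn ℓ) :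
    MemLp (fun x => f (T.chart t x)) 2 (volume.restrict (T.pull t)) := by
  rw [surf_eq_sum (T := T)] at h
  refine (measurableEmbedding_chart _).memLp_map_measure_iff.1 (h.mono_measure ?_)
  exact Finset.single_le_sum (f := fun t => (volume.restrict (T.pull t)).map (T.chart t))
    (fun _ _ => Measure.zero_le _) ht

theorem integral_surf {ℓ : Fin (L + 1)} {f : Euc (n + 1) → ℝ} (h : Integrable f (G.surf ℓ)) :
    ∫ x, f x ∂G.surf ℓ = ∑ t ∈ T.elemsOn ℓ, ∫ x in T.pull t, f (T.chart t x) := by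
  rw [surf_eq_sum (T := T)] at h ⊢
  rw [integral_finsetSum_measure (integrable_finsetSum_measure.1 h)]
  exact Finset.sum_congr rfl fun t _ => (measurableEmbedding_chart _).integral_map _

theorem sum_lintegral_pull_le (i : Fin M) (f : Euc n → ℝ≥0∞) :
    ∑ t with T.idx t = i, ∫⁻ x in T.pull t, f x ≤ ∫⁻ x in G.patch i, f x := by
  rw [← lintegral_biUnion_finset]
  · refine lintegral_mono_set (Set.iUnion₂_subset fun t ht => ?_)
    have := (Finset.mem_filter.1 ht).2
    exact this ▸ pull_subset_patch t
  · intro t ht t' ht' hne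
    have h1 := (Finset.mem_filter.1 ht).2
    have h2 := (Finset.mem_filter.1 ht').2
    refine Set.disjoint_left.2 fun x hx hx' => ?_
    have hx2 : T.chart t x ∈ openElem (t' : Finset (Euc (n + 1))) := by
      have : T.chart t = T.chart t' := by rw [chart, chart, h1, h2]
      rw [this]
      exact hx'
    exact Set.disjoint_left.1 (disjoint_openElem hne) hx hx2
  · exact fun t _ => (isOpen_pull t).measurableSet

theorem sum_elemsOn_lintegral_le (ℓ : Fin (L + 1)) (f : Fin M → Euc n → ℝ≥0∞) :
    ∑ t ∈ T.elemsOn ℓ, ∫⁻ x in T.pull t, f (T.idx t) x ≤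
      ∑ i ∈ G.I ℓ, ∫⁻ x in G.patch i, f i x := by
  rw [← Finset.sum_fiberwise_of_maps_to (g := T.idx) (t := G.I ℓ) fun t ht => mem_elemsOn.1 ht]
  refine Finset.sum_le_sum fun i hi => le_trans (le_of_eq ?_) (sum_lintegral_pull_le (T := T) i _)
  have : (T.elemsOn ℓ).filter (fun t => T.idx t = i) = Finset.univ.filter fun t => T.idx t = i := by
    ext t
    simp only [Finset.mem_filter, Finset.mem_univ, true_and, and_iff_right_iff_imp, mem_elemsOn]
    rintro rfl
    exact hi
  rw [this]
  exact Finset.sum_congr rfl fun t ht => by rw [(Finset.mem_filter.1 ht).2]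

/-- The squared Sobolev norms on the elements sum up to the piecewise norm. -/
theorem sum_sobSq_le {k : ℕ} {ℓ : Fin (L + 1)} {f : Lp ℝ 2 (G.surf ℓ)} (hf : G.MemHpw k ℓ f) {j : ℕ}
    (hj : j ≤ k) :
    ∑ t ∈ T.elemsOn ℓ, sobSq (T.pull t) (weakDerivs (G.patch (T.idx t))
      fun x => f (T.chart t x)) j ≤ ENNReal.ofReal (G.normHpw k ℓ f ^ 2) := by
  rw [← sum_sq_normHk_le]
  calc _ = ∑ idx : Fin j → Fin n, ∑ t ∈ T.elemsOn ℓ, ∫⁻ x in T.pull t,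
        ‖weakDerivs (G.patch (T.idx t)) (fun x => f (G.chart (T.idx t) x)) (List.ofFn idx) x‖ₑ ^ 2 :=
        Finset.sum_comm
    _ ≤ ∑ idx : Fin j → Fin n, ∑ i ∈ G.I ℓ, ∫⁻ x in G.patch i,
        ‖weakDerivs (G.patch i) (fun x => f (G.chart i x)) (List.ofFn idx) x‖ₑ ^ 2 :=
        Finset.sum_le_sum fun idx _ => sum_elemsOn_lintegral_le ℓ fun i x =>
          ‖weakDerivs (G.patch i) (fun x => f (G.chart i x)) (List.ofFn idx) x‖ₑ ^ 2
    _ = ∑ i ∈ G.I ℓ, sobSq (G.patch i) (weakDerivs (G.patch i) fun x => f (G.chart i x)) j :=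
        Finset.sum_comm
    _ ≤ _ := Finset.sum_le_sum fun i hi => (hf i hi).sobSq_le hj

theorem sum_lintegral_pull_pull_le (ℓ : Fin (L + 1)) (F : Euc (n + 1) → Euc (n + 1) → ℝ≥0∞) :
    ∑ t ∈ T.elemsOn ℓ, ∫⁻ x in T.pull t, ∫⁻ y in T.pull t, F (T.chart t x) (T.chart t y) ≤
      ∫⁻ x, ∫⁻ y, F x y ∂G.surf ℓ ∂G.surf ℓ := by
  rw [lintegral_surf (T := T)]
  exact Finset.sum_le_sum fun t ht => lintegral_mono fun x => lintegral_pull_le ht _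

/-! ### Tangential coordinates as polynomials -/

variable (T) in
/-- The affine left inverse of the chart of an element. -/
def unchart (t : T.elems) (y : Euc (n + 1)) : Euc n :=
  ∑ v ∈ (t : Finset (Euc (n + 1))), baryFun (t : Finset (Euc (n + 1))) v y • T.vert t v

theorem unchart_chart (t : T.elems) (x : Euc n) : T.unchart t (T.chart t x) = x := by
  refine (T.chart t).injective ?_
  have h := affineMap_sum_smul' (T.chart t).toAffineMap (sum_lam t x) (T.vert t)
  refine h.trans (Eq.trans (Finset.sum_congr rfl fun v hv => ?_) (sum_lam_smul t x))
  congr 1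
  exact chart_vert hv

theorem comp_unchart_mem_polyFn (t : T.elems) {k : ℕ} {p : Euc n → ℝ} (hp : p ∈ polyFn n k) :
    (fun y => p (T.unchart t y)) ∈ polyFn (n + 1) k := by
  refine comp_mem_polyFn hp fun i => ?_
  have : (fun y => T.unchart t y i) = ∑ v ∈ (t : Finset (Euc (n + 1))),
      T.vert t v i • (baryFun (t : Finset (Euc (n + 1))) v : Euc (n + 1) → ℝ) := by
    funext y
    simp [unchart, Finset.sum_apply, mul_comm]
  rw [this]
  exact Submodule.sum_mem _ fun v _ => Submodule.smul_mem _ _ (affine_mem_polyFn _)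

/-! ### Elements of `H^{1/2}` -/

theorem IsPiecewiseSobolev.interpBound_ne_top {ℓ : Fin (L + 1)} {v : Euc (n + 1) → ℝ} {S : ℝ}
    {Gr : T.elems → Fin n → Euc n → ℝ} (hv : IsPiecewiseSobolev T ℓ v S Gr) {h : ℝ} (hh : 0 < h) :
    interpBound T ℓ h v S Gr ≠ ⊤ := by
  have h1 : (ENNReal.ofReal h)⁻¹ ≠ ⊤ := ENNReal.inv_ne_top.2 (by simpa using hh)
  have h2 := lintegral_sq_ne_top (memLp_surf hv.memLp)
  have h3 : ∑ t ∈ T.elemsOn ℓ, ∑ i, ∫⁻ x in T.pull t, ‖Gr t i x‖ₑ ^ 2 ≠ ⊤ :=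
    ENNReal.sum_ne_top.2 fun t ht => ENNReal.sum_ne_top.2 fun i _ =>
      lintegral_sq_ne_top (hv.memLp_grad t ht i)
  rw [interpBound]
  finiteness

/-- The interpolation estimate for the norm of `H^{1/2}`. -/
theorem exists_hHalf_bound (hn : n = 1 ∨ n = 2) (T : G.Triangulation) (ℓ : Fin (L + 1)) (D : ℝ) :
    ∃ C : ℝ≥0∞, C ≠ ⊤ ∧ ∀ h : ℝ, 0 < h → h ≤ D → ∀ v S Gr, IsPiecewiseSobolev T ℓ v S Gr →
      ∃ η : HHalf (G.surf ℓ), ⇑(fnOf η) =ᵐ[G.surf ℓ] v ∧ ‖η‖ₑ ^ 2 ≤ C * interpBound T ℓ h v S Gr := by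
  obtain ⟨C, hC, hb⟩ := exists_slobodeckij_bound hn T ℓ D
  refine ⟨ENNReal.ofReal D + C, by finiteness, fun h hh hD v S Gr hv => ?_⟩
  have hfin := isFiniteMeasure_surf T ℓ
  have h1 := hb h hh hD v S Gr hv
  have h2 : C * interpBound T ℓ h v S Gr ≠ ⊤ := ENNReal.mul_ne_top hC (hv.interpBound_ne_top hh)
  obtain ⟨η, h3, h4⟩ := exists_hHalf (memLp_surf hv.memLp) (ne_top_of_le_ne_top h2 h1)
  refine ⟨η, h3, h4.trans_le ?_⟩
  rw [add_mul]
  refine add_le_add ?_ h1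
  have hh0 : ENNReal.ofReal h ≠ 0 := by simpa using hh
  calc ∫⁻ x, ‖v x‖ₑ ^ 2 ∂G.surf ℓ
      = ENNReal.ofReal h * ((ENNReal.ofReal h)⁻¹ * ∫⁻ x, ‖v x‖ₑ ^ 2 ∂G.surf ℓ) := by
        rw [← mul_assoc, ENNReal.mul_inv_cancel hh0 ENNReal.ofReal_ne_top, one_mul]
    _ ≤ ENNReal.ofReal D * interpBound T ℓ h v S Gr := by
        gcongr
        exact le_self_add.trans le_self_add

theorem contDiff_chart (t : T.elems) : ContDiff ℝ ∞ (T.chart t) := by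
  have : ⇑(T.chart t) = fun x => (T.chart t).linearIsometry x + T.chart t 0 := by
    funext x
    simpa using (T.chart t).map_vadd 0 x
  rw [this]
  exact (T.chart t).linearIsometry.toContinuousLinearMap.contDiff.add contDiff_const

theorem isPiecewiseSobolev_of_isTest (ℓ : Fin (L + 1)) {w : Euc (n + 1) → ℝ} (hw : IsTest w) :
    ∃ S Gr, IsPiecewiseSobolev T ℓ w S Gr := by
  obtain ⟨S, hS⟩ := hw.2.exists_bound_of_continuous hw.1.continuous
  have hd : ∀ t : T.elems, ContDiff ℝ ∞ fun x => w (T.chart t x) := fun t =>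
    hw.1.comp (contDiff_chart t)
  have hD := fun t : T.elems => hasWeakDerivs_of_contDiff (isOpen_pull t) (isBounded_pull t) (hd t) 1
  exact ⟨S, fun t i => dlist [i] fun x => w (T.chart t x), hw.1.continuous.measurable,
    hw.1.continuous.continuousOn, ae_of_all _ hS, fun t _ => (hD t [] (by simp)).1,
    fun t _ i => (hD t [i] (by simp)).1, fun t _ => (hD t).hasWeakGrad (l := []) (by simp)⟩

/-- `IsNormalTrace` pairs φ only with elements of H^{1/2} that represent the boundary values of w;
this provides such an element. -/
theorem exists_hHalf_of_isTest (hn : n = 1 ∨ n = 2) (T : G.Triangulation) (ℓ : Fin (L + 1))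
    {w : Euc (n + 1) → ℝ} (hw : IsTest w) : ∃ η : HHalf (G.surf ℓ), ⇑(fnOf η) =ᵐ[G.surf ℓ] w := by
  obtain ⟨C, -, hb⟩ := exists_hHalf_bound hn T ℓ 1
  obtain ⟨S, Gr, h⟩ := isPiecewiseSobolev_of_isTest (T := T) ℓ hw
  obtain ⟨η, hη, -⟩ := hb 1 one_pos le_rfl w S Gr h
  exact ⟨η, hη⟩

end Partition.Triangulation

/-! ### Neumann data: cancellation of normal traces -/

theorem ofL2_apply {n : ℕ} {σ : Measure (Euc (n + 1))} (f : Lp ℝ 2 σ) (η : HHalf σ) :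
    ofL2 f η = ∫ x, f x * fnOf η x ∂σ := by
  change inner ℝ f (fnOf η) = _
  rw [L2.inner_def]
  refine integral_congr_ae (ae_of_all _ fun x => ?_)
  simp [mul_comm]

theorem integrable_fderiv_apply {w : Euc m → ℝ} (hw : IsTest w) {v : Euc m → Euc m}
    (hv : MemLp v 2 volume) : Integrable (fun x => fderiv ℝ w x (v x)) volume := by
  have hc : Continuous (fderiv ℝ w) := hw.1.continuous_fderiv (by simp)
  have hs : HasCompactSupport (fderiv ℝ w) := hw.2.fderiv ℝ
  have h1 : MemLp (fderiv ℝ w) 2 volume := hc.memLp_of_hasCompactSupport hs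
  refine (h1.norm.integrable_mul hv.norm).mono' ?_ (ae_of_all _ fun x => ?_)
  · exact isBoundedBilinearMap_apply.continuous.comp_aestronglyMeasurable
      (hc.aestronglyMeasurable.prodMk hv.1)
  · exact (fderiv ℝ w x).le_opNorm (v x)

namespace Partition

variable {n L M : ℕ} {G : Partition n L M}

theorem isOpen_dom (ℓ : Fin (L + 1)) : IsOpen (G.dom ℓ) := by
  refine Fin.cases ?_ (fun j => ?_) ℓ
  · exact (isClosed_iUnion_of_finite fun _ => isClosed_closure).isOpen_compl
  · exact (G.lipschitz j).1

theorem disjoint_dom : Pairwise fun ℓ j => Disjoint (G.dom ℓ) (G.dom j) := by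
  have h0 : ∀ j : Fin L, Disjoint (G.dom 0) (G.dom j.succ) := fun j =>
    Set.disjoint_left.2 fun x hx hxj => hx (Set.mem_iUnion.2 ⟨j, subset_closure hxj⟩)
  intro ℓ j
  refine Fin.cases (fun h => ?_) (fun ℓ h => ?_) ℓ
  · revert h
    refine Fin.cases (fun h => absurd rfl h) (fun j _ => h0 j) j
  · revert h
    refine Fin.cases (fun _ => (h0 ℓ).symm) (fun j h => ?_) j
    exact G.disjoint fun e => h (congrArg Fin.succ e)

theorem compl_iUnion_dom_subset : (⋃ ℓ, G.dom ℓ)ᶜ ⊆ G.skeleton := by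
  intro x hx
  rw [Set.mem_compl_iff, Set.mem_iUnion, not_exists] at hx
  have h0 : x ∈ ⋃ ℓ, closure (G.Ω ℓ) := by
    by_contra h
    exact hx 0 h
  obtain ⟨j, hj⟩ := Set.mem_iUnion.1 h0
  refine Set.mem_iUnion.2 ⟨j, hj, fun h => hx j.succ (interior_subset h)⟩

namespace Triangulation

variable {T : G.Triangulation}

/-- Γ is covered by the finitely many hyperplanes of its elements. -/
theorem volume_skeleton (T : G.Triangulation) : volume G.skeleton = 0 := by
  refine measure_mono_null (t := ⋃ t : T.elems, Set.range (T.chart t)) (fun x hx => ?_) ?_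
  · obtain ⟨t, ht⟩ := skeleton_subset (T := T) hx
    exact Set.mem_iUnion.2 ⟨t, closedElem_subset_range t ht⟩
  · refine measure_iUnion_null fun t => ?_
    rw [← coe_chartRange]
    refine Measure.addHaar_affineSubspace _ _ fun h => ?_
    have h1 := finrank_chartRange (T.chart t)
    rw [h, AffineSubspace.direction_top, finrank_top, finrank_euclideanSpace_fin] at h1
    omega

theorem sum_setIntegral_dom (T : G.Triangulation) {I : Euc (n + 1) → ℝ} (hI : Integrable I volume) :
    ∑ ℓ, ∫ x in G.dom ℓ, I x = ∫ x, I x := by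
  rw [← integral_iUnion_fintype (fun ℓ => (isOpen_dom ℓ).measurableSet) disjoint_dom
    fun ℓ => hI.integrableOn]
  have : (⋃ ℓ, G.dom ℓ) =ᵐ[volume] Set.univ := by
    rw [ae_eq_univ]
    exact measure_mono_null compl_iUnion_dom_subset (volume_skeleton T)
  rw [setIntegral_congr_set this, setIntegral_univ]

/-- The normal traces of a field in `H(div)` on the two sides of the skeleton cancel. -/
theorem sum_integral_eq_zero (hn : n = 1 ∨ n = 2) (T : G.Triangulation) {φ : G.ProdHNegHalf}
    (hφ : φ ∈ G.X) {f : (ℓ : Fin (L + 1)) → Lp ℝ 2 (G.surf ℓ)} (hf : ∀ ℓ, φ ℓ = ofL2 (f ℓ))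
    {w : Euc (n + 1) → ℝ} (hw : IsTest w) : ∑ ℓ, ∫ x, f ℓ x * w x ∂G.surf ℓ = 0 := by
  obtain ⟨v, D, ⟨hv, hD, hdiv⟩, htr⟩ := hφ
  choose η hη using fun ℓ => exists_hHalf_of_isTest hn T ℓ hw
  have hwL : MemLp w 2 volume := hw.1.continuous.memLp_of_hasCompactSupport hw.2
  have h1 := integrable_fderiv_apply hw hv
  have h2 : Integrable (fun x => D x * w x) volume := hD.integrable_mul hwL
  calc ∑ ℓ, ∫ x, f ℓ x * w x ∂G.surf ℓ = ∑ ℓ, φ ℓ (η ℓ) := by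
        refine Finset.sum_congr rfl fun ℓ _ => ?_
        rw [hf ℓ, ofL2_apply]
        refine integral_congr_ae ?_
        filter_upwards [hη ℓ] with x hx
        rw [hx]
    _ = ∑ ℓ, ∫ x in G.dom ℓ, (fderiv ℝ w x (v x) + D x * w x) :=
        Finset.sum_congr rfl fun ℓ _ => htr ℓ w hw (η ℓ) (hη ℓ)
    _ = ∫ x, (fderiv ℝ w x (v x) + D x * w x) := sum_setIntegral_dom T (h1.add h2)
    _ = 0 := by rw [integral_add h1 h2, hdiv w hw, neg_add_cancel]

/-- The fundamental lemma of the calculus of variations on one element. Tests with smooth functions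
on ℝⁿ⁺¹ suffice, since their supports can avoid all other elements. -/
theorem ae_sum_eq_zero (T : G.Triangulation) {f : (ℓ : Fin (L + 1)) → Lp ℝ 2 (G.surf ℓ)}
    (h : ∀ w : Euc (n + 1) → ℝ, IsTest w → ∑ ℓ, ∫ x, f ℓ x * w x ∂G.surf ℓ = 0) (t : T.elems) :
    ∀ᵐ x ∂volume.restrict (T.pull t), ∑ ℓ with T.idx t ∈ G.I ℓ, f ℓ (T.chart t x) = 0 := by
  set μ := (volume.restrict (T.pull t)).map (T.chart t) with hμ
  have hemb := measurableEmbedding_chart (T.chart t)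
  have hfin : IsFiniteMeasure (volume.restrict (T.pull t)) :=
    ⟨by simpa using (isBounded_pull t).measure_lt_top⟩
  have hμfin : IsFiniteMeasure μ := by rw [hμ]; infer_instance
  -- The complement of the other closed elements. It is open because they are finitely many, and it
  -- contains the open element t.
  set V : Set (Euc (n + 1)) := ⋂ t' : {t' : T.elems // t' ≠ t},
    (closedElem (t'.1 : Finset (Euc (n + 1))))ᶜ with hV
  have hVo : IsOpen V := isOpen_iInter_of_finite fun t' => (isCompact_closedElem _).isClosed.isOpen_compl
  have hfL : ∀ ℓ, T.idx t ∈ G.I ℓ →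
      MemLp (fun x => f ℓ (T.chart t x)) 2 (volume.restrict (T.pull t)) := fun ℓ hℓ =>
    memLp_pull (Lp.memLp (f ℓ)) (mem_elemsOn.2 hℓ)
  have hloc : LocallyIntegrableOn (fun y => ∑ ℓ with T.idx t ∈ G.I ℓ, f ℓ y) V μ := by
    have : Integrable (fun y => ∑ ℓ with T.idx t ∈ G.I ℓ, f ℓ y) μ := by
      refine integrable_finsetSum _ fun ℓ hℓ => hemb.integrable_map_iff.2 ?_
      exact (hfL ℓ (Finset.mem_filter.1 hℓ).2).integrable (by norm_num)
    exact this.locallyIntegrable.locallyIntegrableOn V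
  have key := hVo.ae_eq_zero_of_integral_contDiff_smul_eq_zero hloc fun w hw1 hw2 hw3 => by
    have hw : IsTest w := ⟨hw1, hw2⟩
    have hwL : ∀ t' : T.elems, MemLp (fun x => w (T.chart t' x)) 2 (volume.restrict (T.pull t')) :=
      fun t' => Continuous.memLp_restrict_bounded (hw1.continuous.comp (T.chart t').continuous)
        (isOpen_pull t').measurableSet (isBounded_pull t')
    rw [hμ, hemb.integral_map, ← h w hw]
    simp only [smul_eq_mul, Finset.mul_sum]
    have hprod : ∀ ℓ ∈ Finset.univ.filter fun ℓ => T.idx t ∈ G.I ℓ, Integrable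
        (fun x => w (T.chart t x) * f ℓ (T.chart t x)) (volume.restrict (T.pull t)) :=
      fun ℓ hℓ => (hwL t).integrable_mul (hfL ℓ (Finset.mem_filter.1 hℓ).2)
    rw [integral_finsetSum _ hprod, Finset.sum_filter]
    refine Finset.sum_congr rfl fun ℓ _ => ?_
    have hint : Integrable (fun x => f ℓ x * w x) (G.surf ℓ) :=
      (Lp.memLp (f ℓ)).integrable_mul (memLp_surf fun t' _ => hwL t')
    rw [integral_surf (T := T) hint]
    have hz : ∀ t' ∈ T.elemsOn ℓ, t' ≠ t →
        ∫ x in T.pull t', f ℓ (T.chart t' x) * w (T.chart t' x) = 0 := fun t' _ hne => by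
      rw [setIntegral_congr_fun (g := fun _ => (0 : ℝ)) (isOpen_pull t').measurableSet]
      · simp
      · intro x hx
        have : w (T.chart t' x) = 0 := by
          refine image_eq_zero_of_notMem_tsupport fun hxw => ?_
          exact Set.mem_iInter.1 (hw3 hxw) ⟨t', hne⟩ (openElem_subset_closedElem _ hx)
        simp [this]
    split_ifs with hℓ
    · rw [Finset.sum_eq_single t hz fun h => absurd (mem_elemsOn.2 hℓ) h]
      simp only [mul_comm]
    · rw [Finset.sum_eq_zero fun t' ht' => hz t' ht' fun e => hℓ (mem_elemsOn.1 (e ▸ ht'))]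
  have key2 := hemb.ae_map_iff.1 key
  refine ((ae_restrict_iff' (isOpen_pull t).measurableSet).2 (ae_of_all _ fun x hx => ?_)
    : ∀ᵐ x ∂volume.restrict (T.pull t), T.chart t x ∈ V).mp (key2.mono fun x h1 h2 => h1 h2)
  exact Set.mem_iInter.2 fun t' hx' =>
    Set.disjoint_left.1 (openElem_inter_closedElem (Ne.symm t'.2)) hx hx'

/-- Three subdomains cannot share a face: three pairwise opposite numbers are zero, while the signs
are ±1. The cancelling sum therefore has just the two terms ℓ and j, so f_j = -f_ℓ, and the signs
are opposite as well. -/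
theorem ae_sign_mul_eq (T : G.Triangulation) (S : G.SignSystem)
    {f : (ℓ : Fin (L + 1)) → Lp ℝ 2 (G.surf ℓ)} {t : T.elems}
    (h : ∀ᵐ x ∂volume.restrict (T.pull t), ∑ ℓ with T.idx t ∈ G.I ℓ, f ℓ (T.chart t x) = 0)
    {ℓ j : Fin (L + 1)} (hℓ : T.idx t ∈ G.I ℓ) (hj : T.idx t ∈ G.I j) :
    ∀ᵐ x ∂volume.restrict (T.pull t), f j (T.chart t x) =
      (S.s j (T.idx t) : ℝ) * ((S.s ℓ (T.idx t) : ℝ) * f ℓ (T.chart t x)) := by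
  have hsq : ∀ ℓ, T.idx t ∈ G.I ℓ → (S.s ℓ (T.idx t) : ℝ) * S.s ℓ (T.idx t) = 1 := fun ℓ hℓ => by
    have := S.abs_eq_one ℓ _ hℓ
    have h2 : S.s ℓ (T.idx t) * S.s ℓ (T.idx t) = 1 := by
      rw [← abs_mul_abs_self, this, one_mul]
    exact_mod_cast h2
  rcases eq_or_ne ℓ j with rfl | hne
  · refine ae_of_all _ fun x => ?_
    rw [← mul_assoc, hsq ℓ hℓ, one_mul]
  · have hset : (Finset.univ.filter fun ℓ => T.idx t ∈ G.I ℓ) = {ℓ, j} := by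
      ext k
      simp only [Finset.mem_filter, Finset.mem_univ, true_and, Finset.mem_insert,
        Finset.mem_singleton]
      constructor
      · intro hk
        by_contra! hcon
        have a1 := S.opposite ℓ j hne _ hℓ hj
        have a2 := S.opposite k ℓ hcon.1 _ hk hℓ
        have a3 := S.opposite k j hcon.2 _ hk hj
        have a4 := S.abs_eq_one ℓ _ hℓ
        have : S.s ℓ (T.idx t) = 0 := by omega
        rw [this] at a4
        simp at a4
      · rintro (rfl | rfl) <;> assumption
    rw [hset] at h
    have hopp : (S.s j (T.idx t) : ℝ) = -S.s ℓ (T.idx t) := by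
      have := S.opposite ℓ j hne _ hℓ hj
      rw [eq_neg_iff_add_eq_zero, add_comm]
      exact_mod_cast this
    filter_upwards [h] with x hx
    rw [Finset.sum_pair hne] at hx
    rw [hopp, ← mul_assoc, neg_mul, hsq ℓ hℓ]
    linarith

end Triangulation

end Partition

/-! ### Neumann data: local means and the dual norm -/

/-- The pairing with a function of vanishing mean only sees differences. -/
theorem measure_mul_enorm_integral_mul_sq_le {α : Type*} [MeasurableSpace α] {μ : Measure α}
    [IsFiniteMeasure μ] {g η : α → ℝ} (hg : MemLp g 2 μ) (hη : MemLp η 2 μ)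
    (h0 : ∫ x, g x ∂μ = 0) : μ Set.univ * ‖∫ x, g x * η x ∂μ‖ₑ ^ 2 ≤
      (∫⁻ x, ‖g x‖ₑ ^ 2 ∂μ) * ∫⁻ x, ∫⁻ y, ‖η x - η y‖ₑ ^ 2 ∂μ ∂μ := by
  rcases eq_or_ne (μ Set.univ) 0 with hμ | hμ
  · simp [hμ]
  have hgi : Integrable g μ := hg.integrable (by norm_num)
  have hηi : Integrable η μ := hη.integrable (by norm_num)
  have hgη : Integrable (fun x => g x * η x) μ := hg.integrable_mul hη
  -- Since g has mean zero, η(x) may be replaced by the average of η(x) - η(y) over y.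
  have h1 : μ.real Set.univ * ∫ x, g x * η x ∂μ = ∫ x, g x * ∫ y, (η x - η y) ∂μ ∂μ := by
    have : ∀ x, g x * ∫ y, (η x - η y) ∂μ =
        μ.real Set.univ * (g x * η x) - g x * ∫ y, η y ∂μ := fun x => by
      rw [integral_sub (integrable_const _) hηi, integral_const, smul_eq_mul]
      ring
    simp only [this]
    rw [integral_sub (hgη.const_mul _) (hgi.mul_const _), integral_mul_const, h0,
      integral_const_mul]
    ring
  have hm : AEMeasurable (fun x => ‖∫ y, (η x - η y) ∂μ‖ₑ) μ := by
    have : ∀ x, ∫ y, (η x - η y) ∂μ = μ.real Set.univ * η x - ∫ y, η y ∂μ := fun x => by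
      rw [integral_sub (integrable_const _) hηi, integral_const, smul_eq_mul]
    simp only [this]
    exact ((hη.1.aemeasurable.const_mul _).sub_const _).enorm
  have h2 : μ Set.univ * ‖∫ x, g x * η x ∂μ‖ₑ ≤
      ∫⁻ x, ‖g x‖ₑ * ‖∫ y, (η x - η y) ∂μ‖ₑ ∂μ := by
    calc _ = ‖μ.real Set.univ * ∫ x, g x * η x ∂μ‖ₑ := by
          rw [enorm_mul, Real.enorm_of_nonneg measureReal_nonneg, ofReal_measureReal]
      _ ≤ _ := by
          rw [h1]
          refine (enorm_integral_le_lintegral_enorm _).trans_eq ?_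
          simp only [enorm_mul]
  have h3 : ∀ x, ‖∫ y, (η x - η y) ∂μ‖ₑ ^ 2 ≤ μ Set.univ * ∫⁻ y, ‖η x - η y‖ₑ ^ 2 ∂μ := fun x =>
    (pow_le_pow_left₀ zero_le (enorm_integral_le_lintegral_enorm _) 2).trans
      (sq_lintegral_le (hη.1.aemeasurable.const_sub (η x)).enorm)
  have h4 : μ Set.univ * (μ Set.univ * ‖∫ x, g x * η x ∂μ‖ₑ ^ 2) ≤ μ Set.univ *
      ((∫⁻ x, ‖g x‖ₑ ^ 2 ∂μ) * ∫⁻ x, ∫⁻ y, ‖η x - η y‖ₑ ^ 2 ∂μ ∂μ) := by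
    calc _ = (μ Set.univ * ‖∫ x, g x * η x ∂μ‖ₑ) ^ 2 := by ring
      _ ≤ (∫⁻ x, ‖g x‖ₑ * ‖∫ y, (η x - η y) ∂μ‖ₑ ∂μ) ^ 2 := by gcongr
      _ ≤ (∫⁻ x, ‖g x‖ₑ ^ 2 ∂μ) * ∫⁻ x, ‖∫ y, (η x - η y) ∂μ‖ₑ ^ 2 ∂μ :=
          sq_lintegral_mul_le hg.1.aemeasurable.enorm hm
      _ ≤ (∫⁻ x, ‖g x‖ₑ ^ 2 ∂μ) * ∫⁻ x, μ Set.univ * ∫⁻ y, ‖η x - η y‖ₑ ^ 2 ∂μ ∂μ := by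
          gcongr with x
          exact h3 x
      _ = _ := by
          rw [lintegral_const_mul' _ _ (measure_ne_top μ _)]
          ring
  exact (ENNReal.mul_le_mul_iff_right hμ (measure_ne_top μ _)).1 h4

namespace Partition.Triangulation

variable {n L M : ℕ} {G : Partition n L M} {T : G.Triangulation} {κ : ℝ}

theorem exists_elem_poly (hn : 1 ≤ n) (hT : T.ShapeRegular κ) {r : ℕ} {ℓ : Fin (L + 1)}
    {f : Lp ℝ 2 (G.surf ℓ)} (hf : G.MemHpw (r + 1) ℓ f) {t : T.elems} (ht : t ∈ T.elemsOn ℓ) :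
    ∃ p ∈ polyFn n r, ∫ x in T.pull t, (f (T.chart t x) - p x) = 0 ∧
      HasWeakDerivs (T.pull t) (r + 1) ((fun x => f (T.chart t x)) - p)
        (fun l => weakDerivs (G.patch (T.idx t)) (fun x => f (T.chart t x)) l - dlist l p) ∧
      ∀ i j, i + j = r + 1 → sobSq (T.pull t)
        (fun l => weakDerivs (G.patch (T.idx t)) (fun x => f (T.chart t x)) l - dlist l p) j ≤
        (2 * ENNReal.ofReal ((2 * κ) ^ n) * ENNReal.ofReal (size t) ^ 2) ^ i *
          sobSq (T.pull t) (weakDerivs (G.patch (T.idx t)) fun x => f (T.chart t x)) (r + 1) := by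
  have h1 : MemHk (r + 1) (G.patch (T.idx t)) fun x => f (T.chart t x) := hf _ (mem_elemsOn.1 ht)
  exact exists_poly_approx (isOpen_pull t) (convex_pull t) (isBounded_pull t) (pull_nonempty t)
    (h1.1.mono_measure (Measure.restrict_mono (pull_subset_patch t) le_rfl))
    (h1.hasWeakDerivs.restrict (G.isOpen_patch _) (isOpen_pull t) (pull_subset_patch t))
    (fun x hx y hy => dist_le_size (pull_subset_cpull t hx) (pull_subset_cpull t hy))
    (hT.volume_le hn t)

/-- The function that is given on each open element in tangential coordinates. -/
def piecewise (T : G.Triangulation) (p : T.elems → Euc n → ℝ) (y : Euc (n + 1)) : ℝ :=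
  ∑ t : T.elems, (openElem (t : Finset (Euc (n + 1)))).indicator (fun y => p t (T.unchart t y)) y

theorem piecewise_eq {p : T.elems → Euc n → ℝ} {t : T.elems} {y : Euc (n + 1)}
    (hy : y ∈ openElem (t : Finset (Euc (n + 1)))) :
    T.piecewise p y = p t (T.unchart t y) := by
  rw [piecewise, Finset.sum_eq_single t, Set.indicator_of_mem hy]
  · intro t' _ hne
    exact Set.indicator_of_notMem (fun h => Set.disjoint_left.1 (disjoint_openElem hne) h hy) _
  · exact fun h => absurd (Finset.mem_univ t) h

theorem piecewise_chart {p : T.elems → Euc n → ℝ} {t : T.elems} {x : Euc n} (hx : x ∈ T.pull t) :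
    T.piecewise p (T.chart t x) = p t x := by
  rw [piecewise_eq hx, unchart_chart]

theorem piecewise_mem_Ph {p : T.elems → Euc n → ℝ} {k : ℕ} (hp : ∀ t, p t ∈ polyFn n k) :
    T.piecewise p ∈ T.Ph k := by
  intro t ht
  obtain ⟨q, hq, h⟩ := comp_unchart_mem_polyFn ⟨t, ht⟩ (hp ⟨t, ht⟩)
  exact ⟨q, hq, fun x hx => (piecewise_eq (t := ⟨t, ht⟩) hx).trans (h x)⟩

theorem signFn_chart (S : G.SignSystem) (ℓ : Fin (L + 1)) {t : T.elems} {x : Euc n}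
    (hx : x ∈ T.pull t) : S.fn ℓ (T.chart t x) = S.s ℓ (T.idx t) := by
  have hxf : T.chart t x ∈ G.face (T.idx t) := openElem_subset_face t hx
  rw [SignSystem.fn, Finset.sum_eq_single (T.idx t), Set.indicator_of_mem hxf]
  · intro i _ hne
    exact Set.indicator_of_notMem (fun h => Set.disjoint_left.1 (G.disjoint_face hne) h hxf) _
  · exact fun h => absurd (Finset.mem_univ _) h

/-- Within an element 1 ≤ (size t)ⁿ⁺¹ |x - y|^{-(n+1)}, and by shape regularity n of these powers
are absorbed by the measure of the element. The remaining power is the square of the gained half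
order. -/
theorem ShapeRegular.lintegral_sub_sq_le (hn : 1 ≤ n) (hT : T.ShapeRegular κ) (t : T.elems)
    (η : Euc (n + 1) → ℝ) :
    ∫⁻ x in T.pull t, ∫⁻ y in T.pull t, ‖η (T.chart t x) - η (T.chart t y)‖ₑ ^ 2 ≤
      volume (T.pull t) * ((volume (Metric.ball (0 : Euc n) 1))⁻¹ * ENNReal.ofReal ((2 * κ) ^ n) *
        ENNReal.ofReal (size t) * ∫⁻ x in T.pull t, ∫⁻ y in T.pull t,
          kern n ‖T.chart t x - T.chart t y‖ * ‖η (T.chart t x) - η (T.chart t y)‖ₑ ^ 2) := by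
  have hs := size_pos hn t
  have hω0 : volume (Metric.ball (0 : Euc n) 1) ≠ 0 := (Metric.measure_ball_pos _ _ one_pos).ne'
  have hω1 : volume (Metric.ball (0 : Euc n) 1) ≠ ⊤ := measure_ball_lt_top.ne
  have hv := hT.volume_le hn t
  rw [Measure.addHaar_closedBall _ _ hs.le, finrank_euclideanSpace_fin] at hv
  have h1 : ENNReal.ofReal (size t ^ n) ≤ (volume (Metric.ball (0 : Euc n) 1))⁻¹ *
      (ENNReal.ofReal ((2 * κ) ^ n) * volume (T.pull t)) := by
    rw [mul_comm, ← div_eq_mul_inv]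
    exact (ENNReal.le_div_iff_mul_le (Or.inl hω0) (Or.inl hω1)).2 hv
  have h2 : ∀ x ∈ T.pull t, ∀ y ∈ T.pull t, ‖η (T.chart t x) - η (T.chart t y)‖ₑ ^ 2 ≤
      ENNReal.ofReal (size t ^ (n + 1)) * (kern n ‖T.chart t x - T.chart t y‖ *
        ‖η (T.chart t x) - η (T.chart t y)‖ₑ ^ 2) := by
    intro x hx y hy
    rcases eq_or_ne x y with rfl | hne
    · simp
    have hd : 0 < ‖T.chart t x - T.chart t y‖ := by
      rw [norm_chart_sub]
      exact norm_pos_iff.2 (sub_ne_zero.2 hne)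
    have hle : ‖T.chart t x - T.chart t y‖ ≤ size t := by
      rw [norm_chart_sub, ← dist_eq_norm]
      exact dist_le_size (pull_subset_cpull t hx) (pull_subset_cpull t hy)
    rw [← mul_assoc]
    refine le_mul_of_one_le_left zero_le ?_
    rw [kern, ← ENNReal.ofReal_mul (by positivity), ENNReal.one_le_ofReal, ← div_eq_mul_inv,
      one_le_div (by positivity)]
    exact pow_le_pow_left₀ hd.le hle _
  calc _ ≤ ∫⁻ x in T.pull t, ∫⁻ y in T.pull t, ENNReal.ofReal (size t ^ (n + 1)) *
        (kern n ‖T.chart t x - T.chart t y‖ * ‖η (T.chart t x) - η (T.chart t y)‖ₑ ^ 2) :=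
        setLIntegral_mono' (isOpen_pull t).measurableSet fun x hx =>
          setLIntegral_mono' (isOpen_pull t).measurableSet fun y hy => h2 x hx y hy
    _ = ENNReal.ofReal (size t ^ n) * ENNReal.ofReal (size t) *
        ∫⁻ x in T.pull t, ∫⁻ y in T.pull t,
          kern n ‖T.chart t x - T.chart t y‖ * ‖η (T.chart t x) - η (T.chart t y)‖ₑ ^ 2 := by
        rw [← ENNReal.ofReal_mul (by positivity), ← pow_succ,
          ← lintegral_const_mul' _ _ ENNReal.ofReal_ne_top]
        exact lintegral_congr fun x => lintegral_const_mul' _ _ ENNReal.ofReal_ne_top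
    _ ≤ _ := by
        refine (mul_le_mul_left (mul_le_mul_left h1 _) _).trans (le_of_eq ?_)
        ring

/-- Functions with vanishing mean on the elements are small in `H^{-1/2}`. -/
theorem ShapeRegular.enorm_ofL2_apply_sq_le (hn : 1 ≤ n) (hT : T.ShapeRegular κ) {ℓ : Fin (L + 1)}
    {g : Lp ℝ 2 (G.surf ℓ)} (hg : ∀ t ∈ T.elemsOn ℓ, ∫ x in T.pull t, g (T.chart t x) = 0)
    (η : HHalf (G.surf ℓ)) : ‖ofL2 g η‖ₑ ^ 2 ≤
      (volume (Metric.ball (0 : Euc n) 1))⁻¹ * ENNReal.ofReal ((2 * κ) ^ n) *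
        ENNReal.ofReal T.meshSize * (∫⁻ x, ‖g x‖ₑ ^ 2 ∂G.surf ℓ) * ‖η‖ₑ ^ 2 := by
  have hfin := isFiniteMeasure_surf T ℓ
  obtain ⟨B, hB⟩ : ∃ B, B = (volume (Metric.ball (0 : Euc n) 1))⁻¹ *
    ENNReal.ofReal ((2 * κ) ^ n) := ⟨_, rfl⟩
  rw [← hB]
  have hgη : Integrable (fun x => g x * fnOf η x) (G.surf ℓ) :=
    (Lp.memLp g).integrable_mul (Lp.memLp (fnOf η))
  rw [ofL2_apply, integral_surf (T := T) hgη]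
  set k : T.elems → ℝ≥0∞ := fun t => ∫⁻ x in T.pull t, ∫⁻ y in T.pull t,
    kern n ‖T.chart t x - T.chart t y‖ * ‖fnOf η (T.chart t x) - fnOf η (T.chart t y)‖ₑ ^ 2
  set a : T.elems → ℝ≥0∞ := fun t => ∫⁻ x in T.pull t, ‖g (T.chart t x)‖ₑ ^ 2
  have h1 : ∀ t ∈ T.elemsOn ℓ, ‖∫ x in T.pull t, g (T.chart t x) * fnOf η (T.chart t x)‖ₑ ^ 2 ≤
      a t * (B * ENNReal.ofReal T.meshSize * k t) := by
    intro t ht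
    have hft : IsFiniteMeasure (volume.restrict (T.pull t)) :=
      ⟨by simpa using (isBounded_pull t).measure_lt_top⟩
    have h2 := measure_mul_enorm_integral_mul_sq_le (memLp_pull (Lp.memLp g) ht)
      (memLp_pull (Lp.memLp (fnOf η)) ht) (hg t ht)
    rw [Measure.restrict_apply_univ] at h2
    have h3 : volume (T.pull t) ≠ 0 := ((isOpen_pull t).measure_pos volume (pull_nonempty t)).ne'
    refine (ENNReal.mul_le_mul_iff_right h3 (isBounded_pull t).measure_lt_top.ne).1 (h2.trans ?_)
    calc _ ≤ a t * (volume (T.pull t) * (B * ENNReal.ofReal (size t) * k t)) := by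
          rw [hB]
          exact mul_le_mul_right (hT.lintegral_sub_sq_le hn t (fnOf η)) _
      _ ≤ a t * (volume (T.pull t) * (B * ENNReal.ofReal T.meshSize * k t)) := by
          gcongr
          exact size_le_meshSize t
      _ = _ := by ring
  calc _ ≤ (∑ t ∈ T.elemsOn ℓ, ‖∫ x in T.pull t, g (T.chart t x) * fnOf η (T.chart t x)‖ₑ) ^ 2 := by
        gcongr
        exact enorm_sum_le _ _
    _ ≤ (∑ t ∈ T.elemsOn ℓ, a t) * ∑ t ∈ T.elemsOn ℓ, B * ENNReal.ofReal T.meshSize * k t :=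
        sq_sum_le_of_sq_le_mul _ h1
    _ = B * ENNReal.ofReal T.meshSize * (∑ t ∈ T.elemsOn ℓ, a t) * ∑ t ∈ T.elemsOn ℓ, k t := by
        rw [← Finset.mul_sum]; ring
    _ ≤ _ := by
        rw [← lintegral_surf (T := T) ℓ fun x => ‖g x‖ₑ ^ 2]
        gcongr
        refine (sum_lintegral_pull_pull_le ℓ fun x y =>
          kern n ‖x - y‖ * ‖fnOf η x - fnOf η y‖ₑ ^ 2).trans ?_
        rw [HHalf.enorm_sq_eq]
        exact le_add_self

end Partition.Triangulation

theorem ofL2_sub {n : ℕ} {σ : Measure (Euc (n + 1))} (f g : Lp ℝ 2 σ) :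
    ofL2 (f - g) = ofL2 f - ofL2 g := by
  simp only [ofL2, map_sub, ContinuousLinearMap.sub_comp]

namespace Partition.Triangulation

variable {n L M : ℕ} {G : Partition n L M} {T : G.Triangulation} {κ : ℝ}

theorem HasWeakDerivs_sobSq_zero {U : Set (Euc n)} (hU : IsOpen U) {k : ℕ} {u : Euc n → ℝ}
    {g : List (Fin n) → Euc n → ℝ} (h : HasWeakDerivs U k u g)
    (hu : MemLp u 2 (volume.restrict U)) : ∫⁻ x in U, ‖u x‖ₑ ^ 2 = sobSq U g 0 := by
  rw [sobSq_zero]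
  refine lintegral_congr_ae ?_
  filter_upwards [h.ae_eq_nil hU hu] with x hx
  rw [hx]

theorem memLp_poly {k : ℕ} {p : Euc n → ℝ} (hp : p ∈ polyFn n k) (t : T.elems) :
    MemLp p 2 (volume.restrict (T.pull t)) :=
  Continuous.memLp_restrict_bounded (contDiff_of_mem_polyFn hp).continuous
    (isOpen_pull t).measurableSet (isBounded_pull t)

/-- The common polynomial approximation of the two sides on an element. -/
theorem exists_elem_sign_poly (hn : 1 ≤ n) (hT : T.ShapeRegular κ) (S : G.SignSystem) {r : ℕ}
    {f : (ℓ : Fin (L + 1)) → Lp ℝ 2 (G.surf ℓ)} (hf : ∀ ℓ, G.MemHpw (r + 1) ℓ (f ℓ)) (t : T.elems)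
    (h0 : ∀ᵐ x ∂volume.restrict (T.pull t), ∑ ℓ with T.idx t ∈ G.I ℓ, f ℓ (T.chart t x) = 0) :
    ∃ P ∈ polyFn n r, ∀ ℓ, t ∈ T.elemsOn ℓ →
      ∫ x in T.pull t, (f ℓ (T.chart t x) - S.s ℓ (T.idx t) * P x) = 0 ∧
      ∫⁻ x in T.pull t, ‖f ℓ (T.chart t x) - S.s ℓ (T.idx t) * P x‖ₑ ^ 2 ≤
        (2 * ENNReal.ofReal ((2 * κ) ^ n) * ENNReal.ofReal T.meshSize ^ 2) ^ (r + 1) *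
          ∑ j with T.idx t ∈ G.I j, sobSq (T.pull t)
            (weakDerivs (G.patch (T.idx t)) fun x => f j (T.chart t x)) (r + 1) := by
  -- An element on none of the boundaries imposes no condition.
  by_cases hex : ∃ ℓ₀, t ∈ T.elemsOn ℓ₀
  swap
  · exact ⟨0, Submodule.zero_mem _, fun ℓ hℓ => absurd ⟨ℓ, hℓ⟩ hex⟩
  obtain ⟨ℓ₀, hℓ₀⟩ := hex
  obtain ⟨p, hp, hp0, hpw, hpb⟩ := exists_elem_poly hn hT (hf ℓ₀) hℓ₀
  -- The sign of ℓ₀ is built into P, so that s_ℓ P approximates f_ℓ = s_ℓ s_ℓ₀ f_ℓ₀ on either side.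
  refine ⟨fun x => (S.s ℓ₀ (T.idx t) : ℝ) * p x, Submodule.smul_mem _ _ hp, fun ℓ hℓ => ?_⟩
  have hae := ae_sign_mul_eq T S h0 (mem_elemsOn.1 hℓ₀) (mem_elemsOn.1 hℓ)
  have hrw : ∀ᵐ x ∂volume.restrict (T.pull t), f ℓ (T.chart t x) -
      S.s ℓ (T.idx t) * (S.s ℓ₀ (T.idx t) * p x) =
      ((S.s ℓ (T.idx t) : ℝ) * S.s ℓ₀ (T.idx t)) * (f ℓ₀ (T.chart t x) - p x) := by
    filter_upwards [hae] with x hx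
    rw [hx]; ring
  have habs : |(S.s ℓ (T.idx t) : ℝ) * S.s ℓ₀ (T.idx t)| = 1 := by
    have h1 := S.abs_eq_one ℓ _ (mem_elemsOn.1 hℓ)
    have h2 := S.abs_eq_one ℓ₀ _ (mem_elemsOn.1 hℓ₀)
    rw [abs_mul, ← Int.cast_abs, ← Int.cast_abs, h1, h2]
    norm_num
  refine ⟨?_, ?_⟩
  · rw [integral_congr_ae hrw, integral_const_mul, hp0, mul_zero]
  · have hL := (memLp_pull (Lp.memLp (f ℓ₀)) hℓ₀).sub (memLp_poly hp t)
    calc _ = ∫⁻ x in T.pull t, ‖((fun x => f ℓ₀ (T.chart t x)) - p) x‖ₑ ^ 2 := by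
          refine lintegral_congr_ae ?_
          filter_upwards [hrw] with x hx
          rw [hx, enorm_mul, Real.enorm_eq_ofReal_abs, habs, ENNReal.ofReal_one, one_mul]
          rfl
      _ = _ := HasWeakDerivs_sobSq_zero (isOpen_pull t) hpw hL
      _ ≤ _ := hpb (r + 1) 0 rfl
      _ ≤ _ := by
          gcongr
          · exact size_le_meshSize t
          · exact Finset.single_le_sum (f := fun j => sobSq (T.pull t)
              (weakDerivs (G.patch (T.idx t)) fun x => f j (T.chart t x)) (r + 1))
              (fun _ _ => zero_le) (Finset.mem_filter.2 ⟨Finset.mem_univ _, mem_elemsOn.1 hℓ₀⟩)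

theorem sum_elemsOn_sum_le (ℓ : Fin (L + 1)) (F : T.elems → Fin (L + 1) → ℝ≥0∞) :
    ∑ t ∈ T.elemsOn ℓ, ∑ j with T.idx t ∈ G.I j, F t j ≤ ∑ j, ∑ t ∈ T.elemsOn j, F t j := by
  calc _ ≤ ∑ t : T.elems, ∑ j with T.idx t ∈ G.I j, F t j :=
        Finset.sum_le_sum_of_subset (Finset.subset_univ _)
    _ = _ := by
        simp only [Finset.sum_filter, elemsOn]
        exact Finset.sum_comm

/-- The constant of the approximation in `H^{-1/2}`. -/
def negConst (n r : ℕ) (κ : ℝ) : ℝ≥0∞ :=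
  (volume (Metric.ball (0 : Euc n) 1))⁻¹ * ENNReal.ofReal ((2 * κ) ^ n) *
    (2 * ENNReal.ofReal ((2 * κ) ^ n)) ^ (r + 1)

theorem negConst_ne_top (n r : ℕ) (κ : ℝ) : negConst n r κ ≠ ⊤ := by
  have : (volume (Metric.ball (0 : Euc n) 1))⁻¹ ≠ ⊤ :=
    ENNReal.inv_ne_top.2 (Metric.measure_ball_pos _ _ one_pos).ne'
  rw [negConst]
  finiteness

theorem normHpw_nonneg (k : ℕ) (ℓ : Fin (L + 1)) (f : Lp ℝ 2 (G.surf ℓ)) : 0 ≤ G.normHpw k ℓ f :=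
  Real.sqrt_nonneg _

/-- The mean-zero bound contributes h and the L² error h^{2(r+1)}; their product h^{2r+3} is the
square of the rate. -/
theorem ShapeRegular.norm_ofL2_le (hn : 1 ≤ n) (hT : T.ShapeRegular κ) {r : ℕ} {ℓ : Fin (L + 1)}
    {g : Lp ℝ 2 (G.surf ℓ)} (hg : ∀ t ∈ T.elemsOn ℓ, ∫ x in T.pull t, g (T.chart t x) = 0)
    {N : Fin (L + 1) → ℝ} (hN : ∀ j, 0 ≤ N j)
    (hg2 : ∫⁻ x, ‖g x‖ₑ ^ 2 ∂G.surf ℓ ≤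
        (2 * ENNReal.ofReal ((2 * κ) ^ n) * ENNReal.ofReal T.meshSize ^ 2) ^ (r + 1) *
          ∑ j, ENNReal.ofReal (N j ^ 2)) :
    ‖ofL2 g‖ ≤ Real.sqrt (negConst n r κ).toReal * T.meshSize ^ ((r : ℝ) + 3 / 2) * ∑ j, N j := by
  obtain ⟨K, hK⟩ : ∃ K, K = Real.sqrt (negConst n r κ).toReal * T.meshSize ^ ((r : ℝ) + 3 / 2) *
    ∑ j, N j := ⟨_, rfl⟩
  have hK0 : 0 ≤ K := hK ▸ mul_nonneg (mul_nonneg (Real.sqrt_nonneg _)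
    (Real.rpow_nonneg meshSize_nonneg _)) (Finset.sum_nonneg fun ℓ _ => hN ℓ)
  have h2 := exists_rate (negConst_ne_top n r κ) r (meshSize_nonneg (T := T)) hN
  rw [← hK] at h2 ⊢
  refine ContinuousLinearMap.opNorm_le_bound _ hK0 fun η => ?_
  refine norm_le_of_enorm_sq_le (mul_nonneg hK0 (norm_nonneg _)) ?_
  have h1 := hT.enorm_ofL2_apply_sq_le hn hg η
  rw [mul_pow, ENNReal.ofReal_mul (by positivity), ← enorm_sq_eq_ofReal]
  refine h1.trans (mul_le_mul_left (le_trans ?_ h2) _)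
  refine (mul_le_mul_right hg2 _).trans (le_of_eq ?_)
  rw [negConst]
  ring

/-- The common polynomials of `exists_elem_sign_poly` are put together. They have degree r on every
element, so a larger ρ only enlarges the space in which they lie. -/
theorem exists_mem_Xh (hn : n = 1 ∨ n = 2) (S : G.SignSystem) {r ρ : ℕ} (hr : r ≤ ρ)
    (hT : T.ShapeRegular κ) {φ : G.ProdHNegHalf} (hφ : φ ∈ G.X)
    {f : (ℓ : Fin (L + 1)) → Lp ℝ 2 (G.surf ℓ)} (hφf : ∀ ℓ, φ ℓ = ofL2 (f ℓ))
    (hf : ∀ ℓ, G.MemHpw (r + 1) ℓ (f ℓ)) :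
    ∃ χ ∈ T.Xh S ρ, ∀ ℓ, ‖φ ℓ - χ ℓ‖ ≤
      Real.sqrt (negConst n r κ).toReal * T.meshSize ^ ((r : ℝ) + 3 / 2) *
        ∑ ℓ, G.normHpw (r + 1) ℓ (f ℓ) := by
  have hn1 : 1 ≤ n := by omega
  choose P hP hPf using fun t : T.elems => exists_elem_sign_poly hn1 hT S hf t
    (ae_sum_eq_zero T (fun w hw => sum_integral_eq_zero hn T hφ hφf hw) t)
  have hcongr : ∀ ℓ, ∀ t : T.elems, ∀ x ∈ T.pull t,
      S.fn ℓ (T.chart t x) * T.piecewise P (T.chart t x) = S.s ℓ (T.idx t) * P t x :=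
    fun ℓ t x hx => by rw [signFn_chart S ℓ hx, piecewise_chart hx]
  have hmem : ∀ ℓ, MemLp (fun x => S.fn ℓ x * T.piecewise P x) 2 (G.surf ℓ) := fun ℓ =>
    memLp_surf (T := T) fun t _ => by
      refine (memLp_congr_ae ?_).1 ((memLp_poly (hP t) t).const_mul (S.s ℓ (T.idx t) : ℝ))
      exact (ae_restrict_iff' (isOpen_pull t).measurableSet).2
        (ae_of_all _ fun x hx => (hcongr ℓ t x hx).symm)
  refine ⟨WithLp.toLp 2 fun ℓ => ofL2 ((hmem ℓ).toLp _), ⟨T.piecewise P,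
    piecewise_mem_Ph fun t => polyFn_mono hr (hP t), fun ℓ =>
      ⟨(hmem ℓ).toLp _, (hmem ℓ).coeFn_toLp, rfl⟩⟩, fun ℓ => ?_⟩
  obtain ⟨g, hg⟩ : ∃ g : Lp ℝ 2 (G.surf ℓ), g = f ℓ - (hmem ℓ).toLp _ := ⟨_, rfl⟩
  have e : φ ℓ - ofL2 ((hmem ℓ).toLp _) = ofL2 g := by rw [hg, ofL2_sub, ← hφf]
  have hgt : ∀ t ∈ T.elemsOn ℓ, ∀ᵐ x ∂volume.restrict (T.pull t), g (T.chart t x) =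
      f ℓ (T.chart t x) - S.s ℓ (T.idx t) * P t x := by
    intro t ht
    filter_upwards [ae_pull_of_ae_surf (Lp.coeFn_sub (f ℓ) ((hmem ℓ).toLp _)) ht,
      ae_pull_of_ae_surf (hmem ℓ).coeFn_toLp ht,
      ae_restrict_mem (isOpen_pull t).measurableSet] with x h1 h2 h3
    rw [hg, h1, Pi.sub_apply, h2, hcongr ℓ t x h3]
  change ‖φ ℓ - ofL2 ((hmem ℓ).toLp _)‖ ≤ _
  rw [e]
  refine hT.norm_ofL2_le hn1 (fun t ht => ?_) (fun ℓ => normHpw_nonneg _ _ _) ?_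
  · rw [integral_congr_ae (hgt t ht)]
    exact (hPf t ℓ ht).1
  rw [lintegral_surf (T := T)]
  calc _ ≤ ∑ t ∈ T.elemsOn ℓ,
        (2 * ENNReal.ofReal ((2 * κ) ^ n) * ENNReal.ofReal T.meshSize ^ 2) ^ (r + 1) *
        ∑ j with T.idx t ∈ G.I j, sobSq (T.pull t)
          (weakDerivs (G.patch (T.idx t)) fun x => f j (T.chart t x)) (r + 1) := by
        refine Finset.sum_le_sum fun t ht => le_trans (le_of_eq ?_) (hPf t ℓ ht).2
        refine lintegral_congr_ae ?_
        filter_upwards [hgt t ht] with x hx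
        rw [hx]
    _ ≤ _ := by
        rw [← Finset.mul_sum]
        refine mul_le_mul_right ((sum_elemsOn_sum_le ℓ _).trans
          (Finset.sum_le_sum fun j _ => ?_)) _
        exact sum_sobSq_le (hf j) le_rfl

/-- Approximation of Neumann data. -/
theorem iInf_Xh_le (hn : n = 1 ∨ n = 2) (S : G.SignSystem) {r ρ : ℕ} (hr : r ≤ ρ)
    (hT : T.ShapeRegular κ) {φ : G.ProdHNegHalf} (hφ : φ ∈ G.X)
    {f : (ℓ : Fin (L + 1)) → Lp ℝ 2 (G.surf ℓ)} (hφf : ∀ ℓ, φ ℓ = ofL2 (f ℓ))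
    (hf : ∀ ℓ, G.MemHpw (r + 1) ℓ (f ℓ)) :
    ⨅ χ : T.Xh S ρ, ‖φ - (χ : G.ProdHNegHalf)‖ ≤
      ((L + 1 : ℕ) : ℝ) * Real.sqrt (negConst n r κ).toReal * T.meshSize ^ ((r : ℝ) + 3 / 2) *
        ∑ ℓ, G.normHpw (r + 1) ℓ (f ℓ) := by
  obtain ⟨χ, hχ, h⟩ := exists_mem_Xh hn S hr hT hφ hφf hf
  have hbdd : BddBelow (Set.range fun χ : T.Xh S ρ => ‖φ - (χ : G.ProdHNegHalf)‖) :=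
    ⟨0, Set.forall_mem_range.2 fun χ => norm_nonneg (φ - (χ : G.ProdHNegHalf))⟩
  refine (ciInf_le hbdd ⟨χ, hχ⟩).trans ((norm_le_sum_piLp _ (φ - χ)).trans ?_)
  refine (Finset.sum_le_sum fun ℓ _ => h ℓ).trans (le_of_eq ?_)
  rw [Finset.sum_const, Finset.card_univ, Fintype.card_fin, nsmul_eq_mul]
  ring

end Partition.Triangulation

/-! ### Dirichlet data: the Lagrange interpolant -/

namespace Partition.Triangulation

variable {n L M : ℕ} {G : Partition n L M} {T : G.Triangulation} {κ : ℝ}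

section Interpolation

variable [DecidableEq (Euc (n + 1))]

/-- The node `α / k` of an element in tangential coordinates. -/
def node (t : T.elems) (k : ℕ) (α : Euc (n + 1) →₀ ℕ) : Euc n :=
  ∑ v ∈ (t : Finset (Euc (n + 1))), ((α v : ℝ) / k) • T.vert t v

/-- Lagrange interpolation of degree `k` on an element in tangential coordinates. -/
def elemInterp (t : T.elems) (k : ℕ) (u : Euc n → ℝ) (x : Euc n) : ℝ :=
  ∑ α ∈ (t : Finset (Euc (n + 1))).finsuppAntidiag k, u (node t k α) *
    lagrange (t : Finset (Euc (n + 1))) k α fun v => T.lam t v x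

variable (T) in
/-- The vertices of the triangulation. -/
def verts : Finset (Euc (n + 1)) := T.finite_elems.toFinset.biUnion id

variable (T) in
/-- The global Lagrange interpolant of degree `k`. -/
def interp (k : ℕ) (g : Euc (n + 1) → ℝ) (y : Euc (n + 1)) : ℝ :=
  ∑ α ∈ T.verts.finsuppAntidiag k, g (∑ v ∈ T.verts, ((α v : ℝ) / k) • v) *
    lagrange T.verts k α fun v => hat T.K v y

theorem subset_verts (t : T.elems) : (t : Finset (Euc (n + 1))) ⊆ T.verts := fun v hv =>
  Finset.mem_biUnion.2 ⟨t, T.finite_elems.mem_toFinset.2 t.2, hv⟩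

theorem sum_div_eq_one {t : Finset (Euc (n + 1))} {k : ℕ} (hk : k ≠ 0) {α : Euc (n + 1) →₀ ℕ}
    (hα : α ∈ t.finsuppAntidiag k) : ∑ v ∈ t, (α v : ℝ) / k = 1 := by
  rw [← Finset.sum_div, ← Nat.cast_sum, (Finset.mem_finsuppAntidiag.1 hα).1]
  exact div_self (by exact_mod_cast hk)

theorem chart_node {t : T.elems} {k : ℕ} (hk : k ≠ 0) {α : Euc (n + 1) →₀ ℕ}
    (hα : α ∈ (t : Finset (Euc (n + 1))).finsuppAntidiag k) :
    T.chart t (node t k α) = ∑ v ∈ (t : Finset (Euc (n + 1))), ((α v : ℝ) / k) • v := by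
  refine (affineMap_sum_smul' (T.chart t).toAffineMap (sum_div_eq_one hk hα) (T.vert t)).trans ?_
  refine Finset.sum_congr rfl fun v hv => ?_
  congr 1
  exact chart_vert hv

theorem node_mem_cpull {t : T.elems} {k : ℕ} (hk : k ≠ 0) {α : Euc (n + 1) →₀ ℕ}
    (hα : α ∈ (t : Finset (Euc (n + 1))).finsuppAntidiag k) : node t k α ∈ T.cpull t := by
  change T.chart t (node t k α) ∈ convexHull ℝ _
  rw [chart_node hk hα]
  exact (convex_convexHull ℝ _).sum_mem (fun v _ => by positivity) (sum_div_eq_one hk hα)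
    fun v hv => subset_convexHull ℝ _ hv

/-- On an element the hat functions of all other vertices vanish. A multi-index that charges such a
vertex contributes C(0, a) = 0 with a > 0; for the others the foreign factors are C(0, 0) = 1. Thus
a single formula in the hat functions restricts to the local interpolant on each element, and
continuity needs no matching of nodes. -/
theorem interp_chart (k : ℕ) (hk : k ≠ 0) (g : Euc (n + 1) → ℝ) {t : T.elems} {x : Euc n}
    (hx : x ∈ T.cpull t) :
    T.interp k g (T.chart t x) = elemInterp t k (fun x => g (T.chart t x)) x := by
  have hhat : ∀ v, hat T.K v (T.chart t x) = T.lam t v x := fun v => hat_eq t.2.1 hx v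
  have hsub := subset_verts t
  rw [interp, elemInterp]
  symm
  refine Finset.sum_subset_zero_on_sdiff (Finset.finsuppAntidiag_mono hsub k) ?_ ?_
  · intro α hα
    rw [Finset.mem_sdiff] at hα
    obtain ⟨v, hv, hvt⟩ : ∃ v ∈ α.support, v ∉ (t : Finset (Euc (n + 1))) := by
      by_contra! hcon
      refine hα.2 (Finset.mem_finsuppAntidiag.2 ⟨?_, hcon⟩)
      rw [← (Finset.mem_finsuppAntidiag.1 hα.1).1]
      exact Finset.sum_subset hsub fun v _ hvt => Finsupp.notMem_support_iff.1 fun h => hvt (hcon v h)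
    have hz : lagrange T.verts k α (fun v => hat T.K v (T.chart t x)) = 0 := by
      refine Finset.prod_eq_zero ((Finset.mem_finsuppAntidiag.1 hα.1).2 hv) ?_
      have h0 : T.lam t v x = 0 := by rw [lam_of_notMem hvt]
      change Ring.choose ((k : ℝ) * hat T.K v (T.chart t x)) (α v) = 0
      rw [hhat, h0, mul_zero]
      exact Ring.choose_zero_pos ℝ (Nat.pos_of_ne_zero (Finsupp.mem_support_iff.1 hv))
    rw [hz, mul_zero]
  · intro α hα
    have h0 : ∀ v ∈ T.verts, v ∉ (t : Finset (Euc (n + 1))) → α v = 0 := fun v _ hvt =>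
      Finsupp.notMem_support_iff.1 fun h => hvt ((Finset.mem_finsuppAntidiag.1 hα).2 h)
    have h1 : ∑ v ∈ (t : Finset (Euc (n + 1))), ((α v : ℝ) / k) • v =
        ∑ v ∈ T.verts, ((α v : ℝ) / k) • v :=
      Finset.sum_subset hsub fun v hv hvt => by rw [h0 v hv hvt]; simp
    have h2 : lagrange (t : Finset (Euc (n + 1))) k α (fun v => T.lam t v x) =
        lagrange T.verts k α fun v => hat T.K v (T.chart t x) := by
      unfold lagrange
      simp only [hhat]
      exact Finset.prod_subset hsub fun v hv hvt => by rw [h0 v hv hvt, Ring.choose_zero_right]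
    rw [chart_node hk hα, h1, h2]

theorem elemInterp_mem_polyFn (t : T.elems) (k : ℕ) (u : Euc n → ℝ) :
    elemInterp t k u ∈ polyFn n k := by
  have : elemInterp t k u = ∑ α ∈ (t : Finset (Euc (n + 1))).finsuppAntidiag k, u (node t k α) •
      fun x => lagrange (t : Finset (Euc (n + 1))) k α fun v => T.lam t v x := by
    funext x
    simp [elemInterp, Finset.sum_apply]
  rw [this]
  exact Submodule.sum_mem _ fun α hα => Submodule.smul_mem _ _
    (lagrange_comp_mem_polyFn hα fun v _ => affine_mem_polyFn _)

/-- Reproduction in barycentric coordinates, carried to tangential coordinates by the injectivity of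
the chart. -/
theorem elemInterp_eq_self {t : T.elems} {k : ℕ} (hk : k ≠ 0) {p : Euc n → ℝ}
    (hp : p ∈ polyFn n k) : elemInterp t k p = p := by
  funext x
  have h := sum_lagrange_eq hk (T.vert t) hp (sum_lam t x)
  rw [elemInterp]
  refine h.trans ?_
  congr 1
  have h2 := affineMap_sum_smul' (T.chart t).toAffineMap (sum_lam t x) (T.vert t)
  refine (T.chart t).injective (h2.trans (Eq.trans (Finset.sum_congr rfl fun v hv => ?_)
    (sum_lam_smul t x)))
  congr 1
  exact chart_vert hv

theorem elemInterp_sub (t : T.elems) (k : ℕ) (u w : Euc n → ℝ) :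
    elemInterp t k (u - w) = elemInterp t k u - elemInterp t k w := by
  funext x
  simp only [elemInterp, Pi.sub_apply, sub_mul, Finset.sum_sub_distrib]

theorem abs_sum_mul_le {ι : Type*} (s : Finset ι) {a b : ι → ℝ} {A B : ℝ} (hA : 0 ≤ A)
    (ha : ∀ i ∈ s, |a i| ≤ A) (hb : ∀ i ∈ s, |b i| ≤ B) :
    |∑ i ∈ s, a i * b i| ≤ s.card * (A * B) := by
  rw [← nsmul_eq_mul, ← Finset.sum_const]
  refine (Finset.abs_sum_le_sum_abs _ _).trans (Finset.sum_le_sum fun i hi => ?_)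
  rw [abs_mul]
  exact mul_le_mul (ha i hi) (hb i hi) (abs_nonneg _) hA

theorem elemInterp_bound {k : ℕ} (hk : k ≠ 0) {t : T.elems} {u : Euc n → ℝ} {s c d : ℝ}
    (hu : ∀ x ∈ T.cpull t, |u x| ≤ s) {x y : Euc n} (hx : x ∈ T.cpull t)
    (hc : ∀ α ∈ (t : Finset (Euc (n + 1))).finsuppAntidiag k,
      |lagrange (t : Finset (Euc (n + 1))) k α fun v => T.lam t v x| ≤ c ∧
      |lagrange (t : Finset (Euc (n + 1))) k α (fun v => T.lam t v x) -
        lagrange (t : Finset (Euc (n + 1))) k α fun v => T.lam t v y| ≤ d) :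
    |elemInterp t k u x| ≤ ((n + 1).multichoose k : ℕ) * (s * c) ∧
      |elemInterp t k u x - elemInterp t k u y| ≤ ((n + 1).multichoose k : ℕ) * (s * d) := by
  have hs : 0 ≤ s := (abs_nonneg _).trans (hu x hx)
  have hcard : ((t : Finset (Euc (n + 1))).finsuppAntidiag k).card = (n + 1).multichoose k := by
    rw [Finset.card_finsuppAntidiag_nat_eq_multichoose, t.2.2]
  rw [← hcard]
  have hun := fun α (hα : α ∈ (t : Finset (Euc (n + 1))).finsuppAntidiag k) =>
    hu _ (node_mem_cpull hk hα)
  refine ⟨abs_sum_mul_le _ hs hun fun α hα => (hc α hα).1, ?_⟩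
  rw [elemInterp, elemInterp, ← Finset.sum_sub_distrib]
  simp only [← mul_sub]
  exact abs_sum_mul_le _ hs hun fun α hα => (hc α hα).2

/-- Stability of the interpolation on shape regular elements. -/
theorem exists_elemInterp_bound (n k : ℕ) [DecidableEq (Euc (n + 1))] : ∃ C : ℝ, 0 ≤ C ∧
    ∀ {L M : ℕ} {G : Partition n L M} {T : G.Triangulation} {κ : ℝ}, 1 ≤ n → k ≠ 0 →
      T.ShapeRegular κ → ∀ (t : T.elems) {u : Euc n → ℝ} {s : ℝ}, (∀ x ∈ T.cpull t, |u x| ≤ s) →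
      ∀ x ∈ T.cpull t, ∀ y ∈ T.cpull t, |elemInterp t k u x| ≤ C * s ∧
        |elemInterp t k u x - elemInterp t k u y| ≤ C * s * (κ / size t) * ‖x - y‖ := by
  obtain ⟨c, hc, hb⟩ := exists_lagrange_bound (ι := Euc (n + 1)) k (n + 1)
  have hc0 : 0 ≤ c := zero_le_one.trans hc
  refine ⟨((n + 1).multichoose k : ℕ) * c * (2 * (n + 1)), by positivity, ?_⟩
  intro L M G T κ hn hk hT t u s hu x hx y hy
  have hs : 0 ≤ s := (abs_nonneg _).trans (hu x hx)
  have hicc : ∀ x ∈ T.cpull t, ∀ v ∈ (t : Finset (Euc (n + 1))), T.lam t v x ∈ Set.Icc (0 : ℝ) 1 :=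
    fun x hx v _ => baryFun_mem_Icc (indep t) hx v
  have hlam : ∑ v ∈ (t : Finset (Euc (n + 1))), |T.lam t v x - T.lam t v y| ≤
      (n + 1) * (2 * κ / size t * ‖x - y‖) := by
    refine (Finset.sum_le_sum fun v _ => hT.lam_sub_le hn t v x y).trans (le_of_eq ?_)
    rw [Finset.sum_const, t.2.2, nsmul_eq_mul]
    push_cast
    ring
  obtain ⟨h1, h2⟩ := elemInterp_bound (c := c) (d := c * ((n + 1) * (2 * κ / size t * ‖x - y‖)))
    hk hu hx (y := y) fun α hα => by
      obtain ⟨i1, i2⟩ := hb t t.2.2 α hα (fun v => T.lam t v x) (fun v => T.lam t v y)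
        (hicc x hx) (hicc y hy)
      exact ⟨i1, i2.trans (mul_le_mul_of_nonneg_left hlam hc0)⟩
  refine ⟨h1.trans ?_, h2.trans (le_of_eq (by ring))⟩
  have hn1 : (1 : ℝ) ≤ 2 * (n + 1) := by
    have : (0 : ℝ) ≤ n := Nat.cast_nonneg n
    linarith
  calc _ = ((n + 1).multichoose k : ℕ) * c * s * 1 := by ring
    _ ≤ ((n + 1).multichoose k : ℕ) * c * s * (2 * (n + 1)) :=
        mul_le_mul_of_nonneg_left hn1 (by positivity)
    _ = _ := by ring

/-- Lagrange functions are Lipschitz in the coordinates, and hat functions are Lipschitz on Γ. The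
constant depends on T and g and never enters an error bound. -/
theorem exists_interp_lipschitz (T : G.Triangulation) (k : ℕ) (g : Euc (n + 1) → ℝ) :
    ∃ K : ℝ≥0, LipschitzOnWith K (T.interp k g) G.skeleton := by
  obtain ⟨C, hC, hhat⟩ := exists_hat_lipschitz T.K T.finite
  rw [T.space_eq] at hhat
  obtain ⟨c, hc, hb⟩ := exists_lagrange_bound (ι := Euc (n + 1)) k T.verts.card
  have hicc : ∀ x ∈ G.skeleton, ∀ v ∈ T.verts, hat T.K v x ∈ Set.Icc (0 : ℝ) 1 := fun x hx v _ =>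
    hat_mem_Icc (T.space_eq ▸ hx) v
  refine ⟨Real.toNNReal (∑ α ∈ T.verts.finsuppAntidiag k,
    |g (∑ v ∈ T.verts, ((α v : ℝ) / k) • v)| * (c * (T.verts.card * C))), ?_⟩
  refine LipschitzOnWith.of_dist_le_mul fun x hx y hy => ?_
  rw [Real.coe_toNNReal _ (Finset.sum_nonneg fun α _ => by positivity), dist_eq_norm, dist_eq_norm,
    interp, interp, ← Finset.sum_sub_distrib, Finset.sum_mul]
  refine (norm_sum_le _ _).trans (Finset.sum_le_sum fun α hα => ?_)
  rw [← mul_sub, norm_mul, Real.norm_eq_abs, Real.norm_eq_abs, mul_assoc]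
  refine mul_le_mul_of_nonneg_left ?_ (abs_nonneg _)
  refine ((hb _ rfl α hα _ _ (hicc x hx) (hicc y hy)).2).trans ?_
  rw [mul_assoc]
  refine mul_le_mul_of_nonneg_left ?_ (zero_le_one.trans hc)
  refine (Finset.sum_le_sum fun v _ => hhat x hx y hy v).trans (le_of_eq ?_)
  rw [Finset.sum_const, nsmul_eq_mul]
  ring

theorem interp_mem_Qh {k ρ : ℕ} (hk : k ≠ 0) (hkρ : k ≤ ρ + 1) (g : Euc (n + 1) → ℝ) :
    T.interp k g ∈ T.Qh ρ := by
  refine ⟨fun t ht => ?_, ?_⟩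
  · obtain ⟨q, hq, h⟩ := comp_unchart_mem_polyFn ⟨t, ht⟩ (polyFn_mono hkρ
      (elemInterp_mem_polyFn (T := T) ⟨t, ht⟩ k fun x => g (T.chart ⟨t, ht⟩ x)))
    refine ⟨q, hq, fun x hx => ?_⟩
    have hx' := openElem_subset_closedElem t hx
    obtain ⟨z, rfl⟩ := closedElem_subset_range (T := T) ⟨t, ht⟩ hx'
    rw [interp_chart (t := ⟨t, ht⟩) k hk g hx', ← h]
    dsimp only
    rw [unchart_chart]
  · obtain ⟨K, hK⟩ := exists_interp_lipschitz T k g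
    exact hK.continuousOn

end Interpolation

end Partition.Triangulation

/-! ### Dirichlet data: the interpolation error on one element -/

theorem HasWeakGrad.congr_left {U : Set (Euc m)} {u u' : Euc m → ℝ} {g : Fin m → Euc m → ℝ}
    (h : HasWeakGrad U u g) (hu : u =ᵐ[volume.restrict U] u') : HasWeakGrad U u' g := by
  intro w hw hwU i
  rw [← h w hw hwU i]
  exact integral_congr_ae (hu.mono fun x hx => by simp only [hx])

theorem sobSq_one (U : Set (Euc m)) (g : List (Fin m) → Euc m → ℝ) :
    sobSq U g 1 = ∑ i, ∫⁻ x in U, ‖g [i] x‖ₑ ^ 2 := by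
  rw [sobSq_succ, Fintype.sum_unique]
  simp

theorem sobSq_two (U : Set (Euc m)) (g : List (Fin m) → Euc m → ℝ) :
    sobSq U g 2 = ∑ i, ∑ j, ∫⁻ x in U, ‖g [j, i] x‖ₑ ^ 2 := by
  rw [sobSq_succ, ← (Equiv.funUnique (Fin 1) (Fin m)).symm.sum_comp]
  refine Finset.sum_congr rfl fun i _ => Finset.sum_congr rfl fun j _ => ?_
  simp [List.ofFn_succ]

namespace Partition.Triangulation

variable {n L M : ℕ} {G : Partition n L M} {T : G.Triangulation} {κ : ℝ}

/-- The constant of the pointwise approximation by polynomials on an element. -/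
def supConst (n r : ℕ) (κ : ℝ) : ℝ≥0∞ :=
  3 * ((2 * ENNReal.ofReal ((2 * κ) ^ n)) ^ (r + 2) + (2 * ENNReal.ofReal ((2 * κ) ^ n)) ^ (r + 1) +
    (2 * ENNReal.ofReal ((2 * κ) ^ n)) ^ r)

/-- `weak_sup_bound` at interior points; its three terms carry the same power (size t)^{2r+4}. The
maximum over the closed element may lie on the boundary and is reached by continuity. -/
theorem exists_sup_le (hn2 : n ≤ 2) {r : ℕ} {t : T.elems} {u : Euc n → ℝ}
    {D : List (Fin n) → Euc n → ℝ} {N : ℝ≥0∞} (huc : ContinuousOn u (T.cpull t))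
    (hD : HasWeakDerivs (T.pull t) (r + 2) u D)
    (hb : ∀ i j, i + j = r + 2 → sobSq (T.pull t) D j ≤
      (2 * ENNReal.ofReal ((2 * κ) ^ n) * ENNReal.ofReal (size t) ^ 2) ^ i * N) :
    ∃ s : ℝ, 0 ≤ s ∧ (∀ x ∈ T.cpull t, |u x| ≤ s) ∧ volume (T.pull t) * ENNReal.ofReal (s ^ 2) ≤
      supConst n r κ * ENNReal.ofReal (size t) ^ (2 * r + 4) * N := by
  obtain ⟨x₀, hx₀, hmax⟩ := (isCompact_cpull t).exists_isMaxOn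
    ((pull_nonempty t).mono (pull_subset_cpull t)) huc.abs
  refine ⟨|u x₀|, abs_nonneg _, fun x hx => hmax hx, ?_⟩
  obtain ⟨b, hbd⟩ := (isCompact_cpull t).exists_bound_of_continuousOn huc
  have hfin : volume (T.pull t) ≠ ⊤ := (isBounded_pull t).measure_lt_top.ne
  have : IsFiniteMeasure (volume.restrict (T.pull t)) := ⟨by simpa using hfin.lt_top⟩
  have hu : MemLp u 2 (volume.restrict (T.pull t)) :=
    MemLp.of_bound ((huc.mono (pull_subset_cpull t)).aestronglyMeasurable
      (isOpen_pull t).measurableSet) b ((ae_restrict_iff' (isOpen_pull t).measurableSet).2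
        (ae_of_all _ fun x hx => hbd x (pull_subset_cpull t hx)))
  have hnil := hD.ae_eq_nil (isOpen_pull t) hu
  have key : ∀ x ∈ T.pull t, volume (T.pull t) * ‖u x‖ₑ ^ 2 ≤
      supConst n r κ * ENNReal.ofReal (size t) ^ (2 * r + 4) * N := by
    intro x hx
    have h := weak_sup_bound hn2 (isOpen_pull t) (convex_pull t) hu
      (fun i => (hD [i] (by simp)).1) (fun i j => (hD [j, i] (by simp)).1)
      ((hD.hasWeakGrad (l := []) (by simp)).congr_left hnil)
      (fun i => hD.hasWeakGrad (l := [i]) (by simp)) (huc.mono (pull_subset_cpull t))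
      (fun x hx y hy => dist_le_size (pull_subset_cpull t hx) (pull_subset_cpull t hy)) hx
    refine h.trans ?_
    have e : ∫⁻ y in T.pull t, ‖u y‖ₑ ^ 2 = sobSq (T.pull t) D 0 := by
      rw [sobSq_zero]
      exact lintegral_congr_ae (hnil.mono fun x hx => by simp only [hx])
    rw [e, ← sobSq_one, ← sobSq_two]
    have h0 := hb (r + 2) 0 rfl
    have h1 := hb (r + 1) 1 rfl
    have h2 := hb r 2 rfl
    refine (mul_le_mul_right (add_le_add (add_le_add h0 (mul_le_mul_right h1 _))
      (mul_le_mul_right h2 _)) _).trans (le_of_eq ?_)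
    rw [supConst]
    ring
  rw [← closure_pull] at hx₀ huc
  have hcont : ContinuousWithinAt (fun x => volume (T.pull t) * ‖u x‖ₑ ^ 2) (T.pull t) x₀ := by
    refine ENNReal.Tendsto.const_mul (ENNReal.Tendsto.pow ?_) (Or.inr hfin)
    exact (huc x₀ hx₀).mono subset_closure |>.enorm
  have := hcont.closure_le hx₀ continuousWithinAt_const key
  rwa [enorm_sq_eq_ofReal, Real.norm_eq_abs] at this

theorem ShapeRegular.size_pow_mul_le (hn : 1 ≤ n) (hT : T.ShapeRegular κ) (t : T.elems) :
    ENNReal.ofReal (size t) ^ n ≤ (volume (Metric.ball (0 : Euc n) 1))⁻¹ *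
      ENNReal.ofReal ((2 * κ) ^ n) * volume (T.pull t) := by
  have h := hT.volume_le hn t
  rw [Measure.addHaar_closedBall _ _ (size_pos hn t).le, finrank_euclideanSpace_fin,
    ENNReal.ofReal_pow (size_pos hn t).le] at h
  have hne : volume (Metric.ball (0 : Euc n) 1) ≠ 0 := (Metric.measure_ball_pos _ _ one_pos).ne'
  have hnt : volume (Metric.ball (0 : Euc n) 1) ≠ ⊤ := measure_ball_lt_top.ne
  rw [mul_assoc, ← ENNReal.mul_le_iff_le_inv hne hnt]
  rwa [mul_comm]

end Partition.Triangulation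

theorem HasWeakDerivs.congr_fun {U : Set (Euc m)} {k : ℕ} {u u' : Euc m → ℝ}
    {g : List (Fin m) → Euc m → ℝ} (h : HasWeakDerivs U k u g)
    (hu : u =ᵐ[volume.restrict U] u') : HasWeakDerivs U k u' g := fun l hl =>
  ⟨(h l hl).1, fun w hw hwU => by
    rw [← (h l hl).2 w hw hwU]
    exact integral_congr_ae (hu.mono fun x hx => by simp only [hx])⟩

theorem setLIntegral_sq_le {X : Type*} [MeasurableSpace X] {μ : Measure X} {U : Set X}
    (hU : MeasurableSet U) {f : X → ℝ} {b : ℝ} (hf : ∀ x ∈ U, |f x| ≤ b) :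
    ∫⁻ x in U, ‖f x‖ₑ ^ 2 ∂μ ≤ μ U * ENNReal.ofReal (b ^ 2) := by
  rw [mul_comm, ← setLIntegral_const]
  refine setLIntegral_mono' hU fun x hx => ?_
  rw [enorm_sq_eq_ofReal, Real.norm_eq_abs]
  exact ENNReal.ofReal_le_ofReal (pow_le_pow_left₀ (abs_nonneg _) (hf x hx) 2)

namespace Partition.Triangulation

variable {n L M : ℕ} {G : Partition n L M} {T : G.Triangulation} {κ : ℝ}

theorem abs_lineDeriv_le {t : T.elems} {q : Euc n → ℝ} {c : ℝ} (hc : 0 ≤ c)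
    (hq : ∀ x ∈ T.cpull t, ∀ y ∈ T.cpull t, |q x - q y| ≤ c * ‖x - y‖) {x : Euc n}
    (hx : x ∈ T.pull t) (i : Fin n) : |fderiv ℝ q x (stdVec i)| ≤ c := by
  have hlip : LipschitzOnWith (Real.toNNReal c) q (T.pull t) :=
    LipschitzOnWith.of_dist_le_mul fun a ha b hb => by
      rw [Real.dist_eq, dist_eq_norm, Real.coe_toNNReal _ hc]
      exact hq a (pull_subset_cpull t ha) b (pull_subset_cpull t hb)
  have h := norm_fderiv_le_of_lipschitzOn ℝ ((isOpen_pull t).mem_nhds hx) hlip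
  rw [Real.coe_toNNReal _ hc] at h
  refine ((fderiv ℝ q x).le_opNorm _).trans ?_
  have e : ‖(stdVec i : Euc n)‖ = 1 := by simp [stdVec]
  rwa [e, mul_one]

/-- Shape regularity allows the measure of the element to be replaced by (size t)ⁿ. The remaining
exponent 2r + 4 - n is nonnegative, so `size t` may be enlarged to the mesh size, and (n - 1) + (2r
+ 4 - n) = 2r + 3. -/
theorem elem_sup_le (hn : 1 ≤ n) (hn2 : n ≤ 2) {r : ℕ} (hT : T.ShapeRegular κ)
    {t : T.elems} {N : ℝ≥0∞} {s : ℝ}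
    (hsv : volume (T.pull t) * ENNReal.ofReal (s ^ 2) ≤
      supConst n r κ * ENNReal.ofReal (size t) ^ (2 * r + 4) * N) :
    ENNReal.ofReal T.meshSize ^ (n - 1) * ENNReal.ofReal (s ^ 2) ≤
      (volume (Metric.ball (0 : Euc n) 1))⁻¹ * ENNReal.ofReal ((2 * κ) ^ n) * supConst n r κ *
        ENNReal.ofReal T.meshSize ^ (2 * r + 3) * N := by
  obtain ⟨H, hH⟩ : ∃ H, H = ENNReal.ofReal (size t) := ⟨_, rfl⟩
  have hH0 : H ^ n ≠ 0 := hH ▸ pow_ne_zero n (ENNReal.ofReal_pos.2 (size_pos hn t)).ne'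
  have hHt : H ^ n ≠ ⊤ := hH ▸ ENNReal.pow_ne_top ENNReal.ofReal_ne_top
  have hle : H ≤ ENNReal.ofReal T.meshSize := hH ▸ ENNReal.ofReal_le_ofReal (size_le_meshSize t)
  have h := hT.size_pow_mul_le hn t
  rw [← hH] at hsv h
  have h2 : ENNReal.ofReal (s ^ 2) ≤ (volume (Metric.ball (0 : Euc n) 1))⁻¹ *
      ENNReal.ofReal ((2 * κ) ^ n) * supConst n r κ * H ^ (2 * r + 4 - n) * N := by
    rw [← ENNReal.mul_le_mul_iff_right hH0 hHt]
    calc _ ≤ _ := mul_le_mul_left h _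
      _ = (volume (Metric.ball (0 : Euc n) 1))⁻¹ * ENNReal.ofReal ((2 * κ) ^ n) *
          (volume (T.pull t) * ENNReal.ofReal (s ^ 2)) := by ring
      _ ≤ _ := mul_le_mul_right hsv _
      _ = _ := by
          rw [show 2 * r + 4 = n + (2 * r + 4 - n) by omega, pow_add]
          simp only [Nat.add_sub_cancel_left]
          ring
  refine (mul_le_mul_right h2 _).trans ?_
  rw [show 2 * r + 3 = (n - 1) + (2 * r + 4 - n) by omega, pow_add]
  calc _ = (volume (Metric.ball (0 : Euc n) 1))⁻¹ * ENNReal.ofReal ((2 * κ) ^ n) *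
        supConst n r κ * ENNReal.ofReal T.meshSize ^ (n - 1) * H ^ (2 * r + 4 - n) * N := by ring
    _ ≤ (volume (Metric.ball (0 : Euc n) 1))⁻¹ * ENNReal.ofReal ((2 * κ) ^ n) *
        supConst n r κ * ENNReal.ofReal T.meshSize ^ (n - 1) *
          ENNReal.ofReal T.meshSize ^ (2 * r + 4 - n) * N := by gcongr
    _ = _ := by ring

section Interpolation

variable [DecidableEq (Euc (n + 1))]

/-- The bound for Lagrange interpolation on an element. -/
def IsInterpConst (T : G.Triangulation) (k : ℕ) (κ C : ℝ) : Prop :=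
  0 ≤ C ∧ ∀ (t : T.elems) {u : Euc n → ℝ} {s : ℝ}, (∀ x ∈ T.cpull t, |u x| ≤ s) →
    ∀ x ∈ T.cpull t, ∀ y ∈ T.cpull t, |elemInterp t k u x| ≤ C * s ∧
      |elemInterp t k u x - elemInterp t k u y| ≤ C * s * (κ / size t) * ‖x - y‖

/-- The constant of the elementwise interpolation error. -/
def elemConst (n r : ℕ) (κ C : ℝ) : ℝ≥0∞ :=
  ENNReal.ofReal ((1 + C) ^ 2) * supConst n r κ +
  ENNReal.ofReal ((1 + C) ^ 2) * ((volume (Metric.ball (0 : Euc n) 1))⁻¹ *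
      ENNReal.ofReal ((2 * κ) ^ n) * supConst n r κ) +
  (2 * (2 * ENNReal.ofReal ((2 * κ) ^ n)) ^ (r + 1) +
    2 * (n * (ENNReal.ofReal ((C * κ) ^ 2) * supConst n r κ)))

theorem elemConst_ne_top (n r : ℕ) (κ C : ℝ) : elemConst n r κ C ≠ ⊤ := by
  have : (volume (Metric.ball (0 : Euc n) 1))⁻¹ ≠ ⊤ :=
    ENNReal.inv_ne_top.2 (Metric.measure_ball_pos _ _ one_pos).ne'
  rw [elemConst, supConst]
  finiteness

/-- The gradient of the interpolant is at most its Lipschitz constant C s κ / size t, an inverse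
estimate that costs (size t)² in the square; D itself is bounded by `hb`. -/
theorem elem_gradient_le (hn : 1 ≤ n) {r : ℕ} {C : ℝ} (hT : T.ShapeRegular κ)
    (hC : IsInterpConst T (r + 1) κ C) {t : T.elems} {u : Euc n → ℝ}
    {D : List (Fin n) → Euc n → ℝ} {N : ℝ≥0∞} {s : ℝ} (hs : 0 ≤ s) (hus : ∀ x ∈ T.cpull t, |u x| ≤ s)
    (hsv : volume (T.pull t) * ENNReal.ofReal (s ^ 2) ≤
      supConst n r κ * ENNReal.ofReal (size t) ^ (2 * r + 4) * N)
    (hb : sobSq (T.pull t) D 1 ≤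
      (2 * ENNReal.ofReal ((2 * κ) ^ n) * ENNReal.ofReal (size t) ^ 2) ^ (r + 1) * N) :
    ∑ i, ∫⁻ x in T.pull t, ‖D [i] x - fderiv ℝ (elemInterp t (r + 1) u) x (stdVec i)‖ₑ ^ 2 ≤
      (2 * (2 * ENNReal.ofReal ((2 * κ) ^ n)) ^ (r + 1) +
        2 * (n * (ENNReal.ofReal ((C * κ) ^ 2) * supConst n r κ))) *
        ENNReal.ofReal (size t) ^ (2 * r + 2) * N := by
  have hsz := size_pos hn t
  have hκ := hT.pos hn t
  have hd : ∀ x ∈ T.pull t, ∀ i, |fderiv ℝ (elemInterp t (r + 1) u) x (stdVec i)| ≤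
      C * s * (κ / size t) := fun x hx i => by
    refine abs_lineDeriv_le (mul_nonneg (mul_nonneg hC.1 hs) (div_nonneg hκ.le hsz.le)) ?_ hx i
    exact fun x hx y hy => (hC.2 t hus x hx y hy).2
  have h1 : ∀ i, ∫⁻ x in T.pull t, ‖fderiv ℝ (elemInterp t (r + 1) u) x (stdVec i)‖ₑ ^ 2 ≤
      ENNReal.ofReal ((C * κ) ^ 2) * supConst n r κ * ENNReal.ofReal (size t) ^ (2 * r + 2) * N := by
    intro i
    refine (setLIntegral_sq_le (isOpen_pull t).measurableSet fun x hx => hd x hx i).trans ?_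
    have e : (C * s * (κ / size t)) ^ 2 = (C * κ) ^ 2 * ((size t) ^ 2)⁻¹ * s ^ 2 := by
      field_simp
    rw [e, ENNReal.ofReal_mul (by positivity), ENNReal.ofReal_mul (by positivity),
      ENNReal.ofReal_inv_of_pos (by positivity), ENNReal.ofReal_pow hsz.le]
    obtain ⟨H, hH⟩ : ∃ H, H = ENNReal.ofReal (size t) := ⟨_, rfl⟩
    have hH0 : H ^ 2 ≠ 0 := hH ▸ pow_ne_zero 2 (ENNReal.ofReal_pos.2 hsz).ne'
    have hHt : H ^ 2 ≠ ⊤ := hH ▸ ENNReal.pow_ne_top ENNReal.ofReal_ne_top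
    rw [← hH] at hsv ⊢
    calc _ = ENNReal.ofReal ((C * κ) ^ 2) * (H ^ 2)⁻¹ *
          (volume (T.pull t) * ENNReal.ofReal (s ^ 2)) := by ring
      _ ≤ _ := mul_le_mul_right hsv _
      _ = ENNReal.ofReal ((C * κ) ^ 2) * supConst n r κ * H ^ (2 * r + 2) * N *
          ((H ^ 2)⁻¹ * H ^ 2) := by ring
      _ = _ := by rw [ENNReal.inv_mul_cancel hH0 hHt, mul_one]
  calc _ ≤ ∑ i, ((2 * ∫⁻ x in T.pull t, ‖D [i] x‖ₑ ^ 2) +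
        2 * ∫⁻ x in T.pull t, ‖fderiv ℝ (elemInterp t (r + 1) u) x (stdVec i)‖ₑ ^ 2) := by
        refine Finset.sum_le_sum fun i _ => ?_
        have hm : Measurable fun x => fderiv ℝ (elemInterp t (r + 1) u) x (stdVec i) :=
          measurable_fderiv_apply_const ℝ _ _
        rw [← lintegral_const_mul' _ _ (by simp), ← lintegral_const_mul' _ _ (by simp),
          ← lintegral_add_right _ (by fun_prop)]
        exact lintegral_mono fun x => (enorm_sub_sq_le _ _).trans (le_of_eq (mul_add _ _ _))
    _ ≤ 2 * sobSq (T.pull t) D 1 + 2 * (n * (ENNReal.ofReal ((C * κ) ^ 2) * supConst n r κ *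
        ENNReal.ofReal (size t) ^ (2 * r + 2) * N)) := by
        rw [Finset.sum_add_distrib, sobSq_one, Finset.mul_sum]
        refine add_le_add_right ?_ _
        refine (Finset.sum_le_sum fun i _ => mul_le_mul_right (h1 i) 2).trans (le_of_eq ?_)
        rw [Finset.sum_const, Finset.card_univ, Fintype.card_fin, nsmul_eq_mul]
        ring
    _ ≤ _ := by
        refine (add_le_add_left (mul_le_mul_right hb 2) _).trans (le_of_eq ?_)
        ring

/-- Interpolation reproduces p, so g - I g = (g - p) - I (g - p) (`hI`). The stability of I then
reduces everything to the maximum s of |g - p| and to the gradient of g - p. -/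
theorem exists_elem_error (hn : 1 ≤ n) (hn2 : n ≤ 2) {r : ℕ} {C : ℝ} (hT : T.ShapeRegular κ)
    (hC : IsInterpConst T (r + 1) κ C) {ℓ : Fin (L + 1)} {f : Lp ℝ 2 (G.surf ℓ)}
    (hf : G.MemHpw (r + 2) ℓ f) {g : Euc (n + 1) → ℝ} (hg : ContinuousOn g G.skeleton)
    (hfg : f =ᵐ[G.surf ℓ] g) {t : T.elems} (ht : t ∈ T.elemsOn ℓ) :
    ∃ s : ℝ, 0 ≤ s ∧
      (∀ x ∈ T.cpull t, |g (T.chart t x) - elemInterp t (r + 1) (fun x => g (T.chart t x)) x| ≤ s) ∧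
      ENNReal.ofReal T.meshSize ^ (n - 1) * ENNReal.ofReal (s ^ 2) ≤
        elemConst n r κ C * ENNReal.ofReal T.meshSize ^ (2 * r + 3) * sobSq (T.pull t)
          (weakDerivs (G.patch (T.idx t)) fun x => f (T.chart t x)) (r + 2) ∧
      ∫⁻ x in T.pull t, ‖g (T.chart t x) -
          elemInterp t (r + 1) (fun x => g (T.chart t x)) x‖ₑ ^ 2 ≤
        elemConst n r κ C * ENNReal.ofReal T.meshSize ^ (2 * r + 4) * sobSq (T.pull t)
          (weakDerivs (G.patch (T.idx t)) fun x => f (T.chart t x)) (r + 2) ∧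
      ∑ i, ∫⁻ x in T.pull t, ‖weakDerivs (G.patch (T.idx t)) (fun x => f (T.chart t x)) [i] x -
          fderiv ℝ (elemInterp t (r + 1) fun x => g (T.chart t x)) x (stdVec i)‖ₑ ^ 2 ≤
        elemConst n r κ C * ENNReal.ofReal T.meshSize ^ (2 * r + 2) * sobSq (T.pull t)
          (weakDerivs (G.patch (T.idx t)) fun x => f (T.chart t x)) (r + 2) := by
  obtain ⟨p, hp, -, hpD, hb⟩ := exists_elem_poly hn hT (r := r + 1) hf ht
  obtain ⟨N, hN⟩ : ∃ N, N = sobSq (T.pull t)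
    (weakDerivs (G.patch (T.idx t)) fun x => f (T.chart t x)) (r + 2) := ⟨_, rfl⟩
  obtain ⟨gt, hgt⟩ : ∃ gt, gt = fun x => g (T.chart t x) := ⟨_, rfl⟩
  have hpc := contDiff_of_mem_polyFn hp
  have hgc : ContinuousOn gt (T.cpull t) := hgt ▸ hg.comp (T.chart t).continuous.continuousOn
    fun x hx => closedElem_subset_skeleton t hx
  have hae : ((fun x => f (T.chart t x)) - p) =ᵐ[volume.restrict (T.pull t)] gt - p := by
    filter_upwards [ae_pull_of_ae_surf hfg ht] with x hx
    simp only [Pi.sub_apply, hx, hgt]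
  have hD := hpD.congr_fun hae
  have hI : elemInterp t (r + 1) (gt - p) = elemInterp t (r + 1) gt - p := by
    rw [elemInterp_sub, elemInterp_eq_self (Nat.succ_ne_zero r) hp]
  obtain ⟨s, hs, hus, hsv⟩ := exists_sup_le hn2 (hgc.sub hpc.continuous.continuousOn) hD
    (N := N) (by rw [hN]; exact hb)
  have hmesh : ENNReal.ofReal (size t) ≤ ENNReal.ofReal T.meshSize :=
    ENNReal.ofReal_le_ofReal (size_le_meshSize t)
  have herr : ∀ x ∈ T.cpull t, |gt x - elemInterp t (r + 1) gt x| ≤ (1 + C) * s := by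
    intro x hx
    have h1 := (hC.2 t hus x hx x hx).1
    rw [hI] at h1
    have h2 := hus x hx
    rw [Pi.sub_apply] at h1 h2
    calc _ = |(gt x - p x) - (elemInterp t (r + 1) gt x - p x)| := by congr 1; ring
      _ ≤ _ := (abs_sub _ _).trans (by linarith)
  have hgrad := elem_gradient_le hn hT hC hs hus hsv (by rw [hN]; exact hb (r + 1) 1 rfl)
  have hsup := elem_sup_le hn hn2 hT hsv
  have hC0 := hC.1
  subst hgt
  rw [← hN]
  refine ⟨(1 + C) * s, by positivity, herr, ?_, ?_, ?_⟩
  · rw [mul_pow, ENNReal.ofReal_mul (by positivity)]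
    calc _ = ENNReal.ofReal ((1 + C) ^ 2) *
          (ENNReal.ofReal T.meshSize ^ (n - 1) * ENNReal.ofReal (s ^ 2)) := by ring
      _ ≤ _ := mul_le_mul_right hsup _
      _ = (ENNReal.ofReal ((1 + C) ^ 2) * ((volume (Metric.ball (0 : Euc n) 1))⁻¹ *
          ENNReal.ofReal ((2 * κ) ^ n) * supConst n r κ)) *
            ENNReal.ofReal T.meshSize ^ (2 * r + 3) * N := by ring
      _ ≤ _ := by
        refine mul_le_mul_left (mul_le_mul_left ?_ _) _
        rw [elemConst]
        exact le_add_self.trans le_self_add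
  · refine (setLIntegral_sq_le (isOpen_pull t).measurableSet
      fun x hx => herr x (pull_subset_cpull t hx)).trans ?_
    rw [mul_pow, ENNReal.ofReal_mul (by positivity)]
    calc _ = ENNReal.ofReal ((1 + C) ^ 2) *
          (volume (T.pull t) * ENNReal.ofReal (s ^ 2)) := by ring
      _ ≤ ENNReal.ofReal ((1 + C) ^ 2) *
          (supConst n r κ * ENNReal.ofReal T.meshSize ^ (2 * r + 4) * N) :=
        mul_le_mul_right (hsv.trans (by gcongr)) _
      _ = ENNReal.ofReal ((1 + C) ^ 2) * supConst n r κ *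
            ENNReal.ofReal T.meshSize ^ (2 * r + 4) * N := by ring
      _ ≤ _ := by
        refine mul_le_mul_left (mul_le_mul_left ?_ _) _
        rw [elemConst]
        exact le_self_add.trans le_self_add
  · have hdiff : Differentiable ℝ (elemInterp t (r + 1) fun x => g (T.chart t x)) :=
      (contDiff_of_mem_polyFn (elemInterp_mem_polyFn t _ _)).differentiable (by simp)
    have e : ∀ i x, weakDerivs (G.patch (T.idx t)) (fun x => f (T.chart t x)) [i] x -
        fderiv ℝ (elemInterp t (r + 1) fun x => g (T.chart t x)) x (stdVec i) =
        (weakDerivs (G.patch (T.idx t)) (fun x => f (T.chart t x)) [i] - dlist [i] p) x -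
        fderiv ℝ (elemInterp t (r + 1) ((fun x => g (T.chart t x)) - p)) x (stdVec i) := by
      intro i x
      rw [hI, fderiv_sub hdiff.differentiableAt
        ((hpc.differentiable (by simp)).differentiableAt)]
      simp [dlist]
    simp only [e]
    refine hgrad.trans (mul_le_mul' (mul_le_mul' ?_ (pow_le_pow_left' hmesh _)) le_rfl)
    rw [elemConst]
    exact le_add_self

end Interpolation

end Partition.Triangulation

/-! ### Dirichlet data: the error on an unrelated triangulation -/

/-- The first derivatives of a Lipschitz function, indexed by lists. -/
def lipDerivs (q : Euc m → ℝ) : List (Fin m) → Euc m → ℝ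
  | [] => q
  | i :: _ => fun x => lineDeriv ℝ q x (stdVec i)

/-- By Rademacher's theorem the directional derivatives exist almost everywhere and are bounded, and
they may be integrated by parts against compactly supported Lipschitz functions. -/
theorem hasWeakDerivs_lipDerivs {q : Euc m → ℝ} {K : ℝ≥0} (hq : LipschitzWith K q)
    {U : Set (Euc m)} (hU : MeasurableSet U) (hUb : Bornology.IsBounded U) :
    HasWeakDerivs U 1 q (lipDerivs q) := by
  have hfin : IsFiniteMeasure (volume.restrict U) := ⟨by simpa using hUb.measure_lt_top⟩
  intro l hl
  match l, hl with
  | [], _ => exact ⟨MultiTrace.Continuous.memLp_restrict_bounded hq.continuous hU hUb, fun w _ _ => by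
      simp [dlist, lipDerivs]⟩
  | [i], _ =>
    refine ⟨(hq.memLp_lineDeriv (stdVec i)).mono_exponent le_top, fun w hw hwU => ?_⟩
    obtain ⟨K', hK'⟩ := ContDiff.lipschitzWith_of_hasCompactSupport hw.2 hw.1 (by simp)
    have h := hq.integral_lineDeriv_mul_eq (μ := volume) hK' hw.2 (stdVec i)
    have hd : ∀ x, lineDeriv ℝ w x (-stdVec i) = -fderiv ℝ w x (stdVec i) := fun x => by
      rw [((hw.1.differentiable (by simp)) x).lineDeriv_eq_fderiv, map_neg]
    have hts : tsupport (fun x => fderiv ℝ w x (stdVec i)) ⊆ U :=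
      (tsupport_fderiv_apply_subset _ _).trans hwU
    have e1 : ∫ x in U, q x * dlist [i] w x = ∫ x, q x * fderiv ℝ w x (stdVec i) := by
      exact (setIntegral_eq_of_tsupport (f := fun x => q x * fderiv ℝ w x (stdVec i))
        (Set.subset_univ U) hU .univ hts fun x hx => by simp [hx]).symm.trans setIntegral_univ
    have e2 : ∫ x in U, lipDerivs q [i] x * w x = ∫ x, lineDeriv ℝ q x (stdVec i) * w x := by
      exact (setIntegral_eq_of_tsupport (f := fun x => lineDeriv ℝ q x (stdVec i) * w x)
        (Set.subset_univ U) hU .univ hwU fun x hx => by simp [hx]).symm.trans setIntegral_univ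
    rw [e1, e2, h]
    simp only [hd, neg_mul, integral_neg, List.length_singleton, pow_one, mul_comm (q _)]
    ring
  | _ :: _ :: _, h => simp at h

namespace Partition.Triangulation

variable {n L M : ℕ} {G : Partition n L M} {T : G.Triangulation} {κ : ℝ}

/-- Both triangulations exhaust the faces up to null sets, so integrals over elements of one pass,
through the faces, to integrals over elements of the other. -/
theorem sum_elemsOn_lintegral_comm_le (T₀ T : G.Triangulation) (ℓ : Fin (L + 1))
    (f : Fin M → Euc n → ℝ≥0∞) :
    ∑ t ∈ T₀.elemsOn ℓ, ∫⁻ x in T₀.pull t, f (T₀.idx t) x ≤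
      ∑ t ∈ T.elemsOn ℓ, ∫⁻ x in T.pull t, f (T.idx t) x := by
  refine (sum_elemsOn_lintegral_le ℓ f).trans ?_
  rw [← Finset.sum_fiberwise_of_maps_to (g := T.idx) (t := G.I ℓ) fun t ht => mem_elemsOn.1 ht]
  refine Finset.sum_le_sum fun i hi => (lintegral_patch_le (T := T) i (f i)).trans (le_of_eq ?_)
  have : (T.elemsOn ℓ).filter (fun t => T.idx t = i) = Finset.univ.filter fun t => T.idx t = i := by
    ext t
    simp only [Finset.mem_filter, Finset.mem_univ, true_and, and_iff_right_iff_imp, mem_elemsOn]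
    exact fun h => h ▸ hi
  rw [this]
  refine Finset.sum_congr rfl fun t ht => ?_
  rw [(Finset.mem_filter.1 ht).2]

section Interpolation

variable [DecidableEq (Euc (n + 1))]

/-- A Lipschitz function on a subset of ℝⁿ extends to all of ℝⁿ. The extension has weak derivatives
on any open set, no matter how the mesh cuts it. -/
theorem exists_interp_extension (T : G.Triangulation) (k : ℕ) (g : Euc (n + 1) → ℝ) (i : Fin M) :
    ∃ (q : Euc n → ℝ) (K : ℝ≥0), LipschitzWith K q ∧
      ∀ x, G.chart i x ∈ G.skeleton → q x = T.interp k g (G.chart i x) := by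
  obtain ⟨K, hK⟩ := exists_interp_lipschitz T k g
  have h : LipschitzOnWith (K * 1) (T.interp k g ∘ G.chart i) (G.chart i ⁻¹' G.skeleton) :=
    hK.comp ((G.chart i).isometry.lipschitz.lipschitzOnWith) fun x hx => hx
  obtain ⟨q, hq, he⟩ := h.extend_real
  exact ⟨q, _, hq, fun x hx => (he hx).symm⟩

/-- A Lipschitz extension of the interpolant in the tangential coordinates of a face. -/
def interpExt (T : G.Triangulation) (k : ℕ) (g : Euc (n + 1) → ℝ) (i : Fin M) : Euc n → ℝ :=
  (exists_interp_extension T k g i).choose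

theorem exists_lipschitzWith_interpExt (T : G.Triangulation) (k : ℕ) (g : Euc (n + 1) → ℝ)
    (i : Fin M) : ∃ K : ℝ≥0, LipschitzWith K (interpExt T k g i) :=
  ⟨_, (exists_interp_extension T k g i).choose_spec.choose_spec.1⟩

theorem interpExt_eq {k : ℕ} {g : Euc (n + 1) → ℝ} {i : Fin M} {x : Euc n}
    (hx : G.chart i x ∈ G.skeleton) : interpExt T k g i x = T.interp k g (G.chart i x) :=
  (exists_interp_extension T k g i).choose_spec.choose_spec.2 x hx

theorem lineDeriv_interpExt {k : ℕ} (hk : k ≠ 0) {g : Euc (n + 1) → ℝ} {t : T.elems} {x : Euc n}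
    (hx : x ∈ T.pull t) (v : Euc n) : lineDeriv ℝ (interpExt T k g (T.idx t)) x v =
      fderiv ℝ (elemInterp t k fun x => g (T.chart t x)) x v := by
  have h : interpExt T k g (T.idx t) =ᶠ[𝓝 x] elemInterp t k fun x => g (T.chart t x) := by
    filter_upwards [(isOpen_pull t).mem_nhds hx] with y hy
    have hy' := pull_subset_cpull t hy
    rw [interpExt_eq (closedElem_subset_skeleton t hy')]
    exact interp_chart k hk g hy'
  rw [h.lineDeriv_eq]
  exact ((contDiff_of_mem_polyFn (elemInterp_mem_polyFn t k _)).differentiable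
    (by simp) x).lineDeriv_eq_fderiv

/-- The tangential derivatives of the interpolation error on the faces. -/
def errGrad (T : G.Triangulation) (k : ℕ) (g f : Euc (n + 1) → ℝ) (i : Fin M) (j : Fin n)
    (x : Euc n) : ℝ :=
  weakDerivs (G.patch i) (fun x => f (G.chart i x)) [j] x -
    lineDeriv ℝ (interpExt T k g i) x (stdVec j)

/-- The interpolation error, set to zero off the skeleton. -/
def interpErr (T : G.Triangulation) (k : ℕ) (g : Euc (n + 1) → ℝ) : Euc (n + 1) → ℝ :=
  G.skeleton.indicator fun x => g x - T.interp k g x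

theorem continuousOn_interpErr {k : ℕ} {g : Euc (n + 1) → ℝ} (hg : ContinuousOn g G.skeleton) :
    ContinuousOn (interpErr T k g) G.skeleton := by
  obtain ⟨K, hK⟩ := exists_interp_lipschitz T k g
  exact (hg.sub hK.continuousOn).congr fun x hx => Set.indicator_of_mem hx _

theorem measurable_interpErr {k : ℕ} {g : Euc (n + 1) → ℝ} (hg : ContinuousOn g G.skeleton) :
    Measurable (interpErr T k g) := by
  classical
  have h := (continuousOn_interpErr (T := T) (k := k) hg).measurable_piecewise
    (continuousOn_const (c := (0 : ℝ)) (s := G.skeletonᶜ)) isCompact_skeleton.measurableSet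
  convert h using 1
  funext x
  by_cases hx : x ∈ G.skeleton <;> simp [interpErr, hx]

theorem interpErr_chart {k : ℕ} (hk : k ≠ 0) (g : Euc (n + 1) → ℝ) {t : T.elems} {x : Euc n}
    (hx : x ∈ T.cpull t) : interpErr T k g (T.chart t x) =
      g (T.chart t x) - elemInterp t k (fun x => g (T.chart t x)) x := by
  rw [interpErr, Set.indicator_of_mem (closedElem_subset_skeleton t hx), interp_chart k hk g hx]

/-- Elements of T₀ may be crossed by edges of T, where the interpolant has kinks but stays
Lipschitz. Its weak gradient is therefore the almost everywhere derivative of the extension, without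
contributions from the edges; f is in H¹ on the whole face. -/
theorem isPiecewiseSobolev_interpErr (T₀ T : G.Triangulation) {k : ℕ} {ℓ : Fin (L + 1)}
    {k' : ℕ} (hk' : 1 ≤ k') {f : Lp ℝ 2 (G.surf ℓ)} (hf : G.MemHpw k' ℓ f) {g : Euc (n + 1) → ℝ}
    (hg : ContinuousOn g G.skeleton) (hfg : f =ᵐ[G.surf ℓ] g) {S : ℝ}
    (hS : ∀ᵐ x ∂G.surf ℓ, |interpErr T k g x| ≤ S) :
    IsPiecewiseSobolev T₀ ℓ (interpErr T k g) S fun t => errGrad T k g f (T₀.idx t) := by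
  have hmeas := measurable_interpErr (T := T) (k := k) hg
  have hfin := isFiniteMeasure_surf T₀ ℓ
  have hL : MemLp (interpErr T k g) 2 (G.surf ℓ) := MemLp.of_bound hmeas.aestronglyMeasurable S hS
  have hD : ∀ t ∈ T₀.elemsOn ℓ, HasWeakDerivs (T₀.pull t) 1 (fun x => interpErr T k g (T₀.chart t x))
      fun l => weakDerivs (G.patch (T₀.idx t)) (fun x => f (G.chart (T₀.idx t) x)) l -
        lipDerivs (interpExt T k g (T₀.idx t)) l := by
    intro t ht
    obtain ⟨K, hK⟩ := exists_lipschitzWith_interpExt T k g (T₀.idx t)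
    have h1 := ((hf _ (mem_elemsOn.1 ht)).hasWeakDerivs.mono hk').restrict (G.isOpen_patch _) (isOpen_pull t)
      (pull_subset_patch t)
    have h2 := hasWeakDerivs_lipDerivs hK (isOpen_pull t).measurableSet (isBounded_pull t)
    refine (h1.sub h2 (memLp_pull (Lp.memLp f) ht)
      (h2 [] (Nat.zero_le _)).1).congr_fun ?_
    filter_upwards [ae_pull_of_ae_surf hfg ht,
      ae_restrict_mem (isOpen_pull t).measurableSet] with x hx hxt
    have hxs := closedElem_subset_skeleton t (pull_subset_cpull t hxt)
    have e : f (G.chart (T₀.idx t) x) = g (T₀.chart t x) := hx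
    rw [Pi.sub_apply, interpExt_eq hxs, interpErr, Set.indicator_of_mem hxs, e]
    rfl
  exact ⟨hmeas, continuousOn_interpErr hg, hS, fun t ht => memLp_pull hL ht,
    fun t ht j => (hD t ht [j] (by simp)).1,
    fun t ht => ((hD t ht).hasWeakGrad (l := []) (by simp)).congr_left
      ((hD t ht).ae_eq_nil (isOpen_pull t) (memLp_pull hL ht))⟩

end Interpolation

end Partition.Triangulation

namespace Partition.Triangulation

variable {n L M : ℕ} {G : Partition n L M} {T : G.Triangulation} {κ : ℝ}

/-- The three terms scale alike: h⁻¹ h^{2r+4}, h h^{2r+2} and h^{2r+3}. -/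
theorem interpBound_le {T₀ : G.Triangulation} {ℓ : Fin (L + 1)} {h : ℝ} (hh : 0 < h)
    {v : Euc (n + 1) → ℝ} {S : ℝ} {Gr : T₀.elems → Fin n → Euc n → ℝ} {r : ℕ} {A N : ℝ≥0∞}
    (h1 : ∫⁻ x, ‖v x‖ₑ ^ 2 ∂G.surf ℓ ≤ A * ENNReal.ofReal h ^ (2 * r + 4) * N)
    (h2 : ∑ t ∈ T₀.elemsOn ℓ, ∑ i, ∫⁻ x in T₀.pull t, ‖Gr t i x‖ₑ ^ 2 ≤
      A * ENNReal.ofReal h ^ (2 * r + 2) * N)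
    (h3 : ENNReal.ofReal (h ^ (n - 1) * S ^ 2) ≤ A * ENNReal.ofReal h ^ (2 * r + 3) * N) :
    interpBound T₀ ℓ h v S Gr ≤ 3 * A * ENNReal.ofReal h ^ (2 * r + 3) * N := by
  obtain ⟨H, hH⟩ : ∃ H, H = ENNReal.ofReal h := ⟨_, rfl⟩
  have hH0 : H ≠ 0 := hH ▸ (ENNReal.ofReal_pos.2 hh).ne'
  have hHt : H ≠ ⊤ := hH ▸ ENNReal.ofReal_ne_top
  rw [interpBound]
  rw [← hH] at h1 h2 h3 ⊢
  refine (add_le_add (add_le_add (mul_le_mul_right h1 _) (mul_le_mul_right h2 _)) h3).trans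
    (le_of_eq ?_)
  calc _ = (H⁻¹ * H) * (A * H ^ (2 * r + 3) * N) + 2 * (A * H ^ (2 * r + 3) * N) := by ring
    _ = _ := by rw [ENNReal.inv_mul_cancel hH0 hHt]; ring

section Interpolation

variable [DecidableEq (Euc (n + 1))]

theorem interpBound_interpErr_le (hn : 1 ≤ n) (hn2 : n ≤ 2) {r : ℕ} {C : ℝ} (T₀ : G.Triangulation)
    (hT : T.ShapeRegular κ) (hC : IsInterpConst T (r + 1) κ C) (hh : 0 < T.meshSize)
    {ℓ : Fin (L + 1)} {f : Lp ℝ 2 (G.surf ℓ)} (hf : G.MemHpw (r + 2) ℓ f)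
    {g : Euc (n + 1) → ℝ} (hg : ContinuousOn g G.skeleton) (hfg : f =ᵐ[G.surf ℓ] g) :
    ∃ S : ℝ, (∀ᵐ x ∂G.surf ℓ, |interpErr T (r + 1) g x| ≤ S) ∧
      interpBound T₀ ℓ T.meshSize (interpErr T (r + 1) g) S
        (fun t => errGrad T (r + 1) g f (T₀.idx t)) ≤
      3 * elemConst n r κ C * ENNReal.ofReal T.meshSize ^ (2 * r + 3) *
        ENNReal.ofReal (G.normHpw (r + 2) ℓ f ^ 2) := by
  obtain ⟨N, hN⟩ : ∃ N : T.elems → ℝ≥0∞, ∀ t, N t = sobSq (T.pull t)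
    (weakDerivs (G.patch (T.idx t)) fun x => f (T.chart t x)) (r + 2) := ⟨_, fun _ => rfl⟩
  have hNs : ∑ t ∈ T.elemsOn ℓ, N t ≤ ENNReal.ofReal (G.normHpw (r + 2) ℓ f ^ 2) := by
    simp only [hN]
    exact sum_sobSq_le hf le_rfl
  have hex := fun (t : T.elems) (ht : t ∈ T.elemsOn ℓ) => exists_elem_error hn hn2 hT hC hf hg hfg ht
  simp only [← hN] at hex
  choose! s hs0 hsb hsup hL2 hgr using hex
  have hsq : 0 ≤ ∑ t ∈ T.elemsOn ℓ, s t ^ 2 := Finset.sum_nonneg fun _ _ => sq_nonneg _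
  -- The root of the sum of squares dominates each elementwise maximum, and its square is bounded by
  -- the sum of the elementwise Sobolev norms.
  refine ⟨Real.sqrt (∑ t ∈ T.elemsOn ℓ, s t ^ 2), ?_, interpBound_le hh ?_ ?_ ?_⟩
  · refine ae_surf_of_ae_pull (T := T) fun t ht => ?_
    filter_upwards [ae_restrict_mem (isOpen_pull t).measurableSet] with x hx
    have hx' := pull_subset_cpull t hx
    rw [interpErr_chart (Nat.succ_ne_zero r) g hx']
    refine (hsb t ht x hx').trans (Real.le_sqrt_of_sq_le ?_)
    exact Finset.single_le_sum (f := fun t => s t ^ 2) (fun _ _ => sq_nonneg _) ht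
  · rw [lintegral_surf (T := T)]
    refine le_trans (Finset.sum_le_sum fun t ht => le_trans (le_of_eq ?_) (hL2 t ht)) ?_
    · refine setLIntegral_congr_fun (isOpen_pull t).measurableSet fun x hx => ?_
      simp only [interpErr_chart (Nat.succ_ne_zero r) g (pull_subset_cpull t hx)]
    · rw [← Finset.mul_sum]
      exact mul_le_mul_right hNs _
  · calc _ = ∑ i, ∑ t ∈ T₀.elemsOn ℓ, ∫⁻ x in T₀.pull t,
          ‖errGrad T (r + 1) g f (T₀.idx t) i x‖ₑ ^ 2 := Finset.sum_comm
      -- From the elements of T₀, where the seminorm is estimated, to those of T, where the error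
      -- is.
      _ ≤ ∑ i, ∑ t ∈ T.elemsOn ℓ, ∫⁻ x in T.pull t,
          ‖errGrad T (r + 1) g f (T.idx t) i x‖ₑ ^ 2 := Finset.sum_le_sum fun i _ =>
        sum_elemsOn_lintegral_comm_le T₀ T ℓ fun j x => ‖errGrad T (r + 1) g f j i x‖ₑ ^ 2
      _ = ∑ t ∈ T.elemsOn ℓ, ∑ i, ∫⁻ x in T.pull t,
          ‖errGrad T (r + 1) g f (T.idx t) i x‖ₑ ^ 2 := Finset.sum_comm
      _ ≤ ∑ t ∈ T.elemsOn ℓ, elemConst n r κ C *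
          ENNReal.ofReal T.meshSize ^ (2 * r + 2) * N t := by
        refine Finset.sum_le_sum fun t ht => le_trans (le_of_eq ?_) (hgr t ht)
        refine Finset.sum_congr rfl fun i _ => setLIntegral_congr_fun
          (isOpen_pull t).measurableSet fun x hx => ?_
        simp only [errGrad, lineDeriv_interpExt (Nat.succ_ne_zero r) hx]
        rfl
      _ ≤ _ := by
        rw [← Finset.mul_sum]
        exact mul_le_mul_right hNs _
  · rw [Real.sq_sqrt hsq, ENNReal.ofReal_mul (pow_nonneg hh.le _), ENNReal.ofReal_pow hh.le,
      ENNReal.ofReal_sum_of_nonneg fun _ _ => sq_nonneg _, Finset.mul_sum]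
    refine (Finset.sum_le_sum fun t ht => hsup t ht).trans ?_
    rw [← Finset.mul_sum]
    exact mul_le_mul_right hNs _

theorem sub_mem_Yh {r ρ : ℕ} (hr : r ≤ ρ) {ψ : G.ProdHHalf} {g : Euc (n + 1) → ℝ}
    (hψ : ∀ ℓ, fnOf (ψ ℓ) =ᵐ[G.surf ℓ] g) {η : G.ProdHHalf}
    (hη : ∀ ℓ, fnOf (η ℓ) =ᵐ[G.surf ℓ] interpErr T (r + 1) g) : ψ - η ∈ T.Yh ρ := by
  refine ⟨_, interp_mem_Qh (k := r + 1) (Nat.succ_ne_zero r) (by omega) g, fun ℓ => ?_⟩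
  have hmem : ∀ᵐ x ∂G.surf ℓ, x ∈ frontier (G.dom ℓ) :=
    ae_restrict_mem isClosed_frontier.measurableSet
  filter_upwards [Lp.coeFn_sub (fnOf (ψ ℓ)) (fnOf (η ℓ)), hψ ℓ, hη ℓ, hmem] with x h0 h1 h2 h3
  have h4 : (fnOf ((ψ - η) ℓ) : Lp ℝ 2 (G.surf ℓ)) x = (fnOf (ψ ℓ) - fnOf (η ℓ)) x := rfl
  rw [h4, h0, Pi.sub_apply, h1, h2, interpErr, Set.indicator_of_mem (frontier_dom_subset ℓ h3)]
  ring

end Interpolation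

/-- Without elements the surface measures vanish. The case is separate because the mesh size is then
0. -/
theorem mem_Yh_of_isEmpty [IsEmpty T.elems] (ρ : ℕ) (ψ : G.ProdHHalf) : ψ ∈ T.Yh ρ := by
  exact ⟨0, Submodule.zero_mem _, fun ℓ => ae_surf_of_ae_pull (T := T) fun t _ => isEmptyElim t⟩

theorem exists_hHalf_interpErr [DecidableEq (Euc (n + 1))] (hn : 1 ≤ n) (hn2 : n ≤ 2) {r : ℕ}
    {C₁ : ℝ} {T₀ : G.Triangulation} (hT : T.ShapeRegular κ) (hC : IsInterpConst T (r + 1) κ C₁)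
    (hh : 0 < T.meshSize) {C₂ : Fin (L + 1) → ℝ≥0∞}
    (hb : ∀ ℓ, ∀ h : ℝ, 0 < h → h ≤ Metric.diam G.skeleton → ∀ v S Gr,
      IsPiecewiseSobolev T₀ ℓ v S Gr → ∃ η : HHalf (G.surf ℓ), ⇑(fnOf η) =ᵐ[G.surf ℓ] v ∧
        ‖η‖ₑ ^ 2 ≤ C₂ ℓ * interpBound T₀ ℓ h v S Gr)
    (hBt : ∑ ℓ, C₂ ℓ * (3 * elemConst n r κ C₁) ≠ ⊤) {f : (ℓ : Fin (L + 1)) → Lp ℝ 2 (G.surf ℓ)}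
    (hf : ∀ ℓ, G.MemHpw (r + 2) ℓ (f ℓ)) {g : Euc (n + 1) → ℝ} (hg : ContinuousOn g G.skeleton)
    (hfg : ∀ ℓ, f ℓ =ᵐ[G.surf ℓ] g) (ℓ : Fin (L + 1)) :
    ∃ η : HHalf (G.surf ℓ), ⇑(fnOf η) =ᵐ[G.surf ℓ] interpErr T (r + 1) g ∧
      ‖η‖ ≤ Real.sqrt (∑ ℓ, C₂ ℓ * (3 * elemConst n r κ C₁)).toReal *
        T.meshSize ^ ((r : ℝ) + 3 / 2) * ∑ ℓ, G.normHpw (r + 2) ℓ (f ℓ) := by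
  obtain ⟨N, hN⟩ : ∃ N : Fin (L + 1) → ℝ, ∀ ℓ, N ℓ = G.normHpw (r + 2) ℓ (f ℓ) := ⟨_, fun _ => rfl⟩
  have hN0 : ∀ ℓ, 0 ≤ N ℓ := fun ℓ => hN ℓ ▸ normHpw_nonneg _ _ _
  obtain ⟨S, hS, hle⟩ := interpBound_interpErr_le hn hn2 T₀ hT hC hh (hf ℓ) hg (hfg ℓ)
  obtain ⟨η, hη, hηn⟩ := hb ℓ T.meshSize hh meshSize_le_diam _ S _
    (isPiecewiseSobolev_interpErr T₀ T (k := r + 1) (by omega) (hf ℓ) hg (hfg ℓ) hS)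
  simp only [← hN] at hle ⊢
  refine ⟨η, hη, norm_le_of_enorm_sq_le (mul_nonneg (mul_nonneg (Real.sqrt_nonneg _)
    (Real.rpow_nonneg hh.le _)) (Finset.sum_nonneg fun ℓ _ => hN0 ℓ)) ?_⟩
  refine (hηn.trans (mul_le_mul_right hle _)).trans (le_trans ?_ (exists_rate hBt r hh.le hN0))
  rw [← mul_assoc, ← mul_assoc (C₂ ℓ)]
  exact mul_le_mul' (mul_le_mul_left (Finset.single_le_sum
      (f := fun ℓ => C₂ ℓ * (3 * elemConst n r κ C₁)) (fun _ _ => zero_le) (Finset.mem_univ ℓ)) _)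
    (Finset.single_le_sum (f := fun ℓ => ENNReal.ofReal (N ℓ ^ 2)) (fun _ _ => zero_le)
      (Finset.mem_univ ℓ))

/-- Approximation of Dirichlet data. -/
theorem exists_iInf_Yh_le (hn : n = 1 ∨ n = 2) (G : Partition n L M) (r : ℕ) (κ : ℝ) :
    ∃ C : ℝ, 0 ≤ C ∧ ∀ T : G.Triangulation, T.ShapeRegular κ → ∀ ρ, r ≤ ρ → ∀ ψ : G.ProdHHalf,
      (∀ ℓ, G.MemHpw (r + 2) ℓ (fnOf (ψ ℓ))) →
      ∀ g : Euc (n + 1) → ℝ, ContinuousOn g G.skeleton → (∀ ℓ, fnOf (ψ ℓ) =ᵐ[G.surf ℓ] g) →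
      ⨅ η : T.Yh ρ, ‖ψ - (η : G.ProdHHalf)‖ ≤
        C * T.meshSize ^ ((r : ℝ) + 3 / 2) * ∑ ℓ, G.normHpw (r + 2) ℓ (fnOf (ψ ℓ)) := by
  classical
  -- T₀ is chosen from the geometry before T, so the constant does not depend on T. If there is no
  -- triangulation at all, the claim is void.
  by_cases hG : Nonempty G.Triangulation
  swap
  · exact ⟨0, le_rfl, fun T => absurd ⟨T⟩ hG⟩
  obtain ⟨T₀⟩ := hG
  have hn1 : 1 ≤ n := by omega
  obtain ⟨C₁, hC₁, hb₁⟩ := exists_elemInterp_bound n (r + 1)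
  -- The diameter of Γ bounds all mesh sizes.
  choose C₂ hC₂ hb₂ using fun ℓ => exists_hHalf_bound hn T₀ ℓ (Metric.diam G.skeleton)
  have hBt : ∑ ℓ, C₂ ℓ * (3 * elemConst n r κ C₁) ≠ ⊤ :=
    ENNReal.sum_ne_top.2 fun ℓ _ => ENNReal.mul_ne_top (hC₂ ℓ)
      (ENNReal.mul_ne_top (by simp) (elemConst_ne_top _ _ _ _))
  refine ⟨((L + 1 : ℕ) : ℝ) * Real.sqrt (∑ ℓ, C₂ ℓ * (3 * elemConst n r κ C₁)).toReal,
    mul_nonneg (Nat.cast_nonneg _) (Real.sqrt_nonneg _),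
    fun T hT ρ hr ψ hψ g hg hψg => ?_⟩
  have hN : ∀ ℓ, 0 ≤ G.normHpw (r + 2) ℓ (fnOf (ψ ℓ)) := fun ℓ => normHpw_nonneg _ _ _
  have hbdd : BddBelow (Set.range fun η : T.Yh ρ => ‖ψ - (η : G.ProdHHalf)‖) :=
    ⟨0, Set.forall_mem_range.2 fun η => norm_nonneg (ψ - (η : G.ProdHHalf))⟩
  rcases isEmpty_or_nonempty T.elems with hemp | ⟨⟨t⟩⟩
  · refine (ciInf_le hbdd ⟨ψ, mem_Yh_of_isEmpty ρ ψ⟩).trans ?_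
    rw [sub_self, norm_zero]
    exact mul_nonneg (mul_nonneg (mul_nonneg (Nat.cast_nonneg _) (Real.sqrt_nonneg _)) (Real.rpow_nonneg meshSize_nonneg _))
      (Finset.sum_nonneg fun ℓ _ => hN ℓ)
  have hh : 0 < T.meshSize := (size_pos hn1 t).trans_le (size_le_meshSize t)
  have hIC : IsInterpConst T (r + 1) κ C₁ :=
    ⟨hC₁, fun t _ _ => hb₁ hn1 (Nat.succ_ne_zero r) hT t⟩
  choose η hη hηn using exists_hHalf_interpErr hn1 (by omega) hT hIC hh hb₂ hBt hψ hg hψg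
  refine (ciInf_le hbdd ⟨ψ - WithLp.toLp 2 η, sub_mem_Yh hr hψg hη⟩).trans ?_
  rw [sub_sub_cancel]
  refine (norm_le_sum_piLp _ _).trans ((Finset.sum_le_sum fun ℓ _ => hηn ℓ).trans (le_of_eq ?_))
  rw [Finset.sum_const, Finset.card_univ, Fintype.card_fin, nsmul_eq_mul]
  ring

end Partition.Triangulation

end MultiTrace

end

/-! ### The theorem -/

open MultiTrace
theorem mainTheorem12 (n : ℕ) (hn : n = 1 ∨ n = 2) (L M : ℕ) (G : Partition n L M)
    (r : ℕ) (κ : ℝ) :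
    ∃ C : ℝ, ∀ (S : G.SignSystem) (ρ : ℕ), r ≤ ρ →
      ∀ T : G.Triangulation, T.ShapeRegular κ →
        (∀ φ : G.ProdHNegHalf, φ ∈ G.X →
          ∀ f : (ℓ : Fin (L + 1)) → Lp ℝ 2 (G.surf ℓ),
            (∀ ℓ, φ ℓ = ofL2 (f ℓ)) → (∀ ℓ, G.MemHpw (r + 1) ℓ (f ℓ)) →
            ⨅ χ : T.Xh S ρ, ‖φ - (χ : G.ProdHNegHalf)‖
              ≤ C * T.meshSize ^ ((r : ℝ) + 3 / 2) * ∑ ℓ, G.normHpw (r + 1) ℓ (f ℓ)) ∧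
        (∀ ψ : G.ProdHHalf, ψ ∈ G.Y →
          (∀ ℓ, G.MemHpw (r + 2) ℓ (fnOf (ψ ℓ))) →
          (∃ u, G.IsLifting u ψ ∧ G.ContinuousOnSkeleton u) →
            ⨅ η : T.Yh ρ, ‖ψ - (η : G.ProdHHalf)‖
              ≤ C * T.meshSize ^ ((r : ℝ) + 3 / 2) * ∑ ℓ, G.normHpw (r + 2) ℓ (fnOf (ψ ℓ))) := by
  refine (Partition.Triangulation.exists_iInf_Yh_le hn G r κ).elim fun C h => ?_
  -- Both constants are nonnegative, so their sum serves for both estimates.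
  refine ⟨((L + 1 : ℕ) : ℝ) * Real.sqrt (Partition.Triangulation.negConst n r κ).toReal + C, ?_⟩
  intro S ρ hr T hT
  constructor
  · intro φ hφ f hφf hf
    refine (Partition.Triangulation.iInf_Xh_le hn S hr hT hφ hφf hf).trans ?_
    refine mul_le_mul_of_nonneg_right (mul_le_mul_of_nonneg_right (le_add_of_nonneg_right h.1) ?_) ?_
    · exact Real.rpow_nonneg Partition.Triangulation.meshSize_nonneg _
    · exact Finset.sum_nonneg fun ℓ _ => Partition.Triangulation.normHpw_nonneg _ _ _
  -- Each ψ_ℓ is a trace of the lifting u, so the continuous function g of u represents all of them.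
  · rintro ψ - hψ ⟨u, hu, g, hg, hug⟩
    refine (h.2 T hT ρ hr ψ hψ g hg fun ℓ => hug ℓ (ψ ℓ) (hu.2 ℓ)).trans ?_
    refine mul_le_mul_of_nonneg_right (mul_le_mul_of_nonneg_right (le_add_of_nonneg_left ?_) ?_) ?_
    · exact mul_nonneg (Nat.cast_nonneg _) (Real.sqrt_nonneg _)
    · exact Real.rpow_nonneg Partition.Triangulation.meshSize_nonneg _
    · exact Finset.sum_nonneg fun ℓ _ => Partition.Triangulation.normHpw_nonneg _ _ _
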